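/- Let $\mathcal P$ be a (symmetric) operad in $\mathrm{Cat}$ with set of colours $C$ (all categories small), let $B$ be its set of operations (with linearly ordered inputs), let $t:B\to C$ be the target map, and let $A=(A_c)_{c\in C}$ be a family of small categories with the structure of a $\mathcal P$-algebra. *The operad $\mathcal P^+_{sc}$.* It has set of colours $B\sqcup C$. For $c\in C$, the objects of $\mathcal P^+_{sc}(x_1,\dots,x_k;c)$ are black and white $\mathcal P$-trees with root edge decorated with $c$ (no black vertex is decorated with a unit, no two black vertices are adjacent) whose white vertices and leaves are $x_1,\dots,x_k$: a white vertex decorated with $x_i$ if $x_i\in B$, a leaf decorated with $x_i$ if $x_i\in C$; morphisms are given by a morphism of operations for each black vertex. For $b\in B$ the category $\mathcal P^+_{sc}(x_1,\dots,x_k;b)$ is empty unless all $x_i\in B$; in that case its objects are black and white $\mathcal P$-trees $T$ with white vertices $x_1,\dots,x_k$ and with leaves the inputs of $b$, together with a morphism $\epsilon$ from the target $t(T)$ (the composite of all the operations of $T$) to $b$, and its morphisms are given by a morphism for each black vertex inducing $\nu$ with $\epsilon'\cdot t(\nu)=\epsilon$. Composition is insertion of trees in vertices and grafting on leaves, with composition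 of the morphisms $\epsilon$. The restriction of $\mathcal P_{sc}^+$ to the colours $B$ is denoted $\mathcal P^+_*$; for $c\in C$ let $\Delta\mathcal P_c$ be the category of operations of $\mathcal P$ with target $c$ whose morphisms are the unary operations of $\mathcal P^+_*$. Let $\mathrm{End}_A(b)=[\prod_i A_{s_i(b)},A_{t(b)}]$, where $s_i(b)$ are the source colours of $b$. *The Hochschild object.* Let $\delta$ be a $\mathrm{Cat}$-functor to $\mathrm{Cat}$ on each $\Delta\mathcal P_c$, extended to the unary operations of $\mathcal P_{sc}^+$ between equal colours in $C$ by the representable functor $\delta(c)=\mathcal P^+_{sc}(c;c)$. Let $\mathrm{Hoch}(A)_c=\underline{\mathrm{Hom}}_{\Delta\mathcal P_c}(\delta,\mathrm{End}_A)$. *The operad $\mathrm{SC}(\mathcal P)$.* Let $f=t\sqcup \mathrm{id}:B\sqcup C\to C\sqcup C$. For $d\in C\sqcup C$, let $\mathcal P_{sc,d}^+$ be the category with objects $f^{-1}(d)$ and with morphisms the unary operations of $\mathcal P_{sc}^+$. The $\delta$-condensation $\mathrm{SC}(\mathcal P)$ of $\mathcal P_{sc}^+$ along $f$ has set of colours $C\sqcup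 C$ and $$\mathrm{SC}(\mathcal P)(d_1,\dots,d_k;d)=\underline{\mathrm{Hom}}_{\mathcal P_{sc,d}^+}\bigl(\delta,\ \mathcal P_{sc}^+(-,\dots,-;\cdot)\otimes_{\mathcal P_{sc,d_1}^+\times\dots\times\mathcal P_{sc,d_k}^+}\delta(-)\times\dots\times\delta(-)\bigr).$$ **Lemma.** $\mathcal P_{sc}^+$ is an operad in $\mathrm{Cat}$, and the pair $(\mathrm{End}_A,A)$ is a $\mathcal P_{sc}^+$-algebra: a tree acts by evaluating functors at its white vertices and the action of $\mathcal P$ at its black vertices. The extended $\delta$ is a functor, and the categories $\mathrm{SC}(\mathcal P)(d_1,\dots,d_k;d)$ form an operad in $\mathrm{Cat}$, whose composition is induced by the composition of $\mathcal P_{sc}^+$ on the coends. It acts on the categories $\underline{\mathrm{Hom}}_{\mathcal P_{sc,d}^+}(\delta,(\mathrm{End}_A,A))$ by evaluation: a class $[p;z_1,\dots,z_k]$ in the coend sends $(m_1,\dots,m_k)$ to $p(m_1(z_1),\dots,m_k(z_k))$. These categories are canonically isomorphic to $\mathrm{Hoch}(A)_c$ if $d=c$ is in the first copy of $C$ (by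 restriction of $\delta$ to $B$), and to $A_c$ if $d=c$ is in the second copy (by evaluation at the identity). Hence $(\mathrm{Hoch}(A),A)$ is an $\mathrm{SC}(\mathcal P)$-algebra. This structure extends the given one: there is a morphism of operads $\mathcal P\to\mathrm{SC}(\mathcal P)$ over the inclusion of the second copy of $C$, sending an operation $p$ to the class of the corolla with a black vertex decorated with $p$, and the restriction of the action along it is the given $\mathcal P$-algebra structure of $A$. -/

import Mathlib

open CategoryTheory
open scoped Prod

universe u

namespace SwissCheese

set_option linter.unusedVariables false
noncomputable section

/-- The data of a categorical symmetric operad with set of colours `K`: categories of operations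
indexed by finite families of input colours, units, relabelling of the inputs, and simultaneous
composition. -/
structure OperadData (K : Type u) where
  Op : {I : Type} → [Finite I] → (I → K) → K → Cat.{u, u}
  one (c : K) : Op (fun _ : Unit => c) c
  reindex {I J : Type} [Finite I] [Finite J] (e : I ≃ J) {x : I → K} {y : J → K}
    (h : ∀ i, y (e i) = x i) {c : K} : Op x c ⥤ Op y c
  comp {I : Type} [Finite I] {J : I → Type} [∀ i, Finite (J i)] (x : I → K)
    (y : ∀ i, J i → K) (c : K) :
    (Op x c × ∀ i, Op (y i) (x i)) ⥤ Op (fun s : Σ i, J i => y s.1 s.2) c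

/-- The axioms of a categorical symmetric operad: relabelling is functorial, composition is
equivariant, unital and associative. -/
structure OperadData.IsOperad {K : Type u} (P : OperadData K) : Prop where
  reindex_refl {I : Type} [Finite I] (x : I → K) (c : K) :
    P.reindex (Equiv.refl I) (fun _ => rfl) = 𝟭 (P.Op x c)
  reindex_trans {I J L : Type} [Finite I] [Finite J] [Finite L] (e : I ≃ J) (e' : J ≃ L)
    {x : I → K} {y : J → K} {z : L → K} (h : ∀ i, y (e i) = x i) (h' : ∀ j, z (e' j) = y j)
    (c : K) :
    P.reindex e h (c := c) ⋙ P.reindex e' h' =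
      P.reindex (e.trans e') (fun i => (h' (e i)).trans (h i))
  comp_reindex {I : Type} [Finite I] {J J' : I → Type} [∀ i, Finite (J i)] [∀ i, Finite (J' i)]
    (e : ∀ i, J i ≃ J' i) (x : I → K) {y : ∀ i, J i → K} {y' : ∀ i, J' i → K}
    (h : ∀ i j, y' i (e i j) = y i j) (c : K) :
    (𝟭 (P.Op x c)).prod (Functor.pi fun i => P.reindex (e i) (h i)) ⋙ P.comp x y' c =
      P.comp x y c ⋙ P.reindex (Equiv.sigmaCongrRight e) (fun s => h s.1 s.2)
  reindex_comp {I I' : Type} [Finite I] [Finite I'] {J : I' → Type} [∀ i, Finite (J i)]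
    (e : I ≃ I') (x : I' → K) (y : ∀ i, J i → K) (c : K) :
    (P.reindex e (fun _ => rfl)).prod (𝟭 (∀ i, P.Op (y i) (x i))) ⋙ P.comp x y c =
      (𝟭 (P.Op (fun i => x (e i)) c)).prod (Pi.comap (fun i => P.Op (y i) (x i)) e) ⋙
        P.comp (fun i => x (e i)) (fun i => y (e i)) c ⋙
        P.reindex (y := fun s : Σ i, J i => y s.1 s.2) (Equiv.sigmaCongrLeft e) (fun _ => rfl)
  one_comp {J : Type} [Finite J] (y : J → K) (c : K) :
    Functor.prod' (Functor.const _ |>.obj (P.one c)) (Functor.pi' fun _ => 𝟭 (P.Op y c)) ⋙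
        P.comp (fun _ : Unit => c) (fun _ => y) c ⋙
        P.reindex (Equiv.uniqueSigma fun _ : Unit => J) (fun _ => rfl) = 𝟭 (P.Op y c)
  comp_one {I : Type} [Finite I] (x : I → K) (c : K) :
    Functor.prod' (𝟭 (P.Op x c)) (Functor.const _ |>.obj fun i => P.one (x i)) ⋙
        P.comp x (fun i (_ : Unit) => x i) c ⋙
        P.reindex (Equiv.sigmaUnique I fun _ => Unit) (fun _ => rfl) = 𝟭 (P.Op x c)
  assoc_obj {I : Type} [Finite I] {J : I → Type} [∀ i, Finite (J i)] {L : ∀ i, J i → Type}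
    [∀ i j, Finite (L i j)] (x : I → K) (y : ∀ i, J i → K) (z : ∀ i j, L i j → K) (c : K)
    (p : P.Op x c) (q : ∀ i, P.Op (y i) (x i)) (r : ∀ i j, P.Op (z i j) (y i j)) :
    (P.reindex (y := fun s : Σ i, Σ j, L i j => z s.1 s.2.1 s.2.2)
      (Equiv.sigmaAssoc L) (fun _ => rfl)).obj
      ((P.comp (fun s : Σ i, J i => y s.1 s.2) (fun s => z s.1 s.2) c).obj
        ((P.comp x y c).obj (p, q), fun s => r s.1 s.2)) =
    (P.comp x (fun i (t : Σ j, L i j) => z i t.1 t.2) c).obj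
      (p, fun i => (P.comp (y i) (z i) (x i)).obj (q i, r i))
  assoc_map {I : Type} [Finite I] {J : I → Type} [∀ i, Finite (J i)] {L : ∀ i, J i → Type}
    [∀ i j, Finite (L i j)] (x : I → K) (y : ∀ i, J i → K) (z : ∀ i j, L i j → K) (c : K)
    {p p' : P.Op x c} {q q' : ∀ i, P.Op (y i) (x i)} {r r' : ∀ i j, P.Op (z i j) (y i j)}
    (f : p ⟶ p') (g : q ⟶ q') (h : r ⟶ r') :
    (P.reindex (y := fun s : Σ i, Σ j, L i j => z s.1 s.2.1 s.2.2)
      (Equiv.sigmaAssoc L) (fun _ => rfl)).map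
      ((P.comp (fun s : Σ i, J i => y s.1 s.2) (fun s => z s.1 s.2) c).map
        (X := (_, fun s => r s.1 s.2)) (Y := (_, fun s => r' s.1 s.2))
        ((P.comp x y c).map (X := (p, q)) (Y := (p', q')) (f, g), fun s => h s.1 s.2)) ≍
    (P.comp x (fun i (t : Σ j, L i j) => z i t.1 t.2) c).map
      (X := (p, _)) (Y := (p', _))
      (f, fun i => (P.comp (y i) (z i) (x i)).map (X := (q i, r i)) (Y := (q' i, r' i))
        (g i, h i))
/-- Morphisms of operads over a function between the colours. -/
structure OperadHom {K K' : Type u} (φ : K → K') (P : OperadData K) (Q : OperadData K') where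
  map {I : Type} [Finite I] (x : I → K) (c : K) : P.Op x c ⥤ Q.Op (fun i => φ (x i)) (φ c)
  map_one (c : K) : (map (fun _ : Unit => c) c).obj (P.one c) = Q.one (φ c)
  map_reindex {I J : Type} [Finite I] [Finite J] (e : I ≃ J) {x : I → K} {y : J → K}
    (h : ∀ i, y (e i) = x i) (c : K) :
    P.reindex e h ⋙ map y c = map x c ⋙ Q.reindex e (fun i => congrArg φ (h i))
  map_comp {I : Type} [Finite I] {J : I → Type} [∀ i, Finite (J i)] (x : I → K)
    (y : ∀ i, J i → K) (c : K) :
    P.comp x y c ⋙ map (fun s : Σ i, J i => y s.1 s.2) c =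
      (map x c).prod (Functor.pi fun i => map (y i) (x i)) ⋙
        Q.comp (fun i => φ (x i)) (fun i j => φ (y i j)) (φ c)

/-- Transport along an equality of colours. -/
def transport {K : Type u} (M : K → Cat.{u, u}) {k k' : K} (h : k = k') : M k ⥤ M k' :=
  Eq.rec (motive := fun k' _ => M k ⥤ M k') (𝟭 (M k)) h

def endReindex {K : Type u} (M : K → Cat.{u, u}) {I J : Type} (e : I ≃ J) {x : I → K}
    {y : J → K} (h : ∀ i, y (e i) = x i) : (∀ j, M (y j)) ⥤ (∀ i, M (x i)) where
  obj a := fun i => (transport M (h i)).obj (a (e i))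
  map f := fun i => (transport M (h i)).map (f (e i))
  map_id a := funext fun i => (transport M (h i)).map_id _
  map_comp f g := funext fun i => (transport M (h i)).map_comp _ _

/-- Composition of functors of several variables. -/
def endComp {I : Type} {J : I → Type} (X : I → Cat.{u, u}) (Y : ∀ i, J i → Cat.{u, u})
    (Z : Cat.{u, u}) :
    (((∀ i, X i) ⥤ Z) × (∀ i, ((∀ j, Y i j) ⥤ X i))) ⥤ ((∀ s : Σ i, J i, Y s.1 s.2) ⥤ Z) where
  obj F :=
    { obj a := F.1.obj fun i => (F.2 i).obj fun j => a ⟨i, j⟩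
      map {a b} f := F.1.map (X := fun i => (F.2 i).obj fun j => a ⟨i, j⟩)
        (Y := fun i => (F.2 i).obj fun j => b ⟨i, j⟩) fun i => (F.2 i).map fun j => f ⟨i, j⟩
      map_id a := (congrArg _ (funext fun i => (F.2 i).map_id _)).trans (F.1.map_id _)
      map_comp f g :=
        (congrArg _ (funext fun i => (F.2 i).map_comp _ _)).trans (F.1.map_comp _ _) }
  map {F G} α :=
    { app a := F.1.map (X := fun i => (F.2 i).obj fun j => a ⟨i, j⟩)
        (Y := fun i => (G.2 i).obj fun j => a ⟨i, j⟩)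
        (fun i => (α.2 i).app fun j => a ⟨i, j⟩) ≫ α.1.app _
      naturality a b f := by
        dsimp only
        rw [← Category.assoc, ← F.1.map_comp, Category.assoc, ← α.1.naturality,
          ← Category.assoc, ← F.1.map_comp]
        congr 2
        funext i
        exact (α.2 i).naturality _ }
  map_id F := by
    ext a
    exact (congrArg₂ _ (F.1.map_id _) rfl).trans (Category.comp_id _)
  map_comp {F G H} α β := by
    ext a
    refine (congrArg₂ _ (F.1.map_comp (fun i => (α.2 i).app fun j => a ⟨i, j⟩)
      (fun i => (β.2 i).app fun j => a ⟨i, j⟩)) rfl).trans ?_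
    change (_ ≫ _) ≫ α.1.app _ ≫ β.1.app _ = (_ ≫ _) ≫ _ ≫ _
    rw [Category.assoc, Category.assoc, α.1.naturality_assoc]

/-- The endomorphism operad of a family of categories. -/
def endOperad {K : Type u} (M : K → Cat.{u, u}) : OperadData K where
  Op x c := Cat.of ((∀ i, M (x i)) ⥤ M c)
  one c := Pi.eval (fun _ : Unit => M c) ()
  reindex e _ _ h _ := (Functor.whiskeringLeft _ _ _).obj (endReindex M e h)
  comp x y c := endComp (fun i => M (x i)) (fun i j => M (y i j)) (M c)

/-- Algebras over a categorical operad in the category of small categories. -/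
abbrev OperadAlgebra {K : Type u} (P : OperadData K) (M : K → Cat.{u, u}) :=
  OperadHom (fun k : K => k) P (endOperad M)

section Trees

variable {C : Type u} (P : OperadData C)

/-- An operation of `P`, with linearly ordered inputs. -/
structure Operation where
  n : ℕ
  src : Fin n → C
  tgt : C
  op : P.Op src tgt

/-- The colours of the Swiss cheese plus construction: operations and colours of `P`. -/
abbrev Colour := Operation P ⊕ C

variable {P}

def ar : Colour P → ℕ
  | Sum.inl b => b.n
  | Sum.inr _ => 0

def src : (k : Colour P) → Fin (ar k) → C
  | Sum.inl b => b.src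
  | Sum.inr _ => fun i => i.elim0

def tgt : Colour P → C
  | Sum.inl b => b.tgt
  | Sum.inr c => c

variable (P) in
def unitOp (c : C) : P.Op (fun _ : Fin 1 => c) c :=
  (P.reindex (Equiv.ofUnique Unit (Fin 1)) (fun _ => rfl)).obj (P.one c)

variable (P) in
/-- Composition followed by an arbitrary linear ordering of the inputs. -/
def multiComp {n l : ℕ} {m : Fin n → ℕ} (e : (Σ i, Fin (m i)) ≃ Fin l) (s : Fin n → C)
    (t : ∀ i, Fin (m i) → C) (c : C) :
    (P.Op s c × ∀ i, P.Op (t i) (s i)) ⥤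
      P.Op (fun j : Fin l => t (e.symm j).1 (e.symm j).2) c :=
  P.comp s t c ⋙ P.reindex e (fun j => by rw [e.symm_apply_apply])

variable (P) in
/-- Categories with a strict action of the operations of `P` with linearly ordered inputs; `e` is an
arbitrary ordering of the inputs of a composite, so that equivariance is included in `merge_obj`
and `merge_map`. -/
structure FinAlgebra where
  M : C → Cat.{u, u}
  act {n : ℕ} (s : Fin n → C) (c : C) : (P.Op s c × ∀ i, M (s i)) ⥤ M c
  one_obj {c : C} (a : ∀ _ : Fin 1, M c) : (act _ c).obj (unitOp P c, a) = a 0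
  one_map {c : C} {a b : ∀ _ : Fin 1, M c} (f : a ⟶ b) :
    (act _ c).map (X := (unitOp P c, a)) (Y := (unitOp P c, b)) (𝟙 _, f) ≍ f 0
  merge_obj {n l : ℕ} {m : Fin n → ℕ} (e : (Σ i, Fin (m i)) ≃ Fin l) {s : Fin n → C}
    {t : ∀ i, Fin (m i) → C} {c : C} (p : P.Op s c) (q : ∀ i, P.Op (t i) (s i))
    (a : ∀ i j, M (t i j)) :
    (act s c).obj (p, fun i => (act (t i) (s i)).obj (q i, a i)) =
      (act _ c).obj ((multiComp P e s t c).obj (p, q), fun j => a (e.symm j).1 (e.symm j).2)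
  merge_map {n l : ℕ} {m : Fin n → ℕ} (e : (Σ i, Fin (m i)) ≃ Fin l) {s : Fin n → C}
    {t : ∀ i, Fin (m i) → C} {c : C} {p p' : P.Op s c} {q q' : ∀ i, P.Op (t i) (s i)}
    {a a' : ∀ i j, M (t i j)} (f : p ⟶ p') (g : q ⟶ q') (h : a ⟶ a') :
    (act s c).map (X := (p, fun i => (act (t i) (s i)).obj (q i, a i)))
      (Y := (p', fun i => (act (t i) (s i)).obj (q' i, a' i)))
      (f, fun i => (act (t i) (s i)).map (X := (q i, a i)) (Y := (q' i, a' i)) (g i, h i)) ≍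
    (act _ c).map
      (X := ((multiComp P e s t c).obj (p, q), fun j => a (e.symm j).1 (e.symm j).2))
      (Y := ((multiComp P e s t c).obj (p', q'), fun j => a' (e.symm j).1 (e.symm j).2))
      ((multiComp P e s t c).map (X := (p, q)) (Y := (p', q')) (f, g),
        fun j => h (e.symm j).1 (e.symm j).2)

/-- Trees with root colour `c`: white vertices are named by elements `a` of `X` and decorated with
`x a`, black vertices are decorated with arbitrary operations of `P`. A white vertex whose colour
`x a` is in `C` has no inputs and plays the role of a leaf of that colour. -/
inductive Tree {X : Type} (x : X → Colour P) : C → Type u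
  | white (a : X) (ts : ∀ i, Tree x (src (x a) i)) : Tree x (tgt (x a))
  | black {n : ℕ} {s : Fin n → C} {c : C} (p : P.Op s c) (ts : ∀ i, Tree x (s i)) : Tree x c

variable {X : Type} {x : X → Colour P}

namespace Tree

/-- Black vertices decorated with a unit are removed and adjacent black vertices are multiplied, so
that classes are reduced trees, up to isomorphism of trees. -/
inductive Rel : {c : C} → Tree x c → Tree x c → Prop
  | refl {c : C} (t : Tree x c) : Rel t t
  | symm {c : C} {t t' : Tree x c} : Rel t t' → Rel t' t
  | trans {c : C} {t t' t'' : Tree x c} : Rel t t' → Rel t' t'' → Rel t t''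
  | white (a : X) {ts ts' : ∀ i, Tree x (src (x a) i)} :
      (∀ i, Rel (ts i) (ts' i)) → Rel (.white a ts) (.white a ts')
  | black {n : ℕ} {s : Fin n → C} {c : C} (p : P.Op s c) {ts ts' : ∀ i, Tree x (s i)} :
      (∀ i, Rel (ts i) (ts' i)) → Rel (.black p ts) (.black p ts')
  | one {c : C} (ts : ∀ _ : Fin 1, Tree x c) : Rel (.black (unitOp P c) ts) (ts 0)
  | merge {n l : ℕ} {m : Fin n → ℕ} (e : (Σ i, Fin (m i)) ≃ Fin l) {s : Fin n → C}
      {t : ∀ i, Fin (m i) → C} {c : C} (p : P.Op s c) (q : ∀ i, P.Op (t i) (s i))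
      (ts : ∀ i j, Tree x (t i j)) :
      Rel (.black p fun i => .black (q i) (ts i))
        (.black ((multiComp P e s t c).obj (p, q)) fun j => ts (e.symm j).1 (e.symm j).2)

end Tree

variable (x) in
def treeSetoid (c : C) : Setoid (Tree x c) := ⟨Tree.Rel, .refl, .symm, .trans⟩

variable (x) in
def QTree (c : C) : Type u := Quotient (treeSetoid x c)

namespace QTree

def mk {c : C} (t : Tree x c) : QTree x c := Quotient.mk (treeSetoid x c) t

theorem mk_eq {c : C} {t t' : Tree x c} (r : Tree.Rel t t') : mk t = mk t' := Quotient.sound (s := treeSetoid x c) r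

theorem out_mk {c : C} (t : Tree x c) : Tree.Rel (Quotient.out (mk t)) t :=
  Quotient.mk_out (s := treeSetoid x c) t

def white (a : X) (ts : ∀ i, QTree x (src (x a) i)) : QTree x (tgt (x a)) :=
  mk (.white a fun i => Quotient.out (ts i))

def black {n : ℕ} {s : Fin n → C} {c : C} (p : P.Op s c) (ts : ∀ i, QTree x (s i)) : QTree x c :=
  mk (.black p fun i => Quotient.out (ts i))

theorem white_mk (a : X) (ts : ∀ i, Tree x (src (x a) i)) :
    white a (fun i => mk (ts i)) = mk (.white a ts) :=
  mk_eq (.white a fun _ => out_mk _)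

theorem black_mk {n : ℕ} {s : Fin n → C} {c : C} (p : P.Op s c) (ts : ∀ i, Tree x (s i)) :
    black p (fun i => mk (ts i)) = mk (.black p ts) :=
  mk_eq (.black p fun _ => out_mk _)

theorem ind {motive : ∀ {c : C}, QTree x c → Prop}
    (hw : ∀ a ts, (∀ i, motive (ts i)) → motive (white a ts))
    (hb : ∀ {n : ℕ} {s : Fin n → C} {c : C} (p : P.Op s c) (ts : ∀ i, QTree x (s i)),
      (∀ i, motive (ts i)) → motive (black p ts)) {c : C} (t : QTree x c) : motive t := by
  induction t using Quotient.ind with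
  | _ t =>
    induction t with
    | white a ts ih => exact Eq.mp (congrArg motive (white_mk a ts)) (hw a _ ih)
    | black p ts ih => exact Eq.mp (congrArg motive (black_mk p ts)) (hb p _ ih)

theorem exists_mk {n : ℕ} {s : Fin n → C} (ts : ∀ i, QTree x (s i)) :
    ∃ us : ∀ i, Tree x (s i), ts = fun i => mk (us i) :=
  ⟨fun i => Quotient.out (ts i), funext fun i => (Quotient.out_eq (ts i)).symm⟩

theorem one_eq {c : C} (ts : ∀ _ : Fin 1, QTree x c) : black (unitOp P c) ts = ts 0 := by
  obtain ⟨us, rfl⟩ := exists_mk ts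
  exact (black_mk _ us).trans (mk_eq (.one us))

theorem merge_eq {n l : ℕ} {m : Fin n → ℕ} (e : (Σ i, Fin (m i)) ≃ Fin l) {s : Fin n → C}
    {t : ∀ i, Fin (m i) → C} {c : C} (p : P.Op s c) (q : ∀ i, P.Op (t i) (s i))
    (ts : ∀ i j, QTree x (t i j)) :
    black p (fun i => black (q i) (ts i)) =
      black ((multiComp P e s t c).obj (p, q)) fun j => ts (e.symm j).1 (e.symm j).2 := by
  obtain ⟨us, rfl⟩ : ∃ us : ∀ i j, Tree x (t i j), ts = fun i j => mk (us i j) :=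
    ⟨fun i j => Quotient.out (ts i j),
      funext fun i => funext fun j => (Quotient.out_eq (ts i j)).symm⟩
  exact (congrArg (black p) (funext fun i => black_mk (q i) (us i))).trans
    ((black_mk p _).trans ((mk_eq (.merge e p q us)).trans (black_mk _ _).symm))

/-- Generating morphisms between trees: identities, composites, and a morphism at each black
vertex. -/
inductive Cell : {c : C} → QTree x c → QTree x c → Type u
  | id {c : C} (t : QTree x c) : Cell t t
  | comp {c : C} {t t' t'' : QTree x c} : Cell t t' → Cell t' t'' → Cell t t''
  | white (a : X) {ts ts' : ∀ i, QTree x (src (x a) i)} :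
      (∀ i, Cell (ts i) (ts' i)) → Cell (QTree.white a ts) (QTree.white a ts')
  | black {n : ℕ} {s : Fin n → C} {c : C} {p p' : P.Op s c} (f : p ⟶ p')
      {ts ts' : ∀ i, QTree x (s i)} :
      (∀ i, Cell (ts i) (ts' i)) → Cell (QTree.black p ts) (QTree.black p' ts')

/-- Two generating morphisms are identified when functoriality of grafting, or compatibility with
the composition and the units of `P`, forces it. -/
inductive Cell.Rel : {c : C} → {t t' u u' : QTree x c} → Cell t t' → Cell u u' → Prop
  | refl {c : C} {t t' : QTree x c} (f : Cell t t') : Rel f f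
  | symm {c : C} {t t' u u' : QTree x c} {f : Cell t t'} {g : Cell u u'} : Rel f g → Rel g f
  | trans {c : C} {t t' u u' v v' : QTree x c} {f : Cell t t'} {g : Cell u u'} {h : Cell v v'} :
      Rel f g → Rel g h → Rel f h
  | comp {c : C} {t t' t'' u u' u'' : QTree x c} {f : Cell t t'} {f' : Cell u u'}
      {g : Cell t' t''} {g' : Cell u' u''} :
      Rel f f' → Rel g g' → Rel (.comp f g) (.comp f' g')
  | white (a : X) {ts ts' us us' : ∀ i, QTree x (src (x a) i)} {fs : ∀ i, Cell (ts i) (ts' i)}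
      {gs : ∀ i, Cell (us i) (us' i)} :
      (∀ i, Rel (fs i) (gs i)) → Rel (.white a fs) (.white a gs)
  | black {n : ℕ} {s : Fin n → C} {c : C} {p p' : P.Op s c} (f : p ⟶ p')
      {ts ts' us us' : ∀ i, QTree x (s i)} {fs : ∀ i, Cell (ts i) (ts' i)}
      {gs : ∀ i, Cell (us i) (us' i)} :
      (∀ i, Rel (fs i) (gs i)) → Rel (.black f fs) (.black f gs)
  | assoc {c : C} {t₁ t₂ t₃ t₄ : QTree x c} (f : Cell t₁ t₂) (g : Cell t₂ t₃) (h : Cell t₃ t₄) :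
      Rel (.comp (.comp f g) h) (.comp f (.comp g h))
  | id_comp {c : C} {t t' : QTree x c} (f : Cell t t') : Rel (.comp (.id t) f) f
  | comp_id {c : C} {t t' : QTree x c} (f : Cell t t') : Rel (.comp f (.id t')) f
  | white_id (a : X) (ts : ∀ i, QTree x (src (x a) i)) :
      Rel (.white a fun i => .id (ts i)) (.id (QTree.white a ts))
  | white_comp (a : X) {ts ts' ts'' : ∀ i, QTree x (src (x a) i)}
      (fs : ∀ i, Cell (ts i) (ts' i)) (gs : ∀ i, Cell (ts' i) (ts'' i)) :
      Rel (.white a fun i => .comp (fs i) (gs i)) (.comp (.white a fs) (.white a gs))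
  | black_id {n : ℕ} {s : Fin n → C} {c : C} (p : P.Op s c) (ts : ∀ i, QTree x (s i)) :
      Rel (.black (𝟙 p) fun i => .id (ts i)) (.id (QTree.black p ts))
  | black_comp {n : ℕ} {s : Fin n → C} {c : C} {p p' p'' : P.Op s c} (f : p ⟶ p')
      (g : p' ⟶ p'') {ts ts' ts'' : ∀ i, QTree x (s i)}
      (fs : ∀ i, Cell (ts i) (ts' i)) (gs : ∀ i, Cell (ts' i) (ts'' i)) :
      Rel (.black (f ≫ g) fun i => .comp (fs i) (gs i)) (.comp (.black f fs) (.black g gs))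
  | one {c : C} {ts ts' : ∀ _ : Fin 1, QTree x c} (fs : ∀ i, Cell (ts i) (ts' i)) :
      Rel (.black (𝟙 (unitOp P c)) fs) (fs 0)
  | merge {n l : ℕ} {m : Fin n → ℕ} (e : (Σ i, Fin (m i)) ≃ Fin l) {s : Fin n → C}
      {t : ∀ i, Fin (m i) → C} {c : C} {p p' : P.Op s c} {q q' : ∀ i, P.Op (t i) (s i)}
      (f : p ⟶ p') (g : q ⟶ q') {ts ts' : ∀ i j, QTree x (t i j)}
      (fs : ∀ i j, Cell (ts i j) (ts' i j)) :
      Rel (.black f fun i => .black (g i) (fs i))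
        (.black ((multiComp P e s t c).map (X := (p, q)) (Y := (p', q')) (f, g))
          fun j => fs (e.symm j).1 (e.symm j).2)

theorem Cell.Rel.endpoints {c : C} {t t' u u' : QTree x c} {f : Cell t t'} {g : Cell u u'}
    (r : Cell.Rel f g) : t = u ∧ t' = u' := by
  induction r with
  | refl => exact ⟨rfl, rfl⟩
  | symm _ ih => exact ⟨ih.1.symm, ih.2.symm⟩
  | trans _ _ ih ih' => exact ⟨ih.1.trans ih'.1, ih.2.trans ih'.2⟩
  | comp _ _ ih ih' => exact ⟨ih.1, ih'.2⟩
  | white a _ ih => exact ⟨congrArg _ (funext fun i => (ih i).1), congrArg _ (funext fun i => (ih i).2)⟩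
  | black f _ ih => exact ⟨congrArg _ (funext fun i => (ih i).1), congrArg _ (funext fun i => (ih i).2)⟩
  | one => exact ⟨one_eq _, one_eq _⟩
  | merge e => exact ⟨merge_eq e _ _ _, merge_eq e _ _ _⟩
  | _ => exact ⟨rfl, rfl⟩

def homSetoid {c : C} (t t' : QTree x c) : Setoid (Cell t t') := ⟨Cell.Rel, .refl, .symm, .trans⟩

instance (c : C) : Category.{u} (QTree x c) where
  Hom t t' := Quotient (homSetoid (x := x) t t')
  id t := Quotient.mk _ (.id t)
  comp f g := Quotient.map₂ Cell.comp (fun _ _ h _ _ h' => .comp h h') f g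
  id_comp f := by
    induction f using Quotient.ind
    exact Quot.sound (.id_comp _)
  comp_id f := by
    induction f using Quotient.ind
    exact Quot.sound (.comp_id _)
  assoc f g h := by
    induction f using Quotient.ind
    induction g using Quotient.ind
    induction h using Quotient.ind
    exact Quot.sound (.assoc _ _ _)

def hom {c : C} {t t' : QTree x c} (f : Cell t t') : t ⟶ t' := Quotient.mk (homSetoid t t') f

theorem hom_heq {c : C} {t t' u u' : QTree x c} {f : Cell t t'} {g : Cell u u'}
    (r : Cell.Rel f g) : hom f ≍ hom g := by
  obtain ⟨rfl, rfl⟩ := r.endpoints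
  exact heq_of_eq (Quotient.sound r)

theorem exists_hom {n : ℕ} {s : Fin n → C} {ts ts' : ∀ i, QTree x (s i)} (f : ts ⟶ ts') :
    ∃ g : ∀ i, Cell (ts i) (ts' i), f = fun i => hom (g i) :=
  ⟨fun i => Quotient.out (f i), funext fun i => (Quotient.out_eq (f i)).symm⟩

theorem out_hom {c : C} {t t' : QTree x c} (f : Cell t t') :
    Cell.Rel (Quotient.out (hom f)) f :=
  Quotient.exact (Quotient.out_eq (hom f))

end QTree

variable (x) in
/-- The category of trees. -/
def TreeCat (c : C) : Cat.{u, u} := Cat.of (QTree x c)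

namespace TreeCat

open QTree

def white (a : X) : (∀ i, TreeCat x (src (x a) i)) ⥤ TreeCat x (tgt (x a)) where
  obj ts := QTree.white a ts
  map f := hom (.white a fun i => Quotient.out (f i))
  map_id ts := Quot.sound (.trans (.white a fun i => out_hom (.id (ts i))) (.white_id a ts))
  map_comp f g := by
    obtain ⟨f, rfl⟩ := exists_hom f
    obtain ⟨g, rfl⟩ := exists_hom g
    exact Quot.sound (.trans (.white a fun i => (out_hom (.comp (f i) (g i))).trans
      (.comp (out_hom (f i)).symm (out_hom (g i)).symm)) (.white_comp a _ _))

def black {n : ℕ} (s : Fin n → C) (c : C) : (P.Op s c × ∀ i, TreeCat x (s i)) ⥤ TreeCat x c where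
  obj t := QTree.black t.1 t.2
  map f := hom (.black f.1 fun i => Quotient.out (f.2 i))
  map_id t := Quot.sound (.trans (.black _ fun i => out_hom (.id (t.2 i))) (.black_id t.1 t.2))
  map_comp f g := by
    obtain ⟨f, f'⟩ := f
    obtain ⟨g, g'⟩ := g
    obtain ⟨f', rfl⟩ := exists_hom f'
    obtain ⟨g', rfl⟩ := exists_hom g'
    exact Quot.sound (.trans (.black _ fun i => (out_hom (.comp (f' i) (g' i))).trans
      (.comp (out_hom (f' i)).symm (out_hom (g' i)).symm)) (.black_comp f g _ _))

theorem black_map {n : ℕ} {s : Fin n → C} {c : C} {p p' : P.Op s c} (f : p ⟶ p')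
    {ts ts' : ∀ i, QTree x (s i)} (g : ∀ i, Cell (ts i) (ts' i)) :
    (black s c).map (X := (p, ts)) (Y := (p', ts')) (f, fun i => hom (g i)) = hom (.black f g) :=
  Quot.sound (.black f fun i => out_hom (g i))

theorem white_map (a : X) {ts ts' : ∀ i, QTree x (src (x a) i)}
    (g : ∀ i, Cell (ts i) (ts' i)) :
    (white a).map (X := ts) (Y := ts') (fun i => hom (g i)) = hom (.white a g) :=
  Quot.sound (.white a fun i => out_hom (g i))

variable (x) in
def alg : FinAlgebra P where
  M := TreeCat x
  act := black
  one_obj := one_eq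
  one_map f := by
    obtain ⟨g, rfl⟩ := exists_hom f
    exact (heq_of_eq (black_map _ g)).trans (hom_heq (.one g))
  merge_obj := merge_eq
  merge_map {n l m} e {s t c p p' q q' ts ts'} f g h := by
    obtain ⟨k, rfl⟩ : ∃ k : ∀ i j, Cell (ts i j) (ts' i j), h = fun i j => hom (k i j) :=
      ⟨fun i j => Quotient.out (h i j),
        funext fun i => funext fun j => (Quotient.out_eq (h i j)).symm⟩
    have h1 := congrArg (fun z => (black (x := x) s c).map (X := (p, _)) (Y := (p', _)) (f, z))
      (funext fun i => black_map (g i) (k i))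
    exact (heq_of_eq (h1.trans (black_map f _))).trans
      ((hom_heq (.merge e f g k)).trans (heq_of_eq (black_map _ _).symm))

end TreeCat

theorem map_heq {A B : Type*} [Category* A] [Category* B] (F : A ⥤ B) {a b a' b' : A}
    {f : a ⟶ b} {g : a' ⟶ b'} (h : a = a') (h' : b = b') (w : f ≍ g) : F.map f ≍ F.map g := by
  subst h h'
  rw [eq_of_heq w]

theorem comp_heq {A : Type*} [Category* A] {a b c a' b' c' : A} {f : a ⟶ b} {g : b ⟶ c}
    {f' : a' ⟶ b'} {g' : b' ⟶ c'} (h : a = a') (h' : b = b') (h'' : c = c') (w : f ≍ f')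
    (w' : g ≍ g') : f ≫ g ≍ f' ≫ g' := by
  subst h h' h''
  rw [eq_of_heq w, eq_of_heq w']

theorem pi_heq {I : Type*} {A : I → Type*} [∀ i, Category* (A i)] {a b a' b' : ∀ i, A i}
    {f : ∀ i, a i ⟶ b i} {g : ∀ i, a' i ⟶ b' i} (h : ∀ i, a i = a' i) (h' : ∀ i, b i = b' i)
    (w : ∀ i, f i ≍ g i) : f ≍ g := by
  obtain rfl : a = a' := funext h
  obtain rfl : b = b' := funext h'
  exact heq_of_eq (funext fun i => eq_of_heq (w i))

theorem natTrans_heq {A B : Type*} [Category* A] [Category* B] {F G F' G' : A ⥤ B} {α : F ⟶ G}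
    {β : F' ⟶ G'} (h : F = F') (h' : G = G') (w : ∀ a, α.app a ≍ β.app a) : α ≍ β := by
  subst h h'
  exact heq_of_eq (NatTrans.ext (funext fun a => eq_of_heq (w a)))

theorem conj_heq {A : Type*} [Category* A] {a b a' b' : A} (h : a' = a) (f : a ⟶ b) (h' : b = b') :
    eqToHom h ≫ f ≫ eqToHom h' ≍ f := by
  subst h h'
  simp

theorem FinAlgebra.act_heq (N : FinAlgebra P) {n : ℕ} {s : Fin n → C} {c : C} {p p' : P.Op s c}
    (f : p ⟶ p') {a b a' b' : ∀ i, N.M (s i)} {g : a ⟶ b} {g' : a' ⟶ b'} (h : ∀ i, a i = a' i)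
    (h' : ∀ i, b i = b' i) (w : ∀ i, g i ≍ g' i) :
    (N.act s c).map (X := (p, a)) (Y := (p', b)) (f, g) ≍
      (N.act s c).map (X := (p, a')) (Y := (p', b')) (f, g') := by
  obtain rfl : a = a' := funext h
  obtain rfl : b = b' := funext h'
  obtain rfl : g = g' := funext fun i => eq_of_heq (w i)
  rfl

theorem functor_heq {A B : Type*} [Category* A] [Category* B] {F G : A ⥤ B} (h : F = G) {a b : A}
    (f : a ⟶ b) : F.map f ≍ G.map f := by
  subst h
  rfl

/-- Families of functors that commute strictly with the actions of `P`. -/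
structure IsHom (N N' : FinAlgebra P) (G : ∀ c, N.M c ⥤ N'.M c) : Prop where
  act {n : ℕ} (s : Fin n → C) (c : C) :
    N.act s c ⋙ G c = (𝟭 (P.Op s c)).prod (Functor.pi fun i => G (s i)) ⋙ N'.act s c

/-- A family of functors out of trees that computes `φ` at white vertices and the action of `P` at
black vertices. -/
structure IsFold (N : FinAlgebra P) (φ : ∀ a, (∀ i, N.M (src (x a) i)) ⥤ N.M (tgt (x a)))
    (G : ∀ c, TreeCat x c ⥤ N.M c) : Prop where
  hom : IsHom (TreeCat.alg x) N G
  white (a : X) : TreeCat.white a ⋙ G _ = (Functor.pi fun i => G (src (x a) i)) ⋙ φ a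

theorem IsFold.unique {N : FinAlgebra P} {φ : ∀ a, (∀ i, N.M (src (x a) i)) ⥤ N.M (tgt (x a))}
    {G G' : ∀ c, TreeCat x c ⥤ N.M c} (h : IsFold N φ G) (h' : IsFold N φ G') (c : C) :
    G c = G' c := by
  have ho : ∀ {c : C} (t : QTree x c), (G c).obj t = (G' c).obj t := fun t =>
    QTree.ind (motive := fun {c} t => (G c).obj t = (G' c).obj t)
      (fun a ts ih => (Functor.congr_obj (h.white a) ts).trans
        ((congrArg (φ a).obj (funext ih)).trans (Functor.congr_obj (h'.white a) ts).symm))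
      (fun p ts ih => (Functor.congr_obj (h.hom.act _ _) (p, ts)).trans
        ((congrArg (fun z => (N.act _ _).obj (p, z)) (funext ih)).trans
          (Functor.congr_obj (h'.hom.act _ _) (p, ts)).symm)) t
  have hm : ∀ {c : C} {t t' : QTree x c} (f : QTree.Cell t t'),
      (G c).map (QTree.hom f) ≍ (G' c).map (QTree.hom f) := by
    intro c t t' f
    induction f with
    | id t =>
      refine (heq_of_eq ((G _).map_id t)).trans (HEq.trans ?_ (heq_of_eq ((G' _).map_id t).symm))
      rw [ho t]
    | comp f g ih ih' =>
      exact (heq_of_eq ((G _).map_comp _ _)).trans ((comp_heq (ho _) (ho _) (ho _) ih ih').trans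
        (heq_of_eq ((G' _).map_comp _ _).symm))
    | white a fs ih =>
      rw [← TreeCat.white_map]
      exact (functor_heq (h.white a) _).trans ((map_heq (φ a) (funext fun i => ho _)
        (funext fun i => ho _) (pi_heq (fun i => ho _) (fun i => ho _) ih)).trans
          (functor_heq (h'.white a) _).symm)
    | @black n s c p p' f ts ts' fs ih =>
      rw [← TreeCat.black_map]
      exact (functor_heq (h.hom.act s c) (a := (p, ts)) (b := (p', ts')) (f, _)).trans
        ((N.act_heq f (fun i => ho _) (fun i => ho _) ih).trans
        (functor_heq (h'.hom.act s c) (a := (p, ts)) (b := (p', ts')) (f, _)).symm)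
  refine CategoryTheory.Functor.hext ho fun t t' f => ?_
  obtain ⟨f, rfl⟩ := Quotient.exists_rep f
  exact hm f

section Fold

variable (N : FinAlgebra P) (φ : ∀ a, (∀ i, N.M (src (x a) i)) ⥤ N.M (tgt (x a)))

def foldTree : {c : C} → Tree x c → N.M c
  | _, .white a ts => (φ a).obj fun i => foldTree (ts i)
  | _, .black p ts => (N.act _ _).obj (p, fun i => foldTree (ts i))

theorem foldTree_rel {c : C} {t t' : Tree x c} (r : Tree.Rel t t') :
    foldTree N φ t = foldTree N φ t' := by
  induction r with
  | refl => rfl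
  | symm _ ih => exact ih.symm
  | trans _ _ ih ih' => exact ih.trans ih'
  | white a _ ih => exact congrArg (φ a).obj (funext ih)
  | black p _ ih => exact congrArg (fun z => (N.act _ _).obj (p, z)) (funext ih)
  | one ts => exact N.one_obj _
  | merge e p q ts => exact N.merge_obj e p q _

def foldObj {c : C} : QTree x c → N.M c := Quotient.lift (foldTree N φ) fun _ _ => foldTree_rel N φ

theorem foldObj_out {c : C} (t : QTree x c) : foldTree N φ (Quotient.out t) = foldObj N φ t :=
  congrArg (foldObj N φ) (Quotient.out_eq t)

theorem foldObj_white (a : X) (ts : ∀ i, QTree x (src (x a) i)) :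
    foldObj N φ (QTree.white a ts) = (φ a).obj fun i => foldObj N φ (ts i) :=
  congrArg (φ a).obj (funext fun i => foldObj_out N φ (ts i))

theorem foldObj_black {n : ℕ} {s : Fin n → C} {c : C} (p : P.Op s c) (ts : ∀ i, QTree x (s i)) :
    foldObj N φ (QTree.black p ts) = (N.act s c).obj (p, fun i => foldObj N φ (ts i)) :=
  congrArg (fun z => (N.act s c).obj (p, z)) (funext fun i => foldObj_out N φ (ts i))

def foldCell : {c : C} → {t t' : QTree x c} → QTree.Cell t t' → (foldObj N φ t ⟶ foldObj N φ t')
  | _, _, _, .id t => 𝟙 _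
  | _, _, _, .comp f g => foldCell f ≫ foldCell g
  | _, _, _, .white a fs => eqToHom (foldObj_white N φ a _) ≫
      (φ a).map (fun i => foldCell (fs i)) ≫ eqToHom (foldObj_white N φ a _).symm
  | _, _, _, .black (p := p) (p' := p') (ts := ts) (ts' := ts') f fs =>
      eqToHom (foldObj_black N φ _ _) ≫
      (N.act _ _).map (X := (p, fun i => foldObj N φ (ts i)))
        (Y := (p', fun i => foldObj N φ (ts' i))) (f, fun i => foldCell (fs i)) ≫
      eqToHom (foldObj_black N φ _ _).symm

theorem foldCell_white (a : X) {ts ts' : ∀ i, QTree x (src (x a) i)}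
    (fs : ∀ i, QTree.Cell (ts i) (ts' i)) :
    foldCell N φ (.white a fs) ≍ (φ a).map fun i => foldCell N φ (fs i) := by
  rw [foldCell]
  exact conj_heq _ _ _

theorem foldCell_black {n : ℕ} {s : Fin n → C} {c : C} {p p' : P.Op s c} (f : p ⟶ p')
    {ts ts' : ∀ i, QTree x (s i)} (fs : ∀ i, QTree.Cell (ts i) (ts' i)) :
    foldCell N φ (.black f fs) ≍ (N.act s c).map (X := (p, fun i => foldObj N φ (ts i)))
        (Y := (p', fun i => foldObj N φ (ts' i))) (f, fun i => foldCell N φ (fs i)) := by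
  rw [foldCell]
  exact conj_heq _ _ _

theorem foldCell_id {c : C} (t : QTree x c) : foldCell N φ (.id t) = 𝟙 _ := by
  rw [foldCell]

theorem foldCell_comp {c : C} {t t' t'' : QTree x c} (f : QTree.Cell t t')
    (g : QTree.Cell t' t'') :
    foldCell N φ (.comp f g) = foldCell N φ f ≫ foldCell N φ g := by
  rw [foldCell]

theorem foldCell_rel {c : C} {t t' u u' : QTree x c} {f : QTree.Cell t t'} {g : QTree.Cell u u'}
    (r : QTree.Cell.Rel f g) : foldCell N φ f ≍ foldCell N φ g := by
  induction r with
  | refl => rfl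
  | symm _ ih => exact ih.symm
  | trans _ _ ih ih' => exact ih.trans ih'
  | comp r r' ih ih' =>
    rw [foldCell, foldCell]
    exact comp_heq (congrArg _ r.endpoints.1) (congrArg _ r.endpoints.2)
      (congrArg _ r'.endpoints.2) ih ih'
  | white a r ih =>
    refine (foldCell_white N φ _ _).trans (HEq.trans ?_ (foldCell_white N φ _ _).symm)
    exact map_heq _ (funext fun i => congrArg _ (r i).endpoints.1)
      (funext fun i => congrArg _ (r i).endpoints.2)
      (pi_heq (fun i => congrArg _ (r i).endpoints.1) (fun i => congrArg _ (r i).endpoints.2) ih)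
  | black f r ih =>
    refine (foldCell_black N φ _ _).trans (HEq.trans ?_ (foldCell_black N φ _ _).symm)
    exact N.act_heq f (fun i => congrArg _ (r i).endpoints.1)
      (fun i => congrArg _ (r i).endpoints.2) ih
  | assoc f g h => simp only [foldCell, Category.assoc, heq_eq_eq]
  | id_comp => simp only [foldCell, Category.id_comp, heq_eq_eq]
  | comp_id => simp only [foldCell, Category.comp_id, heq_eq_eq]
  | white_id a ts =>
    rw [foldCell, foldCell]
    refine (conj_heq _ _ _).trans ?_
    simp only [foldCell]
    refine (heq_of_eq ((φ a).map_id fun i => foldObj N φ (ts i))).trans ?_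
    rw [foldObj_white]
  | white_comp a fs gs =>
    simp only [foldCell, Category.assoc, eqToHom_trans_assoc, eqToHom_refl, Category.id_comp]
    rw [← Category.assoc ((φ a).map _) ((φ a).map _)]
    exact heq_of_eq (congrArg (fun z => _ ≫ z ≫ _) ((φ a).map_comp _ _))
  | black_id p ts =>
    rw [foldCell, foldCell]
    refine (conj_heq _ _ _).trans ?_
    simp only [foldCell]
    refine (heq_of_eq ((N.act _ _).map_id (p, fun i => foldObj N φ (ts i)))).trans ?_
    rw [foldObj_black]
  | black_comp f g fs gs =>
    simp only [foldCell, Category.assoc, eqToHom_trans_assoc, eqToHom_refl, Category.id_comp]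
    rw [← Category.assoc ((N.act _ _).map _) ((N.act _ _).map _)]
    exact heq_of_eq (congrArg (eqToHom _ ≫ ·) (congrArg (· ≫ eqToHom _)
      ((N.act _ _).map_comp (X := (_, _)) (Y := (_, _)) (Z := (_, _)) (f, _) (g, _))))
  | one fs =>
    exact (foldCell_black N φ _ _).trans (N.one_map _)
  | merge e f g fs =>
    refine (foldCell_black N φ _ _).trans (HEq.trans ?_ (foldCell_black N φ _ _).symm)
    refine HEq.trans ?_ (N.merge_map e f g fun i j => foldCell N φ (fs i j))
    refine N.act_heq f (fun i => foldObj_black N φ _ _) (fun i => foldObj_black N φ _ _) fun i => ?_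
    exact foldCell_black N φ _ _

/-- Evaluation of trees in an algebra, given the values at the white vertices. -/
def fold (c : C) : TreeCat x c ⥤ N.M c where
  obj := foldObj N φ
  map {t t'} := Quotient.lift (s := QTree.homSetoid (x := x) t t') (foldCell N φ)
    fun _ _ r => eq_of_heq (foldCell_rel N φ r)
  map_id t := foldCell_id N φ t
  map_comp f g := by
    obtain ⟨f, rfl⟩ := Quotient.exists_rep f
    obtain ⟨g, rfl⟩ := Quotient.exists_rep g
    exact foldCell_comp N φ f g

theorem fold_isFold : IsFold N φ (fold N φ) where
  hom := by
    refine ⟨fun {n} s c => ?_⟩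
    refine CategoryTheory.Functor.hext (fun t => foldObj_black N φ t.1 t.2) ?_
    rintro ⟨p, ts⟩ ⟨p', ts'⟩ ⟨f, g⟩
    obtain ⟨g, rfl⟩ := QTree.exists_hom g
    exact (heq_of_eq (congrArg (fun z => (fold N φ c).map z) (TreeCat.black_map f g))).trans
      (foldCell_black N φ f g)
  white a := by
    refine CategoryTheory.Functor.hext (foldObj_white N φ a) ?_
    intro ts ts' f
    obtain ⟨f, rfl⟩ := QTree.exists_hom f
    exact (heq_of_eq (congrArg (fun z => (fold N φ _).map z) (TreeCat.white_map a f))).trans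
      (foldCell_white N φ a f)

end Fold


theorem IsHom.comp {N N' N'' : FinAlgebra P} {G : ∀ c, N.M c ⥤ N'.M c}
    {H : ∀ c, N'.M c ⥤ N''.M c} (h : IsHom N N' G) (h' : IsHom N' N'' H) :
    IsHom N N'' fun c => G c ⋙ H c := ⟨fun s c =>
  (congrArg (· ⋙ H c) (h.act s c)).trans
    (congrArg ((𝟭 (P.Op s c)).prod (Functor.pi fun i => G (s i)) ⋙ ·) (h'.act s c))⟩

/-- Operations act pointwise on functors with values in an algebra. -/
def powMap {S T B : Type u} {I : Type} {A : I → Type u} [Category.{u} S] [Category.{u} T]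
    [Category.{u} B] [∀ i, Category.{u} (A i)] (Φ : T × (∀ i, A i) ⥤ B) :
    ((S ⥤ T) × ∀ i, (S ⥤ A i)) ⥤ (S ⥤ B) where
  obj F := Functor.prod' F.1 (Functor.pi' F.2) ⋙ Φ
  map {F G} α := Functor.whiskerRight
    ({ app := fun σ => (α.1.app σ, fun i => (α.2 i).app σ)
       naturality := fun σ τ f => Prod.ext (α.1.naturality f)
        (funext fun i => (α.2 i).naturality f) } :
      Functor.prod' F.1 (Functor.pi' F.2) ⟶ Functor.prod' G.1 (Functor.pi' G.2)) Φ
  map_id F := NatTrans.ext (funext fun σ => Φ.map_id _)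
  map_comp {F G H} α β := NatTrans.ext (funext fun σ => Φ.map_comp
    (X := (F.1.obj σ, fun i => (F.2 i).obj σ)) (Y := (G.1.obj σ, fun i => (G.2 i).obj σ))
    (Z := (H.1.obj σ, fun i => (H.2 i).obj σ)) (α.1.app σ, fun i => (α.2 i).app σ)
    (β.1.app σ, fun i => (β.2 i).app σ))

theorem FinAlgebra.pow_one (S : Cat.{u, u}) (N : FinAlgebra P) {c : C}
    (a : ∀ _ : Fin 1, S ⥤ N.M c) :
    (powMap (N.act (fun _ => c) c)).obj ((Functor.const S).obj (unitOp P c), a) = a 0 :=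
  CategoryTheory.Functor.hext (fun σ => N.one_obj fun i => (a i).obj σ)
    fun σ τ f => N.one_map fun i => (a i).map f

theorem FinAlgebra.pow_merge (S : Cat.{u, u}) (N : FinAlgebra P) {n l : ℕ} {m : Fin n → ℕ}
    (e : (Σ i, Fin (m i)) ≃ Fin l) {s : Fin n → C} {t : ∀ i, Fin (m i) → C} {c : C}
    (p : P.Op s c) (q : ∀ i, P.Op (t i) (s i)) (a : ∀ i j, S ⥤ N.M (t i j)) :
    (powMap (N.act s c)).obj ((Functor.const S).obj p, fun i =>
        (powMap (N.act (t i) (s i))).obj ((Functor.const S).obj (q i), a i)) =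
      (powMap (N.act _ c)).obj ((Functor.const S).obj ((multiComp P e s t c).obj (p, q)),
        fun j => a (e.symm j).1 (e.symm j).2) := by
  refine CategoryTheory.Functor.hext (fun σ => N.merge_obj e p q fun i j => (a i j).obj σ)
    fun σ τ f => HEq.trans (N.merge_map e (𝟙 p) (𝟙 q) fun i j => (a i j).map f) ?_
  rw [show (multiComp P e s t c).map (X := (p, q)) (Y := (p, q)) (𝟙 p, 𝟙 q) = 𝟙 _ from
    (multiComp P e s t c).map_id (p, q)]
  rfl

/-- The algebra of functors from `S` to `N`, with the pointwise action. -/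
def FinAlgebra.pow (S : Cat.{u, u}) (N : FinAlgebra P) : FinAlgebra P where
  M c := Cat.of (S ⥤ N.M c)
  act s c := (Functor.const S).prod (𝟭 (∀ i, S ⥤ N.M (s i))) ⋙ powMap (N.act s c)
  one_obj := N.pow_one S
  one_map {c a b} f := natTrans_heq (N.pow_one S a) (N.pow_one S b)
    fun σ => N.one_map fun i => (f i).app σ
  merge_obj e s t c := N.pow_merge S e
  merge_map {n l m} e {s t c p p' q q' a a'} f g h :=
    natTrans_heq (N.pow_merge S e p q a) (N.pow_merge S e p' q' a')
      fun σ => N.merge_map e f g fun i j => (h i j).app σ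

def powOp {S B : Type u} {I : Type} {A : I → Type u} [Category.{u} S]
    [Category.{u} B] [∀ i, Category.{u} (A i)] (Φ : S × (∀ i, A i) ⥤ B) :
    (∀ i, (S ⥤ A i)) ⥤ (S ⥤ B) :=
  Functor.prod' (Functor.const _ |>.obj (𝟭 S)) (𝟭 _) ⋙ powMap Φ

theorem IsHom.whiskerRight (S : Cat.{u, u}) {N N' : FinAlgebra P} {G : ∀ c, N.M c ⥤ N'.M c}
    (h : IsHom N N' G) :
    IsHom (N.pow S) (N'.pow S) fun c => (Functor.whiskeringRight S _ _).obj (G c) := ⟨fun s c =>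
  congrArg (fun Φ => (Functor.const S).prod (𝟭 (∀ i, S ⥤ N.M (s i))) ⋙ powMap Φ) (h.act s c)⟩

theorem IsHom.whiskerLeft {S S' : Cat.{u, u}} (K : S' ⥤ S) (N : FinAlgebra P) :
    IsHom (N.pow S) (N.pow S') fun c => (Functor.whiskeringLeft S' S _).obj K := ⟨fun s c => rfl⟩

theorem IsHom.evaluation (S : Cat.{u, u}) (σ : S) (N : FinAlgebra P) :
    IsHom (N.pow S) N fun c => (evaluation S _).obj σ := by
  refine ⟨fun s c => ?_⟩
  refine CategoryTheory.Functor.hext (fun t => rfl) ?_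
  rintro ⟨p, a⟩ ⟨q, b⟩ ⟨f, g⟩
  rfl

/-- Grafting trees onto a vertex whose colour is known to be `k`. -/
def whiteAt {k : Colour P} (a : X) (h : x a = k) :
    (∀ i, TreeCat x (src k i)) ⥤ TreeCat x (tgt k) :=
  Eq.rec (motive := fun k _ => (∀ i, TreeCat x (src k i)) ⥤ TreeCat x (tgt k))
    (TreeCat.white a) h

def opOf : (k : Colour P) → k.isLeft → P.Op (src k) (tgt k)
  | Sum.inl b, _ => b.op

/-- The action of the operation which is the colour `k`. -/
def FinAlgebra.actOf (N : FinAlgebra P) (k : Colour P) (hk : k.isLeft) :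
    (∀ i, N.M (src k i)) ⥤ N.M (tgt k) :=
  Functor.prod' (Functor.const _ |>.obj (opOf k hk)) (𝟭 _) ⋙ N.act (src k) (tgt k)

theorem IsHom.actOf {N N' : FinAlgebra P} {G : ∀ c, N.M c ⥤ N'.M c} (h : IsHom N N' G)
    (k : Colour P) (hk : k.isLeft) :
    N.actOf k hk ⋙ G (tgt k) = (Functor.pi fun i => G (src k i)) ⋙ N'.actOf k hk := by
  refine (congrArg (Functor.prod' (Functor.const _ |>.obj (opOf k hk)) (𝟭 _) ⋙ ·)
    (h.act (src k) (tgt k))).trans ?_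
  refine CategoryTheory.Functor.hext (fun t => rfl) fun t t' f => heq_of_eq ?_
  exact congrArg (fun z => (N'.act _ _).map (X := (_, fun i => (G _).obj (t i)))
    (Y := (_, fun i => (G _).obj (t' i))) (z, fun i => (G _).map (f i))) rfl

/-- The vertices of colours `x`, together with one leaf for each input of `k`. -/
def wl (x : X → Colour P) (k : Colour P) : X ⊕ Fin (ar k) → Colour P :=
  Sum.elim x fun i => Sum.inr (src k i)

/-- The tree consisting of a single edge ending in the given leaf. -/
def leaf (x : X → Colour P) (k : Colour P) (i : Fin (ar k)) : TreeCat (wl x k) (src k i) :=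
  (whiteAt (x := wl x k) (k := Sum.inr (src k i)) (Sum.inr i) rfl).obj fun j => j.elim0

/-- Trees with root colour the output colour of `k`, with vertices `x` and leaves the inputs of
`k`. -/
abbrev Ctx (x : X → Colour P) (k : Colour P) : Cat.{u, u} := TreeCat (wl x k) (tgt k)

def plugWhite {Y W : Type} {y : Y → Colour P} {w : W → Colour P} (k : Colour P) (r : Y → W)
    (h : ∀ j, w (r j) = y j) : (v : Y ⊕ Fin (ar k)) →
      (∀ i, (∀ i, TreeCat w (src k i)) ⥤ TreeCat w (src (wl y k v) i)) ⥤
        ((∀ i, TreeCat w (src k i)) ⥤ TreeCat w (tgt (wl y k v)))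
  | Sum.inl j => powOp (CategoryTheory.Prod.snd _ _ ⋙ whiteAt (r j) (h j))
  | Sum.inr i => Functor.const _ |>.obj (Pi.eval _ i)

/-- Evaluation of a tree whose leaves are the inputs of `k`: the white vertices become those of
another family of vertices, along `r`, and the leaves are replaced by the given trees. -/
def plug {Y W : Type} {y : Y → Colour P} {w : W → Colour P} (k : Colour P) (r : Y → W)
    (h : ∀ j, w (r j) = y j) (c : C) :
    TreeCat (wl y k) c ⥤ ((∀ i, TreeCat w (src k i)) ⥤ TreeCat w c) :=
  fold (x := wl y k) ((TreeCat.alg w).pow (Cat.of (∀ i, TreeCat w (src k i))))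
    (plugWhite k r h) c

def compWhite {Y : X → Type} {y : ∀ a, Y a → Colour P} {Z : Type} {z : Z → Colour P}
    (r : (Σ a, Y a) → Z) (h : ∀ s, z (r s) = y s.1 s.2) (k : Colour P) : (v : X ⊕ Fin (ar k)) →
      (∀ i, (∀ a, Ctx (y a) (x a)) ⥤ TreeCat (wl z k) (src (wl x k v) i)) ⥤
        ((∀ a, Ctx (y a) (x a)) ⥤ TreeCat (wl z k) (tgt (wl x k v)))
  | Sum.inl a => powOp ((Pi.eval _ a).prod (𝟭 _) ⋙ Functor.uncurry.obj
      (plug (w := wl z k) (x a) (fun j => Sum.inl (r ⟨a, j⟩)) (fun j => h ⟨a, j⟩) (tgt (x a))))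
  | Sum.inr i => powOp (CategoryTheory.Prod.snd _ _ ⋙
      whiteAt (x := wl z k) (k := Sum.inr (src k i)) (Sum.inr i) rfl)

/-- Simultaneous insertion of trees in the white vertices of a tree. -/
def treeComp {Y : X → Type} {y : ∀ a, Y a → Colour P} {Z : Type} {z : Z → Colour P}
    (r : (Σ a, Y a) → Z) (h : ∀ s, z (r s) = y s.1 s.2) (k : Colour P) (c : C) :
    TreeCat (wl x k) c ⥤ ((∀ a, Ctx (y a) (x a)) ⥤ TreeCat (wl z k) c) :=
  fold (x := wl x k) ((TreeCat.alg (wl z k)).pow (Cat.of (∀ a, Ctx (y a) (x a))))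
    (compWhite r h k) c

variable (P) in
def noVertex : Empty → Colour P := Empty.elim

def targetWhite (k : Colour P) (hx : ∀ a, (x a).isLeft) : (v : X ⊕ Fin (ar k)) →
    (∀ i, TreeCat (wl (noVertex P) k) (src (wl x k v) i)) ⥤
      TreeCat (wl (noVertex P) k) (tgt (wl x k v))
  | Sum.inl a => (TreeCat.alg _).actOf (x a) (hx a)
  | Sum.inr i => whiteAt (x := wl (noVertex P) k) (k := Sum.inr (src k i)) (Sum.inr i) rfl

/-- The target of a tree: all vertices are made black, so that they are multiplied in `P`. -/
def target (k : Colour P) (hx : ∀ a, (x a).isLeft) (c : C) :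
    TreeCat (wl x k) c ⥤ TreeCat (wl (noVertex P) k) c :=
  fold (x := wl x k) (TreeCat.alg _) (targetWhite k hx) c

theorem plug_isFold {Y W : Type} {y : Y → Colour P} {w : W → Colour P} (k : Colour P)
    (r : Y → W) (h : ∀ j, w (r j) = y j) :
    IsFold (x := wl y k) ((TreeCat.alg w).pow (Cat.of (∀ i, TreeCat w (src k i))))
      (plugWhite k r h) (plug k r h) :=
  fold_isFold _ _

theorem treeComp_isFold {Y : X → Type} {y : ∀ a, Y a → Colour P} {Z : Type} {z : Z → Colour P}
    (r : (Σ a, Y a) → Z) (h : ∀ s, z (r s) = y s.1 s.2) (k : Colour P) :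
    IsFold (x := wl x k) ((TreeCat.alg (wl z k)).pow (Cat.of (∀ a, Ctx (y a) (x a))))
      (compWhite r h k) (treeComp r h k) :=
  fold_isFold _ _

theorem target_isFold (k : Colour P) (hx : ∀ a, (x a).isLeft) :
    IsFold (x := wl x k) (TreeCat.alg (wl (noVertex P) k)) (targetWhite k hx) (target k hx) :=
  fold_isFold _ _

def plug₀ (k k' : Colour P) (c : C) : TreeCat (wl (noVertex P) k') c ⥤
    ((∀ i, TreeCat (wl (noVertex P) k) (src k' i)) ⥤ TreeCat (wl (noVertex P) k) c) :=
  plug (w := wl (noVertex P) k) k' (fun j => Sum.inl j) (fun j => j.elim) c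

theorem plug₀_isFold (k k' : Colour P) :
    IsFold (x := wl (noVertex P) k') ((TreeCat.alg (wl (noVertex P) k)).pow
      (Cat.of (∀ i, TreeCat (wl (noVertex P) k) (src k' i))))
      (plugWhite (w := wl (noVertex P) k) k' (fun j => Sum.inl j) (fun j => j.elim))
      (plug₀ k k') :=
  plug_isFold _ _ _

theorem whiteAt_target {k k' : Colour P} (hx : ∀ a, (x a).isLeft) (hk : k'.isLeft) (a : X)
    (h : x a = k') :
    whiteAt (x := wl x k) (Sum.inl a) h ⋙ target k hx (tgt k') =
      (Functor.pi fun i => target k hx (src k' i)) ⋙ (TreeCat.alg _).actOf k' hk := by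
  subst h
  exact (target_isFold k hx).white (Sum.inl a)

theorem target_leaf (k : Colour P) (hx : ∀ a, (x a).isLeft) (i : Fin (ar k)) :
    (target k hx (src k i)).obj (leaf x k i) = leaf (noVertex P) k i :=
  (Functor.congr_obj ((target_isFold k hx).white (Sum.inr i)) (fun j => j.elim0)).trans
    (congrArg (whiteAt (x := wl (noVertex P) k) (k := Sum.inr (src k i)) (Sum.inr i) rfl).obj
      (funext fun j => j.elim0))

def plugTarget {Y : Type} {y : Y → Colour P} (k k' : Colour P) (hy : ∀ j, (y j).isLeft) {Z : Type}
    {z : Z → Colour P} (hz : ∀ j, (z j).isLeft) : (v : Y ⊕ Fin (ar k')) →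
      (∀ i, (∀ i, TreeCat (wl z k) (src k' i)) ⥤
        TreeCat (wl (noVertex P) k) (src (wl y k' v) i)) ⥤
        ((∀ i, TreeCat (wl z k) (src k' i)) ⥤ TreeCat (wl (noVertex P) k) (tgt (wl y k' v)))
  | Sum.inl j => ((TreeCat.alg _).pow (Cat.of (∀ i, TreeCat (wl z k) (src k' i)))).actOf (y j) (hy j)
  | Sum.inr i => Functor.const _ |>.obj (Pi.eval _ i ⋙ target k hz _)

theorem plug_target {Y : Type} {y : Y → Colour P} {Z : Type} {z : Z → Colour P} (k k' : Colour P)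
    (hy : ∀ j, (y j).isLeft) (hz : ∀ j, (z j).isLeft) (r : Y → Z) (h : ∀ j, z (r j) = y j) (c : C) :
    plug (w := wl z k) k' (fun j => Sum.inl (r j)) h c ⋙
        (Functor.whiskeringRight _ _ _).obj (target k hz c) =
      target k' hy c ⋙ plug₀ k k' c ⋙
        (Functor.whiskeringLeft _ _ _).obj (Functor.pi fun i => target k hz (src k' i)) := by
  have h1 := plug_isFold (w := wl z k) k' (fun j => Sum.inl (r j)) h
  have h3 := (plug₀_isFold k k').hom.comp
    (.whiskerLeft (S' := Cat.of (∀ i, TreeCat (wl z k) (src k' i)))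
      (Functor.pi fun i => target k hz (src k' i)) _)
  refine IsFold.unique (N := (TreeCat.alg _).pow (Cat.of (∀ i, TreeCat (wl z k) (src k' i))))
    (φ := plugTarget k k' hy hz)
    (G := fun c => plug (w := wl z k) k' (fun j => Sum.inl (r j)) h c ⋙
      (Functor.whiskeringRight _ _ _).obj (target k hz c))
    (G' := fun c => target k' hy c ⋙ plug₀ k k' c ⋙
        (Functor.whiskeringLeft _ _ _).obj (Functor.pi fun i => target k hz (src k' i)))
    ⟨h1.hom.comp ((target_isFold k hz).hom.whiskerRight _), ?_⟩
    ⟨(target_isFold k' hy).hom.comp h3, ?_⟩ c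
  · rintro (j | i)
    · have e := whiteAt_target (k := k) hz (hy j) (r j) (h j)
      refine (congrArg (· ⋙ (Functor.whiskeringRight _ _ _).obj (target k hz _))
        (h1.white (Sum.inl j))).trans ?_
      exact congrArg (fun Φ => Functor.pi _ ⋙ powOp (CategoryTheory.Prod.snd _ _ ⋙ Φ)) e
    · exact congrArg (· ⋙ (Functor.whiskeringRight _ _ _).obj (target k hz _))
        (h1.white (Sum.inr i))
  · rintro (j | i)
    · refine (congrArg (· ⋙ (plug₀ k k' _ ⋙ (Functor.whiskeringLeft _ _ _).obj
        (Functor.pi fun i => target k hz (src k' i)))) ((target_isFold k' hy).white (Sum.inl j))).trans ?_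
      exact congrArg (Functor.pi _ ⋙ ·) (h3.actOf (y j) (hy j))
    · refine (congrArg (· ⋙ (plug₀ k k' _ ⋙ (Functor.whiskeringLeft _ _ _).obj
        (Functor.pi fun i => target k hz (src k' i)))) ((target_isFold k' hy).white (Sum.inr i))).trans ?_
      exact congrArg ((Functor.pi fun j => target k' hy (src (wl y k' (Sum.inr i)) j)) ⋙ ·)
        (congrArg (· ⋙ (Functor.whiskeringLeft _ _ _).obj
        (Functor.pi fun i => target k hz (src k' i))) ((plug₀_isFold k k').white (Sum.inr i)))

theorem uncurry_comp {A B D E : Type u} [Category.{u} A] [Category.{u} B] [Category.{u} D]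
    [Category.{u} E] (F : A ⥤ B ⥤ D) (G : D ⥤ E) : Functor.uncurry.obj F ⋙ G =
      Functor.uncurry.obj (F ⋙ (Functor.whiskeringRight B D E).obj G) :=
  CategoryTheory.Functor.hext (fun _ => rfl) fun _ _ _ => heq_of_eq (G.map_comp _ _)

def treeComp₀ (k : Colour P) (c : C) : TreeCat (wl x k) c ⥤
    ((∀ a, Ctx (noVertex P) (x a)) ⥤ TreeCat (wl (noVertex P) k) c) :=
  treeComp (y := fun _ => noVertex P) (fun s => s.2) (fun s => s.2.elim) k c

theorem treeComp_target {Y : X → Type} {y : ∀ a, Y a → Colour P} {Z : Type} {z : Z → Colour P}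
    (r : (Σ a, Y a) → Z) (h : ∀ s, z (r s) = y s.1 s.2) (k : Colour P)
    (hy : ∀ a j, (y a j).isLeft) (hz : ∀ j, (z j).isLeft) (c : C) :
    treeComp r h k c ⋙ (Functor.whiskeringRight _ _ _).obj (target k hz c) =
      treeComp₀ k c ⋙
        (Functor.whiskeringLeft _ _ _).obj (Functor.pi fun a => target (x a) (hy a) (tgt (x a))) := by
  refine IsFold.unique (N := (TreeCat.alg _).pow (Cat.of (∀ a, Ctx (y a) (x a))))
    (φ := fun v => match v with
      | Sum.inl a => powOp ((Pi.eval _ a ⋙ target (x a) (hy a) (tgt (x a))).prod (𝟭 _) ⋙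
          Functor.uncurry.obj (plug₀ k (x a) (tgt (x a))))
      | Sum.inr i => powOp (CategoryTheory.Prod.snd _ _ ⋙
          whiteAt (x := wl (noVertex P) k) (k := Sum.inr (src k i)) (Sum.inr i) rfl))
    (G := fun c => treeComp r h k c ⋙ (Functor.whiskeringRight _ _ _).obj (target k hz c))
    (G' := fun c => treeComp₀ k c ⋙
        (Functor.whiskeringLeft _ _ _).obj (Functor.pi fun a => target (x a) (hy a) (tgt (x a))))
    ⟨(treeComp_isFold r h k).hom.comp ((target_isFold k hz).hom.whiskerRight _), ?_⟩
    ⟨(treeComp_isFold _ _ k).hom.comp (.whiskerLeft _ _), ?_⟩ c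
  · rintro (a | i)
    · refine (congrArg (· ⋙ (Functor.whiskeringRight _ _ _).obj (target k hz _))
        ((treeComp_isFold r h k).white (Sum.inl a))).trans ?_
      exact congrArg (fun Φ => (Functor.pi fun j => treeComp r h k (src (wl x k (Sum.inl a)) j)) ⋙
        powOp (S := ∀ a, Ctx (y a) (x a)) ((Pi.eval _ a).prod (𝟭 _) ⋙ Φ))
        ((uncurry_comp (plug (w := wl z k) (x a) (fun j => Sum.inl (r ⟨a, j⟩))
          (fun j => h ⟨a, j⟩) (tgt (x a))) (target k hz (tgt (x a)))).trans
        (congrArg Functor.uncurry.obj (plug_target k (x a) (hy a) hz (fun j => r ⟨a, j⟩)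
          (fun j => h ⟨a, j⟩) (tgt (x a)))))
    · refine (congrArg (· ⋙ (Functor.whiskeringRight _ _ _).obj (target k hz _))
        ((treeComp_isFold r h k).white (Sum.inr i))).trans ?_
      exact congrArg (fun Φ => (Functor.pi fun j => treeComp r h k (src (wl x k (Sum.inr i)) j)) ⋙
        powOp (S := ∀ a, Ctx (y a) (x a)) (CategoryTheory.Prod.snd _ _ ⋙ Φ))
        ((target_isFold k hz).white (Sum.inr i))
  · rintro (a | i)
    · exact congrArg (· ⋙ (Functor.whiskeringLeft _ _ _).obj _)
        ((treeComp_isFold _ _ k).white (Sum.inl a))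
    · exact congrArg (· ⋙ (Functor.whiskeringLeft _ _ _).obj _)
        ((treeComp_isFold _ _ k).white (Sum.inr i))

theorem treeComp₀_isFold (k : Colour P) : IsFold (x := wl x k)
    ((TreeCat.alg (wl (noVertex P) k)).pow (Cat.of (∀ a, Ctx (noVertex P) (x a))))
    (compWhite (y := fun _ => noVertex P) (z := noVertex P) (fun s => s.2) (fun s => s.2.elim) k)
    (treeComp₀ k) :=
  treeComp_isFold _ _ k

theorem uncurry_eval {A B D : Type u} [Category.{u} A] [Category.{u} B] [Category.{u} D]
    (F : A ⥤ B ⥤ D) (a : A) :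
    Functor.prod' (Functor.const _ |>.obj a) (𝟭 B) ⋙ Functor.uncurry.obj F = F.obj a :=
  CategoryTheory.Functor.hext (fun _ => rfl) fun _ _ _ => heq_of_eq (by simp)

/-- The tree with a single vertex, black and decorated with the operation `k`. -/
def corolla (k : Colour P) (hk : k.isLeft) : Ctx (noVertex P) k :=
  ((TreeCat.alg (wl (noVertex P) k)).actOf k hk).obj (leaf (noVertex P) k)

theorem plug₀_leaf (k k' : Colour P) (i : Fin (ar k')) :
    (plug₀ k k' (src k' i)).obj (leaf (noVertex P) k' i) = Pi.eval _ i :=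
  Functor.congr_obj ((plug₀_isFold k k').white (Sum.inr i)) (fun j => j.elim0)

theorem plug₀_corolla (k k' : Colour P) (hk : k'.isLeft) :
    (plug₀ k k' (tgt k')).obj (corolla k' hk) = (TreeCat.alg (wl (noVertex P) k)).actOf k' hk := by
  have e : (fun i => (plug₀ k k' (src k' i)).obj (leaf (noVertex P) k' i)) =
    fun i => Pi.eval _ i := funext fun i => plug₀_leaf k k' i
  exact (Functor.congr_obj ((plug₀_isFold k k').hom.actOf k' hk) (leaf (noVertex P) k')).trans
    (congrArg (((TreeCat.alg (wl (noVertex P) k)).pow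
      (Cat.of (∀ i, TreeCat (wl (noVertex P) k) (src k' i)))).actOf k' hk).obj e)

theorem treeComp₀_corolla (k : Colour P) (hx : ∀ a, (x a).isLeft) (c : C) :
    treeComp₀ k c ⋙ (evaluation _ _).obj (fun a => corolla (x a) (hx a)) = target k hx c := by
  refine IsFold.unique (N := TreeCat.alg _) (φ := targetWhite k hx)
    (G := fun c => treeComp₀ k c ⋙ (evaluation (∀ a, Ctx (noVertex P) (x a)) _).obj
      (fun a => corolla (x a) (hx a)))
    ⟨(treeComp₀_isFold k).hom.comp (.evaluation (Cat.of (∀ a, Ctx (noVertex P) (x a))) _ _), ?_⟩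
    (target_isFold k hx) c
  rintro (a | i)
  · refine (congrArg (· ⋙ (evaluation (∀ a, Ctx (noVertex P) (x a)) _).obj
      (fun a => corolla (x a) (hx a))) ((treeComp₀_isFold k).white (Sum.inl a))).trans ?_
    exact congrArg ((Functor.pi fun i => treeComp₀ k (src (wl x k (Sum.inl a)) i) ⋙
        (evaluation (∀ a, Ctx (noVertex P) (x a)) _).obj (fun a => corolla (x a) (hx a))) ⋙ ·)
      ((uncurry_eval (plug₀ k (x a) (tgt (x a))) (corolla (x a) (hx a))).trans
        (plug₀_corolla k (x a) (hx a)))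
  · exact congrArg (· ⋙ (evaluation (∀ a, Ctx (noVertex P) (x a)) _).obj
      (fun a => corolla (x a) (hx a))) ((treeComp₀_isFold k).white (Sum.inr i))

/-- The tree with a single vertex, white and decorated with `k`. -/
def unitTree (k : Colour P) : Ctx (fun _ : Unit => k) k :=
  (TreeCat.white (x := wl (fun _ : Unit => k) k) (Sum.inl ())).obj (leaf _ k)

theorem target_unitTree (k : Colour P) (hk : k.isLeft) :
    (target k (fun _ : Unit => hk) (tgt k)).obj (unitTree k) = corolla k hk := by
  have e : (fun i => (target k (fun _ : Unit => hk) (src k i)).obj (leaf _ k i)) =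
    leaf (noVertex P) k := funext fun i => target_leaf k _ i
  exact (Functor.congr_obj ((target_isFold k fun _ : Unit => hk).white (Sum.inl ()))
    (leaf _ k)).trans (congrArg ((TreeCat.alg (wl (noVertex P) k)).actOf k hk).obj e)

def weightTree (g : X → ℕ) : {c : C} → Tree x c → ℕ
  | _, .white a ts => g a + ∑ i, weightTree g (ts i)
  | _, .black _ ts => ∑ i, weightTree g (ts i)

theorem weightTree_rel (g : X → ℕ) {c : C} {t t' : Tree x c} (r : Tree.Rel t t') :
    weightTree g t = weightTree g t' := by
  induction r with
  | refl => rfl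
  | symm _ ih => exact ih.symm
  | trans _ _ ih ih' => exact ih.trans ih'
  | white a _ ih => simp only [weightTree, ih]
  | black p _ ih => simp only [weightTree, ih]
  | one ts => simp [weightTree]
  | merge e p q ts =>
    simp only [weightTree]
    rw [Equiv.sum_comp e.symm fun s => weightTree g (ts s.1 s.2)]
    rw [Fintype.sum_sigma]

/-- The total weight of the white vertices and leaves of a tree, counted with multiplicity. -/
def weight (g : X → ℕ) {c : C} : TreeCat x c → ℕ :=
  Quotient.lift (s := treeSetoid x c) (weightTree g) fun _ _ => weightTree_rel g

theorem weight_out (g : X → ℕ) {c : C} (t : QTree x c) :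
    weightTree g (Quotient.out t) = weight g t :=
  congrArg (weight g) (Quotient.out_eq t)

theorem weight_white (g : X → ℕ) (a : X) (ts : ∀ i, TreeCat x (src (x a) i)) :
    weight g ((TreeCat.white a).obj ts) = g a + ∑ i, weight g (ts i) :=
  congrArg (g a + ·) (Finset.sum_congr rfl fun i _ => weight_out g (ts i))

theorem weight_black (g : X → ℕ) {n : ℕ} {s : Fin n → C} {c : C} (p : P.Op s c)
    (ts : ∀ i, TreeCat x (s i)) :
    weight g ((TreeCat.black s c).obj (p, ts)) = ∑ i, weight g (ts i) :=
  Finset.sum_congr (s₁ := Finset.univ) rfl fun i _ => weight_out g (ts i)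

theorem weight_whiteAt (g : X → ℕ) {k : Colour P} (a : X) (h : x a = k)
    (ts : ∀ i, TreeCat x (src k i)) :
    weight g ((whiteAt a h).obj ts) = g a + ∑ i, weight g (ts i) := by
  subst h
  exact weight_white g a ts

theorem weight_plug {Y W : Type} {y : Y → Colour P} {w : W → Colour P} (k : Colour P) (r : Y → W)
    (h : ∀ j, w (r j) = y j) (g : W → ℕ) (ts : ∀ i, TreeCat w (src k i)) {c : C}
    (q : TreeCat (wl y k) c) :
    weight g (((plug k r h c).obj q).obj ts) =
      weight (Sum.elim (fun j => g (r j)) fun i => weight g (ts i)) q := by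
  refine QTree.ind (motive := fun {c} q => weight g (((plug k r h c).obj q).obj ts) =
      weight (Sum.elim (fun j => g (r j)) fun i => weight g (ts i)) q) ?_ ?_ q
  · rintro (j | i) us ih
    · refine (congrArg (fun F => weight g (F.obj ts)) (Functor.congr_obj
        ((plug_isFold k r h).white (Sum.inl j)) us)).trans ?_
      exact (weight_whiteAt g (r j) (h j) _).trans ((congrArg (g (r j) + ·)
        (Finset.sum_congr rfl fun i _ => ih i)).trans (weight_white (x := wl y k) (Sum.elim (fun j => g (r j)) fun i => weight g (ts i)) (Sum.inl j) us).symm)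
    · refine (congrArg (fun F => weight g (F.obj ts)) (Functor.congr_obj
        ((plug_isFold k r h).white (Sum.inr i)) us)).trans ?_
      exact (weight_white (x := wl y k) (Sum.elim (fun j => g (r j)) fun i => weight g (ts i)) (Sum.inr i) us).symm
  · intro n s c p us ih
    refine (congrArg (fun F => weight g (F.obj ts)) (Functor.congr_obj
        ((plug_isFold k r h).hom.act s c) (p, us))).trans ?_
    exact (weight_black g p _).trans ((Finset.sum_congr rfl fun i _ => ih i).trans
      (weight_black (x := wl y k) (Sum.elim (fun j => g (r j)) fun i => weight g (ts i)) p us).symm)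

/-- Every white vertex and every leaf occurs exactly once. -/
def Linear {c : C} (t : TreeCat x c) : Prop := ∀ g : X → ℕ, weight g t = ∑ᶠ a, g a

theorem linear_unitTree (k : Colour P) : Linear (unitTree k) := by
  intro g
  rw [finsum_eq_sum_of_fintype, Fintype.sum_sum_type]
  refine (weight_white g (Sum.inl ()) _).trans ?_
  refine congrArg₂ (· + ·) (by simp) (Finset.sum_congr rfl fun i _ => ?_)
  refine (weight_whiteAt g (Sum.inr i) rfl _).trans ?_
  exact congrArg (g (Sum.inr i) + ·) Finset.sum_empty

theorem linear_treeComp {Y : X → Type} [Finite X] [∀ a, Finite (Y a)] {y : ∀ a, Y a → Colour P}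
    {Z : Type} {z : Z → Colour P} (r : (Σ a, Y a) ≃ Z) (h : ∀ s, z (r s) = y s.1 s.2)
    (k : Colour P) {t : Ctx x k} {q : ∀ a, Ctx (y a) (x a)} (ht : Linear t)
    (hq : ∀ a, Linear (q a)) : Linear (((treeComp r h k _).obj t).obj q) := by
  intro g
  have := Fintype.ofFinite X
  have := fun a => Fintype.ofFinite (Y a)
  have := Fintype.ofEquiv _ r
  have key : ∀ {c : C} (t : TreeCat (wl x k) c), weight g (((treeComp r h k c).obj t).obj q) =
      weight (Sum.elim (fun a => ∑ j, g (Sum.inl (r ⟨a, j⟩))) fun i => g (Sum.inr i)) t := by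
    intro c t
    refine QTree.ind (motive := fun {c} t => weight g (((treeComp r h k c).obj t).obj q) =
      weight (Sum.elim (fun a => ∑ j, g (Sum.inl (r ⟨a, j⟩))) fun i => g (Sum.inr i)) t) ?_ ?_ t
    · rintro (a | i) us ih
      · refine (congrArg (fun F => weight g (F.obj q)) (Functor.congr_obj
          ((treeComp_isFold r h k).white (Sum.inl a)) us)).trans ?_
        refine (weight_plug (w := wl z k) (x a) (fun j => Sum.inl (r ⟨a, j⟩)) (fun j => h ⟨a, j⟩) g
          _ (q a)).trans ((hq a _).trans ?_)
        rw [finsum_eq_sum_of_fintype, Fintype.sum_sum_type]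
        exact (congrArg ((∑ j, g (Sum.inl (r ⟨a, j⟩))) + ·)
          (Finset.sum_congr rfl fun i _ => ih i)).trans (weight_white (x := wl x k) (Sum.elim (fun a => ∑ j, g (Sum.inl (r ⟨a, j⟩))) fun i => g (Sum.inr i)) (Sum.inl a) us).symm
      · refine (congrArg (fun F => weight g (F.obj q)) (Functor.congr_obj
          ((treeComp_isFold r h k).white (Sum.inr i)) us)).trans ?_
        exact (weight_whiteAt g (Sum.inr i) rfl _).trans ((congrArg (g (Sum.inr i) + ·)
          (Finset.sum_congr rfl fun i _ => ih i)).trans (weight_white (x := wl x k) (Sum.elim (fun a => ∑ j, g (Sum.inl (r ⟨a, j⟩))) fun i => g (Sum.inr i)) (Sum.inr i) us).symm)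
    · intro n s c p us ih
      refine (congrArg (fun F => weight g (F.obj q)) (Functor.congr_obj
        ((treeComp_isFold r h k).hom.act s c) (p, us))).trans ?_
      exact (weight_black g p _).trans ((Finset.sum_congr rfl fun i _ => ih i).trans
        (weight_black (x := wl x k) (Sum.elim (fun a => ∑ j, g (Sum.inl (r ⟨a, j⟩))) fun i => g (Sum.inr i)) p us).symm)
  rw [key, ht, finsum_eq_sum_of_fintype, finsum_eq_sum_of_fintype, Fintype.sum_sum_type,
    Fintype.sum_sum_type, ← Equiv.sum_comp r fun a => g (Sum.inl a), Fintype.sum_sigma]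
  rfl

theorem comp_target {Y : X → Type} {y : ∀ a, Y a → Colour P} {Z : Type} {z : Z → Colour P}
    (r : (Σ a, Y a) → Z) (h : ∀ s, z (r s) = y s.1 s.2) (k : Colour P)
    (hy : ∀ a j, (y a j).isLeft) (hz : ∀ j, (z j).isLeft) :
    Functor.uncurry.obj (treeComp r h k (tgt k)) ⋙ target k hz (tgt k) =
      (𝟭 (Ctx x k)).prod (Functor.pi fun a => target (x a) (hy a) (tgt (x a))) ⋙
        Functor.uncurry.obj (treeComp₀ k (tgt k)) :=
  (uncurry_comp _ _).trans (congrArg Functor.uncurry.obj (treeComp_target r h k hy hz (tgt k)))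

theorem eps_natural {A B B₀ D : Type u} [Category.{u} A] [Category.{u} B] [Category.{u} B₀]
    [Category.{u} D] {F : A × B ⥤ D} {K : B ⥤ B₀} {U : A ⥤ B₀ ⥤ D} {G : A ⥤ D} {β : B₀}
    (h : F = (𝟭 A).prod K ⋙ Functor.uncurry.obj U) (h' : U ⋙ (evaluation B₀ D).obj β = G)
    {t t' : A} {q q' : B} (f : t ⟶ t') (g : q ⟶ q') {e : K.obj q ⟶ β} {e' : K.obj q' ⟶ β}
    (he : K.map g ≫ e' = e) {w : D} {ε : G.obj t ⟶ w} {ε' : G.obj t' ⟶ w}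
    (hε : G.map f ≫ ε' = ε) :
    F.map (X := (t, q)) (Y := (t', q')) (f, g) ≫ eqToHom (Functor.congr_obj h (t', q')) ≫
        (U.obj t').map e' ≫ eqToHom (Functor.congr_obj h' t') ≫ ε' =
      eqToHom (Functor.congr_obj h (t, q)) ≫ (U.obj t).map e ≫
        eqToHom (Functor.congr_obj h' t) ≫ ε := by
  subst h h' he hε
  simp

/-- Operations of the Swiss cheese plus construction: black and white trees with given white
vertices and leaves and, if the output colour is an operation of `P`, a morphism from the target
of the tree to this operation. -/
structure PscObj (x : X → Colour P) (k : Colour P) where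
  tree : Ctx x k
  linear : Linear tree
  allLeft : k.isLeft → ∀ a, (x a).isLeft
  eps (hk : k.isLeft) : (target k (allLeft hk) (tgt k)).obj tree ⟶ corolla k hk

namespace PscObj

variable {k : Colour P}

/-- Morphisms are given by a morphism at each black vertex, compatible with the morphisms `eps`. -/
instance : Category.{u} (PscObj x k) where
  Hom T T' := { ν : T.tree ⟶ T'.tree //
    ∀ hk, (target k (T.allLeft hk) (tgt k)).map ν ≫ T'.eps hk = T.eps hk }
  id T := ⟨𝟙 _, fun hk => (congrArg (· ≫ T.eps hk) ((target k _ _).map_id _)).trans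
    (Category.id_comp _)⟩
  comp {T T' T''} f g := ⟨f.1 ≫ g.1, fun hk => by
    rw [Functor.map_comp, Category.assoc, g.2 hk, f.2 hk]⟩
  id_comp f := Subtype.ext (Category.id_comp f.1)
  comp_id f := Subtype.ext (Category.comp_id f.1)
  assoc f g h := Subtype.ext (Category.assoc f.1 g.1 h.1)

variable (x k) in
def forget : PscObj x k ⥤ Ctx x k where
  obj T := T.tree
  map ν := ν.1

def unit (k : Colour P) : PscObj (fun _ : Unit => k) k where
  tree := unitTree k
  linear := linear_unitTree k
  allLeft hk _ := hk
  eps hk := eqToHom (target_unitTree k hk)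

variable [Finite X] {Y : X → Type} [∀ a, Finite (Y a)] {y : ∀ a, Y a → Colour P} {Z : Type}
  {z : Z → Colour P}

/-- Insertion of trees in the vertices of a tree, and grafting of trees on its leaves. -/
def comp (r : (Σ a, Y a) ≃ Z) (h : ∀ s, z (r s) = y s.1 s.2) (k : Colour P) :
    (PscObj x k × ∀ a, PscObj (y a) (x a)) ⥤ PscObj z k where
  obj T :=
    have hz : k.isLeft → ∀ j, (z j).isLeft := fun hk j => by
      obtain ⟨s, rfl⟩ := r.surjective j
      rw [h]
      exact (T.2 s.1).allLeft (T.1.allLeft hk s.1) s.2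
    { tree := (Functor.uncurry.obj (treeComp r h k (tgt k))).obj (T.1.tree, fun a => (T.2 a).tree)
      linear := linear_treeComp r h k T.1.linear fun a => (T.2 a).linear
      allLeft := hz
      eps hk :=
        eqToHom (Functor.congr_obj (comp_target r h k
          (fun a => (T.2 a).allLeft (T.1.allLeft hk a)) (hz hk)) (T.1.tree, fun a => (T.2 a).tree)) ≫
        ((treeComp₀ k (tgt k)).obj T.1.tree).map (fun a => (T.2 a).eps (T.1.allLeft hk a)) ≫
        eqToHom (Functor.congr_obj (treeComp₀_corolla k (T.1.allLeft hk) (tgt k)) T.1.tree) ≫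
        T.1.eps hk }
  map {T T'} f := ⟨(Functor.uncurry.obj (treeComp r h k (tgt k))).map
      (X := (T.1.tree, fun a => (T.2 a).tree)) (Y := (T'.1.tree, fun a => (T'.2 a).tree))
      (f.1.1, fun a => (f.2 a).1), fun hk =>
    eps_natural (comp_target r h k _ _) (treeComp₀_corolla k _ (tgt k)) f.1.1 (fun a => (f.2 a).1)
      (funext fun a => (f.2 a).2 (T.1.allLeft hk a)) (f.1.2 hk)⟩
  map_id T := Subtype.ext ((Functor.uncurry.obj (treeComp r h k (tgt k))).map_id
    (T.1.tree, fun a => (T.2 a).tree))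
  map_comp {T T' T''} f g := Subtype.ext ((Functor.uncurry.obj (treeComp r h k (tgt k))).map_comp
    (X := (T.1.tree, fun a => (T.2 a).tree)) (Y := (T'.1.tree, fun a => (T'.2 a).tree))
    (Z := (T''.1.tree, fun a => (T''.2 a).tree))
    (f.1.1, fun a => (f.2 a).1) (g.1.1, fun a => (g.2 a).1))

end PscObj

variable (P) in
/-- The Swiss cheese plus construction of `P`. -/
def Psc : OperadData (Colour P) where
  Op x k := Cat.of (PscObj x k)
  one k := PscObj.unit k
  reindex {I J} _ _ e {x y} h k :=
    Functor.prod' (𝟭 _) (Functor.const _ |>.obj fun i => PscObj.unit (x i)) ⋙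
      PscObj.comp (y := fun i (_ : Unit) => x i) ((Equiv.sigmaUnique I fun _ => Unit).trans e)
        (fun s => h s.1) k
  comp x y k := PscObj.comp (Equiv.refl _) (fun _ => rfl) k

/-- Restriction of an operad along a function between colours. -/
def OperadData.restrict {K K' : Type u} (Q : OperadData K) (φ : K' → K) : OperadData K' where
  Op x c := Q.Op (fun i => φ (x i)) (φ c)
  one c := Q.one (φ c)
  reindex e _ _ h _ := Q.reindex e fun i => congrArg φ (h i)
  comp x y c := Q.comp (fun i => φ (x i)) (fun i j => φ (y i j)) (φ c)

end Trees

section Condensation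

variable {K D : Type u} (Q : OperadData K) (f : K → D)

/-- Composition of an operation with a unary operation at its output. -/
def OperadData.postcomp {J : Type} [Finite J] (y : J → K) (k k' : K) :
    (Q.Op (fun _ : Unit => k) k' × Q.Op y k) ⥤ Q.Op y k' :=
  (𝟭 _).prod (Functor.pi' fun _ : Unit => 𝟭 _) ⋙ Q.comp (fun _ : Unit => k) (fun _ => y) k' ⋙
    Q.reindex (Equiv.uniqueSigma fun _ : Unit => J) (fun _ => rfl)

/-- Composition of an operation with unary operations at its inputs. -/
def OperadData.precomp {I : Type} [Finite I] (x x' : I → K) (k : K) :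
    (Q.Op x' k × ∀ i, Q.Op (fun _ : Unit => x i) (x' i)) ⥤ Q.Op x k :=
  Q.comp x' (fun i (_ : Unit) => x i) k ⋙
    Q.reindex (Equiv.sigmaUnique I fun _ => Unit) (fun _ => rfl)

/-- A functor with values in categories on each fibre of `f`, where morphisms between colours are
the unary operations. -/
structure Weight where
  obj : K → Cat.{u, u}
  act {k k' : K} (h : f k = f k') : Q.Op (fun _ : Unit => k) k' ⥤ (obj k ⥤ obj k')

variable {Q f}

structure Weight.IsFunctor (X : Weight Q f) : Prop where
  one (k : K) : (X.act (rfl : f k = f k)).obj (Q.one k) = 𝟭 (X.obj k)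
  comp {k k' k'' : K} (h : f k = f k') (h' : f k' = f k'') :
    (Q.postcomp (fun _ : Unit => k) k' k'').prod (𝟭 (X.obj k)) ⋙
        Functor.uncurry.obj (X.act (h.trans h')) =
      prod.associator _ _ _ ⋙ (𝟭 _).prod (Functor.uncurry.obj (X.act h)) ⋙
        Functor.uncurry.obj (X.act h')

/-- The category of objects and morphisms on which two functors agree. -/
structure Equalized {A B : Type u} [Category.{u} A] [Category.{u} B] (F G : A ⥤ B) where
  val : A
  eq : F.obj val = G.obj val

instance {A B : Type u} [Category.{u} A] [Category.{u} B] (F G : A ⥤ B) :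
    Category.{u} (Equalized F G) where
  Hom a b := { g : a.val ⟶ b.val // F.map g ≍ G.map g }
  id a := ⟨𝟙 a.val, by rw [F.map_id, G.map_id, a.eq]⟩
  comp {a b c} g h := ⟨g.1 ≫ h.1, by
    rw [F.map_comp, G.map_comp]
    exact comp_heq a.eq b.eq c.eq g.2 h.2⟩
  id_comp g := Subtype.ext (Category.id_comp g.1)
  comp_id g := Subtype.ext (Category.comp_id g.1)
  assoc g h l := Subtype.ext (Category.assoc g.1 h.1 l.1)

def Equalized.incl {A B : Type u} [Category.{u} A] [Category.{u} B] (F G : A ⥤ B) :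
    Equalized F G ⥤ A where
  obj a := a.val
  map g := g.1

abbrev Families (d : D) (X Y : Weight Q f) := ∀ k : {k // f k = d}, X.obj k.1 ⥤ Y.obj k.1

/-- Acting in `X` and then applying the family. -/
def actThen (d : D) (X Y : Weight Q f) : Families d X Y ⥤
    ∀ kk : {k // f k = d} × {k // f k = d},
      Q.Op (fun _ : Unit => kk.1.1) kk.2.1 ⥤ (X.obj kk.1.1 ⥤ Y.obj kk.2.1) :=
  Functor.pi' fun kk => Pi.eval _ kk.2 ⋙ Functor.whiskeringRight _ _ _ ⋙
    (Functor.whiskeringLeft _ _ _).obj (X.act (kk.1.2.trans kk.2.2.symm))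

/-- Applying the family and then acting in `Y`. -/
def thenAct (d : D) (X Y : Weight Q f) : Families d X Y ⥤
    ∀ kk : {k // f k = d} × {k // f k = d},
      Q.Op (fun _ : Unit => kk.1.1) kk.2.1 ⥤ (X.obj kk.1.1 ⥤ Y.obj kk.2.1) :=
  Functor.pi' fun kk => Pi.eval _ kk.1 ⋙ Functor.whiskeringLeft _ _ _ ⋙
    (Functor.whiskeringLeft _ _ _).obj (Y.act (kk.1.2.trans kk.2.2.symm))

/-- The category of natural transformations over the fibre of `d`. -/
def HomCat (d : D) (X Y : Weight Q f) : Cat.{u, u} :=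
  Cat.of (Equalized (actThen d X Y) (thenAct d X Y))

/-- The component of natural transformations at an object of the fibre. -/
def component {d : D} (X Y : Weight Q f) (k : {k // f k = d}) :
    HomCat d X Y ⥤ (X.obj k.1 ⥤ Y.obj k.1) :=
  Equalized.incl _ _ ⋙ Pi.eval _ k

section Coend

variable (X : Weight Q f) {I : Type} [Finite I] (d : I → D) (k : K)

def coendBase : Cat.{u, u} := Cat.of (Σ x : ∀ i, {c // f c = d i},
  Q.Op (fun i => (x i).1) k × ∀ i, X.obj (x i).1)

def coendRel : Cat.{u, u} := Cat.of (Σ x : ∀ i, {c // f c = d i} × {c // f c = d i},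
  (Q.Op (fun i => (x i).2.1) k × ∀ i, Q.Op (fun _ : Unit => (x i).1.1) (x i).2.1) ×
    ∀ i, X.obj (x i).1.1)

def coendLeft : coendRel X d k ⥤ coendBase X d k :=
  Sigma.desc fun x => (Q.precomp (fun i => (x i).1.1) (fun i => (x i).2.1) k).prod (𝟭 _) ⋙
    Sigma.incl (C := fun x : ∀ i, {c // f c = d i} =>
      Q.Op (fun i => (x i).1) k × ∀ i, X.obj (x i).1) fun i => (x i).1

def coendRight : coendRel X d k ⥤ coendBase X d k :=
  Sigma.desc fun x => Functor.prod' (CategoryTheory.Prod.fst _ _ ⋙ CategoryTheory.Prod.fst _ _)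
    (Functor.pi' fun i => ((CategoryTheory.Prod.snd _ _ ⋙ Pi.eval _ i).prod (Pi.eval _ i)) ⋙
      Functor.uncurry.obj (X.act ((x i).1.2.trans (x i).2.2.symm))) ⋙
    Sigma.incl (C := fun x : ∀ i, {c // f c = d i} =>
      Q.Op (fun i => (x i).1) k × ∀ i, X.obj (x i).1) fun i => (x i).2

/-- The coend of `Q(-, …, -; k)` and `X(-) × … × X(-)` over the product of the fibres. -/
def coend : Cat.{u, u} :=
  Limits.coequalizer (coendLeft X d k).toCatHom (coendRight X d k).toCatHom

/-- The structural functors of the coend. -/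
def coendMk (x : ∀ i, {c // f c = d i}) :
    (Q.Op (fun i => (x i).1) k × ∀ i, X.obj (x i).1) ⥤ coend X d k :=
  Sigma.incl (C := fun x : ∀ i, {c // f c = d i} =>
      Q.Op (fun i => (x i).1) k × ∀ i, X.obj (x i).1) x ⋙
    (Limits.coequalizer.π (coendLeft X d k).toCatHom (coendRight X d k).toCatHom).toFunctor

end Coend

/-- The action of the unary operations on the coend. -/
structure CoendAction (X : Weight Q f) where
  act {I : Type} [Finite I] (d : I → D) (k k' : K) :
    Q.Op (fun _ : Unit => k) k' ⥤ (coend X d k ⥤ coend X d k')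
  act_mk {I : Type} [Finite I] (d : I → D) (k k' : K) (x : ∀ i, {c // f c = d i}) :
    (𝟭 _).prod (coendMk X d k x) ⋙ Functor.uncurry.obj (act d k k') =
      prod.inverseAssociator _ _ _ ⋙ (Q.postcomp (fun i => (x i).1) k k').prod (𝟭 _) ⋙
        coendMk X d k' x

def CoendAction.weight {X : Weight Q f} (E : CoendAction X) {I : Type} [Finite I] (d : I → D) :
    Weight Q f where
  obj k := coend X d k
  act _ := E.act d _ _

/-- The operations of the condensation of `Q` along `f`, with their composition. All the functors
out of coends are determined by their values on the generators `coendMk`, and all the functors into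
`HomCat` by their components. -/
structure Condensation (X : Weight Q f) extends CoendAction X where
  one (d : D) : HomCat d X (toCoendAction.weight fun _ : Unit => d)
  one_component (d : D) (k : {k // f k = d}) : (component _ _ k).obj (one d) =
    Functor.prod' (Functor.const _ |>.obj (Q.one k.1)) (Functor.pi' fun _ : Unit => 𝟭 _) ⋙
      coendMk X (fun _ : Unit => d) k.1 fun _ => k
  relabel {I J : Type} [Finite I] [Finite J] (e : I ≃ J) {d : I → D} {d' : J → D}
    (h : ∀ i, d' (e i) = d i) (k : K) : coend X d k ⥤ coend X d' k
  relabel_mk {I J : Type} [Finite I] [Finite J] (e : I ≃ J) {d : I → D} {d' : J → D}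
    (h : ∀ i, d' (e i) = d i) (k : K) (x : ∀ j, {c // f c = d' j}) :
    (𝟭 _).prod (Pi.comap (fun j => X.obj (x j).1) e) ⋙
        coendMk X d k (fun i => ⟨(x (e i)).1, (x (e i)).2.trans (h i)⟩) ⋙ relabel e h k =
      (Q.reindex e (y := fun j => (x j).1) fun _ => rfl).prod (𝟭 _) ⋙ coendMk X d' k x
  reindex {I J : Type} [Finite I] [Finite J] (e : I ≃ J) {d : I → D} {d' : J → D}
    (h : ∀ i, d' (e i) = d i) (d₀ : D) :
    HomCat d₀ X (toCoendAction.weight d) ⥤ HomCat d₀ X (toCoendAction.weight d')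
  reindex_component {I J : Type} [Finite I] [Finite J] (e : I ≃ J) {d : I → D} {d' : J → D}
    (h : ∀ i, d' (e i) = d i) (d₀ : D) (k : {k // f k = d₀}) :
    reindex e h d₀ ⋙ component _ _ k =
      component _ _ k ⋙ (Functor.whiskeringRight _ _ _).obj (relabel e h k.1)
  mul {I : Type} [Finite I] {J : I → Type} [∀ i, Finite (J i)] (x : I → K) (d : ∀ i, J i → D)
    (k : K) : (Q.Op x k × ∀ i, coend X (d i) (x i)) ⥤ coend X (fun s : Σ i, J i => d s.1 s.2) k
  mul_mk {I : Type} [Finite I] {J : I → Type} [∀ i, Finite (J i)] (x : I → K) (d : ∀ i, J i → D)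
    (k : K) (y : ∀ i j, {c // f c = d i j}) :
    (𝟭 _).prod (Functor.pi fun i => coendMk X (d i) (x i) (y i)) ⋙ mul x d k =
      Functor.prod'
        ((𝟭 _).prod (Functor.pi fun i => CategoryTheory.Prod.fst _ _) ⋙
          Q.comp x (fun i j => (y i j).1) k)
        (Functor.pi' fun s : Σ i, J i => CategoryTheory.Prod.snd _ _ ⋙ Pi.eval _ s.1 ⋙
          CategoryTheory.Prod.snd _ _ ⋙ Pi.eval _ s.2) ⋙
      coendMk X (fun s : Σ i, J i => d s.1 s.2) k fun s => y s.1 s.2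
  subst {I : Type} [Finite I] {J : I → Type} [∀ i, Finite (J i)] (d : I → D) (d' : ∀ i, J i → D)
    (k : K) : (∀ i, HomCat (d i) X (toCoendAction.weight (d' i))) ⥤
      (coend X d k ⥤ coend X (fun s : Σ i, J i => d' s.1 s.2) k)
  subst_mk {I : Type} [Finite I] {J : I → Type} [∀ i, Finite (J i)] (d : I → D)
    (d' : ∀ i, J i → D) (k : K) (x : ∀ i, {c // f c = d i}) :
    (𝟭 _).prod (coendMk X d k x) ⋙ Functor.uncurry.obj (subst d d' k) =
      Functor.prod' (CategoryTheory.Prod.snd _ _ ⋙ CategoryTheory.Prod.fst _ _)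
        (Functor.pi' fun i => (Pi.eval _ i).prod (CategoryTheory.Prod.snd _ _ ⋙ Pi.eval _ i) ⋙
          Functor.uncurry.obj (component X (toCoendAction.weight (d' i)) (x i))) ⋙
      mul (fun i => (x i).1) d' k
  comp {I : Type} [Finite I] {J : I → Type} [∀ i, Finite (J i)] (d : I → D) (d' : ∀ i, J i → D)
    (d₀ : D) : (HomCat d₀ X (toCoendAction.weight d) ×
      ∀ i, HomCat (d i) X (toCoendAction.weight (d' i))) ⥤
        HomCat d₀ X (toCoendAction.weight fun s : Σ i, J i => d' s.1 s.2)
  comp_component {I : Type} [Finite I] {J : I → Type} [∀ i, Finite (J i)] (d : I → D)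
    (d' : ∀ i, J i → D) (d₀ : D) (k : {k // f k = d₀}) :
    comp d d' d₀ ⋙ component _ _ k = (component _ _ k).prod (subst d d' k.1) ⋙
      Functor.uncurry.obj (Functor.whiskeringLeft _ _ _)

/-- The condensation, as an operad on the set `D`. -/
def Condensation.operad {X : Weight Q f} (S : Condensation X) : OperadData D where
  Op d d₀ := HomCat d₀ X (S.weight d)
  one := S.one
  reindex e _ _ h d₀ := S.reindex e h d₀
  comp := S.comp

/-- The underlying functor of an algebra. -/
def algebraWeight (f : K → D) (B : K → Cat.{u, u}) (m : ∀ {I : Type} [Finite I] (x : I → K) (k : K),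
    Q.Op x k ⥤ ((∀ i, B (x i)) ⥤ B k)) : Weight Q f where
  obj := B
  act {k k'} _ := m (fun _ : Unit => k) k' ⋙
    (Functor.whiskeringLeft _ _ _).obj (Functor.pi' fun _ => 𝟭 _)

/-- The action of the condensation on the categories of natural transformations from `X` to an
algebra `B`: an element `[p; z]` of the coend acts on natural transformations `m` by evaluating
`p` on the family `m z`. -/
structure CondensedAlgebra {X : Weight Q f} (S : Condensation X) (B : K → Cat.{u, u})
    (m : ∀ {I : Type} [Finite I] (x : I → K) (k : K), Q.Op x k ⥤ ((∀ i, B (x i)) ⥤ B k)) where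
  ev {I : Type} [Finite I] (d : I → D) (k : K) :
    (∀ i, HomCat (d i) X (algebraWeight f B m)) ⥤ (coend X d k ⥤ B k)
  ev_mk {I : Type} [Finite I] (d : I → D) (k : K) (x : ∀ i, {c // f c = d i}) :
    (𝟭 _).prod (coendMk X d k x) ⋙ Functor.uncurry.obj (ev d k) =
      Functor.prod' (CategoryTheory.Prod.snd _ _ ⋙ CategoryTheory.Prod.fst _ _)
        (Functor.pi' fun i => (Pi.eval _ i).prod (CategoryTheory.Prod.snd _ _ ⋙ Pi.eval _ i) ⋙
          Functor.uncurry.obj (component X (algebraWeight f B m) (x i))) ⋙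
      Functor.uncurry.obj (m (fun i => (x i).1) k)
  alg : OperadAlgebra S.operad fun d => HomCat d X (algebraWeight f B m)
  alg_component {I : Type} [Finite I] (d : I → D) (d₀ : D) (k : {k // f k = d₀}) :
    Functor.uncurry.obj (alg.map d d₀) ⋙ component X (algebraWeight f B m) k =
      (component X (S.weight d) k).prod (ev d k.1) ⋙
        Functor.uncurry.obj (Functor.whiskeringLeft _ _ _)

end Condensation

section Pair

variable {C : Type u} {P : OperadData C}

theorem transport_apply {C : Type u} (M : C → Cat.{u, u}) {S : Type} (s : S → C) (g : ∀ i, M (s i))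
    {i j : S} (h : i = j) : (transport M (congrArg s h)).obj (g i) = g j := by
  subst h
  rfl

theorem transport_map_apply {C : Type u} (M : C → Cat.{u, u}) {S : Type} (s : S → C)
    {g g' : ∀ i, M (s i)} (f : g ⟶ g') {i j : S} (h : i = j) :
    (transport M (congrArg s h)).map (f i) ≍ f j := by
  subst h
  rfl

theorem unitOp_act {A : C → Cat.{u, u}} (α : OperadAlgebra P A) (c : C) :
    (α.map (fun _ : Fin 1 => c) c).obj (unitOp P c) = Pi.eval _ 0 := by
  have h := congrArg (fun F => endReindex A (Equiv.ofUnique Unit (Fin 1)) (x := fun _ : Unit => c)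
    (y := fun _ : Fin 1 => c) (fun _ => rfl) ⋙ F) (α.map_one c)
  exact (Functor.congr_obj (α.map_reindex (Equiv.ofUnique Unit (Fin 1)) (y := fun _ => c)
    (fun _ => rfl) c) (P.one c)).trans h

/-- Reindexing of a family along a bijection. -/
def gather (A : C → Cat.{u, u}) {n l : ℕ} {m : Fin n → ℕ} (e : (Σ i, Fin (m i)) ≃ Fin l)
    (t : ∀ i, Fin (m i) → C) :
    (∀ s : Σ i, Fin (m i), A (t s.1 s.2)) ⥤ ∀ j, A (t (e.symm j).1 (e.symm j).2) where
  obj a j := a (e.symm j)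
  map f j := f (e.symm j)

theorem gather_endReindex (A : C → Cat.{u, u}) {n l : ℕ} {m : Fin n → ℕ}
    (e : (Σ i, Fin (m i)) ≃ Fin l) (t : ∀ i, Fin (m i) → C)
    (h : ∀ s : Σ i, Fin (m i), t (e.symm (e s)).1 (e.symm (e s)).2 = t s.1 s.2) :
    gather A e t ⋙ endReindex A e (x := fun s : Σ i, Fin (m i) => t s.1 s.2)
      (y := fun j => t (e.symm j).1 (e.symm j).2) h = 𝟭 _ := by
  refine CategoryTheory.Functor.hext (fun a => funext fun s => ?_) fun a b f => ?_
  · exact transport_apply A (fun s : Σ i, Fin (m i) => t s.1 s.2) a (e.symm_apply_apply s)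
  · exact pi_heq (fun s => transport_apply A (fun s : Σ i, Fin (m i) => t s.1 s.2) a
      (e.symm_apply_apply s)) (fun s => transport_apply A (fun s : Σ i, Fin (m i) => t s.1 s.2) b
      (e.symm_apply_apply s)) fun s => transport_map_apply A
        (fun s : Σ i, Fin (m i) => t s.1 s.2) f (e.symm_apply_apply s)

theorem multiComp_act {A : C → Cat.{u, u}} (α : OperadAlgebra P A) {n l : ℕ} {m : Fin n → ℕ}
    (e : (Σ i, Fin (m i)) ≃ Fin l) (s : Fin n → C) (t : ∀ i, Fin (m i) → C) (c : C) :
    multiComp P e s t c ⋙ α.map _ c ⋙ (Functor.whiskeringLeft _ _ _).obj (gather A e t) =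
      (α.map s c).prod (Functor.pi fun i => α.map (t i) (s i)) ⋙
        endComp (fun i => A (s i)) (fun i j => A (t i j)) (A c) := by
  have h : ∀ s : Σ i, Fin (m i), t (e.symm (e s)).1 (e.symm (e s)).2 = t s.1 s.2 :=
    fun s => by rw [e.symm_apply_apply]
  have h1 := congrArg (P.comp s t c ⋙ ·) (congrArg
    (· ⋙ (Functor.whiskeringLeft _ _ (A c)).obj (gather A e t)) (α.map_reindex e
      (x := fun s : Σ i, Fin (m i) => t s.1 s.2) (y := fun j => t (e.symm j).1 (e.symm j).2) h c))
  refine h1.trans ?_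
  refine Eq.trans ?_ (α.map_comp s t c)
  exact congrArg (fun K => P.comp s t c ⋙ α.map (fun s : Σ i, Fin (m i) => t s.1 s.2) c ⋙
    (Functor.whiskeringLeft _ _ (A c)).obj K) (gather_endReindex A e t h)

/-- The action on finite ordered families which underlies an algebra. -/
def OperadHom.finAlgebra {A : C → Cat.{u, u}} (α : OperadAlgebra P A) : FinAlgebra P where
  M := A
  act s c := Functor.uncurry.obj (α.map s c)
  one_obj a := Functor.congr_obj (unitOp_act α _) a
  one_map {c a b} f := by
    refine (heq_of_eq ?_).trans (functor_heq (unitOp_act α c) f)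
    exact (congrArg (· ≫ _) (congrArg (fun z => NatTrans.app z _)
      ((α.map (fun _ : Fin 1 => c) c).map_id (unitOp P c)))).trans (Category.id_comp _)
  merge_obj {n l m} e {s t c} p q a := by
    exact (Functor.congr_obj (Functor.congr_obj (multiComp_act α e s t c) (p, q))
      (fun s => a s.1 s.2)).symm
  merge_map {n l m} e {s t c p p' q q' a a'} f g h := by
    have e1 := functor_heq (congrArg Functor.uncurry.obj (multiComp_act α e s t c))
      (a := ((p, q), fun s => a s.1 s.2)) (b := ((p', q'), fun s => a' s.1 s.2))
      ((f, g), fun s => h s.1 s.2)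
    refine HEq.trans (heq_of_eq ?_) e1.symm
    have e2 := ((α.map s c).map f).naturality (X := fun i => ((α.map (t i) (s i)).obj (q i)).obj (a i))
      (Y := fun i => ((α.map (t i) (s i)).obj (q' i)).obj (a i))
      (fun i => ((α.map (t i) (s i)).map (g i)).app (a i))
    have e3 := ((α.map s c).obj p').map_comp
      (X := fun i => ((α.map (t i) (s i)).obj (q i)).obj (a i))
      (Y := fun i => ((α.map (t i) (s i)).obj (q' i)).obj (a i))
      (Z := fun i => ((α.map (t i) (s i)).obj (q' i)).obj (a' i))
      (fun i => ((α.map (t i) (s i)).map (g i)).app (a i))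
      (fun i => ((α.map (t i) (s i)).obj (q' i)).map (h i))
    refine (congrArg (((α.map s c).map f).app _ ≫ ·) e3).trans ?_
    exact (Category.assoc _ _ _).symm.trans (congrArg (· ≫ _) e2.symm)

/-- The categories `[∏ A (src b), A (tgt b)]` for the operations `b` of `P`, together with the
categories `A c`. -/
def pair (A : C → Cat.{u, u}) : Colour P → Cat.{u, u}
  | Sum.inl b => Cat.of ((∀ i, A (b.src i)) ⥤ A b.tgt)
  | Sum.inr c => A c

/-- Objects of the pair as functors on the inputs; there are none for a colour of `P`. -/
def evalPair (A : C → Cat.{u, u}) :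
    (k : Colour P) → pair A k ⥤ ((∀ i, A (src k i)) ⥤ A (tgt k))
  | Sum.inl b => 𝟭 ((∀ i, A (b.src i)) ⥤ A b.tgt)
  | Sum.inr c => Functor.const _

def ofFunctor (A : C → Cat.{u, u}) :
    (k : Colour P) → ((∀ i, A (src k i)) ⥤ A (tgt k)) ⥤ pair A k
  | Sum.inl b => 𝟭 ((∀ i, A (b.src i)) ⥤ A b.tgt)
  | Sum.inr c => (evaluation _ (A c)).obj fun i : Fin 0 => i.elim0

/-- The values at the white vertices and at the leaves of a tree. -/
def pairWhite (A : C → Cat.{u, u}) {X : Type} (x : X → Colour P) (k : Colour P) :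
    (v : X ⊕ Fin (ar k)) →
      (∀ i, ((∀ a, pair A (x a)) × (∀ i, A (src k i))) ⥤ A (src (wl x k v) i)) ⥤
        (((∀ a, pair A (x a)) × (∀ i, A (src k i))) ⥤ A (tgt (wl x k v)))
  | Sum.inl a => powOp ((CategoryTheory.Prod.fst _ _ ⋙ Pi.eval _ a).prod (𝟭 _) ⋙
      Functor.uncurry.obj (evalPair A (x a)))
  | Sum.inr i => Functor.const _ |>.obj (CategoryTheory.Prod.snd _ _ ⋙ Pi.eval _ i)

/-- A tree acts by evaluating the given functors at its white vertices and the action of `P` at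
its black vertices. -/
def pairMap {A : C → Cat.{u, u}} (α : OperadAlgebra P A) {X : Type} (x : X → Colour P)
    (k : Colour P) : PscObj x k ⥤ ((∀ a, pair A (x a)) ⥤ pair A k) :=
  PscObj.forget x k ⋙
    fold (x := wl x k) (α.finAlgebra.pow (Cat.of ((∀ a, pair A (x a)) × (∀ i, A (src k i)))))
      (pairWhite A x k) (tgt k) ⋙
    Functor.curry ⋙ (Functor.whiskeringRight _ _ _).obj (ofFunctor A k)

variable (P) in
/-- The operations of the Swiss cheese plus construction all of whose colours are operations of
`P`: the operad for algebras over the plus construction of `P` with an internal algebra. -/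
def PPlus : OperadData (Operation P) := (Psc P).restrict Sum.inl

/-- The target map on the operations of `P` and the identity on the colours of `P`. -/
def colourMap : Colour P → C ⊕ C := Sum.map Operation.tgt id

variable (P) in
/-- Unary operations between copies of the same algebra colour act on the representable functor. -/
def reprAct {c c' : C} (h : c = c') : (Psc P).Op (fun _ : Unit => Sum.inr c) (Sum.inr c') ⥤
    ((Psc P).Op (fun _ : Unit => Sum.inr c) (Sum.inr c) ⥤
      (Psc P).Op (fun _ : Unit => Sum.inr c') (Sum.inr c')) :=
  Eq.rec (motive := fun c' _ => (Psc P).Op (fun _ : Unit => Sum.inr c) (Sum.inr c') ⥤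
    ((Psc P).Op (fun _ : Unit => Sum.inr c) (Sum.inr c) ⥤
      (Psc P).Op (fun _ : Unit => Sum.inr c') (Sum.inr c')))
    (Functor.curry.obj ((Psc P).postcomp (fun _ : Unit => Sum.inr c) (Sum.inr c) (Sum.inr c))) h

/-- The extension of `δ` by the representable functors on the colours of `P`. -/
def extend (δ : Weight (PPlus P) Operation.tgt) : Weight (Psc P) colourMap where
  obj
    | Sum.inl b => δ.obj b
    | Sum.inr c => (Psc P).Op (fun _ : Unit => Sum.inr c) (Sum.inr c)
  act {k k'} h := match k, k', h with
    | Sum.inl b, Sum.inl b', h => δ.act (Sum.inl.inj h)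
    | Sum.inl _, Sum.inr _, h => absurd h (fun h => by cases h)
    | Sum.inr _, Sum.inl _, h => absurd h (fun h => by cases h)
    | Sum.inr _, Sum.inr _, h => reprAct P (Sum.inr.inj h)

variable {A : C → Cat.{u, u}}

/-- The endomorphism object of `A`, as a functor on the operations of `P`. -/
def endWeight (α : OperadAlgebra P A) : Weight (PPlus P) Operation.tgt :=
  algebraWeight Operation.tgt (fun b => pair A (Sum.inl b))
    fun x b => pairMap α (fun i => Sum.inl (x i)) (Sum.inl b)

/-- The Hochschild object of `A`. -/
def Hoch (δ : Weight (PPlus P) Operation.tgt) (α : OperadAlgebra P A) (c : C) : Cat.{u, u} :=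
  HomCat c δ (endWeight α)

def hochPair (δ : Weight (PPlus P) Operation.tgt) (α : OperadAlgebra P A) : C ⊕ C → Cat.{u, u}
  | Sum.inl c => Hoch δ α c
  | Sum.inr c => A c

abbrev pairWeight (α : OperadAlgebra P A) : Weight (Psc P) colourMap :=
  algebraWeight colourMap (pair A) (pairMap α)

theorem pi_apply_heq {I : Type*} {A : I → Type*} [∀ i, Category* (A i)] {a b a' b' : ∀ i, A i}
    {f : a ⟶ b} {g : a' ⟶ b'} (h : a = a') (h' : b = b') (w : f ≍ g) (i : I) : f i ≍ g i := by
  subst h h'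
  rw [eq_of_heq w]

/-- Restriction of natural transformations to the operations of `P`. -/
def restrictHoch (δ : Weight (PPlus P) Operation.tgt) (α : OperadAlgebra P A) (c : C) :
    HomCat (Sum.inl c) (extend δ) (pairWeight α) ⥤ Hoch δ α c where
  obj m := 
    { val := fun b => m.val ⟨Sum.inl b.1, congrArg Sum.inl b.2⟩
      eq := funext fun bb => congrFun m.eq
        (⟨Sum.inl bb.1.1, congrArg Sum.inl bb.1.2⟩, ⟨Sum.inl bb.2.1, congrArg Sum.inl bb.2.2⟩) }
  map {m m'} g := ⟨fun b => g.1 ⟨Sum.inl b.1, congrArg Sum.inl b.2⟩,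
    pi_heq
      (fun bb => congrFun m.eq (⟨Sum.inl bb.1.1, congrArg Sum.inl bb.1.2⟩,
        ⟨Sum.inl bb.2.1, congrArg Sum.inl bb.2.2⟩))
      (fun bb => congrFun m'.eq (⟨Sum.inl bb.1.1, congrArg Sum.inl bb.1.2⟩,
        ⟨Sum.inl bb.2.1, congrArg Sum.inl bb.2.2⟩))
      (fun bb => pi_apply_heq m.eq m'.eq g.2 (⟨Sum.inl bb.1.1, congrArg Sum.inl bb.1.2⟩,
        ⟨Sum.inl bb.2.1, congrArg Sum.inl bb.2.2⟩))⟩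
  map_id m := rfl
  map_comp g g' := rfl

/-- Evaluation of a natural transformation at the identity. -/
def evalAtOne (δ : Weight (PPlus P) Operation.tgt) {Y : Weight (Psc P) colourMap} (c : C) :
    HomCat (Sum.inr c) (extend δ) Y ⥤ Y.obj (Sum.inr c) :=
  component (extend δ) Y ⟨Sum.inr c, rfl⟩ ⋙ (evaluation _ _).obj ((Psc P).one (Sum.inr c))

/-- Natural transformations from the extension of `δ` to `(End A, A)` are the objects of
`(Hoch A, A)`. -/
def comparison (δ : Weight (PPlus P) Operation.tgt) (α : OperadAlgebra P A) : (d : C ⊕ C) →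
    HomCat d (extend δ) (pairWeight α) ⥤ hochPair δ α d
  | Sum.inl c => restrictHoch δ α c
  | Sum.inr c => evalAtOne δ c

/-- The black corolla on leaves `x` decorated with an operation of `P`. -/
def blackTree {I : Type} [Finite I] (x : I → C) (c : C) :
    P.Op x c ⥤ TreeCat (wl (P := P) (fun i => Sum.inr (x i)) (Sum.inr c)) c :=
  Functor.prod' (P.reindex (Finite.equivFin I) (y := fun j => x ((Finite.equivFin I).symm j))
      (fun i => congrArg x ((Finite.equivFin I).symm_apply_apply i)))
    (Functor.const _ |>.obj fun j =>
      (whiteAt (x := wl (P := P) (fun i => Sum.inr (x i)) (Sum.inr c))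
        (k := Sum.inr (x ((Finite.equivFin I).symm j)))
        (Sum.inl ((Finite.equivFin I).symm j)) rfl).obj fun l => l.elim0) ⋙
    TreeCat.black (fun j => x ((Finite.equivFin I).symm j)) c

theorem linear_blackTree {I : Type} [Finite I] (x : I → C) (c : C) (p : P.Op x c) :
    Linear ((blackTree x c).obj p) := by
  intro g
  refine (weight_black g _ _).trans ?_
  have h : ∀ j, weight g ((whiteAt (x := wl (P := P) (fun i => Sum.inr (x i)) (Sum.inr c))
        (k := Sum.inr (x ((Finite.equivFin I).symm j)))
        (Sum.inl ((Finite.equivFin I).symm j)) rfl).obj fun l => l.elim0) =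
      g (Sum.inl ((Finite.equivFin I).symm j)) := fun j =>
    (weight_whiteAt g (k := Sum.inr (x ((Finite.equivFin I).symm j))) _ rfl _).trans
      (congrArg (fun z : ℕ => g _ + z) Finset.sum_empty)
  refine (Finset.sum_congr rfl fun j _ => h j).trans ?_
  have := Fintype.ofFinite I
  rw [finsum_eq_sum_of_fintype, Fintype.sum_sum_type,
    Equiv.sum_comp (Finite.equivFin I).symm fun i => g (Sum.inl i)]
  exact (Nat.add_zero _).symm

/-- The black corolla as an operation of the Swiss cheese plus construction. -/
def blackCorolla {I : Type} [Finite I] (x : I → C) (c : C) :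
    P.Op x c ⥤ (Psc P).Op (fun i => Sum.inr (x i)) (Sum.inr c) where
  obj p :=
    { tree := (blackTree x c).obj p
      linear := linear_blackTree x c p
      allLeft := fun h => absurd h (by simp)
      eps := fun h => absurd h (by simp) }
  map f := ⟨(blackTree x c).map f, fun h => absurd h (by simp)⟩
  map_id p := Subtype.ext ((blackTree x c).map_id p)
  map_comp f g := Subtype.ext ((blackTree x c).map_comp f g)

/-- The class in the coend of the black corolla decorated with an operation of `P`, with the
identities as second components. -/
def corollaClass (δ : Weight (PPlus P) Operation.tgt) {I : Type} [Finite I] (x : I → C) (c : C) :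
    P.Op x c ⥤ coend (extend δ) (fun i => Sum.inr (x i)) (Sum.inr c) :=
  Functor.prod' (blackCorolla x c) (Functor.const _ |>.obj fun i => (Psc P).one (Sum.inr (x i))) ⋙
    coendMk (extend δ) (fun i => Sum.inr (x i)) (Sum.inr c) fun i => ⟨Sum.inr (x i), rfl⟩

end Pair

end
end SwissCheese

open SwissCheese

set_option linter.unusedVariables false

/-!
The whole argument is carried out on arrows. For a category `A`, `Arr A` is the type of its arrows
with their endpoints; a functor acts on arrows, and two functors are equal as soon as they act
equally (`Arr.functor_ext`, and `Arr.functor_ext₂` for functors into functor categories). So every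
equation of functors in the statement becomes an equation without heterogeneous equality between
operations on arrows. In the other direction, `IsMap` says that an expression in a variable arrow
comes from a functor, which is what the uniqueness principles below require of both sides.

*Trees.* The arrows between trees are generated under composition by white and black vertices
(`TreeCat.arr_ind`), so two functors out of trees agree if they do so at the vertices whenever they
do so on the branches (`TreeCat.arr_ext`). Substitution for leaves `PL`, insertion in vertices `TC`
and evaluation `EV` are computed at the vertices by their definition as folds, and this induction
gives the associativity `TC_TC` of insertion and its compatibility `EV_TC` with evaluation. The
former, together with the same facts for the composites of morphisms `ε`, gives the axioms of an
operad for `Psc P` (`psc_arrLaws`); the latter says that `(End A, A)` is an algebra over it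
(`pairAlgebra`).

*Condensation.* This part works for any operad `Q` in `Cat`, any function `f` between colours and
any functor `X` on the unary operations. A coend is a coequalizer of categories whose pair of
functors is reflexive (a common section inserts identities). Reflexivity is what makes finite
products of such coequalizers coequalizers of the products (`IsPresentation.prod`,
`IsPresentation.pi`); consequently maps out of products of coends, with parameters, are given by
and determined by their values on classes `GN X d k x p z` (`coend_lift`, `coend_ext`,
`coendPi_lift`, `coendPi_ext`). Categories of natural transformations are characterized by
components (`homCat_lift`, `homCat_ext`). Relabelling `RL`, the action `actE`, composition with
operations of `Q` (`ML`), substitution of natural transformations (`SB`) and evaluation on an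
algebra (`EVC`) are constructed by the existence half, and every axiom of the condensation and of
its action is checked on classes by the uniqueness half, where it reduces to an axiom of `Q` or of
the algebra (`condensation_arrLaws`, `condensedAlgebra`).

*Comparison.* Over the first copy of `C` the fibre of the map on colours consists of operations, and
restricting to it loses nothing. Over the second copy the fibre is a single colour, on which the
extended `δ` is representable, so that the Yoneda lemma (`exists_yoneda`) identifies natural
transformations with their values at the identity. Hence `comparison` is an isomorphism, and the
action is transported along it (`transportAlgebra`).

*The morphism from `P`.* Since adjacent black vertices are multiplied and black units are removed,
black corollas compose as the operations of `P` do (`BC_idA`, `BC_rei`, `BC_cmp`). By the Yoneda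
lemma their classes define a morphism to the condensation (`inclHom`), and evaluating a black
corolla is the action of `P` on `A` (`evalAtOne_actA_inclMap`).
-/

namespace SwissCheese

noncomputable section

/-! ### Arrows of a category -/

/-- The arrows of a category, with their endpoints. An equation between functors is the same as an
equation between their actions on arrows, which involves no heterogeneous equality. -/
structure Arr (A : Type*) [Category* A] where
  dom : A
  cod : A
  hom : dom ⟶ cod

namespace Arr

variable {A B D E S : Type*} [Category* A] [Category* B] [Category* D] [Category* E] [Category* S]

/-- The identity arrow. -/
def id (a : A) : Arr A := ⟨a, a, 𝟙 a⟩

/-- The action of a functor on arrows. -/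
def map (F : A ⥤ B) (φ : Arr A) : Arr B := ⟨F.obj φ.dom, F.obj φ.cod, F.map φ.hom⟩

/-- A pair of arrows as an arrow of the product. -/
def pair (φ : Arr A) (ψ : Arr B) : Arr (A × B) := ⟨(φ.dom, ψ.dom), (φ.cod, ψ.cod), (φ.hom, ψ.hom)⟩

/-- The first component of an arrow of a product. -/
def fst (φ : Arr (A × B)) : Arr A := ⟨φ.dom.1, φ.cod.1, φ.hom.1⟩

/-- The second component of an arrow of a product. -/
def snd (φ : Arr (A × B)) : Arr B := ⟨φ.dom.2, φ.cod.2, φ.hom.2⟩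

/-- A family of arrows as an arrow of the product. -/
def pi {I : Type*} {M : I → Type*} [∀ i, Category* (M i)] (φ : ∀ i, Arr (M i)) :
    Arr (∀ i, M i) := ⟨fun i => (φ i).dom, fun i => (φ i).cod, fun i => (φ i).hom⟩

/-- The components of an arrow of a product. -/
def proj {I : Type*} {M : I → Type*} [∀ i, Category* (M i)] (φ : Arr (∀ i, M i)) (i : I) :
    Arr (M i) := ⟨φ.dom i, φ.cod i, φ.hom i⟩

/-- The diagonal of the naturality square of a transformation at an arrow. -/
def app (φ : Arr (A ⥤ B)) (ξ : Arr A) : Arr B :=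
  ⟨φ.dom.obj ξ.dom, φ.cod.obj ξ.cod, φ.hom.app ξ.dom ≫ φ.cod.map ξ.hom⟩

theorem mk_eq {a b a' b' : A} {f : a ⟶ b} {g : a' ⟶ b'} (h : a = a') (h' : b = b') (w : f ≍ g) :
    Arr.mk a b f = Arr.mk a' b' g := by
  subst h h' w
  rfl

theorem heq_of_eq {a b a' b' : A} {f : a ⟶ b} {g : a' ⟶ b'} (h : Arr.mk a b f = Arr.mk a' b' g) :
    f ≍ g := by
  cases h
  rfl

/-- Functors that agree on arrows are equal. -/
theorem functor_ext {F G : A ⥤ B} (h : ∀ φ : Arr A, map F φ = map G φ) : F = G :=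
  CategoryTheory.Functor.hext (fun a => congrArg Arr.dom (h (id a)))
    fun a b f => heq_of_eq (h ⟨a, b, f⟩)

theorem functor_congr {F G : A ⥤ B} (h : F = G) (φ : Arr A) : map F φ = map G φ :=
  congrArg (fun F => map F φ) h

theorem uncurry_injective {F G : A ⥤ B ⥤ D} (h : Functor.uncurry.obj F = Functor.uncurry.obj G) :
    F = G := by
  refine CategoryTheory.Functor.hext (fun a => ?_) fun a b f => ?_
  · refine CategoryTheory.Functor.hext (fun c => Functor.congr_obj h (a, c)) fun c d g => ?_
    have := functor_heq h (a := (a, c)) (b := (a, d)) (𝟙 a, g)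
    simpa [Functor.uncurry] using this
  · have ho : ∀ a, F.obj a = G.obj a := fun a => by
      refine CategoryTheory.Functor.hext (fun c => Functor.congr_obj h (a, c)) fun c d g => ?_
      have := functor_heq h (a := (a, c)) (b := (a, d)) (𝟙 a, g)
      simpa [Functor.uncurry] using this
    refine natTrans_heq (ho a) (ho b) fun c => ?_
    have := functor_heq h (a := (a, c)) (b := (b, c)) (f, 𝟙 c)
    simpa [Functor.uncurry] using this

/-- Functors of two variables that agree on pairs of arrows are equal; it suffices to compare the
diagonals of the naturality squares. -/
theorem functor_ext₂ {F G : A ⥤ B ⥤ D}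
    (h : ∀ (φ : Arr A) (ψ : Arr B), (map F φ).app ψ = (map G φ).app ψ) : F = G :=
  uncurry_injective (functor_ext fun φ => h φ.fst φ.snd)

theorem app_id (F : A ⥤ B) (φ : Arr A) : (id F).app φ = map F φ :=
  mk_eq rfl rfl (_root_.heq_of_eq (Category.id_comp _))

theorem map_id (F : A ⥤ B) (a : A) : map F (id a) = id (F.obj a) :=
  mk_eq rfl rfl (_root_.heq_of_eq (F.map_id a))

theorem app_map_id (φ : Arr (A ⥤ B)) (a : A) :
    φ.app (id a) = ⟨φ.dom.obj a, φ.cod.obj a, φ.hom.app a⟩ :=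
  mk_eq rfl rfl (_root_.heq_of_eq ((congrArg _ (φ.cod.map_id a)).trans (Category.comp_id _)))

theorem app_curry (F : A × B ⥤ D) (φ : Arr A) (ψ : Arr B) :
    (map (Functor.curry.obj F) φ).app ψ = map F (pair φ ψ) :=
  mk_eq rfl rfl (_root_.heq_of_eq ((F.map_comp (X := (φ.dom, ψ.dom)) (Y := (φ.cod, ψ.dom))
    (Z := (φ.cod, ψ.cod)) (φ.hom, 𝟙 _) (𝟙 _, ψ.hom)).symm.trans
      (congrArg (F.map (X := (φ.dom, ψ.dom)) (Y := (φ.cod, ψ.cod)))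
        (Prod.ext (Category.comp_id _) (Category.id_comp _)))))

theorem app_whiskeringRight (F : B ⥤ D) (φ : Arr (A ⥤ B)) (ψ : Arr A) :
    (map ((Functor.whiskeringRight A B D).obj F) φ).app ψ = map F (φ.app ψ) :=
  mk_eq rfl rfl (_root_.heq_of_eq (F.map_comp _ _).symm)

/-- Horizontal composition of natural transformations, on arrows. -/
theorem app_app_whiskeringLeft (φ : Arr (A ⥤ B)) (χ : Arr (B ⥤ D)) (ψ : Arr A) :
    ((map (Functor.whiskeringLeft A B D) φ).app χ).app ψ = χ.app (φ.app ψ) := by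
  refine mk_eq rfl rfl (_root_.heq_of_eq ?_)
  dsimp [map, app]
  simp

theorem app_app_whiskeringRight (φ : Arr (B ⥤ D)) (χ : Arr (A ⥤ B)) (ψ : Arr A) :
    ((map (Functor.whiskeringRight A B D) φ).app χ).app ψ = φ.app (χ.app ψ) := by
  refine mk_eq rfl rfl (_root_.heq_of_eq ?_)
  dsimp [map, app]
  simp

theorem app_powMap {S T B : Type u} {I : Type} {A : I → Type u} [Category.{u} S] [Category.{u} T]
    [Category.{u} B] [∀ i, Category.{u} (A i)] (Φ : T × (∀ i, A i) ⥤ B) (φ : Arr (S ⥤ T))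
    (ψ : ∀ i, Arr (S ⥤ A i)) (σ : Arr S) :
    (map (powMap Φ) (pair φ (pi ψ))).app σ = map Φ (pair (φ.app σ) (pi fun i => (ψ i).app σ)) :=
  mk_eq rfl rfl (_root_.heq_of_eq (Φ.map_comp (X := (_, fun i => _)) (Y := (_, fun i => _))
    (Z := (_, fun i => _)) (_, fun i => _) (_, fun i => _)).symm)

theorem app_powOp {S B : Type u} {I : Type} {A : I → Type u} [Category.{u} S]
    [Category.{u} B] [∀ i, Category.{u} (A i)] (Φ : S × (∀ i, A i) ⥤ B)
    (ψ : ∀ i, Arr (S ⥤ A i)) (σ : Arr S) :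
    (map (powOp Φ) (pi ψ)).app σ = map Φ (pair σ (pi fun i => (ψ i).app σ)) :=
  (app_powMap Φ (id (𝟭 S)) ψ σ).trans
    (congrArg (fun τ => map Φ (pair τ (pi fun i => (ψ i).app σ))) (app_id _ _))

/-- Composition of functors of several variables, on arrows. -/
theorem app_endComp {I : Type} {J : I → Type} (X : I → Cat.{u, u}) (Y : ∀ i, J i → Cat.{u, u})
    (Z : Cat.{u, u}) (φ : Arr ((∀ i, X i) ⥤ Z)) (ψ : ∀ i, Arr ((∀ j, Y i j) ⥤ X i))
    (σ : Arr (∀ s : Σ i, J i, Y s.1 s.2)) :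
    (map (endComp X Y Z) (pair φ (pi ψ))).app σ =
      φ.app (pi fun i => (ψ i).app (pi fun j => σ.proj ⟨i, j⟩)) := by
  refine mk_eq rfl rfl (_root_.heq_of_eq ?_)
  have e := φ.cod.map_comp (X := fun i => (ψ i).dom.obj fun j => σ.dom ⟨i, j⟩)
    (Y := fun i => (ψ i).cod.obj fun j => σ.dom ⟨i, j⟩)
    (Z := fun i => (ψ i).cod.obj fun j => σ.cod ⟨i, j⟩)
    (fun i => (ψ i).hom.app fun j => σ.dom ⟨i, j⟩)
    (fun i => (ψ i).cod.map (X := fun j => σ.dom ⟨i, j⟩) (Y := fun j => σ.cod ⟨i, j⟩)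
      fun j => σ.hom ⟨i, j⟩)
  refine Eq.trans ?_ (congrArg (φ.hom.app _ ≫ ·) e).symm
  refine Eq.trans ?_ (Category.assoc _ _ _)
  exact congrArg (· ≫ _) (φ.hom.naturality _)

/-- Composition of arrows with matching endpoints. -/
def comp (φ ψ : Arr A) (h : φ.cod = ψ.dom) : Arr A := ⟨φ.dom, ψ.cod, φ.hom ≫ eqToHom h ≫ ψ.hom⟩

theorem comp_congr {φ φ' ψ ψ' : Arr A} (e : φ = φ') (e' : ψ = ψ') (h : φ.cod = ψ.dom) :
    comp φ ψ h = comp φ' ψ' (by rw [← e, ← e', h]) := by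
  subst e e'
  rfl

theorem comp_assoc (φ ψ χ : Arr A) (h : φ.cod = ψ.dom) (h' : ψ.cod = χ.dom) :
    comp (comp φ ψ h) χ h' = comp φ (comp ψ χ h') h := by
  simp [comp]

theorem map_comp (F : A ⥤ B) (φ ψ : Arr A) (h : φ.cod = ψ.dom) :
    map F (comp φ ψ h) = comp (map F φ) (map F ψ) (congrArg F.obj h) := by
  simp [comp, map, eqToHom_map]

theorem comp_id (φ : Arr A) {a : A} (h : φ.cod = a) : comp φ (id a) h = φ := by
  subst h
  simp [comp, id]

theorem id_comp (φ : Arr A) {a : A} (h : a = φ.dom) : comp (id a) φ h = φ := by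
  subst h
  simp [comp, id]

theorem mk_eqToHom {a b : A} (h : a = b) : (⟨a, b, eqToHom h⟩ : Arr A) = id b := by
  subst h
  rfl

theorem mk_eqToHom_comp {a b c : A} (h : a = b) (g : b ⟶ c) :
    (⟨a, c, eqToHom h ≫ g⟩ : Arr A) = ⟨b, c, g⟩ := by
  subst h
  simp

end Arr

/-! ### Categorical operads on arrows -/

namespace OperadData

variable {K : Type u} (P : OperadData K)

/-- Relabelling of the inputs, on arrows. -/
def rei {I J : Type} [Finite I] [Finite J] (e : I ≃ J) {x : I → K} {y : J → K}
    (h : ∀ i, y (e i) = x i) {c : K} (p : Arr (P.Op x c)) : Arr (P.Op y c) :=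
  Arr.map (P.reindex e h) p

/-- Simultaneous composition, on arrows. -/
def cmp {I : Type} [Finite I] {J : I → Type} [∀ i, Finite (J i)] (x : I → K)
    (y : ∀ i, J i → K) (c : K) (p : Arr (P.Op x c)) (q : ∀ i, Arr (P.Op (y i) (x i))) :
    Arr (P.Op (fun s : Σ i, J i => y s.1 s.2) c) :=
  Arr.map (P.comp x y c) (.pair p (.pi q))

/-- The identity arrow of the unit. -/
def idA (c : K) : Arr (P.Op (fun _ : Unit => c) c) := Arr.id (P.one c)

/-- The axioms of an operad, on arrows. -/
structure ArrLaws : Prop where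
  rei_refl {I : Type} [Finite I] (x : I → K) (c : K) (p : Arr (P.Op x c)) :
    P.rei (Equiv.refl I) (fun _ => rfl) p = p
  rei_rei {I J L : Type} [Finite I] [Finite J] [Finite L] (e : I ≃ J) (e' : J ≃ L)
    {x : I → K} {y : J → K} {z : L → K} (h : ∀ i, y (e i) = x i) (h' : ∀ j, z (e' j) = y j)
    (c : K) (p : Arr (P.Op x c)) :
    P.rei e' h' (P.rei e h p) = P.rei (e.trans e') (fun i => (h' (e i)).trans (h i)) p
  cmp_rei {I : Type} [Finite I] {J J' : I → Type} [∀ i, Finite (J i)] [∀ i, Finite (J' i)]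
    (e : ∀ i, J i ≃ J' i) (x : I → K) {y : ∀ i, J i → K} {y' : ∀ i, J' i → K}
    (h : ∀ i j, y' i (e i j) = y i j) (c : K) (p : Arr (P.Op x c))
    (q : ∀ i, Arr (P.Op (y i) (x i))) :
    P.cmp x y' c p (fun i => P.rei (e i) (h i) (q i)) =
      P.rei (y := fun s : Σ i, J' i => y' s.1 s.2) (Equiv.sigmaCongrRight e)
        (fun s => h s.1 s.2) (P.cmp x y c p q)
  rei_cmp {I I' : Type} [Finite I] [Finite I'] {J : I' → Type} [∀ i, Finite (J i)]
    (e : I ≃ I') (x : I' → K) (y : ∀ i, J i → K) (c : K) (p : Arr (P.Op (fun i => x (e i)) c))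
    (q : ∀ i, Arr (P.Op (y i) (x i))) :
    P.cmp x y c (P.rei e (fun _ => rfl) p) q =
      P.rei (y := fun s : Σ i, J i => y s.1 s.2) (Equiv.sigmaCongrLeft e) (fun _ => rfl)
        (P.cmp (fun i => x (e i)) (fun i => y (e i)) c p fun i => q (e i))
  one_cmp {J : Type} [Finite J] (y : J → K) (c : K) (q : Arr (P.Op y c)) :
    P.rei (y := y) (Equiv.uniqueSigma fun _ : Unit => J) (fun _ => rfl)
      (P.cmp (fun _ : Unit => c) (fun _ => y) c (P.idA c) fun _ => q) = q
  cmp_one {I : Type} [Finite I] (x : I → K) (c : K) (p : Arr (P.Op x c)) :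
    P.rei (y := x) (Equiv.sigmaUnique I fun _ => Unit) (fun _ => rfl)
      (P.cmp x (fun i (_ : Unit) => x i) c p fun i => P.idA (x i)) = p
  assoc {I : Type} [Finite I] {J : I → Type} [∀ i, Finite (J i)] {L : ∀ i, J i → Type}
    [∀ i j, Finite (L i j)] (x : I → K) (y : ∀ i, J i → K) (z : ∀ i j, L i j → K) (c : K)
    (p : Arr (P.Op x c)) (q : ∀ i, Arr (P.Op (y i) (x i)))
    (r : ∀ i j, Arr (P.Op (z i j) (y i j))) :
    P.rei (y := fun s : Σ i, Σ j, L i j => z s.1 s.2.1 s.2.2) (Equiv.sigmaAssoc L) (fun _ => rfl)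
      (P.cmp (fun s : Σ i, J i => y s.1 s.2) (fun s => z s.1 s.2) c (P.cmp x y c p q)
        fun s => r s.1 s.2) =
    P.cmp x (fun i (t : Σ j, L i j) => z i t.1 t.2) c p
      fun i => P.cmp (y i) (z i) (x i) (q i) (r i)

variable {P}

theorem IsOperad.arrLaws (hP : P.IsOperad) : P.ArrLaws where
  rei_refl x c := Arr.functor_congr (hP.reindex_refl x c)
  rei_rei e e' _ _ _ h h' c := Arr.functor_congr (hP.reindex_trans e e' h h' c)
  cmp_rei e x _ _ h c p q := Arr.functor_congr (hP.comp_reindex e x h c) (.pair p (.pi q))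
  rei_cmp e x y c p q := Arr.functor_congr (hP.reindex_comp e x y c) (.pair p (.pi q))
  one_cmp y c q := by
    refine Eq.trans ?_ (Arr.functor_congr (hP.one_comp y c) q)
    rfl
  cmp_one x c p := by
    refine Eq.trans ?_ (Arr.functor_congr (hP.comp_one x c) p)
    rfl
  assoc x y z c p q r := Arr.mk_eq (hP.assoc_obj x y z c p.dom (fun i => (q i).dom) fun i j =>
      (r i j).dom)
    (hP.assoc_obj x y z c p.cod (fun i => (q i).cod) fun i j => (r i j).cod)
    (hP.assoc_map x y z c p.hom (fun i => (q i).hom) fun i j => (r i j).hom)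

theorem ArrLaws.isOperad (hP : P.ArrLaws) : P.IsOperad where
  reindex_refl x c := Arr.functor_ext (hP.rei_refl x c)
  reindex_trans e e' _ _ _ h h' c := Arr.functor_ext (hP.rei_rei e e' h h' c)
  comp_reindex e x _ _ h c := Arr.functor_ext fun φ => hP.cmp_rei e x h c φ.fst φ.snd.proj
  reindex_comp e x y c := Arr.functor_ext fun φ => hP.rei_cmp e x y c φ.fst φ.snd.proj
  one_comp y c := Arr.functor_ext fun q => hP.one_cmp y c q
  comp_one x c := Arr.functor_ext fun p => hP.cmp_one x c p
  assoc_obj x y z c p q r := by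
    have h := hP.assoc x y z c (Arr.id p) (fun i => Arr.id (q i)) fun i j => Arr.id (r i j)
    exact congrArg Arr.dom h
  assoc_map x y z c p p' q q' r r' f g h := by
    have h := hP.assoc x y z c ⟨p, p', f⟩ (fun i => ⟨q i, q' i, g i⟩)
      fun i j => ⟨r i j, r' i j, h i j⟩
    exact Arr.heq_of_eq h

end OperadData

namespace Arr

variable {A B D E S : Type*} [Category* A] [Category* B] [Category* D] [Category* E] [Category* S]

theorem pair_comp (φ ψ : Arr A) (h : φ.cod = ψ.dom) (σ : Arr B)
    (h' : (pair φ σ).cod = (pair ψ (id σ.cod)).dom) :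
    pair (comp φ ψ h) σ = comp (pair φ σ) (pair ψ (id σ.cod)) h' := by
  obtain ⟨F, G, φ⟩ := φ
  obtain ⟨G', H, ψ⟩ := ψ
  obtain rfl : G = G' := h
  refine mk_eq rfl rfl (_root_.heq_of_eq (Prod.ext rfl ?_))
  exact ((Category.comp_id _).symm.trans (congrArg (σ.hom ≫ ·) (Category.id_comp _).symm))

theorem pi_comp {I : Type*} {M : I → Type*} [∀ i, Category* (M i)] (φ ψ : ∀ i, Arr (M i))
    (h : ∀ i, (φ i).cod = (ψ i).dom) :
    pi (fun i => comp (φ i) (ψ i) (h i)) = comp (pi φ) (pi ψ) (funext h) := by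
  obtain ⟨a, b, f, rfl⟩ : ∃ (a b : ∀ i, M i) (f : ∀ i, a i ⟶ b i), φ = fun i => ⟨a i, b i, f i⟩ :=
    ⟨fun i => (φ i).dom, fun i => (φ i).cod, fun i => (φ i).hom, rfl⟩
  obtain ⟨b', c, g, rfl⟩ : ∃ (a b : ∀ i, M i) (f : ∀ i, a i ⟶ b i), ψ = fun i => ⟨a i, b i, f i⟩ :=
    ⟨fun i => (ψ i).dom, fun i => (ψ i).cod, fun i => (ψ i).hom, rfl⟩
  obtain rfl : b = b' := funext h
  rfl

/-- Maps on arrows that come from a functor. -/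
def IsMap (m : Arr A → Arr B) : Prop := ∃ F : A ⥤ B, ∀ φ, m φ = map F φ

namespace IsMap

theorem self : IsMap fun φ : Arr A => φ := ⟨𝟭 A, fun _ => rfl⟩

theorem constId (b : B) : IsMap fun _ : Arr A => id b :=
  ⟨(Functor.const A).obj b, fun _ => rfl⟩

theorem map (F : B ⥤ D) {m : Arr A → Arr B} (h : IsMap m) : IsMap fun φ => Arr.map F (m φ) := by
  obtain ⟨G, hG⟩ := h
  exact ⟨G ⋙ F, fun φ => congrArg (Arr.map F) (hG φ)⟩

theorem fst {m : Arr A → Arr (B × D)} (h : IsMap m) : IsMap fun φ => (m φ).fst :=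
  h.map (CategoryTheory.Prod.fst B D)

theorem snd {m : Arr A → Arr (B × D)} (h : IsMap m) : IsMap fun φ => (m φ).snd :=
  h.map (CategoryTheory.Prod.snd B D)

theorem proj {I : Type*} {M : I → Type*} [∀ i, Category* (M i)] {m : Arr A → Arr (∀ i, M i)}
    (h : IsMap m) (i : I) : IsMap fun φ => (m φ).proj i :=
  h.map (Pi.eval M i)

theorem pair {m : Arr A → Arr B} {n : Arr A → Arr D} (h : IsMap m) (h' : IsMap n) :
    IsMap fun φ => Arr.pair (m φ) (n φ) := by
  obtain ⟨F, hF⟩ := h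
  obtain ⟨G, hG⟩ := h'
  exact ⟨Functor.prod' F G, fun φ => congrArg₂ Arr.pair (hF φ) (hG φ)⟩

theorem pi {I : Type*} {M : I → Type*} [∀ i, Category* (M i)] {m : ∀ i, Arr A → Arr (M i)}
    (h : ∀ i, IsMap (m i)) : IsMap fun φ => Arr.pi fun i => m i φ := by
  choose F hF using h
  exact ⟨Functor.pi' F, fun φ => congrArg Arr.pi (funext fun i => hF i φ)⟩

theorem app {m : Arr A → Arr (B ⥤ D)} {n : Arr A → Arr B} (h : IsMap m) (h' : IsMap n) :
    IsMap fun φ => (m φ).app (n φ) :=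
  (h.pair h').map (Functor.uncurry.obj (𝟭 (B ⥤ D)))

theorem comp {m : Arr B → Arr D} {n : Arr A → Arr B} (h : IsMap m) (h' : IsMap n) :
    IsMap fun φ => m (n φ) := by
  obtain ⟨F, hF⟩ := h
  obtain ⟨G, hG⟩ := h'
  exact ⟨G ⋙ F, fun φ => (hF _).trans (congrArg (Arr.map F) (hG φ))⟩

theorem map_comp {m : Arr A → Arr B} (h : IsMap m) (φ ψ : Arr A) (w : φ.cod = ψ.dom) :
    ∃ w', m (Arr.comp φ ψ w) = Arr.comp (m φ) (m ψ) w' := by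
  obtain ⟨F, hF⟩ := h
  rw [hF φ, hF ψ, hF]
  exact ⟨_, Arr.map_comp F φ ψ w⟩

end IsMap

end Arr

open SwissCheese.Arr (IsMap)

/-! ### Trees on arrows -/

section Trees

variable {C : Type u} {P : OperadData C} {X : Type} {x : X → Colour P}

namespace TreeCat

/-- A white vertex, on arrows. -/
def whiteA (a : X) (ts : ∀ i, Arr (TreeCat x (src (x a) i))) : Arr (TreeCat x (tgt (x a))) :=
  Arr.map (white a) (.pi ts)

/-- A white vertex whose colour is known to be `k`, on arrows. -/
def whiteAtA {k : Colour P} (a : X) (h : x a = k) (ts : ∀ i, Arr (TreeCat x (src k i))) :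
    Arr (TreeCat x (tgt k)) :=
  Arr.map (whiteAt a h) (.pi ts)

/-- A black vertex, on arrows. -/
def blackA {n : ℕ} {s : Fin n → C} {c : C} (p : Arr (P.Op s c))
    (ts : ∀ i, Arr (TreeCat x (s i))) : Arr (TreeCat x c) :=
  Arr.map (black s c) (.pair p (.pi ts))

/-- Induction on the arrows between trees. -/
theorem arr_ind {motive : ∀ {c : C}, Arr (TreeCat x c) → Prop}
    (hw : ∀ a (ts : ∀ i, Arr (TreeCat x (src (x a) i))), (∀ i, motive (ts i)) →
      motive (whiteA a ts))
    (hb : ∀ {n : ℕ} {s : Fin n → C} {c : C} (p : Arr (P.Op s c)) (ts : ∀ i, Arr (TreeCat x (s i))),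
      (∀ i, motive (ts i)) → motive (blackA p ts))
    (hc : ∀ {c : C} (φ ψ : Arr (TreeCat x c)) (h : φ.cod = ψ.dom), motive φ → motive ψ →
      motive (φ.comp ψ h)) {c : C} (φ : Arr (TreeCat x c)) : motive φ := by
  have hi : ∀ {c : C} (t : QTree x c), motive (Arr.id (A := TreeCat x c) t) := fun t =>
    QTree.ind (motive := fun {c} t => motive (Arr.id (A := TreeCat x c) t))
      (fun a ts ih => by
        have := hw a (fun i => Arr.id (A := TreeCat x _) (ts i)) ih
        rwa [show whiteA a (fun i => Arr.id (A := TreeCat x _) (ts i)) = _ from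
          Arr.map_id (white a) ts] at this)
      (fun {n s c} p ts ih => by
        have := hb (Arr.id p) (fun i => Arr.id (A := TreeCat x _) (ts i)) ih
        rwa [show blackA (Arr.id p) (fun i => Arr.id (A := TreeCat x _) (ts i)) = _ from
          Arr.map_id (black s c) (p, ts)] at this) t
  have hm : ∀ {c : C} {t t' : QTree x c} (f : QTree.Cell t t'),
      motive (c := c) ⟨t, t', QTree.hom f⟩ := by
    intro c t t' f
    induction f with
    | id t => exact hi t
    | comp f g ih ih' =>
      exact Eq.mp (congrArg motive (show Arr.comp (A := TreeCat x _) ⟨_, _, QTree.hom f⟩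
          ⟨_, _, QTree.hom g⟩ rfl =
        ⟨_, _, QTree.hom (.comp f g)⟩ from Arr.mk_eq rfl rfl
          (heq_of_eq (congrArg (QTree.hom f ≫ ·) (Category.id_comp (QTree.hom g))))))
              (hc _ _ rfl ih ih')
    | white a fs ih =>
      rw [← TreeCat.white_map]
      exact hw a (fun i => ⟨_, _, QTree.hom (fs i)⟩) ih
    | @black n s c p p' f ts ts' fs ih =>
      rw [← TreeCat.black_map]
      exact hb ⟨_, _, f⟩ (fun i => ⟨_, _, QTree.hom (fs i)⟩) ih
  obtain ⟨t, t', f⟩ := φ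
  obtain ⟨f, rfl⟩ := Quotient.exists_rep f
  exact hm f

/-- Two families of functors out of trees, with parameters in `S`, agree if they agree at white and
black vertices whenever they agree on the branches. -/
theorem arr_ext {S : Type*} [Category* S] {M : C → Type*} [∀ c, Category* (M c)]
    {m n : ∀ {c : C}, Arr (TreeCat x c) → Arr S → Arr (M c)}
    (hm : ∀ c, IsMap fun φ : Arr (TreeCat x c × S) => m φ.fst φ.snd)
    (hn : ∀ c, IsMap fun φ : Arr (TreeCat x c × S) => n φ.fst φ.snd)
    (hw : ∀ a (ts : ∀ i, Arr (TreeCat x (src (x a) i))) (σ : Arr S),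
      (∀ i, m (ts i) σ = n (ts i) σ) → m (whiteA a ts) σ = n (whiteA a ts) σ)
    (hb : ∀ {k : ℕ} {s : Fin k → C} {c : C} (p : Arr (P.Op s c))
      (ts : ∀ i, Arr (TreeCat x (s i))) (σ : Arr S),
      (∀ i, m (ts i) σ = n (ts i) σ) → m (blackA p ts) σ = n (blackA p ts) σ)
    {c : C} (φ : Arr (TreeCat x c)) (σ : Arr S) : m φ σ = n φ σ := by
  refine arr_ind (motive := fun φ => ∀ σ, m φ σ = n φ σ)
      (fun a ts ih σ => hw a ts σ fun i => ih i σ)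
    (fun p ts ih σ => hb p ts σ fun i => ih i σ) (fun {c} φ ψ h ih ih' σ => ?_) φ σ
  -- For a composite of trees the parameter is attached to the first factor, and the second factor
  -- has an identity as its parameter.
  have hp : (Arr.pair φ σ).cod = (Arr.pair ψ (Arr.id σ.cod)).dom := Prod.ext h rfl
  have e := Arr.pair_comp φ ψ h σ hp
  obtain ⟨w, e1⟩ := (hm c).map_comp _ _ hp
  obtain ⟨w', e2⟩ := (hn c).map_comp _ _ hp
  refine ((congrArg (fun z => m z.fst z.snd) e).trans e1).trans
    (Eq.trans ?_ ((congrArg (fun z => n z.fst z.snd) e).trans e2).symm)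
  exact Arr.comp_congr (ih σ) (ih' _) _

end TreeCat

open TreeCat

/-- A fold is computed at a white vertex from its values on the branches. -/
theorem IsFold.map_white {N : FinAlgebra P}
    {φ : ∀ a, (∀ i, N.M (src (x a) i)) ⥤ N.M (tgt (x a))} {G : ∀ c, TreeCat x c ⥤ N.M c}
    (h : IsFold N φ G) (a : X) (ts : ∀ i, Arr (TreeCat x (src (x a) i))) :
    Arr.map (G _) (whiteA a ts) = Arr.map (φ a) (.pi fun i => Arr.map (G _) (ts i)) :=
  Arr.functor_congr (h.white a) (.pi ts)

/-- A fold is computed at a black vertex from its values on the branches. -/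
theorem IsFold.map_black {N : FinAlgebra P}
    {φ : ∀ a, (∀ i, N.M (src (x a) i)) ⥤ N.M (tgt (x a))} {G : ∀ c, TreeCat x c ⥤ N.M c}
    (h : IsFold N φ G) {n : ℕ} {s : Fin n → C} {c : C} (p : Arr (P.Op s c))
    (ts : ∀ i, Arr (TreeCat x (s i))) :
    Arr.map (G _) (blackA p ts) = Arr.map (N.act s c)
        (.pair p (.pi fun i => Arr.map (G _) (ts i))) :=
  Arr.functor_congr (h.hom.act s c) (.pair p (.pi ts))

theorem FinAlgebra.app_pow_act (S : Cat.{u, u}) (N : FinAlgebra P) {n : ℕ} {s : Fin n → C} {c : C}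
    (p : Arr (P.Op s c)) (ts : ∀ i, Arr (S ⥤ N.M (s i))) (σ : Arr S) :
    Arr.app (A := S) (B := N.M c) (Arr.map ((N.pow S).act s c) (.pair p (.pi ts))) σ =
      Arr.map (N.act s c) (.pair p (.pi fun i => (ts i).app σ)) := by
  refine (Arr.app_powMap (N.act s c) (Arr.map (Functor.const S) p) ts σ).trans ?_
  refine congrArg (fun z => Arr.map (N.act s c) (.pair z (.pi fun i => (ts i).app σ))) ?_
  exact Arr.mk_eq rfl rfl (heq_of_eq (Category.comp_id _))

section Plug

variable {Y W : Type} {y : Y → Colour P} {w : W → Colour P}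

/-- Substitution of trees for the leaves of a tree, on arrows. -/
def PL (k : Colour P) (r : Y → W) (h : ∀ j, w (r j) = y j) {c : C} (q : Arr (TreeCat (wl y k) c))
    (us : ∀ i, Arr (TreeCat w (src k i))) : Arr (TreeCat w c) :=
  Arr.app (A := ∀ i, TreeCat w (src k i)) (Arr.map (plug k r h c) q) (.pi us)

variable (k : Colour P) (r : Y → W) (h : ∀ j, w (r j) = y j)

theorem PL_white_inl (j : Y) (ts : ∀ i, Arr (TreeCat (wl y k) (src (y j) i)))
    (us : ∀ i, Arr (TreeCat w (src k i))) :
    PL k r h (whiteA (x := wl y k) (Sum.inl j) ts) us =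
      whiteAtA (r j) (h j) fun i => PL k r h (ts i) us :=
  (congrArg (fun z => Arr.app (A := ∀ i, TreeCat w (src k i)) (B := TreeCat w (tgt (y j))) z
      (.pi us))
    ((plug_isFold k r h).map_white (Sum.inl j) ts)).trans
    (Arr.app_powOp (CategoryTheory.Prod.snd _ _ ⋙ whiteAt (r j) (h j)) _ _)

theorem PL_white_inr (i : Fin (ar k)) (ts) (us : ∀ i, Arr (TreeCat w (src k i))) :
    PL k r h (whiteA (x := wl y k) (Sum.inr i) ts) us = us i :=
  (congrArg (fun z => Arr.app (A := ∀ i, TreeCat w (src k i)) (B := TreeCat w (src k i)) z (.pi us))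
    ((plug_isFold k r h).map_white (Sum.inr i) ts)).trans (Arr.app_id (Pi.eval _ i) _)

theorem PL_black {n : ℕ} {s : Fin n → C} {c : C} (p : Arr (P.Op s c))
    (ts : ∀ i, Arr (TreeCat (wl y k) (s i))) (us : ∀ i, Arr (TreeCat w (src k i))) :
    PL k r h (blackA p ts) us = blackA p fun i => PL k r h (ts i) us :=
  (congrArg (fun z => Arr.app (A := ∀ i, TreeCat w (src k i)) (B := TreeCat w c) z (.pi us))
    ((plug_isFold k r h).map_black p ts)).trans
    (FinAlgebra.app_pow_act (Cat.of (∀ i, TreeCat w (src k i))) (alg w) p _ _)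

theorem PL_whiteAt {k' : Colour P} (j : Y) (h' : y j = k')
    (ts : ∀ i, Arr (TreeCat (wl y k) (src k' i))) (us : ∀ i, Arr (TreeCat w (src k i))) :
    PL k r h (whiteAtA (x := wl y k) (Sum.inl j) h' ts) us =
      whiteAtA (r j) ((h j).trans h') fun i => PL k r h (ts i) us := by
  subst h'
  exact PL_white_inl k r h j ts us

theorem isMap_PL {A : Type*} [Category* A] {c : C} {m : Arr A → Arr (TreeCat (wl y k) c)}
    {n : ∀ i, Arr A → Arr (TreeCat w (src k i))} (hm : IsMap m) (hn : ∀ i, IsMap (n i)) :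
    IsMap fun φ => PL k r h (m φ) fun i => n i φ :=
  (hm.map (plug k r h c)).app (.pi hn)

end Plug

/-- The identity arrow of a leaf. -/
def leafA (x : X → Colour P) (k : Colour P) (i : Fin (ar k)) : Arr (TreeCat (wl x k) (src k i)) :=
  Arr.id (leaf x k i)

theorem whiteAtA_inr (k : Colour P) (i : Fin (ar k)) (ts : ∀ _ : Fin 0, _) :
    whiteAtA (x := wl x k) (k := Sum.inr (src k i)) (Sum.inr i) rfl ts = leafA x k i := by
  refine Eq.trans (congrArg (fun z => Arr.map (whiteAt (x := wl x k) (k := Sum.inr (src k i))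
    (Sum.inr i) rfl) z) (?_ : Arr.pi ts = Arr.id fun j : Fin 0 => j.elim0))
    (Arr.map_id _ fun j : Fin 0 => j.elim0)
  exact Arr.mk_eq (funext fun j : Fin 0 => j.elim0) (funext fun j : Fin 0 => j.elim0)
    (pi_heq (fun j : Fin 0 => j.elim0) (fun j : Fin 0 => j.elim0) fun j : Fin 0 => j.elim0)

theorem whiteA_inr (k : Colour P) (i : Fin (ar k)) (ts) :
    whiteA (x := wl x k) (Sum.inr i) ts = leafA x k i := whiteAtA_inr k i ts

section TreeComp

variable {Y : X → Type} {y : ∀ a, Y a → Colour P} {Z : Type} {z : Z → Colour P}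

/-- Insertion of trees in the vertices of a tree, on arrows. -/
def TC (r : (Σ a, Y a) → Z) (h : ∀ s, z (r s) = y s.1 s.2) (k : Colour P) {c : C}
    (t : Arr (TreeCat (wl x k) c)) (q : ∀ a, Arr (Ctx (y a) (x a))) : Arr (TreeCat (wl z k) c) :=
  Arr.app (A := ∀ a, Ctx (y a) (x a)) (Arr.map (treeComp r h k c) t) (.pi q)

variable (r : (Σ a, Y a) → Z) (h : ∀ s, z (r s) = y s.1 s.2) (k : Colour P)

theorem TC_white_inl (a : X) (ts : ∀ i, Arr (TreeCat (wl x k) (src (x a) i)))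
    (q : ∀ a, Arr (Ctx (y a) (x a))) :
    TC r h k (whiteA (x := wl x k) (Sum.inl a) ts) q =
      PL (w := wl z k) (x a) (fun j => Sum.inl (r ⟨a, j⟩)) (fun j => h ⟨a, j⟩) (q a)
        fun i => TC r h k (ts i) q := by
  refine (congrArg (fun z => Arr.app (A := ∀ a, Ctx (y a) (x a)) z (.pi q))
    ((treeComp_isFold r h k).map_white (Sum.inl a) ts)).trans ?_
  exact Arr.app_powOp ((Pi.eval (fun a => Ctx (y a) (x a)) a).prod
    (𝟭 (∀ i, TreeCat (wl z k) (src (x a) i))) ⋙ Functor.uncurry.obj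
      (plug (w := wl z k) (x a) (fun j => Sum.inl (r ⟨a, j⟩)) (fun j => h ⟨a, j⟩) (tgt (x a)))) _ _

theorem TC_white_inr (i : Fin (ar k)) (ts) (q : ∀ a, Arr (Ctx (y a) (x a))) :
    TC r h k (whiteA (x := wl x k) (Sum.inr i) ts) q = leafA z k i := by
  refine (congrArg (fun z => Arr.app (A := ∀ a, Ctx (y a) (x a)) z (.pi q))
    ((treeComp_isFold r h k).map_white (Sum.inr i) ts)).trans ?_
  refine (Arr.app_powOp (S := ∀ a, Ctx (y a) (x a)) (CategoryTheory.Prod.snd _ _ ⋙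
      whiteAt (x := wl z k) (k := Sum.inr (src k i)) (Sum.inr i) rfl) _ _).trans ?_
  exact whiteAtA_inr k i _

theorem TC_black {n : ℕ} {s : Fin n → C} {c : C} (p : Arr (P.Op s c))
    (ts : ∀ i, Arr (TreeCat (wl x k) (s i))) (q : ∀ a, Arr (Ctx (y a) (x a))) :
    TC r h k (blackA p ts) q = blackA p fun i => TC r h k (ts i) q :=
  (congrArg (fun z => Arr.app (A := ∀ a, Ctx (y a) (x a)) z (.pi q))
    ((treeComp_isFold r h k).map_black p ts)).trans
    (FinAlgebra.app_pow_act (Cat.of (∀ a, Ctx (y a) (x a))) (alg (wl z k)) p _ _)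

theorem isMap_TC {A : Type*} [Category* A] {c : C} {m : Arr A → Arr (TreeCat (wl x k) c)}
    {n : ∀ a, Arr A → Arr (Ctx (y a) (x a))} (hm : IsMap m) (hn : ∀ i, IsMap (n i)) :
    IsMap fun φ => TC r h k (m φ) fun i => n i φ :=
  (hm.map (treeComp r h k c)).app (.pi hn)

end TreeComp

end Trees

open TreeCat

/-! ### Substitution of trees -/

section Trees

variable {C : Type u} {P : OperadData C} {X : Type} {x : X → Colour P}

/-- Associativity of the substitution for leaves. -/
theorem PL_PL {Y₁ Y₂ W : Type} {y₁ : Y₁ → Colour P} {y₂ : Y₂ → Colour P} {w : W → Colour P}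
    (k₁ k₂ : Colour P) (ρ₁ : Y₁ → Y₂) (h₁ : ∀ j, y₂ (ρ₁ j) = y₁ j) (ρ₂ : Y₂ → W)
    (h₂ : ∀ j, w (ρ₂ j) = y₂ j) {c : C} (q : Arr (TreeCat (wl y₁ k₁) c))
    (us : ∀ i, Arr (TreeCat (wl y₂ k₂) (src k₁ i))) (vs : ∀ i, Arr (TreeCat w (src k₂ i))) :
    PL k₂ ρ₂ h₂ (PL (w := wl y₂ k₂) k₁ (fun j => Sum.inl (ρ₁ j)) h₁ q us) vs =
      PL k₁ (fun j => ρ₂ (ρ₁ j)) (fun j => (h₂ (ρ₁ j)).trans (h₁ j)) q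
        fun i => PL k₂ ρ₂ h₂ (us i) vs := by
  refine arr_ext (S := (∀ i, TreeCat (wl y₂ k₂) (src k₁ i)) × ∀ i, TreeCat w (src k₂ i))
    (M := fun c => TreeCat w c)
    (m := fun q σ => PL k₂ ρ₂ h₂ (PL (w := wl y₂ k₂) k₁ (fun j => Sum.inl (ρ₁ j)) h₁ q σ.fst.proj)
      σ.snd.proj)
    (n := fun q σ => PL k₁ (fun j => ρ₂ (ρ₁ j)) (fun j => (h₂ (ρ₁ j)).trans (h₁ j)) q
        fun i => PL k₂ ρ₂ h₂ (σ.fst.proj i) σ.snd.proj)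
    (fun c => isMap_PL _ _ _ (isMap_PL _ _ _ IsMap.self.fst fun i => IsMap.self.snd.fst.proj i)
      fun i => IsMap.self.snd.snd.proj i)
    (fun c => isMap_PL _ _ _ IsMap.self.fst fun i => isMap_PL _ _ _ (IsMap.self.snd.fst.proj i)
      fun i => IsMap.self.snd.snd.proj i) ?_ ?_ q (.pair (.pi us) (.pi vs))
  · rintro (j | i) ts σ ih
    · refine (congrArg (fun z => PL k₂ ρ₂ h₂ z σ.snd.proj) (PL_white_inl _ _ _ j ts _)).trans ?_
      refine (PL_whiteAt k₂ ρ₂ h₂ (ρ₁ j) (h₁ j) _ _).trans ?_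
      refine Eq.trans ?_ (PL_white_inl k₁ _ _ j ts _).symm
      exact congrArg (whiteAtA _ _) (funext ih)
    · exact (congrArg (fun z => PL k₂ ρ₂ h₂ z σ.snd.proj) (PL_white_inr _ _ _ i ts _)).trans
        (PL_white_inr k₁ _ _ i ts fun i => PL k₂ ρ₂ h₂ (σ.fst.proj i) σ.snd.proj).symm
  · intro n s c p ts σ ih
    refine (congrArg (fun z => PL k₂ ρ₂ h₂ z σ.snd.proj) (PL_black _ _ _ p ts _)).trans ?_
    refine (PL_black k₂ ρ₂ h₂ p _ _).trans (Eq.trans ?_ (PL_black k₁ _ _ p ts _).symm)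
    exact congrArg (blackA p) (funext ih)

/-- Substitution replaces a leaf by the corresponding tree. -/
theorem PL_leafA {Y W : Type} {y : Y → Colour P} {w : W → Colour P} (k : Colour P) (r : Y → W)
    (h : ∀ j, w (r j) = y j) (i : Fin (ar k)) (us : ∀ i, Arr (TreeCat w (src k i))) :
    PL k r h (leafA y k i) us = us i :=
  (congrArg (fun z => PL k r h z us) (whiteA_inr k i fun j : Fin 0 => j.elim0).symm).trans
    (PL_white_inr k r h i _ us)

theorem PL_congr {Y W : Type} {y : Y → Colour P} {w : W → Colour P} (k : Colour P) {r r' : Y → W}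
    (h : ∀ j, w (r j) = y j) (h' : ∀ j, w (r' j) = y j) (e : r = r') {c : C}
    {q : Arr (TreeCat (wl y k) c)} {us us' : ∀ i, Arr (TreeCat w (src k i))} (e' : us = us') :
    PL k r h q us = PL k r' h' q us' := by
  subst e e'
  rfl

/-- Renaming of the white vertices of a tree, on arrows. -/
def RN {Y Z : Type} {y : Y → Colour P} {z : Z → Colour P} (ρ : Y → Z) (h : ∀ j, z (ρ j) = y j)
    (k : Colour P) {c : C} (t : Arr (TreeCat (wl y k) c)) : Arr (TreeCat (wl z k) c) :=
  PL (w := wl z k) k (fun j => Sum.inl (ρ j)) h t (leafA z k)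

theorem RN_id {Y : Type} {y : Y → Colour P} (k : Colour P) {c : C} (t : Arr (TreeCat (wl y k) c)) :
    RN (fun j => j) (fun _ => rfl) k t = t := by
  refine arr_ext (S := Discrete PUnit.{1}) (M := fun c => TreeCat (wl y k) c)
    (m := fun t _ => RN (fun j => j) (fun _ => rfl) k t) (n := fun t _ => t)
    (fun c => isMap_PL _ _ _ IsMap.self.fst fun i => .constId _) (fun c => IsMap.self.fst)
    ?_ ?_ t (Arr.id ⟨⟨⟩⟩)
  · rintro (j | i) ts σ ih
    · exact (PL_white_inl _ _ _ j ts _).trans (congrArg (whiteA (Sum.inl j)) (funext ih))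
    · exact (PL_white_inr _ _ _ i ts _).trans (whiteA_inr k i ts).symm
  · intro n s c p ts σ ih
    exact (PL_black _ _ _ p ts _).trans (congrArg (blackA p) (funext ih))

theorem RN_RN {Y₁ Y₂ Y₃ : Type} {y₁ : Y₁ → Colour P} {y₂ : Y₂ → Colour P} {y₃ : Y₃ → Colour P}
    (k : Colour P) (ρ₁ : Y₁ → Y₂) (h₁ : ∀ j, y₂ (ρ₁ j) = y₁ j) (ρ₂ : Y₂ → Y₃)
    (h₂ : ∀ j, y₃ (ρ₂ j) = y₂ j) {c : C} (t : Arr (TreeCat (wl y₁ k) c)) :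
    RN ρ₂ h₂ k (RN ρ₁ h₁ k t) = RN (fun j => ρ₂ (ρ₁ j)) (fun j => (h₂ (ρ₁ j)).trans (h₁ j)) k t :=
  (PL_PL (w := wl y₃ k) k k ρ₁ h₁ (fun j => Sum.inl (ρ₂ j)) h₂ t _ _).trans
    (congrArg (PL (w := wl y₃ k) k _ _ t) (funext fun i => PL_leafA (w := wl y₃ k) _ _ _ i _))

theorem PL_RN {Y₁ Y₂ W : Type} {y₁ : Y₁ → Colour P} {y₂ : Y₂ → Colour P} {w : W → Colour P}
    (k : Colour P) (ρ₁ : Y₁ → Y₂) (h₁ : ∀ j, y₂ (ρ₁ j) = y₁ j) (ρ₂ : Y₂ → W)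
    (h₂ : ∀ j, w (ρ₂ j) = y₂ j) {c : C} (t : Arr (TreeCat (wl y₁ k) c))
    (us : ∀ i, Arr (TreeCat w (src k i))) :
    PL k ρ₂ h₂ (RN ρ₁ h₁ k t) us =
      PL k (fun j => ρ₂ (ρ₁ j)) (fun j => (h₂ (ρ₁ j)).trans (h₁ j)) t us :=
  (PL_PL k k ρ₁ h₁ ρ₂ h₂ t _ _).trans
    (congrArg (PL k _ _ t) (funext fun i => PL_leafA _ _ _ i _))

section

variable {Y : X → Type} {y : ∀ a, Y a → Colour P} {Z : Type} {z : Z → Colour P}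
  (r : (Σ a, Y a) → Z) (h : ∀ s, z (r s) = y s.1 s.2) (k : Colour P)

theorem TC_leafA (i : Fin (ar k)) (q : ∀ a, Arr (Ctx (y a) (x a))) :
    TC r h k (leafA x k i) q = leafA z k i :=
  (congrArg (fun z => TC r h k z q) (whiteA_inr k i fun j : Fin 0 => j.elim0).symm).trans
    (TC_white_inr r h k i _ q)

theorem RN_TC {V : Type} {v : V → Colour P} (ρ : Z → V) (h' : ∀ j, v (ρ j) = z j) {c : C}
    (t : Arr (TreeCat (wl x k) c)) (q : ∀ a, Arr (Ctx (y a) (x a))) :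
    RN ρ h' k (TC r h k t q) = TC (fun s => ρ (r s)) (fun s => (h' (r s)).trans (h s)) k t q := by
  refine arr_ext (S := ∀ a, Ctx (y a) (x a)) (M := fun c => TreeCat (wl v k) c)
    (m := fun t σ => RN ρ h' k (TC r h k t σ.proj))
    (n := fun t σ => TC (fun s => ρ (r s)) (fun s => (h' (r s)).trans (h s)) k t σ.proj)
    (fun c => isMap_PL _ _ _ (isMap_TC _ _ _ IsMap.self.fst fun i => IsMap.self.snd.proj i)
      fun i => .constId _)
    (fun c => isMap_TC _ _ _ IsMap.self.fst fun i => IsMap.self.snd.proj i) ?_ ?_ t (.pi q)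
  · rintro (a | i) ts σ ih
    · refine (congrArg (RN ρ h' k) (TC_white_inl r h k a ts _)).trans ?_
      refine (PL_PL (w := wl v k) _ _ _ _ _ _ _ _ _).trans ?_
      refine Eq.trans ?_ (TC_white_inl _ _ k a ts _).symm
      exact congrArg (PL (w := wl v k) _ _ _ _) (funext ih)
    · refine (congrArg (RN ρ h' k) (TC_white_inr r h k i ts _)).trans ?_
      exact (PL_leafA (w := wl v k) k _ _ i _).trans (TC_white_inr _ _ k i ts _).symm
  · intro n s c p ts σ ih
    refine (congrArg (RN ρ h' k) (TC_black r h k p ts _)).trans ?_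
    refine (PL_black (w := wl v k) k _ _ p _ _).trans (Eq.trans ?_ (TC_black _ _ k p ts _).symm)
    exact congrArg (blackA p) (funext ih)

theorem TC_RN_right {Y' : X → Type} {y' : ∀ a, Y' a → Colour P} (ρ : ∀ a, Y' a → Y a)
    (h' : ∀ a j, y a (ρ a j) = y' a j) {c : C}
    (t : Arr (TreeCat (wl x k) c)) (q : ∀ a, Arr (Ctx (y' a) (x a))) :
    TC r h k t (fun a => RN (ρ a) (h' a) (x a) (q a)) =
      TC (fun s => r ⟨s.1, ρ s.1 s.2⟩) (fun s => (h ⟨s.1, ρ s.1 s.2⟩).trans (h' s.1 s.2)) k t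
          q := by
  refine arr_ext (S := ∀ a, Ctx (y' a) (x a)) (M := fun c => TreeCat (wl z k) c)
    (m := fun t σ => TC r h k t fun a => RN (ρ a) (h' a) (x a) (σ.proj a))
    (n := fun t σ => TC (fun s => r ⟨s.1, ρ s.1 s.2⟩)
      (fun s => (h ⟨s.1, ρ s.1 s.2⟩).trans (h' s.1 s.2)) k t σ.proj)
    (fun c => isMap_TC _ _ _ IsMap.self.fst fun i => isMap_PL _ _ _ (IsMap.self.snd.proj i)
      fun i => .constId _)
    (fun c => isMap_TC _ _ _ IsMap.self.fst fun i => IsMap.self.snd.proj i) ?_ ?_ t (.pi q)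
  · rintro (a | i) ts σ ih
    · refine (TC_white_inl r h k a ts _).trans ?_
      refine (PL_RN (w := wl z k) _ _ _ _ _ _ _).trans ?_
      refine Eq.trans ?_ (TC_white_inl _ _ k a ts _).symm
      exact congrArg (PL (w := wl z k) _ _ _ _) (funext ih)
    · exact (TC_white_inr r h k i ts _).trans (TC_white_inr _ _ k i ts _).symm
  · intro n s c p ts σ ih
    refine (TC_black r h k p ts _).trans (Eq.trans ?_ (TC_black _ _ k p ts _).symm)
    exact congrArg (blackA p) (funext ih)

end

/-- The identity arrow of the tree with a single white vertex. -/
def unitA (k : Colour P) : Arr (Ctx (fun _ : Unit => k) k) := Arr.id (unitTree k)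

theorem unitA_eq (k : Colour P) :
    unitA k = whiteA (x := wl (fun _ : Unit => k) k) (Sum.inl ()) (leafA _ k) :=
  (Arr.map_id (white (x := wl (fun _ : Unit => k) k) (Sum.inl ())) (leaf _ k)).symm

/-- Insertion in the tree with a single white vertex. -/
theorem TC_unitA {k : Colour P} {Y Z : Type} {y : Unit → Y → Colour P} {z : Z → Colour P}
    (r : (Σ _ : Unit, Y) → Z) (h : ∀ s, z (r s) = y s.1 s.2) (q : ∀ a, Arr (Ctx (y a) k)) :
    TC r h k (unitA k) q = RN (fun j => r ⟨(), j⟩) (fun j => h ⟨(), j⟩) k (q ()) := by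
  refine (congrArg (fun t => TC r h k t q) (unitA_eq k)).trans ?_
  refine (TC_white_inl r h k () _ q).trans ?_
  exact congrArg (PL (w := wl z k) _ _ _ _) (funext fun i => TC_leafA r h k i q)

theorem PL_unitA {k : Colour P} {W : Type} {w : W → Colour P} (r : Unit → W)
    (h : ∀ j, w (r j) = k) (us : ∀ i, Arr (TreeCat w (src k i))) :
    PL (y := fun _ : Unit => k) k r h (unitA k) us = whiteAtA (r ()) (h ()) us := by
  refine (congrArg (fun t => PL k r h t us) (unitA_eq k)).trans ?_
  refine (PL_white_inl (y := fun _ : Unit => k) k r h () _ us).trans ?_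
  exact congrArg (whiteAtA _ _) (funext fun i => PL_leafA k r h i us)

/-- Insertion of trees with a single white vertex. -/
theorem TC_units {Z : Type} {z : Z → Colour P}
    (r : (Σ _ : X, Unit) → Z) (h : ∀ s, z (r s) = x s.1) (k : Colour P) {c : C}
    (t : Arr (TreeCat (wl x k) c)) :
    TC (y := fun a _ => x a) r h k t (fun a => unitA (x a)) =
      RN (fun a => r ⟨a, ()⟩) (fun a => h ⟨a, ()⟩) k t := by
  refine arr_ext (S := Discrete PUnit.{1}) (M := fun c => TreeCat (wl z k) c)
    (m := fun t _ => TC (y := fun a _ => x a) r h k t (fun a => unitA (x a)))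
    (n := fun t _ => RN (fun a => r ⟨a, ()⟩) (fun a => h ⟨a, ()⟩) k t)
    (fun c => isMap_TC _ _ _ IsMap.self.fst fun i => .constId _)
    (fun c => isMap_PL _ _ _ IsMap.self.fst fun i => .constId _) ?_ ?_ t (Arr.id ⟨⟨⟩⟩)
  · rintro (a | i) ts σ ih
    · refine (TC_white_inl (y := fun a _ => x a) r h k a ts _).trans ?_
      refine (PL_unitA (w := wl z k) _ _ _).trans ?_
      refine Eq.trans ?_ (PL_white_inl (w := wl z k) k _ _ a ts _).symm
      exact congrArg (whiteAtA (x := wl z k) _ _) (funext ih)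
    · exact (TC_white_inr (y := fun a _ => x a) r h k i ts _).trans
        (PL_white_inr (w := wl z k) k _ _ i ts _).symm
  · intro n s c p ts σ ih
    refine (TC_black (y := fun a _ => x a) r h k p ts _).trans
      (Eq.trans ?_ (PL_black (w := wl z k) k _ _ p ts _).symm)
    exact congrArg (blackA p) (funext ih)

section Assoc

variable {Y Z : Type} {z : Z → Colour P} (ρ : Y → Z) {W : Z → Type} {w : ∀ b, W b → Colour P}
  {V : Type} {v : V → Colour P} (r' : (Σ b, W b) → V) (h' : ∀ s, v (r' s) = w s.1 s.2)
  {U : Type} {u : U → Colour P} (r₁ : (Σ j, W (ρ j)) → U)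
  (h₁ : ∀ s, u (r₁ s) = w (ρ s.1) s.2) (r₂ : U → V) (h₂ : ∀ s, v (r₂ s) = u s)

/-- Insertion of trees in the vertices commutes with substitution of trees for the leaves. -/
theorem TC_PL (hr : ∀ j l, r₂ (r₁ ⟨j, l⟩) = r' ⟨ρ j, l⟩) (k k' : Colour P) {c : C}
    (q : Arr (TreeCat (wl (fun j => z (ρ j)) k') c))
    (us : ∀ i, Arr (TreeCat (wl z k) (src k' i))) (s : ∀ b, Arr (Ctx (w b) (z b))) :
    TC r' h' k (PL (y := fun j => z (ρ j)) (w := wl z k) k' (fun j => Sum.inl (ρ j)) (fun _ => rfl)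
        q us) s =
      PL (w := wl v k) k' (fun l => Sum.inl (r₂ l)) h₂
        (TC (x := fun j => z (ρ j)) (y := fun j => w (ρ j)) r₁ h₁ k' q fun j => s (ρ j))
        fun i => TC r' h' k (us i) s := by
  refine arr_ext (S := (∀ i, TreeCat (wl z k) (src k' i)) × ∀ b, Ctx (w b) (z b))
    (M := fun c => TreeCat (wl v k) c)
    (m := fun q σ => TC r' h' k (PL (y := fun j => z (ρ j)) (w := wl z k) k'
        (fun j => Sum.inl (ρ j)) (fun _ => rfl) q
      σ.fst.proj) σ.snd.proj)
    (n := fun q σ => PL (w := wl v k) k' (fun l => Sum.inl (r₂ l)) h₂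
        (TC (x := fun j => z (ρ j)) (y := fun j => w (ρ j)) r₁ h₁ k' q fun j => σ.snd.proj (ρ j))
        fun i => TC r' h' k (σ.fst.proj i) σ.snd.proj)
    (fun c => isMap_TC _ _ _ (isMap_PL (y := fun j => z (ρ j)) _ _ _ IsMap.self.fst
      fun i => IsMap.self.snd.fst.proj i)
      fun i => IsMap.self.snd.snd.proj i)
    (fun c => isMap_PL _ _ _ (isMap_TC (x := fun j => z (ρ j)) (y := fun j => w (ρ j)) _ _ _
      IsMap.self.fst fun i => IsMap.self.snd.snd.proj (ρ i))
      fun i => isMap_TC _ _ _ (IsMap.self.snd.fst.proj i) fun i => IsMap.self.snd.snd.proj i)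
      ?_ ?_ q (.pair (.pi us) (.pi s))
  · rintro (j | i) ts σ ih
    · refine (congrArg (fun t => TC r' h' k t σ.snd.proj)
          (PL_white_inl (y := fun j => z (ρ j)) (w := wl z k) k' _ _ j ts _)).trans ?_
      refine (TC_white_inl r' h' k (ρ j) _ _).trans ?_
      refine Eq.trans ?_ (congrArg (fun t => PL (w := wl v k) k' (fun l => Sum.inl (r₂ l)) h₂ t _)
        (TC_white_inl (x := fun j => z (ρ j)) (y := fun j => w (ρ j)) r₁ h₁ k' j ts _).symm)
      refine Eq.trans ?_ (PL_PL (w := wl v k) _ _ _ _ _ _ _ _ _).symm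
      exact PL_congr (w := wl v k) _ _ _ (funext fun l => congrArg Sum.inl (hr j l).symm)
          (funext ih)
    · refine (congrArg (fun t => TC r' h' k t σ.snd.proj)
          (PL_white_inr (y := fun j => z (ρ j)) (w := wl z k) k' _ _ i ts _)).trans ?_
      refine Eq.trans ?_ (congrArg (fun t => PL (w := wl v k) k' (fun l => Sum.inl (r₂ l)) h₂ t _)
        (TC_white_inr (x := fun j => z (ρ j)) (y := fun j => w (ρ j)) r₁ h₁ k' i ts _).symm)
      exact (PL_leafA (w := wl v k) _ _ _ i fun i => TC r' h' k (σ.fst.proj i) σ.snd.proj).symm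
  · intro n s c p ts σ ih
    refine (congrArg (fun t => TC r' h' k t σ.snd.proj)
        (PL_black (y := fun j => z (ρ j)) (w := wl z k) k' _ _ p ts _)).trans ?_
    refine (TC_black r' h' k p _ _).trans ?_
    refine Eq.trans ?_ (congrArg (fun t => PL (w := wl v k) k' (fun l => Sum.inl (r₂ l)) h₂ t _)
      (TC_black (x := fun j => z (ρ j)) (y := fun j => w (ρ j)) r₁ h₁ k' p ts _).symm)
    refine Eq.trans ?_ (PL_black (w := wl v k) k' _ _ p _ _).symm
    exact congrArg (blackA p) (funext ih)

theorem TC_RN (hr : ∀ j l, r₂ (r₁ ⟨j, l⟩) = r' ⟨ρ j, l⟩) (k : Colour P) {c : C}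
    (t : Arr (TreeCat (wl (fun j => z (ρ j)) k) c)) (s : ∀ b, Arr (Ctx (w b) (z b))) :
    TC r' h' k (RN ρ (fun _ => rfl) k t) s =
      RN r₂ h₂ k (TC (x := fun j => z (ρ j)) (y := fun j => w (ρ j)) r₁ h₁ k t fun j => s (ρ j)) :=
  (TC_PL ρ r' h' r₁ h₁ r₂ h₂ hr k k t _ s).trans
    (congrArg (PL (w := wl v k) k _ _ _) (funext fun i => TC_leafA r' h' k i s))

end Assoc

/-- Associativity of the insertion of trees. -/
theorem TC_TC {Y : X → Type} {Z : Type} {z : Z → Colour P} (r : (Σ a, Y a) → Z)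
    {W : Z → Type} {w : ∀ b, W b → Colour P}
    {V : Type} {v : V → Colour P} (r' : (Σ b, W b) → V) (h' : ∀ s, v (r' s) = w s.1 s.2)
    {U : X → Type} {u : ∀ a, U a → Colour P} (r₁ : ∀ a, (Σ j, W (r ⟨a, j⟩)) → U a)
    (h₁ : ∀ a s, u a (r₁ a s) = w (r ⟨a, s.1⟩) s.2) (r₂ : (Σ a, U a) → V)
    (h₂ : ∀ s, v (r₂ s) = u s.1 s.2) (hr : ∀ a j l, r₂ ⟨a, r₁ a ⟨j, l⟩⟩ = r' ⟨r ⟨a, j⟩, l⟩)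
    (k : Colour P) {c : C} (t : Arr (TreeCat (wl x k) c))
    (q : ∀ a, Arr (Ctx (fun j => z (r ⟨a, j⟩)) (x a))) (s : ∀ b, Arr (Ctx (w b) (z b))) :
    TC r' h' k (TC (y := fun a j => z (r ⟨a, j⟩)) r (fun _ => rfl) k t q) s =
      TC (y := u) r₂ h₂ k t fun a => TC (x := fun j => z (r ⟨a, j⟩))
        (y := fun j => w (r ⟨a, j⟩)) (r₁ a) (h₁ a) (x a) (q a) fun j => s (r ⟨a, j⟩) := by
  refine arr_ext (S := (∀ a, Ctx (fun j => z (r ⟨a, j⟩)) (x a)) × ∀ b, Ctx (w b) (z b))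
    (M := fun c => TreeCat (wl v k) c)
    (m := fun t σ => TC r' h' k (TC (y := fun a j => z (r ⟨a, j⟩)) r (fun _ => rfl) k t σ.fst.proj)
      σ.snd.proj)
    (n := fun t σ => TC (y := u) r₂ h₂ k t fun a => TC (x := fun j => z (r ⟨a, j⟩))
        (y := fun j => w (r ⟨a, j⟩)) (r₁ a) (h₁ a) (x a) (σ.fst.proj a)
          fun j => σ.snd.proj (r ⟨a, j⟩))
    (fun c => isMap_TC _ _ _ (isMap_TC (y := fun a j => z (r ⟨a, j⟩)) _ _ _ IsMap.self.fst
      fun i => IsMap.self.snd.fst.proj i) fun i => IsMap.self.snd.snd.proj i)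
    (fun c => isMap_TC _ _ _ IsMap.self.fst fun a => isMap_TC (x := fun j => z (r ⟨a, j⟩))
        (y := fun j => w (r ⟨a, j⟩)) _ _ _ (IsMap.self.snd.fst.proj a)
        fun j => IsMap.self.snd.snd.proj (r ⟨a, j⟩)) ?_ ?_ t (.pair (.pi q) (.pi s))
  · rintro (a | i) ts σ ih
    · refine (congrArg (fun t => TC r' h' k t σ.snd.proj)
        (TC_white_inl (y := fun a j => z (r ⟨a, j⟩)) r (fun _ => rfl) k a ts _)).trans ?_
      refine (TC_PL (fun j => r ⟨a, j⟩) r' h' (r₁ a) (h₁ a) (fun l => r₂ ⟨a, l⟩)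
        (fun l => h₂ ⟨a, l⟩) (hr a) k (x a) (σ.fst.proj a) _ _).trans ?_
      refine Eq.trans ?_ (TC_white_inl (y := u) r₂ h₂ k a ts _).symm
      exact congrArg (PL (w := wl v k) _ _ _ _) (funext ih)
    · refine (congrArg (fun t => TC r' h' k t σ.snd.proj)
        (TC_white_inr (y := fun a j => z (r ⟨a, j⟩)) r (fun _ => rfl) k i ts _)).trans ?_
      exact (TC_leafA r' h' k i _).trans (TC_white_inr (y := u) r₂ h₂ k i ts _).symm
  · intro n s c p ts σ ih
    refine (congrArg (fun t => TC r' h' k t σ.snd.proj)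
        (TC_black (y := fun a j => z (r ⟨a, j⟩)) r (fun _ => rfl) k p ts _)).trans ?_
    refine (TC_black r' h' k p _ _).trans (Eq.trans ?_ (TC_black (y := u) r₂ h₂ k p ts _).symm)
    exact congrArg (blackA p) (funext ih)

theorem TC_id {Y : X → Type} {y : ∀ a, Y a → Colour P} {Z : Type} {z : Z → Colour P}
    (r : (Σ a, Y a) → Z) (h : ∀ s, z (r s) = y s.1 s.2) (k : Colour P) {c : C}
    (t : TreeCat (wl x k) c) (q : ∀ a, Ctx (y a) (x a)) :
    TC r h k (Arr.id t) (fun a => Arr.id (q a)) = Arr.id (((treeComp r h k c).obj t).obj q) := by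
  refine (congrArg (fun z => Arr.app (A := ∀ a, Ctx (y a) (x a)) z (Arr.id q))
    (Arr.map_id (treeComp r h k c) t)).trans ?_
  exact (Arr.app_id _ _).trans (Arr.map_id _ q)

end Trees

open TreeCat

/-! ### The axioms of an operad for the Swiss cheese plus construction -/

section Trees

variable {C : Type u} {P : OperadData C} {X : Type} {x : X → Colour P}

/-- Insertion of trees without white vertices in the vertices of a tree, on arrows. -/
def TC₀ (k : Colour P) {c : C} (t : Arr (TreeCat (wl x k) c))
    (β : ∀ a, Arr (Ctx (noVertex P) (x a))) : Arr (TreeCat (wl (noVertex P) k) c) :=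
  TC (y := fun _ => noVertex P) (fun s => s.2) (fun s => s.2.elim) k t β

theorem TC₀_unitA (k : Colour P) (β : ∀ _ : Unit, Arr (Ctx (noVertex P) k)) :
    TC₀ k (unitA k) β = β () :=
  (TC_unitA (y := fun _ => noVertex P) _ _ β).trans (RN_id k _)

theorem TC₀_RN {Y Z : Type} {z : Z → Colour P} (ρ : Y → Z) (k : Colour P) {c : C}
    (t : Arr (TreeCat (wl (fun j => z (ρ j)) k) c)) (β : ∀ a, Arr (Ctx (noVertex P) (z a))) :
    TC₀ k (RN ρ (fun _ => rfl) k t) β = TC₀ (x := fun j => z (ρ j)) k t fun j => β (ρ j) :=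
  (TC_RN ρ (w := fun _ => noVertex P) _ _ (u := noVertex P) (fun s => s.2) (fun s => s.2.elim)
    (fun j => j) (fun j => j.elim) (fun j l => rfl) k t β).trans (RN_id k _)

/-- Associativity of insertion when the trees inserted last have no white vertices. -/
theorem TC₀_TC {Y : X → Type} (y : ∀ a, Y a → Colour P) (k : Colour P) {c : C}
    (t : Arr (TreeCat (wl x k) c)) (q : ∀ a, Arr (Ctx (y a) (x a)))
    (β : ∀ s : Σ a, Y a, Arr (Ctx (noVertex P) (y s.1 s.2))) :
    TC₀ k (TC (z := fun s : Σ a, Y a => y s.1 s.2) (fun s => s) (fun _ => rfl) k t q) β =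
      TC₀ k t fun a => TC₀ (x a) (q a) fun j => β ⟨a, j⟩ :=
  TC_TC (z := fun s : Σ a, Y a => y s.1 s.2) (w := fun _ => noVertex P) (fun s => s) _ _
    (u := fun _ => noVertex P) (fun a s => s.2) (fun a s => s.2.elim) (fun s => s.2)
    (fun s => s.2.elim) (fun a j l => rfl) k t q β

namespace PscObj

variable {k : Colour P}

/-- The underlying arrow between trees. -/
def treeA (φ : Arr (PscObj x k)) : Arr (Ctx x k) := Arr.map (forget x k) φ

/-- The morphism from the target of a tree to its output operation, as an arrow between trees
without white vertices. -/
def epsA (T : PscObj x k) (hk : k.isLeft) : Arr (TreeCat (wl (noVertex P) k) (tgt k)) :=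
  ⟨_, _, T.eps hk⟩

theorem obj_ext {T T' : PscObj x k} (h : T.tree = T'.tree)
    (h' : ∀ hk, epsA T hk = epsA T' hk) : T = T' := by
  obtain ⟨t, l, a, e⟩ := T
  obtain ⟨t', l', a', e'⟩ := T'
  obtain rfl : t = t' := h
  obtain rfl : e = e' := funext fun hk => eq_of_heq (Arr.heq_of_eq (h' hk))
  rfl

theorem arr_ext {φ ψ : Arr (PscObj x k)} (h : treeA φ = treeA ψ)
    (h' : ∀ hk, epsA φ.dom hk = epsA ψ.dom hk) (h'' : ∀ hk, epsA φ.cod hk = epsA ψ.cod hk) :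
    φ = ψ := by
  obtain ⟨T, T', f⟩ := φ
  obtain ⟨U, U', g⟩ := ψ
  obtain rfl : T = U := obj_ext (congrArg Arr.dom h) h'
  obtain rfl : T' = U' := obj_ext (congrArg Arr.cod h) h''
  obtain rfl : f = g := Subtype.ext (eq_of_heq (Arr.heq_of_eq h))
  rfl

theorem epsA_unit (k : Colour P) (hk : k.isLeft) : epsA (unit k) hk = Arr.id (corolla k hk) :=
  Arr.mk_eqToHom (target_unitTree k hk)

variable [Finite X] {Y : X → Type} [∀ a, Finite (Y a)] {y : ∀ a, Y a → Colour P} {Z : Type}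
  {z : Z → Colour P}

/-- The morphism `ε` of a composite: first the morphisms `ε` of the inserted trees, then that of
the ambient tree. -/
theorem epsA_comp (r : (Σ a, Y a) ≃ Z) (h : ∀ s, z (r s) = y s.1 s.2) (k : Colour P)
    (T : PscObj x k) (q : ∀ a, PscObj (y a) (x a)) (hk : k.isLeft) :
    epsA ((comp r h k).obj (T, q)) hk =
      Arr.comp (TC₀ k (Arr.id T.tree) fun a => epsA (q a) (T.allLeft hk a)) (epsA T hk)
        (Functor.congr_obj (treeComp₀_corolla k (T.allLeft hk) (tgt k)) T.tree) := by
  refine (Arr.mk_eqToHom_comp (A := TreeCat (wl (noVertex P) k) (tgt k)) _ _).trans ?_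
  refine Arr.comp_congr (φ := ⟨_, _, ((treeComp₀ k (tgt k)).obj T.tree).map
    (fun a => (q a).eps (T.allLeft hk a))⟩) (ψ := epsA T hk) (Eq.symm ?_) rfl
    (Functor.congr_obj (treeComp₀_corolla k (T.allLeft hk) (tgt k)) T.tree)
  refine (congrArg (fun z => Arr.app (A := ∀ a, Ctx (noVertex P) (x a)) z
    (.pi fun a => epsA (q a) (T.allLeft hk a))) (Arr.map_id (treeComp₀ k (tgt k)) T.tree)).trans ?_
  exact Arr.app_id _ _

theorem epsA_comp_unit (r : (Σ _ : X, Unit) ≃ Z) (h : ∀ s, z (r s) = x s.1) (k : Colour P)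
    (T : PscObj x k) (hk : k.isLeft) :
    epsA ((comp (y := fun a _ => x a) r h k).obj (T, fun a => unit (x a))) hk = epsA T hk := by
  refine (epsA_comp (y := fun a _ => x a) r h k T _ hk).trans ?_
  refine (Arr.comp_congr ((congrArg (TC₀ k (Arr.id T.tree))
    (funext fun a => epsA_unit (x a) _)).trans (TC_id _ _ k _ _)) rfl _).trans ?_
  exact Arr.id_comp _ _

end PscObj

open PscObj

section

variable {I : Type} [Finite I]

theorem treeA_cmp {J : I → Type} [∀ i, Finite (J i)] (x : I → Colour P)
    (y : ∀ i, J i → Colour P) (k : Colour P) (p : Arr ((Psc P).Op x k))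
    (q : ∀ i, Arr ((Psc P).Op (y i) (x i))) :
    treeA ((Psc P).cmp x y k p q) = TC (z := fun s : Σ i, J i => y s.1 s.2) (fun s => s)
      (fun _ => rfl) k (treeA p) fun i => treeA (q i) := rfl

theorem epsA_cmp {J : I → Type} [∀ i, Finite (J i)] (x : I → Colour P)
    (y : ∀ i, J i → Colour P) (k : Colour P) (T : PscObj x k) (q : ∀ i, PscObj (y i) (x i))
    (hk : k.isLeft) : epsA (((Psc P).comp x y k).obj (T, q)) hk =
      Arr.comp (TC₀ k (Arr.id T.tree) fun a => epsA (q a) (T.allLeft hk a)) (epsA T hk)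
        (Functor.congr_obj (treeComp₀_corolla k (T.allLeft hk) (tgt k)) T.tree) :=
  epsA_comp (Equiv.refl _) (fun _ => rfl) k T q hk

theorem epsA_cmp_one (x : I → Colour P) (k : Colour P) (T : PscObj x k) (hk : k.isLeft) :
    epsA (((Psc P).comp x (fun i (_ : Unit) => x i) k).obj (T, fun i => (Psc P).one (x i))) hk =
      epsA T hk :=
  epsA_comp_unit (Equiv.refl _) (fun _ => rfl) k T hk

theorem treeA_rei {J : Type} [Finite J] (e : I ≃ J) {x : I → Colour P} {y : J → Colour P}
    (h : ∀ i, y (e i) = x i) {k : Colour P} (p : Arr ((Psc P).Op x k)) :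
    treeA ((Psc P).rei e h p) = RN e h k (treeA p) :=
  TC_units ((Equiv.sigmaUnique I fun _ => Unit).trans e) (fun s => h s.1) k (treeA p)

theorem treeA_idA (k : Colour P) : treeA ((Psc P).idA k) = unitA k :=
  Arr.map_id (forget _ k) (unit k)

theorem epsA_rei {J : Type} [Finite J] (e : I ≃ J) {x : I → Colour P} {y : J → Colour P}
    (h : ∀ i, y (e i) = x i) {k : Colour P} (T : PscObj x k) (hk : k.isLeft) :
    epsA (((Psc P).reindex e h).obj T) hk = epsA T hk :=
  epsA_comp_unit _ _ k T hk

end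

section

attribute [local irreducible] PL TC RN treeA OperadData.rei OperadData.cmp

theorem treeA_psc_cmp_rei {I : Type} [Finite I] {J J' : I → Type} [∀ i, Finite (J i)]
    [∀ i, Finite (J' i)] (e : ∀ i, J i ≃ J' i) (x : I → Colour P) {y : ∀ i, J i → Colour P}
    {y' : ∀ i, J' i → Colour P} (h : ∀ i j, y' i (e i j) = y i j) (k : Colour P)
    (p : Arr ((Psc P).Op x k)) (q : ∀ i, Arr ((Psc P).Op (y i) (x i))) :
    treeA ((Psc P).cmp x y' k p (fun i => (Psc P).rei (e i) (h i) (q i))) =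
      treeA ((Psc P).rei (y := fun s : Σ i, J' i => y' s.1 s.2) (Equiv.sigmaCongrRight e)
        (fun s => h s.1 s.2) ((Psc P).cmp x y k p q)) := by
  refine (treeA_cmp x y' k p _).trans ?_
  refine Eq.trans ?_ ((treeA_rei _ _ _).trans (congrArg (RN _ _ k) (treeA_cmp x y k p q))).symm
  refine (congrArg (TC _ _ k _) (funext fun i => treeA_rei (e i) (h i) (q i))).trans ?_
  exact (TC_RN_right _ _ k _ _ _ _).trans (RN_TC (z := fun s : Σ i, J i => y s.1 s.2)
    (fun s => s) (fun _ => rfl) k (Equiv.sigmaCongrRight e) (fun s => h s.1 s.2) (treeA p)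
    fun i => treeA (q i)).symm

theorem treeA_psc_rei_cmp {I I' : Type} [Finite I] [Finite I'] {J : I' → Type} [∀ i, Finite (J i)]
    (e : I ≃ I') (x : I' → Colour P) (y : ∀ i, J i → Colour P) (k : Colour P)
    (p : Arr ((Psc P).Op (fun i => x (e i)) k)) (q : ∀ i, Arr ((Psc P).Op (y i) (x i))) :
    treeA ((Psc P).cmp x y k ((Psc P).rei e (fun _ => rfl) p) q) =
      treeA ((Psc P).rei (y := fun s : Σ i, J i => y s.1 s.2) (Equiv.sigmaCongrLeft e)
          (fun _ => rfl)
        ((Psc P).cmp (fun i => x (e i)) (fun i => y (e i)) k p fun i => q (e i))) := by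
  refine (treeA_cmp x y k _ q).trans ?_
  refine Eq.trans ?_ ((treeA_rei (y := fun s : Σ i, J i => y s.1 s.2) (Equiv.sigmaCongrLeft e)
    (fun _ => rfl) _).trans (congrArg (RN _ _ k)
      (treeA_cmp (fun i => x (e i)) (fun i => y (e i)) k p fun i => q (e i)))).symm
  refine (congrArg (fun t => TC (z := fun s : Σ i, J i => y s.1 s.2) (fun s => s) (fun _ => rfl) k t
    fun i => treeA (q i)) (treeA_rei e (fun _ => rfl) p)).trans ?_
  exact TC_RN (z := x) (w := y) e (fun s => s) (fun _ => rfl) (fun s => s) (fun _ => rfl)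
    (Equiv.sigmaCongrLeft e) (fun _ => rfl) (fun j l => rfl) k _ _

theorem treeA_psc_one_cmp {J : Type} [Finite J] (y : J → Colour P) (k : Colour P)
    (q : Arr ((Psc P).Op y k)) :
    treeA ((Psc P).rei (y := y) (Equiv.uniqueSigma fun _ : Unit => J) (fun _ => rfl)
      ((Psc P).cmp (fun _ : Unit => k) (fun _ => y) k ((Psc P).idA k) fun _ => q)) =
      treeA (q) := by
  refine (treeA_rei _ _ _).trans ?_
  refine (congrArg (RN _ _ k) ((treeA_cmp _ _ k _ _).trans
    ((congrArg (fun t => TC (z := fun s : Σ _ : Unit, J => y s.2) (fun s => s) (fun _ => rfl) k t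
        fun _ => treeA q) (treeA_idA k)).trans
      (TC_unitA (y := fun _ => y) _ _ fun _ => treeA q)))).trans ?_
  exact (RN_RN k _ _ _ _ _).trans (RN_id k _)

theorem treeA_psc_cmp_one {I : Type} [Finite I] (x : I → Colour P) (k : Colour P)
    (p : Arr ((Psc P).Op x k)) :
    treeA ((Psc P).rei (y := x) (Equiv.sigmaUnique I fun _ => Unit) (fun _ => rfl)
      ((Psc P).cmp x (fun i (_ : Unit) => x i) k p fun i => (Psc P).idA (x i))) =
      treeA (p) := by
  refine (treeA_rei _ _ _).trans ?_
  refine (congrArg (RN _ _ k) ((treeA_cmp _ _ k _ _).trans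
    ((congrArg (TC _ _ k _) (funext fun i => treeA_idA (x i))).trans
      (TC_units _ _ k (treeA p))))).trans ?_
  exact (RN_RN k _ _ _ _ _).trans (RN_id k _)

theorem treeA_psc_assoc {I : Type} [Finite I] {J : I → Type} [∀ i, Finite (J i)]
    {L : ∀ i, J i → Type}
    [∀ i j, Finite (L i j)] (x : I → Colour P) (y : ∀ i, J i → Colour P)
    (z : ∀ i j, L i j → Colour P) (k : Colour P)
    (p : Arr ((Psc P).Op x k)) (q : ∀ i, Arr ((Psc P).Op (y i) (x i)))
    (r : ∀ i j, Arr ((Psc P).Op (z i j) (y i j))) :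
    treeA ((Psc P).rei (y := fun s : Σ i, Σ j, L i j => z s.1 s.2.1 s.2.2) (Equiv.sigmaAssoc L)
      (fun _ => rfl) ((Psc P).cmp (fun s : Σ i, J i => y s.1 s.2) (fun s => z s.1 s.2) k
        ((Psc P).cmp x y k p q) fun s => r s.1 s.2)) =
      treeA ((Psc P).cmp x (fun i (t : Σ j, L i j) => z i t.1 t.2) k p
      fun i => (Psc P).cmp (y i) (z i) (x i) (q i) (r i)) := by
  refine (treeA_rei _ _ _).trans ?_
  refine (congrArg (RN _ _ k) ((treeA_cmp _ _ k _ _).trans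
    (congrArg (fun t => TC (z := fun s : Σ s : Σ i, J i, L s.1 s.2 => z s.1.1 s.1.2 s.2)
      (fun s => s) (fun _ => rfl) k t fun s => treeA (r s.1 s.2)) (treeA_cmp _ _ k p q)))).trans ?_
  refine Eq.trans ?_ ((treeA_cmp _ _ k _ _).trans
    (congrArg (TC _ _ k _) (funext fun i => treeA_cmp _ _ _ (q i) (r i)))).symm
  refine (RN_TC _ _ k _ _ _ _).trans ?_
  exact TC_TC (z := fun s : Σ i, J i => y s.1 s.2) (w := fun s => z s.1 s.2) (fun s => s) _ _
    (u := fun i (t : Σ j, L i j) => z i t.1 t.2) (fun i s => s) (fun i s => rfl)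
    (fun s => s) (fun s => rfl) (fun a j l => rfl) k _ _ fun s => treeA (r s.1 s.2)

end

/-- Insertion in a fixed tree is functorial in the inserted trees. -/
theorem TC₀_comp (k : Colour P) {c : C} (t : TreeCat (wl x k) c)
    (φ ψ : ∀ a, Arr (Ctx (noVertex P) (x a))) (h : ∀ a, (φ a).cod = (ψ a).dom) :
    ∃ w, TC₀ k (Arr.id t) (fun a => (φ a).comp (ψ a) (h a)) =
      (TC₀ k (Arr.id t) φ).comp (TC₀ k (Arr.id t) ψ) w := by
  have hm : IsMap fun β : Arr (∀ a, Ctx (noVertex P) (x a)) => TC₀ k (Arr.id t) β.proj :=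
    isMap_TC _ _ _ (.constId _) fun a => IsMap.self.proj a
  obtain ⟨w, e⟩ := hm.map_comp (.pi φ) (.pi ψ) (funext h)
  exact ⟨w, (congrArg (fun β : Arr (∀ a, Ctx (noVertex P) (x a)) => TC₀ k (Arr.id t) β.proj)
    (Arr.pi_comp φ ψ h)).trans e⟩

theorem psc_cmp_rei {I : Type} [Finite I] {J J' : I → Type} [∀ i, Finite (J i)]
    [∀ i, Finite (J' i)] (e : ∀ i, J i ≃ J' i) (x : I → Colour P) {y : ∀ i, J i → Colour P}
    {y' : ∀ i, J' i → Colour P} (h : ∀ i j, y' i (e i j) = y i j) (k : Colour P)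
    (p : Arr ((Psc P).Op x k)) (q : ∀ i, Arr ((Psc P).Op (y i) (x i))) :
    (Psc P).cmp x y' k p (fun i => (Psc P).rei (e i) (h i) (q i)) =
      (Psc P).rei (y := fun s : Σ i, J' i => y' s.1 s.2) (Equiv.sigmaCongrRight e)
        (fun s => h s.1 s.2) ((Psc P).cmp x y k p q) := by
  have hE : ∀ (T : PscObj x k) (q : ∀ i, PscObj (y i) (x i)) (hk : k.isLeft),
      epsA (((Psc P).comp x y' k).obj (T, fun i => ((Psc P).reindex (e i) (h i)).obj (q i))) hk =
        epsA (((Psc P).reindex (y := fun s : Σ i, J' i => y' s.1 s.2)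
          (Equiv.sigmaCongrRight e) (fun s => h s.1 s.2)).obj (((Psc P).comp x y k).obj (T, q)))
              hk := by
    intro T q hk
    refine (epsA_cmp x y' k T _ hk).trans (Eq.trans ?_ ((epsA_rei _ _ _ hk).trans
      (epsA_cmp x y k T q hk)).symm)
    exact Arr.comp_congr (congrArg (TC₀ k _) (funext fun i => epsA_rei (e i) (h i) (q i) _)) rfl _
  exact PscObj.arr_ext (treeA_psc_cmp_rei e x h k p q) (hE p.dom fun i => (q i).dom)
      (hE p.cod fun i => (q i).cod)

theorem psc_rei_cmp {I I' : Type} [Finite I] [Finite I'] {J : I' → Type} [∀ i, Finite (J i)]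
    (e : I ≃ I') (x : I' → Colour P) (y : ∀ i, J i → Colour P) (k : Colour P)
    (p : Arr ((Psc P).Op (fun i => x (e i)) k)) (q : ∀ i, Arr ((Psc P).Op (y i) (x i))) :
    (Psc P).cmp x y k ((Psc P).rei e (fun _ => rfl) p) q =
      (Psc P).rei (y := fun s : Σ i, J i => y s.1 s.2) (Equiv.sigmaCongrLeft e) (fun _ => rfl)
        ((Psc P).cmp (fun i => x (e i)) (fun i => y (e i)) k p fun i => q (e i)) := by
  have hE : ∀ (T : PscObj (fun i => x (e i)) k) (q : ∀ i, PscObj (y i) (x i)) (hk : k.isLeft),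
      epsA (((Psc P).comp x y k).obj (((Psc P).reindex e (fun _ => rfl)).obj T, q)) hk =
        epsA (((Psc P).reindex (y := fun s : Σ i, J i => y s.1 s.2)
          (Equiv.sigmaCongrLeft e) (fun _ => rfl)).obj
            (((Psc P).comp (fun i => x (e i)) (fun i => y (e i)) k).obj (T, fun i => q (e i))))
                hk := by
    intro T q hk
    refine (epsA_cmp x y k _ q hk).trans (Eq.trans ?_ ((epsA_rei _ _ _ hk).trans
      (epsA_cmp (fun i => x (e i)) (fun i => y (e i)) k T _ hk)).symm)
    refine Arr.comp_congr ?_ (epsA_rei e (fun _ => rfl) T hk) _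
    refine (congrArg (fun t => TC₀ k t _) (?_ : _ = RN e (fun _ => rfl) k (Arr.id T.tree))).trans
      (TC₀_RN e k _ _)
    refine Eq.trans ?_ (treeA_rei e (fun _ => rfl) (Arr.id T))
    exact (congrArg treeA (Arr.map_id ((Psc P).reindex e _) T)).symm
  exact PscObj.arr_ext (treeA_psc_rei_cmp e x y k p q) (hE p.dom fun i => (q i).dom)
      (hE p.cod fun i => (q i).cod)

theorem psc_one_cmp {J : Type} [Finite J] (y : J → Colour P) (k : Colour P)
    (q : Arr ((Psc P).Op y k)) :
    (Psc P).rei (y := y) (Equiv.uniqueSigma fun _ : Unit => J) (fun _ => rfl)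
      ((Psc P).cmp (fun _ : Unit => k) (fun _ => y) k ((Psc P).idA k) fun _ => q) = q := by
  have hE : ∀ (T : PscObj y k) (hk : k.isLeft),
      epsA (((Psc P).reindex (y := y) (Equiv.uniqueSigma fun _ : Unit => J) (fun _ => rfl)).obj
        (((Psc P).comp (fun _ : Unit => k) (fun _ => y) k).obj ((Psc P).one k, fun _ => T))) hk =
        epsA T hk := by
    intro T hk
    refine (epsA_rei _ _ _ hk).trans ((epsA_cmp (fun _ : Unit => k) (fun _ => y) k (unit k)
        (fun _ => T) hk).trans ?_)
    refine (Arr.comp_congr (TC₀_unitA k _) (epsA_unit k hk) _).trans ?_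
    exact Arr.comp_id _ _
  exact PscObj.arr_ext (treeA_psc_one_cmp y k q) (hE q.dom) (hE q.cod)

theorem psc_cmp_one {I : Type} [Finite I] (x : I → Colour P) (k : Colour P)
    (p : Arr ((Psc P).Op x k)) :
    (Psc P).rei (y := x) (Equiv.sigmaUnique I fun _ => Unit) (fun _ => rfl)
      ((Psc P).cmp x (fun i (_ : Unit) => x i) k p fun i => (Psc P).idA (x i)) = p := by
  have hE : ∀ (T : PscObj x k) (hk : k.isLeft),
      epsA (((Psc P).reindex (y := x) (Equiv.sigmaUnique I fun _ => Unit) (fun _ => rfl)).obj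
        (((Psc P).comp x (fun i (_ : Unit) => x i) k).obj (T, fun i => (Psc P).one (x i)))) hk =
        epsA T hk :=
    fun T hk => (epsA_rei _ _ _ hk).trans (epsA_cmp_one x k T hk)
  exact PscObj.arr_ext (treeA_psc_cmp_one x k p) (hE p.dom) (hE p.cod)

theorem psc_assoc {I : Type} [Finite I] {J : I → Type} [∀ i, Finite (J i)] {L : ∀ i, J i → Type}
    [∀ i j, Finite (L i j)] (x : I → Colour P) (y : ∀ i, J i → Colour P)
    (z : ∀ i j, L i j → Colour P) (k : Colour P)
    (p : Arr ((Psc P).Op x k)) (q : ∀ i, Arr ((Psc P).Op (y i) (x i)))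
    (r : ∀ i j, Arr ((Psc P).Op (z i j) (y i j))) :
    (Psc P).rei (y := fun s : Σ i, Σ j, L i j => z s.1 s.2.1 s.2.2) (Equiv.sigmaAssoc L)
      (fun _ => rfl) ((Psc P).cmp (fun s : Σ i, J i => y s.1 s.2) (fun s => z s.1 s.2) k
        ((Psc P).cmp x y k p q) fun s => r s.1 s.2) =
    (Psc P).cmp x (fun i (t : Σ j, L i j) => z i t.1 t.2) k p
      fun i => (Psc P).cmp (y i) (z i) (x i) (q i) (r i) := by
  have hE : ∀ (T : PscObj x k) (q : ∀ i, PscObj (y i) (x i)) (r : ∀ i j, PscObj (z i j) (y i j))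
      (hk : k.isLeft),
      epsA (((Psc P).reindex (y := fun s : Σ i, Σ j, L i j => z s.1 s.2.1 s.2.2)
        (Equiv.sigmaAssoc L) (fun _ => rfl)).obj
        (((Psc P).comp (fun s : Σ i, J i => y s.1 s.2) (fun s => z s.1 s.2) k).obj
          (((Psc P).comp x y k).obj (T, q), fun s => r s.1 s.2))) hk =
      epsA (((Psc P).comp x (fun i (t : Σ j, L i j) => z i t.1 t.2) k).obj
        (T, fun i => ((Psc P).comp (y i) (z i) (x i)).obj (q i, r i))) hk := by
    intro T q r hk
    refine (epsA_rei _ _ _ hk).trans ((epsA_cmp (fun s : Σ i, J i => y s.1 s.2)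
      (fun s => z s.1 s.2) k _ _ hk).trans ?_)
    refine Eq.trans ?_ (epsA_cmp x (fun i (t : Σ j, L i j) => z i t.1 t.2) k T _ hk).symm
    have ht : Arr.id (((Psc P).comp x y k).obj (T, q)).tree =
        TC (z := fun s : Σ i, J i => y s.1 s.2) (fun s => s) (fun _ => rfl) k (Arr.id T.tree)
          fun i => Arr.id (q i).tree :=
      (TC_id _ _ k _ _).symm
    have ha := funext fun i => epsA_cmp (y i) (z i) (x i) (q i) (r i)
      (T.allLeft hk i)
    obtain ⟨w, hw⟩ := TC₀_comp k T.tree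
      (fun i => TC₀ (x i) (Arr.id (q i).tree) fun j => epsA (r i j)
          ((q i).allLeft (T.allLeft hk i) j))
      (fun i => epsA (q i) (T.allLeft hk i))
      (fun i => Functor.congr_obj (treeComp₀_corolla (x i) ((q i).allLeft (T.allLeft hk i))
        (tgt (x i))) (q i).tree)
    refine (Arr.comp_congr ((congrArg (fun t => TC₀ k t _) ht).trans (TC₀_TC y k _ _ _))
      (epsA_cmp x y k T q hk) _).trans ?_
    refine Eq.trans ?_ (Arr.comp_congr ((congrArg (TC₀ k _) ha).trans hw) rfl _).symm
    exact (Arr.comp_assoc _ _ _ _ _).symm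
  exact PscObj.arr_ext (treeA_psc_assoc x y z k p q r)
      (hE p.dom (fun i => (q i).dom) fun i j => (r i j).dom)
    (hE p.cod (fun i => (q i).cod) fun i j => (r i j).cod)

variable (P) in
/-- The Swiss cheese plus construction is an operad. -/
theorem psc_arrLaws : (Psc P).ArrLaws where
  rei_refl x k p := PscObj.arr_ext ((treeA_rei _ _ p).trans (RN_id k _))
      (epsA_rei (Equiv.refl _) (fun _ => rfl) p.dom)
    (epsA_rei (Equiv.refl _) (fun _ => rfl) p.cod)
  rei_rei e e' _ _ _ h h' k p := PscObj.arr_ext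
    ((treeA_rei e' h' _).trans ((congrArg (RN e' h' k) (treeA_rei e h p)).trans
      ((RN_RN k e h e' h' _).trans (treeA_rei (e.trans e') _ p).symm)))
    (fun hk => (epsA_rei e' h' _ hk).trans ((epsA_rei e h p.dom hk).trans
      (epsA_rei (e.trans e') (fun i => (h' (e i)).trans (h i)) p.dom hk).symm))
    (fun hk => (epsA_rei e' h' _ hk).trans ((epsA_rei e h p.cod hk).trans
      (epsA_rei (e.trans e') (fun i => (h' (e i)).trans (h i)) p.cod hk).symm))
  cmp_rei := psc_cmp_rei
  rei_cmp := psc_rei_cmp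
  one_cmp := psc_one_cmp
  cmp_one := psc_cmp_one
  assoc := psc_assoc

end Trees

open SwissCheese.TreeCat SwissCheese.PscObj

/-! ### The action of trees on the endomorphism object and the algebra -/

theorem Arr.app_app_curry {A B D : Type*} [Category* A] [Category* B] [Category* D]
    (φ : Arr (A × B ⥤ D)) (ξ : Arr A) (η : Arr B) :
    ((map Functor.curry φ).app ξ).app η = φ.app (pair ξ η) := by
  refine mk_eq rfl rfl (_root_.heq_of_eq ?_)
  have e := φ.cod.map_comp (X := (ξ.dom, η.dom)) (Y := (ξ.cod, η.dom))
    (Z := (ξ.cod, η.cod)) (ξ.hom, 𝟙 _) (𝟙 _, η.hom)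
  refine (Category.assoc _ _ _).trans (congrArg (φ.hom.app _ ≫ ·) (e.symm.trans ?_))
  exact congrArg (φ.cod.map (X := (ξ.dom, η.dom)) (Y := (ξ.cod, η.cod)))
    (Prod.ext (Category.comp_id _) (Category.id_comp _))

section Pair

variable {C : Type u} {P : OperadData C} {A : C → Cat.{u, u}}

/-- Evaluation of an object of the pair at a family of inputs, on arrows. -/
def EP (A : C → Cat.{u, u}) (k : Colour P) (φ : Arr (pair A k)) (v : ∀ i, Arr (A (src k i))) :
    Arr (A (tgt k)) :=
  Arr.app (A := ∀ i, A (src k i)) (Arr.map (evalPair A k) φ) (.pi v)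

theorem evalPair_comp_ofFunctor (A : C → Cat.{u, u}) (k : Colour P) :
    evalPair A k ⋙ ofFunctor A k = 𝟭 _ := by
  cases k <;> rfl

theorem pi_fin_zero {M : Fin 0 → Type u} [∀ i, Category.{u} (M i)] (v : ∀ i, Arr (M i)) :
    Arr.pi v = Arr.id fun i : Fin 0 => i.elim0 :=
  Arr.mk_eq (funext fun j : Fin 0 => j.elim0) (funext fun j : Fin 0 => j.elim0)
    (pi_heq (fun j : Fin 0 => j.elim0) (fun j : Fin 0 => j.elim0) fun j : Fin 0 => j.elim0)

theorem map_evalPair_ofFunctor (k : Colour P)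
    (φ : Arr ((∀ i, A (src k i)) ⥤ A (tgt k))) (v : ∀ i, Arr (A (src k i))) :
    EP A k (Arr.map (ofFunctor A k) φ) v = φ.app (.pi v) := by
  cases k with
  | inl b => rfl
  | inr c =>
    refine Eq.trans ?_ (congrArg φ.app (pi_fin_zero v)).symm
    exact (Arr.mk_eq rfl rfl (heq_of_eq (Category.comp_id _))).trans
      (Arr.app_map_id φ _).symm

/-- Functors with values in the pair are determined by the values of their values. -/
theorem pair_ext {S T : Type*} [Category* S] [Category* T] {k : Colour P}
    {F G : S ⥤ T ⥤ pair A k}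
    (h : ∀ σ τ v, EP A k ((Arr.map F σ).app τ) v = EP A k ((Arr.map G σ).app τ) v) : F = G := by
  refine Arr.uncurry_injective ?_
  have e : Functor.uncurry.obj F ⋙ evalPair A k = Functor.uncurry.obj G ⋙ evalPair A k :=
    Arr.functor_ext₂ fun σ v => h σ.fst σ.snd v.proj
  have := congrArg (· ⋙ ofFunctor A k) e
  simpa only [Functor.assoc, evalPair_comp_ofFunctor, Functor.comp_id] using this

theorem pair_ext₁ {S : Type*} [Category* S] {k : Colour P} {F G : S ⥤ pair A k}
    (h : ∀ σ v, EP A k (Arr.map F σ) v = EP A k (Arr.map G σ) v) : F = G := by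
  have e : F ⋙ evalPair A k = G ⋙ evalPair A k := Arr.functor_ext₂ fun σ v => h σ v.proj
  have := congrArg (· ⋙ ofFunctor A k) e
  simpa only [Functor.assoc, evalPair_comp_ofFunctor, Functor.comp_id] using this

variable (α : OperadAlgebra P A) {X : Type} {x : X → Colour P}

/-- Evaluation of a tree, given values at its white vertices and its leaves, on arrows. -/
def EV (k : Colour P) {c : C} (t : Arr (TreeCat (wl x k) c)) (m : ∀ a, Arr (pair A (x a)))
    (v : ∀ i, Arr (A (src k i))) : Arr (A c) :=
  Arr.app (A := (∀ a, pair A (x a)) × (∀ i, A (src k i)))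
    (Arr.map (fold (x := wl x k)
      (α.finAlgebra.pow (Cat.of ((∀ a, pair A (x a)) × (∀ i, A (src k i)))))
      (pairWhite A x k) c) t) (.pair (.pi m) (.pi v))

section

variable (k : Colour P) (m : ∀ a, Arr (pair A (x a))) (v : ∀ i, Arr (A (src k i)))

theorem EV_white_inl (a : X) (ts : ∀ i, Arr (TreeCat (wl x k) (src (x a) i))) :
    EV α k (whiteA (x := wl x k) (Sum.inl a) ts) m v =
      EP A (x a) (m a) fun i => EV α k (ts i) m v := by
  refine (congrArg (fun z => Arr.app (A := (∀ a, pair A (x a)) × (∀ i, A (src k i)))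
    (B := A (tgt (x a))) z (.pair (.pi m) (.pi v)))
    ((fold_isFold (x := wl x k) (α.finAlgebra.pow (Cat.of ((∀ a, pair A (x a)) ×
      (∀ i, A (src k i))))) (pairWhite A x k)).map_white (Sum.inl a) ts)).trans ?_
  exact Arr.app_powOp ((CategoryTheory.Prod.fst (∀ a, pair A (x a)) (∀ i, A (src k i)) ⋙
    Pi.eval (fun a => pair A (x a)) a).prod (𝟭 (∀ i, A (src (x a) i))) ⋙
      Functor.uncurry.obj (evalPair A (x a))) _ _

theorem EV_white_inr (i : Fin (ar k)) (ts) :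
    EV α k (whiteA (x := wl x k) (Sum.inr i) ts) m v = v i :=
  (congrArg (fun z => Arr.app (A := (∀ a, pair A (x a)) × (∀ i, A (src k i)))
    (B := A (src k i)) z (.pair (.pi m) (.pi v)))
    ((fold_isFold (x := wl x k) (α.finAlgebra.pow (Cat.of ((∀ a, pair A (x a)) ×
      (∀ i, A (src k i))))) (pairWhite A x k)).map_white (Sum.inr i) ts)).trans
    (Arr.app_id (CategoryTheory.Prod.snd (∀ a, pair A (x a)) (∀ i, A (src k i)) ⋙
      Pi.eval (fun i => A (src k i)) i) _)

theorem EV_black {n : ℕ} {s : Fin n → C} {c : C} (p : Arr (P.Op s c))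
    (ts : ∀ i, Arr (TreeCat (wl x k) (s i))) :
    EV α k (blackA p ts) m v =
      (Arr.map (α.map s c) p).app (.pi fun i => EV α k (ts i) m v) :=
  (congrArg (fun z => Arr.app (A := (∀ a, pair A (x a)) × (∀ i, A (src k i)))
    (B := A c) z (.pair (.pi m) (.pi v)))
    ((fold_isFold (x := wl x k) (α.finAlgebra.pow (Cat.of ((∀ a, pair A (x a)) ×
      (∀ i, A (src k i))))) (pairWhite A x k)).map_black p ts)).trans
    (FinAlgebra.app_pow_act (Cat.of ((∀ a, pair A (x a)) × (∀ i, A (src k i)))) α.finAlgebra p _ _)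

theorem EV_leafA (i : Fin (ar k)) : EV α k (leafA x k i) m v = v i :=
  (congrArg (fun t => EV α k t m v) (whiteA_inr k i fun j : Fin 0 => j.elim0).symm).trans
    (EV_white_inr α k m v i _)

theorem EV_whiteAt {k' : Colour P} (a : X) (h : x a = k')
    (ts : ∀ i, Arr (TreeCat (wl x k) (src k' i))) :
    EV α k (whiteAtA (x := wl x k) (Sum.inl a) h ts) m v =
      EP A k' (Arr.map (transport (pair A) h) (m a)) fun i => EV α k (ts i) m v := by
  subst h
  exact EV_white_inl α k m v a ts

end

theorem isMap_EV {S : Type*} [Category* S] (k : Colour P) {c : C}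
    {t : Arr S → Arr (TreeCat (wl x k) c)} {m : ∀ a, Arr S → Arr (pair A (x a))}
    {v : ∀ i, Arr S → Arr (A (src k i))} (ht : IsMap t) (hm : ∀ a, IsMap (m a))
    (hv : ∀ i, IsMap (v i)) : IsMap fun φ => EV α k (t φ) (fun a => m a φ) fun i => v i φ :=
  (ht.map (fold (x := wl x k) (α.finAlgebra.pow (Cat.of ((∀ a, pair A (x a)) ×
    (∀ i, A (src k i))))) (pairWhite A x k) c)).app ((IsMap.pi hm).pair (.pi hv))

/-- Evaluation turns substitution for leaves into substitution of values. -/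
theorem EV_PL {Y Z : Type} {y : Y → Colour P} {z : Z → Colour P} (k k' : Colour P) (r : Y → Z)
    (h : ∀ j, z (r j) = y j) {c : C} (q : Arr (TreeCat (wl y k) c))
    (us : ∀ i, Arr (TreeCat (wl z k') (src k i))) (m : ∀ j, Arr (pair A (z j)))
    (v : ∀ i, Arr (A (src k' i))) :
    EV α k' (PL (w := wl z k') k (fun j => Sum.inl (r j)) h q us) m v =
      EV α k q (fun j => Arr.map (transport (pair A) (h j)) (m (r j)))
        fun i => EV α k' (us i) m v := by
  refine arr_ext (S := (∀ i, TreeCat (wl z k') (src k i)) × (∀ j, pair A (z j)) ×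
      ∀ i, A (src k' i)) (M := fun c => A c)
    (m := fun q σ => EV α k' (PL (w := wl z k') k (fun j => Sum.inl (r j)) h q σ.fst.proj)
      σ.snd.fst.proj σ.snd.snd.proj)
    (n := fun q σ => EV α k q
      (fun j => Arr.map (transport (pair A) (h j)) (σ.snd.fst.proj (r j)))
      fun i => EV α k' (σ.fst.proj i) σ.snd.fst.proj σ.snd.snd.proj)
    (fun c => isMap_EV α _ (isMap_PL _ _ _ IsMap.self.fst fun i => IsMap.self.snd.fst.proj i)
      (fun i => IsMap.self.snd.snd.fst.proj i) fun i => IsMap.self.snd.snd.snd.proj i)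
    (fun c => isMap_EV α _ IsMap.self.fst (fun j => (IsMap.self.snd.snd.fst.proj (r j)).map _)
      fun i => isMap_EV α _ (IsMap.self.snd.fst.proj i)
      (fun i => IsMap.self.snd.snd.fst.proj i) fun i => IsMap.self.snd.snd.snd.proj i)
    ?_ ?_ q (.pair (.pi us) (.pair (.pi m) (.pi v)))
  · rintro (j | i) ts σ ih
    · refine (congrArg (fun t => EV α k' t σ.snd.fst.proj σ.snd.snd.proj)
        (PL_white_inl _ _ _ j ts _)).trans ?_
      refine (EV_whiteAt α k' _ _ (r j) (h j) _).trans ?_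
      refine Eq.trans ?_ (EV_white_inl α k _ _ j ts).symm
      exact congrArg (EP A _ _) (funext ih)
    · exact (congrArg (fun t => EV α k' t σ.snd.fst.proj σ.snd.snd.proj)
        (PL_white_inr _ _ _ i ts _)).trans (EV_white_inr α k _
          (fun i => EV α k' (σ.fst.proj i) σ.snd.fst.proj σ.snd.snd.proj) i ts).symm
  · intro n s c p ts σ ih
    refine (congrArg (fun t => EV α k' t σ.snd.fst.proj σ.snd.snd.proj)
      (PL_black _ _ _ p ts _)).trans ?_
    refine (EV_black α k' _ _ p _).trans (Eq.trans ?_ (EV_black α k _ _ p ts).symm)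
    exact congrArg (fun z => Arr.app (A := ∀ i, A (s i)) (Arr.map (α.map s c) p) (.pi z))
      (funext ih)

theorem EV_RN {Y Z : Type} {y : Y → Colour P} {z : Z → Colour P} (ρ : Y → Z)
    (h : ∀ j, z (ρ j) = y j) (k : Colour P) {c : C} (t : Arr (TreeCat (wl y k) c))
    (m : ∀ j, Arr (pair A (z j))) (v : ∀ i, Arr (A (src k i))) :
    EV α k (RN ρ h k t) m v =
      EV α k t (fun j => Arr.map (transport (pair A) (h j)) (m (ρ j))) v :=
  (EV_PL α k k ρ h t _ m v).trans (congrArg (EV α k t _) (funext fun i => EV_leafA α k m v i))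

theorem EV_unitA (k : Colour P) (m : Unit → Arr (pair A k)) (v : ∀ i, Arr (A (src k i))) :
    EV α (x := fun _ : Unit => k) k (unitA k) m v = EP A k (m ()) v :=
  (congrArg (fun t => EV α (x := fun _ : Unit => k) k t m v) (unitA_eq k)).trans
    ((EV_white_inl α (x := fun _ : Unit => k) k m v () _).trans
      (congrArg (EP A k (m ())) (funext fun i => EV_leafA α (x := fun _ : Unit => k) k m v i)))

variable (x) in
/-- The action of trees on the pair. -/
def treeMap (k : Colour P) : Ctx x k ⥤ (∀ a, pair A (x a)) ⥤ pair A k :=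
  fold (x := wl x k) (α.finAlgebra.pow (Cat.of ((∀ a, pair A (x a)) × (∀ i, A (src k i)))))
    (pairWhite A x k) (tgt k) ⋙ Functor.curry ⋙
      (Functor.whiskeringRight _ _ _).obj (ofFunctor A k)

/-- The action of trees on the pair, on arrows. -/
def PM (k : Colour P) (t : Arr (Ctx x k)) (m : ∀ a, Arr (pair A (x a))) : Arr (pair A k) :=
  Arr.app (A := ∀ a, pair A (x a)) (Arr.map (treeMap α x k) t) (.pi m)

/-- The value of the action of a tree at a family of inputs is the evaluation of the tree. -/
theorem EP_PM (k : Colour P) (t : Arr (Ctx x k)) (m : ∀ a, Arr (pair A (x a)))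
    (v : ∀ i, Arr (A (src k i))) : EP A k (PM α k t m) v = EV α k t m v := by
  refine (congrArg (fun z => EP A k z v) (Arr.app_whiskeringRight (A := ∀ a, pair A (x a))
    (B := (∀ i, A (src k i)) ⥤ A (tgt k)) (D := pair A k) (ofFunctor A k)
    (Arr.map Functor.curry (Arr.map (fold (x := wl x k) (α.finAlgebra.pow
      (Cat.of ((∀ a, pair A (x a)) × (∀ i, A (src k i))))) (pairWhite A x k) (tgt k)) t))
    (.pi m))).trans ?_
  refine (map_evalPair_ofFunctor k _ v).trans ?_
  exact Arr.app_app_curry (A := ∀ a, pair A (x a)) (B := ∀ i, A (src k i)) _ _ _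

theorem isMap_PM {S : Type*} [Category* S] (k : Colour P)
    {t : Arr S → Arr (Ctx x k)} {m : ∀ a, Arr S → Arr (pair A (x a))}
    (ht : IsMap t) (hm : ∀ a, IsMap (m a)) : IsMap fun φ => PM α k (t φ) (fun a => m a φ) :=
  (ht.map (treeMap α x k)).app (IsMap.pi hm)

/-- Evaluation turns insertion of trees into composition: the inserted trees act first, and their
values decorate the vertices of the ambient tree. -/
theorem EV_TC {Y : X → Type} {y : ∀ a, Y a → Colour P} (k : Colour P) {c : C}
    (t : Arr (TreeCat (wl x k) c)) (q : ∀ a, Arr (Ctx (y a) (x a)))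
    (m : ∀ s : Σ a, Y a, Arr (pair A (y s.1 s.2))) (v : ∀ i, Arr (A (src k i))) :
    EV α k (TC (z := fun s : Σ a, Y a => y s.1 s.2) (fun s => s) (fun _ => rfl) k t q) m v =
      EV α k t (fun a => PM α (x a) (q a) fun j => m ⟨a, j⟩) v := by
  refine arr_ext (S := (∀ a, Ctx (y a) (x a)) × (∀ s : Σ a, Y a, pair A (y s.1 s.2)) ×
      ∀ i, A (src k i)) (M := fun c => A c)
    (m := fun t σ => EV α k (TC (z := fun s : Σ a, Y a => y s.1 s.2) (fun s => s) (fun _ => rfl) k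
      t σ.fst.proj) σ.snd.fst.proj σ.snd.snd.proj)
    (n := fun t σ => EV α k t
      (fun a => PM α (x a) (σ.fst.proj a) fun j => σ.snd.fst.proj ⟨a, j⟩) σ.snd.snd.proj)
    (fun c => isMap_EV α _ (isMap_TC _ _ _ IsMap.self.fst fun i => IsMap.self.snd.fst.proj i)
      (fun i => IsMap.self.snd.snd.fst.proj i) fun i => IsMap.self.snd.snd.snd.proj i)
    (fun c => isMap_EV α _ IsMap.self.fst (fun a => isMap_PM α (x a) (IsMap.self.snd.fst.proj a)
      fun j => IsMap.self.snd.snd.fst.proj (I := Σ a, Y a) ⟨a, j⟩) fun i =>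
          IsMap.self.snd.snd.snd.proj i)
    ?_ ?_ t (.pair (.pi q) (.pair (.pi m) (.pi v)))
  · rintro (a | i) ts σ ih
    · refine (congrArg (fun t => EV α k t σ.snd.fst.proj σ.snd.snd.proj)
        (TC_white_inl _ _ k a ts _)).trans ?_
      refine (EV_PL α (y := y a) (z := fun s : Σ a, Y a => y s.1 s.2) (x a) k (fun j => ⟨a, j⟩)
        (fun _ => rfl) (σ.fst.proj a) _ σ.snd.fst.proj σ.snd.snd.proj).trans ?_
      refine Eq.trans ?_ ((EV_white_inl α k (fun a => PM α (x a) (σ.fst.proj a)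
        fun j => σ.snd.fst.proj (I := Σ a, Y a) ⟨a, j⟩) σ.snd.snd.proj a ts).trans
          (EP_PM α (x a) (σ.fst.proj a) (fun j => σ.snd.fst.proj (I := Σ a, Y a) ⟨a, j⟩) _)).symm
      exact congrArg (EV α (x a) (σ.fst.proj a)
        fun j => σ.snd.fst.proj (I := Σ a, Y a) ⟨a, j⟩) (funext ih)
    · refine (congrArg (fun t => EV α k t σ.snd.fst.proj σ.snd.snd.proj)
        (TC_white_inr _ _ k i ts _)).trans ?_
      refine (EV_leafA α k σ.snd.fst.proj σ.snd.snd.proj i).trans ?_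
      exact (EV_white_inr α k (fun a => PM α (x a) (σ.fst.proj a)
        fun j => σ.snd.fst.proj (I := Σ a, Y a) ⟨a, j⟩) σ.snd.snd.proj i ts).symm
  · intro n s c p ts σ ih
    refine (congrArg (fun t => EV α k t σ.snd.fst.proj σ.snd.snd.proj)
      (TC_black _ _ k p ts _)).trans ?_
    refine (EV_black α k _ _ p _).trans (Eq.trans ?_ (EV_black α k _ _ p ts).symm)
    exact congrArg (fun z => Arr.app (A := ∀ i, A (s i)) (Arr.map (α.map s c) p) (.pi z))
      (funext ih)

/-- The pair `(End A, A)` is an algebra over the Swiss cheese plus construction. -/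
def pairAlgebra : OperadAlgebra (Psc P) (pair A) where
  map x k := pairMap α x k
  map_one k := by
    refine pair_ext₁ fun σ v => ?_
    refine Eq.trans ?_ (EV_unitA α k σ.proj v)
    refine Eq.trans ?_ (EP_PM α (x := fun _ : Unit => k) k (unitA k) σ.proj v)
    refine congrArg (fun z => EP A k z v) ?_
    refine (Arr.app_id ((pairMap α (fun _ : Unit => k) k).obj (PscObj.unit k)) σ).symm.trans ?_
    refine congrArg (fun z => Arr.app (A := ∀ _ : Unit, pair A k) z σ) ?_
    exact (Arr.map_id (pairMap α (fun _ : Unit => k) k) (PscObj.unit k)).symm.trans rfl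
  map_reindex {I J} _ _ e {x y} h k := by
    refine pair_ext fun p m v => ?_
    refine (EP_PM α k (treeA ((Psc P).rei e h p)) m.proj v).trans ?_
    refine (congrArg (fun t => EV α k t m.proj v) (treeA_rei e h p)).trans ?_
    refine (EV_RN α e h k _ _ _).trans ?_
    exact (EP_PM α k (treeA p) _ v).symm
  map_comp {I} _ {J} _ x y k := by
    refine pair_ext fun p m v => ?_
    refine (EP_PM α k (treeA ((Psc P).cmp x y k p.fst p.snd.proj)) m.proj v).trans ?_
    refine (EV_TC α k (treeA p.fst) (fun i => treeA (p.snd.proj i)) m.proj v).trans ?_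
    refine (EP_PM α k (treeA p.fst) _ v).symm.trans ?_
    refine congrArg (fun z => EP A k z v) ?_
    exact (Arr.app_endComp (fun i => pair A (x i)) (fun i j => pair A (y i j)) (pair A k) _ _
      _).symm

end Pair

/-! ### Composition with unary operations -/

namespace OperadData

variable {K : Type u} (Q : OperadData K)

/-- Composition with a unary operation at the output, on arrows. -/
def post {J : Type} [Finite J] {y : J → K} {k k' : K} (u : Arr (Q.Op (fun _ : Unit => k) k'))
    (p : Arr (Q.Op y k)) : Arr (Q.Op y k') :=
  Q.rei (y := y) (Equiv.uniqueSigma fun _ : Unit => J) (fun _ => rfl)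
    (Q.cmp (fun _ : Unit => k) (fun _ => y) k' u fun _ => p)

/-- Composition with unary operations at the inputs, on arrows. -/
def pre {I : Type} [Finite I] {x x' : I → K} {k : K} (p : Arr (Q.Op x' k))
    (u : ∀ i, Arr (Q.Op (fun _ : Unit => x i) (x' i))) : Arr (Q.Op x k) :=
  Q.rei (y := x) (Equiv.sigmaUnique I fun _ => Unit) (fun _ => rfl)
    (Q.cmp x' (fun i (_ : Unit) => x i) k p u)

variable {Q}

theorem rei_congr {I J : Type} [Finite I] [Finite J] {e e' : I ≃ J} {x : I → K} {y : J → K}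
    (h : ∀ i, y (e i) = x i) (he : e = e') {c : K} (p : Arr (Q.Op x c)) :
    Q.rei e h p = Q.rei e' (fun i => he ▸ h i) p := by
  subst he
  rfl

namespace ArrLaws

variable (hQ : Q.ArrLaws)
include hQ

theorem rei_rei_congr {I J J' L : Type} [Finite I] [Finite J] [Finite J'] [Finite L]
    (e₁ : I ≃ J) (e₂ : J ≃ L) (e₁' : I ≃ J') (e₂' : J' ≃ L) {x : I → K} {y : J → K} {y' : J' → K}
    {z : L → K} (h₁ : ∀ i, y (e₁ i) = x i) (h₂ : ∀ i, z (e₂ i) = y i)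
    (h₁' : ∀ i, y' (e₁' i) = x i) (h₂' : ∀ i, z (e₂' i) = y' i) {c : K} (p : Arr (Q.Op x c))
    (he : ∀ i, e₂ (e₁ i) = e₂' (e₁' i)) :
    Q.rei e₂ h₂ (Q.rei e₁ h₁ p) = Q.rei e₂' h₂' (Q.rei e₁' h₁' p) :=
  (hQ.rei_rei e₁ e₂ h₁ h₂ c p).trans ((rei_congr _ (Equiv.ext he) p).trans
    (hQ.rei_rei e₁' e₂' h₁' h₂' c p).symm)

theorem rei_post {J L : Type} [Finite J] [Finite L] (e : J ≃ L) {y : J → K} {z : L → K}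
    (h : ∀ j, z (e j) = y j) {k k' : K} (u : Arr (Q.Op (fun _ : Unit => k) k'))
    (p : Arr (Q.Op y k)) : Q.rei e h (Q.post u p) = Q.post u (Q.rei e h p) := by
  refine Eq.trans ?_ (congrArg (Q.rei (y := z) (Equiv.uniqueSigma fun _ : Unit => L)
    (fun _ => rfl)) (hQ.cmp_rei (fun _ : Unit => e) (fun _ => k) (fun _ => h) k' u fun _ => p)).symm
  exact hQ.rei_rei_congr _ _ _ _ _ _ _ _ _ fun s => rfl

theorem pre_one {I : Type} [Finite I] {x : I → K} {k : K} (p : Arr (Q.Op x k)) :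
    Q.pre p (fun i => Q.idA (x i)) = p := hQ.cmp_one x k p

theorem post_one {J : Type} [Finite J] {y : J → K} {k : K} (p : Arr (Q.Op y k)) :
    Q.post (Q.idA k) p = p := hQ.one_cmp y k p

theorem post_cmp {I : Type} [Finite I] {J : I → Type} [∀ i, Finite (J i)] {x : I → K}
    {y : ∀ i, J i → K} {k k' : K} (u : Arr (Q.Op (fun _ : Unit => k) k')) (p : Arr (Q.Op x k))
    (q : ∀ i, Arr (Q.Op (y i) (x i))) :
    Q.post u (Q.cmp x y k p q) = Q.cmp x y k' (Q.post u p) q := by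
  refine (congrArg (Q.rei (y := fun s : Σ i, J i => y s.1 s.2)
    (Equiv.uniqueSigma fun _ : Unit => Σ i, J i) (fun _ => rfl))
    (hQ.assoc (fun _ : Unit => k) (fun _ => x) (fun _ => y) k' u (fun _ => p)
      fun _ => q).symm).trans ?_
  refine Eq.trans ?_ (hQ.rei_cmp (Equiv.uniqueSigma fun _ : Unit => I) x y k' _ q).symm
  refine (hQ.rei_rei _ _ _ _ _ _).trans ?_
  exact rei_congr _ (Equiv.ext fun s => rfl) _

theorem cmp_pre {I : Type} [Finite I] {J : I → Type} [∀ i, Finite (J i)] {x : I → K}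
    {y y' : ∀ i, J i → K} {k : K} (p : Arr (Q.Op x k)) (q : ∀ i, Arr (Q.Op (y' i) (x i)))
    (u : ∀ i j, Arr (Q.Op (fun _ : Unit => y i j) (y' i j))) :
    Q.cmp x y k p (fun i => Q.pre (q i) (u i)) =
      Q.pre (Q.cmp x y' k p q) (x := fun s : Σ i, J i => y s.1 s.2) fun s => u s.1 s.2 := by
  refine (hQ.cmp_rei (fun i => Equiv.sigmaUnique (J i) fun _ => Unit) x
    (y := fun i s => y i s.1) (fun i j => rfl) k p
      fun i => Q.cmp (y' i) (fun j (_ : Unit) => y i j) (x i) (q i) (u i)).trans ?_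
  refine (congrArg (Q.rei (y := fun s : Σ i, J i => y s.1 s.2) (Equiv.sigmaCongrRight fun i =>
    Equiv.sigmaUnique (J i) fun _ => Unit) fun _ => rfl) (hQ.assoc x y'
      (fun i j (_ : Unit) => y i j) k p q u).symm).trans ?_
  refine (hQ.rei_rei _ _ _ _ _ _).trans ?_
  exact rei_congr _ (Equiv.ext fun s => rfl) _

/-- Unary operations move across a composite, from the outer operation to the inner ones. -/
theorem cmp_pre_left {I : Type} [Finite I] {J : I → Type} [∀ i, Finite (J i)] {x x' : I → K}
    {y : ∀ i, J i → K} {k : K} (p : Arr (Q.Op x' k))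
    (u : ∀ i, Arr (Q.Op (fun _ : Unit => x i) (x' i))) (q : ∀ i, Arr (Q.Op (y i) (x i))) :
    Q.cmp x y k (Q.pre p u) q = Q.cmp x' y k p fun i => Q.post (u i) (q i) := by
  refine (hQ.rei_cmp (Equiv.sigmaUnique I fun _ => Unit) x y k
    (Q.cmp x' (fun i (_ : Unit) => x i) k p u) q).trans ?_
  refine Eq.trans ?_ (hQ.cmp_rei (fun i => Equiv.uniqueSigma fun _ : Unit => J i) x'
    (y := fun i s => y i s.2) (fun i j => rfl) k p
      fun i => Q.cmp (fun _ : Unit => x i) (fun _ => y i) (x' i) (u i) fun _ => q i).symm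
  refine Eq.trans ?_ (congrArg (Q.rei (y := fun s : Σ i, J i => y s.1 s.2)
    (Equiv.sigmaCongrRight fun i => Equiv.uniqueSigma fun _ : Unit => J i) fun _ => rfl)
      (hQ.assoc x' (fun i (_ : Unit) => x i) (fun i _ => y i) k p u fun i _ => q i))
  refine Eq.trans ?_ (hQ.rei_rei _ _ _ _ _ _).symm
  exact rei_congr _ (Equiv.ext fun s => rfl) _

theorem rei_pre {I J : Type} [Finite I] [Finite J] (e : I ≃ J) {x x' : I → K} {y y' : J → K}
    (h : ∀ i, y (e i) = x i) (h' : ∀ i, y' (e i) = x' i) {k : K} (p : Arr (Q.Op x' k))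
    (u : ∀ i, Arr (Q.Op (fun _ : Unit => x i) (x' i)))
    (v : ∀ j, Arr (Q.Op (fun _ : Unit => y j) (y' j))) (huv : ∀ i, v (e i) ≍ u i) :
    Q.rei e h (Q.pre p u) = Q.pre (Q.rei e h' p) v := by
  obtain rfl : x = fun i => y (e i) := funext fun i => (h i).symm
  obtain rfl : x' = fun i => y' (e i) := funext fun i => (h' i).symm
  obtain rfl : u = fun i => v (e i) := funext fun i => (eq_of_heq (huv i)).symm
  refine Eq.trans ?_ (congrArg (Q.rei (y := y) (Equiv.sigmaUnique J fun _ => Unit) fun _ => rfl)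
    (hQ.rei_cmp e y' (fun j (_ : Unit) => y j) k p v)).symm
  exact hQ.rei_rei_congr _ _ _ _ _ _ _ _ _ fun s => rfl

end ArrLaws

end OperadData

/-! ### Presentations of categories and their products -/

/-- A functor `π` presents `E` as the quotient of `T` by a reflexive pair of functors: functors out
of `E`, with parameters, are the functors out of `T` which coequalize the pair. -/
structure IsPresentation {R T E : Type u} [Category.{u} R] [Category.{u} T] [Category.{u} E]
    (l r : R ⥤ T) (π : T ⥤ E) : Prop where
  refl (φ : Arr T) : ∃ ρ, Arr.map l ρ = φ ∧ Arr.map r ρ = φ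
  lift {S B : Type u} [Category.{u} S] [Category.{u} B] (G : S × T ⥤ B)
    (h : ∀ σ ρ, Arr.map G (.pair σ (Arr.map l ρ)) = Arr.map G (.pair σ (Arr.map r ρ))) :
    ∃ F : S × E ⥤ B, ∀ σ φ, Arr.map F (.pair σ (Arr.map π φ)) = Arr.map G (.pair σ φ)
  ext {S B : Type u} [Category.{u} S] [Category.{u} B] {F F' : S × E ⥤ B}
    (h : ∀ σ φ, Arr.map F (.pair σ (Arr.map π φ)) = Arr.map F' (.pair σ (Arr.map π φ))) : F = F'

namespace IsPresentation

section

variable {R T E R' T' E' : Type u} [Category.{u} R] [Category.{u} T] [Category.{u} E]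
  [Category.{u} R'] [Category.{u} T'] [Category.{u} E'] {l r : R ⥤ T} {π : T ⥤ E}
  {l' r' : R' ⥤ T'} {π' : T' ⥤ E'}

/-- Presentations are invariant under isomorphisms of categories. -/
theorem of_iso (h : IsPresentation l r π) (a : T' ⥤ T) (a' : T ⥤ T') (b : E' ⥤ E) (b' : E ⥤ E')
    (c : R' ⥤ R) (c' : R ⥤ R')
    (ha : ∀ φ, Arr.map a' (Arr.map a φ) = φ) (ha' : ∀ φ, Arr.map a (Arr.map a' φ) = φ)
    (hb : ∀ φ, Arr.map b' (Arr.map b φ) = φ)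
    (hπ : ∀ φ, Arr.map π (Arr.map a φ) = Arr.map b (Arr.map π' φ))
    (hl : ∀ ρ, Arr.map l' (Arr.map c' ρ) = Arr.map a' (Arr.map l ρ))
    (hr : ∀ ρ, Arr.map r' (Arr.map c' ρ) = Arr.map a' (Arr.map r ρ)) :
    IsPresentation l' r' π' where
  refl φ := by
    obtain ⟨ρ, e, e'⟩ := h.refl (Arr.map a φ)
    exact ⟨Arr.map c' ρ, by rw [hl, e, ha], by rw [hr, e', ha]⟩
  lift {S B} _ _ G hG := by
    obtain ⟨F, hF⟩ := h.lift ((𝟭 S).prod a' ⋙ G) fun σ ρ => by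
      have := hG σ (Arr.map c' ρ)
      rw [hl, hr] at this
      exact this
    refine ⟨(𝟭 S).prod b ⋙ F, fun σ φ => ?_⟩
    refine (congrArg (fun z => Arr.map F (.pair σ z)) (hπ φ)).symm.trans ((hF σ _).trans ?_)
    exact congrArg (fun z => Arr.map G (.pair σ z)) (ha φ)
  ext {S B} _ _ F F' hF := by
    have := h.ext (F := (𝟭 S).prod b' ⋙ F) (F' := (𝟭 S).prod b' ⋙ F') fun σ φ => by
      have e : Arr.map b' (Arr.map π φ) = Arr.map π' (Arr.map a' φ) := by
        rw [← hb (Arr.map π' (Arr.map a' φ)), ← hπ, ha']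
      refine (congrArg (fun z => Arr.map F (.pair σ z)) e).trans ((hF _ _).trans
        (congrArg (fun z => Arr.map F' (.pair σ z)) e).symm)
    refine Arr.functor_ext fun φ => ?_
    refine (congrArg (fun z => Arr.map F (.pair φ.fst z)) (hb φ.snd)).symm.trans
      ((Arr.functor_congr this (.pair φ.fst (Arr.map b φ.snd))).trans
        (congrArg (fun z => Arr.map F' (.pair φ.fst z)) (hb φ.snd)))

/-- Products of presentations: since the pairs are reflexive, the factors can be treated one after
the other. -/
theorem prod (h : IsPresentation l r π) (h' : IsPresentation l' r' π') :
    IsPresentation (l.prod l') (r.prod r') (π.prod π') where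
  refl φ := by
    obtain ⟨ρ, e₁, e₂⟩ := h.refl φ.fst
    obtain ⟨ρ', e₁', e₂'⟩ := h'.refl φ.snd
    exact ⟨.pair ρ ρ', congrArg₂ Arr.pair e₁ e₁', congrArg₂ Arr.pair e₂ e₂'⟩
  lift {S B} _ _ G hG := by
    have hG' : ∀ σ ρ ρ', Arr.map G (.pair σ (.pair (Arr.map l ρ) (Arr.map l' ρ'))) =
      Arr.map G (.pair σ (.pair (Arr.map r ρ) (Arr.map r' ρ'))) := fun σ ρ ρ' => hG σ (.pair ρ ρ')
    -- Descend in the second variable, treating the first as a parameter, with the two sides related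
    -- by the degenerate element over the first coordinate.
    obtain ⟨F₁, h₁⟩ := h'.lift (S := S × T) (prod.associator _ _ _ ⋙ G) fun σ ρ' => by
      obtain ⟨ρ, e₁, e₂⟩ := h.refl σ.snd
      have := hG' σ.fst ρ ρ'
      rw [e₁, e₂] at this
      exact this
    have h₁ : ∀ σ φ ψ, Arr.map F₁ (.pair (.pair σ φ) (Arr.map π' ψ)) =
      Arr.map G (.pair σ (.pair φ ψ)) := fun σ φ ψ => h₁ (.pair σ φ) ψ
    -- Being determined on classes, the result still coequalizes the pair in the first variable.
    have h₂ : (((𝟭 S).prod l).prod (𝟭 E')) ⋙ F₁ = (((𝟭 S).prod r).prod (𝟭 E')) ⋙ F₁ :=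
      h'.ext fun σ ψ => by
        obtain ⟨ρ', e₁, e₂⟩ := h'.refl ψ
        refine (h₁ σ.fst (Arr.map l σ.snd) ψ).trans (Eq.trans ?_
          (h₁ σ.fst (Arr.map r σ.snd) ψ).symm)
        have := hG' σ.fst σ.snd ρ'
        rwa [e₁, e₂] at this
    obtain ⟨F₂, h₃⟩ := h.lift (S := S × E') (Functor.prod'
        ((CategoryTheory.Prod.fst _ _).prod (𝟭 _))
      (CategoryTheory.Prod.fst _ _ ⋙ CategoryTheory.Prod.snd _ _) ⋙ F₁) fun σ ρ =>
        Arr.functor_congr h₂ (.pair (.pair σ.fst ρ) σ.snd)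
    refine ⟨Functor.prod' ((𝟭 S).prod (CategoryTheory.Prod.snd _ _))
      (CategoryTheory.Prod.snd _ _ ⋙ CategoryTheory.Prod.fst _ _) ⋙ F₂, fun σ φ => ?_⟩
    exact (h₃ (.pair σ (Arr.map π' φ.snd)) φ.fst).trans (h₁ _ _ _)
  ext {S B} _ _ F F' hF := by
    have e₁ : (prod.associator S T E' ⋙ (𝟭 S).prod (π.prod (𝟭 E'))) ⋙ F =
        (prod.associator S T E' ⋙ (𝟭 S).prod (π.prod (𝟭 E'))) ⋙ F' :=
      h'.ext fun σ ψ => hF σ.fst (.pair σ.snd ψ)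
    have e₂ : (Functor.prod' (CategoryTheory.Prod.fst (S × E') E ⋙ CategoryTheory.Prod.fst _ _)
        (Functor.prod' (CategoryTheory.Prod.snd _ _)
          (CategoryTheory.Prod.fst _ _ ⋙ CategoryTheory.Prod.snd _ _))) ⋙ F =
        (Functor.prod' (CategoryTheory.Prod.fst (S × E') E ⋙ CategoryTheory.Prod.fst _ _)
        (Functor.prod' (CategoryTheory.Prod.snd _ _)
          (CategoryTheory.Prod.fst _ _ ⋙ CategoryTheory.Prod.snd _ _))) ⋙ F' :=
      h.ext fun σ φ => Arr.functor_congr e₁ (.pair (.pair σ.fst φ) σ.snd)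
    exact Arr.functor_ext fun φ => Arr.functor_congr e₂ (.pair (.pair φ.fst φ.snd.snd) φ.snd.fst)

end

/-- Functors between products given by functors between the factors, along a bijection. -/
def piCast {I J : Type} (e : I ≃ J) (T : J → Type u) [∀ j, Category.{u} (T j)] :
    (∀ i, T (e i)) ⥤ ∀ j, T j :=
  Functor.pi' fun j => Pi.eval (fun i => T (e i)) (e.symm j) ⋙
    Eq.rec (motive := fun j' _ => T (e (e.symm j)) ⥤ T j') (𝟭 _) (e.apply_symm_apply j)

theorem map_piCast {I J : Type} (e : I ≃ J) (T : J → Type u) [∀ j, Category.{u} (T j)]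
    (φ : ∀ j, Arr (T j)) : Arr.map (piCast e T) (.pi fun i => φ (e i)) = .pi φ := by
  have h : ∀ j j' (w : j = j'), Arr.map (Eq.rec (motive := fun j' _ => T j ⥤ T j') (𝟭 _) w) (φ j) =
      φ j' := by
    rintro j _ rfl
    rfl
  exact congrArg Arr.pi (funext fun j => h _ _ (e.apply_symm_apply j))

theorem exists_family {I J : Type} (e : I ≃ J) {T : J → Type*} (φ : ∀ i, T (e i)) :
    ∃ ψ : ∀ j, T j, φ = fun i => ψ (e i) :=
  ⟨Equiv.piCongrLeft T e φ, funext fun i => (Equiv.piCongrLeft_apply_apply T e φ i).symm⟩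

/-- A family indexed by `Option I` from its values. -/
def toOption {I : Type} (T : Option I → Type u) [∀ i, Category.{u} (T i)] :
    ((∀ i, T (some i)) × T none) ⥤ ∀ i, T i :=
  Functor.pi' fun i => match i with
    | some i => CategoryTheory.Prod.fst _ _ ⋙ Pi.eval _ i
    | none => CategoryTheory.Prod.snd _ _

/-- The values of a family indexed by `Option I`, with that at `none` apart. -/
def ofOption {I : Type} (T : Option I → Type u) [∀ i, Category.{u} (T i)] :
    (∀ i, T i) ⥤ (∀ i, T (some i)) × T none :=
  Functor.prod' (Functor.pi' fun i => Pi.eval T (some i)) (Pi.eval T none)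

theorem arr_option_ext {I : Type} {T : Option I → Type u} [∀ i, Category.{u} (T i)]
    {φ ψ : Arr (∀ i, T i)} (h : ∀ i, φ.proj (some i) = ψ.proj (some i))
    (h' : φ.proj none = ψ.proj none) : φ = ψ :=
  congrArg Arr.pi (funext fun i => match i with
    | some i => h i
    | none => h' : φ.proj = ψ.proj)

/-- Finite products of presentations. -/
theorem pi (I : Type) [Finite I] : ∀ {R T E : I → Type u} [∀ i, Category.{u} (R i)]
    [∀ i, Category.{u} (T i)] [∀ i, Category.{u} (E i)] {l r : ∀ i, R i ⥤ T i} {π : ∀ i, T i ⥤ E i}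
    (h : ∀ i, IsPresentation (l i) (r i) (π i)),
    IsPresentation (Functor.pi l) (Functor.pi r) (Functor.pi π) := by
  refine Finite.induction_empty_option (P := fun I => ∀ {R T E : I → Type u}
    [∀ i, Category.{u} (R i)]
    [∀ i, Category.{u} (T i)] [∀ i, Category.{u} (E i)] {l r : ∀ i, R i ⥤ T i} {π : ∀ i, T i ⥤ E i}
    (h : ∀ i, IsPresentation (l i) (r i) (π i)),
    IsPresentation (Functor.pi l) (Functor.pi r) (Functor.pi π)) ?_ ?_ ?_ I
  · intro I J e ih R T E _ _ _ l r π h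
    have ih := ih fun i => h (e i)
    refine ih.of_iso (Pi.comap T e) (piCast e T) (Pi.comap E e) (piCast e E) (Pi.comap R e)
      (piCast e R) (fun φ => map_piCast e T φ.proj) (fun φ => ?_) (fun φ => map_piCast e E φ.proj)
      (fun φ => rfl) (fun ρ => ?_) (fun ρ => ?_)
    · obtain ⟨φ', hφ⟩ := exists_family e (T := fun j => Arr (T j)) φ.proj
      obtain rfl : φ = .pi fun i => φ' (e i) := congrArg Arr.pi hφ
      exact congrArg (Arr.map (Pi.comap T e)) (map_piCast e T φ')
    · obtain ⟨ρ', hρ⟩ := exists_family e (T := fun j => Arr (R j)) ρ.proj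
      obtain rfl : ρ = .pi fun i => ρ' (e i) := congrArg Arr.pi hρ
      refine (congrArg (Arr.map (Functor.pi l)) (map_piCast e R ρ')).trans ?_
      exact (map_piCast e T fun j => Arr.map (l j) (ρ' j)).symm
    · obtain ⟨ρ', hρ⟩ := exists_family e (T := fun j => Arr (R j)) ρ.proj
      obtain rfl : ρ = .pi fun i => ρ' (e i) := congrArg Arr.pi hρ
      refine (congrArg (Arr.map (Functor.pi r)) (map_piCast e R ρ')).trans ?_
      exact (map_piCast e T fun j => Arr.map (r j) (ρ' j)).symm
  · intro R T E _ _ _ l r π h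
    have e : ∀ {T : PEmpty → Type u} [∀ i, Category.{u} (T i)] (φ ψ : Arr (∀ i, T i)), φ = ψ :=
      fun φ ψ => congrArg Arr.pi (funext fun i => i.elim : φ.proj = ψ.proj)
    refine ⟨fun φ => ⟨.pi fun i => i.elim, e _ _, e _ _⟩, fun {S B} _ _ G hG => ?_,
      fun {S B} _ _ F F' hF => Arr.functor_ext fun φ => ?_⟩
    · let H : (∀ i, E i) ⥤ ∀ i, T i := Functor.pi' fun i => i.elim
      exact ⟨(𝟭 S).prod H ⋙ G, fun σ φ => congrArg (fun z => Arr.map G (.pair σ z))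
        (e (Arr.map H (Arr.map (Functor.pi π) φ)) φ)⟩
    · have := hF φ.fst (.pi fun i => i.elim)
      rw [e (Arr.map (Functor.pi π) _) φ.snd] at this
      exact this
  · intro I _ ih R T E _ _ _ l r π h
    have ih := ih fun i => h (some i)
    exact (ih.prod (h none)).of_iso (ofOption T) (toOption T) (ofOption E) (toOption E) (ofOption R)
      (toOption R) (fun φ => arr_option_ext (fun i => rfl) rfl) (fun φ => rfl)
      (fun φ => arr_option_ext (fun i => rfl) rfl) (fun φ => rfl)
      (fun φ => arr_option_ext (fun i => rfl) rfl) (fun φ => arr_option_ext (fun i => rfl) rfl)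

end IsPresentation

theorem Arr.exists_incl {I : Type*} {A : I → Type*} [∀ i, Category* (A i)]
    (φ : Arr (Σ i, A i)) : ∃ i ψ, φ = Arr.map (Sigma.incl i) ψ := by
  obtain ⟨a, b, g⟩ := φ
  change Sigma.SigmaHom a b at g
  cases g with
  | @mk i a b g => exact ⟨i, ⟨a, b, g⟩, rfl⟩

/-! ### Weights and coends on arrows -/

section Condensation

variable {K D : Type u} {Q : OperadData K} {f : K → D}

/-- The action of unary operations on a weight, on arrows. -/
def Weight.actA (X : Weight Q f) {k k' : K} (h : f k = f k')
    (u : Arr (Q.Op (fun _ : Unit => k) k')) (z : Arr (X.obj k)) : Arr (X.obj k') :=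
  Arr.app (A := X.obj k) (B := X.obj k') (Arr.map (X.act h) u) z

theorem Weight.IsFunctor.actA_one {X : Weight Q f} (hX : X.IsFunctor) {k : K} (z : Arr (X.obj k)) :
    X.actA rfl (Q.idA k) z = z := by
  refine (congrArg (fun w => Arr.app (A := X.obj k) (B := X.obj k) w z)
    (Arr.map_id (X.act rfl) (Q.one k))).trans ?_
  refine (Arr.app_id (A := X.obj k) (B := X.obj k) _ z).trans ?_
  exact Arr.functor_congr (hX.one k) z

theorem Weight.IsFunctor.actA_post {X : Weight Q f} (hX : X.IsFunctor) {k k' k'' : K}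
    (h : f k = f k') (h' : f k' = f k'') (u' : Arr (Q.Op (fun _ : Unit => k') k''))
    (u : Arr (Q.Op (fun _ : Unit => k) k')) (z : Arr (X.obj k)) :
    X.actA (h.trans h') (Q.post u' u) z = X.actA h' u' (X.actA h u z) :=
  Arr.functor_congr (hX.comp h h') (.pair (.pair u' u) z)

/-- The axioms of a functor on the unary operations, on arrows. -/
theorem Weight.isFunctor {X : Weight Q f} (h1 : ∀ k (z : Arr (X.obj k)),
    X.actA rfl (Q.idA k) z = z)
    (h2 : ∀ {k k' k'' : K} (h : f k = f k') (h' : f k' = f k'')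
      (u' : Arr (Q.Op (fun _ : Unit => k') k'')) (u : Arr (Q.Op (fun _ : Unit => k) k'))
      (z : Arr (X.obj k)), X.actA (h.trans h') (Q.post u' u) z = X.actA h' u' (X.actA h u z)) :
    X.IsFunctor where
  one k := Arr.functor_ext fun z => by
    refine Eq.trans ?_ (h1 k z)
    refine Eq.symm ((congrArg (fun w => Arr.app (A := X.obj k) (B := X.obj k) w z)
      (Arr.map_id (X.act rfl) (Q.one k))).trans ?_)
    exact Arr.app_id (A := X.obj k) (B := X.obj k) _ z
  comp h h' := Arr.functor_ext fun φ => h2 h h' φ.fst.fst φ.fst.snd φ.snd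

section Coend

variable {X : Weight Q f} {I : Type} [Finite I] {d : I → D} {k : K}

/-- The class of an operation and a family in the coend, on arrows. -/
def GN (X : Weight Q f) {I : Type} [Finite I] (d : I → D) (k : K) (x : ∀ i, {c // f c = d i})
    (p : Arr (Q.Op (fun i => (x i).1) k)) (z : ∀ i, Arr (X.obj (x i).1)) : Arr (coend X d k) :=
  Arr.map (coendMk X d k x) (.pair p (.pi z))

variable (X d k) in
/-- The quotient functor onto the coend. -/
def coendπ : coendBase X d k ⥤ coend X d k :=
  (Limits.coequalizer.π (coendLeft X d k).toCatHom (coendRight X d k).toCatHom).toFunctor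

theorem coendBase_arr (φ : Arr (coendBase X d k)) : ∃ (x : ∀ i, {c // f c = d i})
    (p : Arr (Q.Op (fun i => (x i).1) k)) (z : ∀ i, Arr (X.obj (x i).1)),
    φ = Arr.map (Sigma.incl (C := fun x : ∀ i, {c // f c = d i} =>
      Q.Op (fun i => (x i).1) k × ∀ i, X.obj (x i).1) x) (.pair p (.pi z)) := by
  obtain ⟨x, ψ, rfl⟩ := Arr.exists_incl (A := fun x : ∀ i, {c // f c = d i} =>
      Q.Op (fun i => (x i).1) k × ∀ i, X.obj (x i).1) φ
  exact ⟨x, ψ.fst, ψ.snd.proj, rfl⟩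

/-- An operation composed with unary operations at its inputs has the same class as the operation
with the unary operations acting on the family. -/
theorem GN_pre (x x' : ∀ i, {c // f c = d i}) (p : Arr (Q.Op (fun i => (x' i).1) k))
    (u : ∀ i, Arr (Q.Op (fun _ : Unit => (x i).1) (x' i).1)) (z : ∀ i, Arr (X.obj (x i).1)) :
    GN X d k x (Q.pre p u) z =
      GN X d k x' p fun i => X.actA ((x i).2.trans (x' i).2.symm) (u i) (z i) := by
  have h := congrArg Cat.Hom.toFunctor (Limits.coequalizer.condition (coendLeft X d k).toCatHom
    (coendRight X d k).toCatHom)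
  exact Arr.functor_congr h (Arr.map (Sigma.incl (C := fun x : ∀ i, {c // f c = d i} ×
    {c // f c = d i} => (Q.Op (fun i => (x i).2.1) k × ∀ i, Q.Op (fun _ : Unit => (x i).1.1)
      (x i).2.1) × ∀ i, X.obj (x i).1.1) fun i => (x i, x' i)) (.pair (.pair p (.pi u)) (.pi z)))

/-- The coend is a quotient in the sense of `IsPresentation`: the identities give a common section
of the pair, and parameters are handled by currying, as functors out of `T` with parameters in `S`
are functors from `T` to `S ⥤ B`. -/
theorem coend_isPresentation (hQ : Q.ArrLaws) (hX : X.IsFunctor) :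
    IsPresentation (coendLeft X d k) (coendRight X d k) (coendπ X d k) where
  refl φ := by
    obtain ⟨x, p, z, rfl⟩ := coendBase_arr φ
    refine ⟨Arr.map (Sigma.incl (C := fun x : ∀ i, {c // f c = d i} ×
      {c // f c = d i} => (Q.Op (fun i => (x i).2.1) k × ∀ i, Q.Op (fun _ : Unit => (x i).1.1)
      (x i).2.1) × ∀ i, X.obj (x i).1.1) fun i => (x i, x i)) (.pair (.pair p
        (.pi fun i => Q.idA (x i).1)) (.pi z)), ?_, ?_⟩
    · exact congrArg (fun p => Arr.map (Sigma.incl (C := fun x : ∀ i, {c // f c = d i} =>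
        Q.Op (fun i => (x i).1) k × ∀ i, X.obj (x i).1) x) (.pair p (.pi z))) (hQ.pre_one p)
    · exact congrArg (fun z => Arr.map (Sigma.incl (C := fun x : ∀ i, {c // f c = d i} =>
        Q.Op (fun i => (x i).1) k × ∀ i, X.obj (x i).1) x) (.pair p (.pi z)))
          (funext fun i => hX.actA_one (z i))
  lift {S B} _ _ G hG := by
    have e : (coendLeft X d k).toCatHom ≫ (Functor.toCatHom (C := coendBase X d k) (D := S ⥤ B)
        (Functor.curry.obj (CategoryTheory.Prod.swap _ _ ⋙ G))) =
        (coendRight X d k).toCatHom ≫ (Functor.toCatHom (C := coendBase X d k) (D := S ⥤ B)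
        (Functor.curry.obj (CategoryTheory.Prod.swap _ _ ⋙ G))) :=
      congrArg Functor.toCatHom (Arr.functor_ext₂ fun ρ σ =>
        (Arr.app_curry (CategoryTheory.Prod.swap _ _ ⋙ G) (Arr.map (coendLeft X d k) ρ) σ).trans
            ((hG σ ρ).trans
          (Arr.app_curry (CategoryTheory.Prod.swap _ _ ⋙ G) (Arr.map (coendRight X d k) ρ) σ).symm))
    refine ⟨CategoryTheory.Prod.swap _ _ ⋙ Functor.uncurry.obj
        (Limits.coequalizer.desc _ e).toFunctor,
      fun σ φ => ?_⟩
    have h := congrArg Cat.Hom.toFunctor (Limits.coequalizer.π_desc _ e)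
    refine Eq.trans ?_ (Arr.app_curry (CategoryTheory.Prod.swap _ _ ⋙ G) φ σ)
    exact congrArg (fun w : Arr (S ⥤ B) => w.app σ) (Arr.functor_congr h φ)
  ext {S B} _ _ F F' h := by
    have e : (Functor.toCatHom (C := coend X d k) (D := S ⥤ B)
        (Functor.curry.obj (CategoryTheory.Prod.swap _ _ ⋙ F))) =
            (Functor.toCatHom (C := coend X d k) (D := S ⥤ B)
        (Functor.curry.obj (CategoryTheory.Prod.swap _ _ ⋙ F'))) :=
      Limits.coequalizer.hom_ext (congrArg Functor.toCatHom (Arr.functor_ext₂ fun φ σ =>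
        (Arr.app_curry (CategoryTheory.Prod.swap _ _ ⋙ F) (Arr.map (coendπ X d k) φ) σ).trans
            ((h σ φ).trans
          (Arr.app_curry (CategoryTheory.Prod.swap _ _ ⋙ F') (Arr.map (coendπ X d k) φ) σ).symm)))
    refine Arr.functor_ext fun φ => ?_
    have := congrArg (fun w : Arr (S ⥤ B) => w.app φ.fst)
      (Arr.functor_congr (congrArg Cat.Hom.toFunctor e) φ.snd)
    exact (Arr.app_curry (CategoryTheory.Prod.swap _ _ ⋙ F) φ.snd φ.fst).symm.trans (this.trans
      (Arr.app_curry (CategoryTheory.Prod.swap _ _ ⋙ F') φ.snd φ.fst))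

end Coend
end Condensation

/-! ### Maps out of products of coends -/

section PiSigma

variable {S B : Type u} [Category.{u} S] [Category.{u} B] {L : Type} {Z : L → Type u}
  {A : ∀ l, Z l → Type u} [∀ l z, Category.{u} (A l z)]

/-- The value of `piSigma` on morphisms. A morphism in a sum of categories has both ends in the same
summand, which gives the equation between the indices. -/
def piSigmaMap {x x' : ∀ l, Z l} {a : ∀ l, A l (x l)} {a' : ∀ l, A l (x' l)}
    (g : ∀ l, (⟨x l, a l⟩ : Σ z, A l z) ⟶ ⟨x' l, a' l⟩) (hx : x = x') :
    (⟨x, a⟩ : Σ x : ∀ l, Z l, ∀ l, A l (x l)) ⟶ ⟨x', a'⟩ := by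
  subst hx
  exact (Sigma.incl (C := fun x : ∀ l, Z l => ∀ l, A l (x l)) x).map
    fun l => (Sigma.incl (x l)).preimage (g l)

theorem sigma_fst_eq {I : Type*} {M : I → Type*} [∀ i, Category* (M i)] {a b : Σ i, M i}
    (g : a ⟶ b) : a.1 = b.1 := by
  change Sigma.SigmaHom a b at g
  cases g
  rfl

variable (A) in
/-- Products distribute over sums. -/
def piSigma : (∀ l, Σ z, A l z) ⥤ Σ x : ∀ l, Z l, ∀ l, A l (x l) where
  obj t := ⟨fun l => (t l).1, fun l => (t l).2⟩
  map g := piSigmaMap g (funext fun l => sigma_fst_eq (g l))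
  map_id t := by
    refine (congrArg (Sigma.incl (C := fun x : ∀ l, Z l => ∀ l, A l (x l)) fun l => (t l).1).map
      (funext fun l => (Sigma.incl (t l).1).preimage_id)).trans ?_
    exact (Sigma.incl (C := fun x : ∀ l, Z l => ∀ l, A l (x l)) fun l => (t l).1).map_id _
  map_comp {t t' t''} g g' := by
    have key : ∀ {x x' x'' : ∀ l, Z l} {a : ∀ l, A l (x l)} {a' : ∀ l, A l (x' l)}
        {a'' : ∀ l, A l (x'' l)} (g : ∀ l, (⟨x l, a l⟩ : Σ z, A l z) ⟶ ⟨x' l, a' l⟩)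
        (g' : ∀ l, (⟨x' l, a' l⟩ : Σ z, A l z) ⟶ ⟨x'' l, a'' l⟩) (h : x = x') (h' : x' = x''),
        piSigmaMap (fun l => g l ≫ g' l) (h.trans h') = piSigmaMap g h ≫ piSigmaMap g' h' := by
      intro x x' x'' a a' a'' g g' h h'
      subst h h'
      refine (congrArg (Sigma.incl (C := fun x : ∀ l, Z l => ∀ l, A l (x l)) x).map
        (funext fun l => (Sigma.incl (x l)).preimage_comp (g l) (g' l))).trans ?_
      exact (Sigma.incl (C := fun x : ∀ l, Z l => ∀ l, A l (x l)) x).map_comp _ _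
    exact key g g' _ _

theorem map_piSigma (x : ∀ l, Z l) (φ : ∀ l, Arr (A l (x l))) :
    Arr.map (piSigma A) (.pi fun l => Arr.map (Sigma.incl (x l)) (φ l)) =
      Arr.map (Sigma.incl x) (.pi φ) := by
  refine Arr.mk_eq rfl rfl (heq_of_eq ?_)
  exact congrArg (Sigma.incl (C := fun x : ∀ l, Z l => ∀ l, A l (x l)) x).map
    (funext fun l => (Sigma.incl (x l)).preimage_map _)

/-- Functors out of a product of sums, with parameters. -/
theorem exists_piSigma_desc (F : ∀ x : ∀ l, Z l, S × (∀ l, A l (x l)) ⥤ B) :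
    ∃ G : S × (∀ l, Σ z, A l z) ⥤ B, ∀ σ x (φ : ∀ l, Arr (A l (x l))),
      Arr.map G (.pair σ (.pi fun l => Arr.map (Sigma.incl (x l)) (φ l))) =
        Arr.map (F x) (.pair σ (.pi φ)) := by
  let H : (Σ x : ∀ l, Z l, ∀ l, A l (x l)) ⥤ S ⥤ B := Sigma.desc fun x =>
    Functor.curry.obj (CategoryTheory.Prod.swap _ _ ⋙ F x)
  refine ⟨CategoryTheory.Prod.swap _ _ ⋙ Functor.uncurry.obj (piSigma A ⋙ H), fun σ x φ => ?_⟩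
  refine (congrArg (fun z => (Arr.map H z).app σ) (map_piSigma x φ)).trans ?_
  exact Arr.app_curry (CategoryTheory.Prod.swap _ _ ⋙ F x) (.pi φ) σ

end PiSigma

section Condensation

variable {K D : Type u} {Q : OperadData K} {f : K → D} {X : Weight Q f}

section

variable {L : Type} [Finite L] {J : L → Type} [∀ l, Finite (J l)] {d : ∀ l, J l → D} {k : L → K}
  {S B : Type u} [Category.{u} S] [Category.{u} B]

/-- Maps out of products of coends, with parameters, are determined by their values on classes. -/
theorem coendPi_ext (hQ : Q.ArrLaws) (hX : X.IsFunctor)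
    {m n : Arr S → (∀ l, Arr (coend X (d l) (k l))) → Arr B}
    (hm : IsMap fun φ : Arr (S × ∀ l, coend X (d l) (k l)) => m φ.fst φ.snd.proj)
    (hn : IsMap fun φ : Arr (S × ∀ l, coend X (d l) (k l)) => n φ.fst φ.snd.proj)
    (h : ∀ σ (x : ∀ l j, {c // f c = d l j}) (p : ∀ l, Arr (Q.Op (fun j => (x l j).1) (k l)))
      (z : ∀ l j, Arr (X.obj (x l j).1)),
      m σ (fun l => GN X (d l) (k l) (x l) (p l) (z l)) =
        n σ (fun l => GN X (d l) (k l) (x l) (p l) (z l)))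
    (σ : Arr S) (w : ∀ l, Arr (coend X (d l) (k l))) : m σ w = n σ w := by
  obtain ⟨F, hF⟩ := hm
  obtain ⟨G, hG⟩ := hn
  have e : F = G := (IsPresentation.pi L fun l =>
    coend_isPresentation (X := X) (d := d l) (k := k l) hQ hX).ext fun σ φ => by
      choose x p z h' using fun l => coendBase_arr (φ.proj l)
      obtain rfl : φ = .pi fun l => _ := congrArg Arr.pi (funext h')
      exact (hF _).symm.trans ((h σ x p z).trans (hG
          (.pair σ (.pi fun l => GN X (d l) (k l) (x l) (p l) (z l)))))
  exact (hF (.pair σ (.pi w))).trans ((Arr.functor_congr e _).trans (hG (.pair σ (.pi w))).symm)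

/-- Maps out of products of coends, with parameters, from compatible values on classes. -/
theorem coendPi_lift (hQ : Q.ArrLaws) (hX : X.IsFunctor)
    (m : ∀ (x : ∀ l j, {c // f c = d l j}), Arr S → (∀ l, Arr (Q.Op (fun j => (x l j).1) (k l))) →
      (∀ l j, Arr (X.obj (x l j).1)) → Arr B)
    (hm : ∀ x, IsMap fun φ : Arr (S × ∀ l, (Q.Op (fun j => (x l j).1) (k l) ×
      ∀ j, X.obj (x l j).1)) => m x φ.fst (fun l => (φ.snd.proj l).fst)
        fun l => (φ.snd.proj l).snd.proj)
    (h : ∀ σ (x x' : ∀ l j, {c // f c = d l j}) (p : ∀ l, Arr (Q.Op (fun j => (x' l j).1) (k l)))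
      (u : ∀ l j, Arr (Q.Op (fun _ : Unit => (x l j).1) (x' l j).1))
      (z : ∀ l j, Arr (X.obj (x l j).1)),
      m x σ (fun l => Q.pre (p l) (u l)) z =
        m x' σ p fun l j => X.actA ((x l j).2.trans (x' l j).2.symm) (u l j) (z l j)) :
    ∃ F : S × (∀ l, coend X (d l) (k l)) ⥤ B, ∀ σ x p z,
      Arr.map F (.pair σ (.pi fun l => GN X (d l) (k l) (x l) (p l) (z l))) = m x σ p z := by
  choose F hF using hm
  obtain ⟨G, hG⟩ := exists_piSigma_desc (Z := fun l => ∀ j, {c // f c = d l j})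
    (A := fun l x => Q.Op (fun j => (x j).1) (k l) × ∀ j, X.obj (x j).1) F
  obtain ⟨H, hH⟩ := (IsPresentation.pi L fun l =>
    coend_isPresentation (X := X) (d := d l) (k := k l) hQ hX).lift G fun σ ρ => by
      choose x a h' using fun l => Arr.exists_incl (A := fun x : ∀ j, {c // f c = d l j} ×
        {c // f c = d l j} => (Q.Op (fun j => (x j).2.1) (k l) ×
          ∀ j, Q.Op (fun _ : Unit => (x j).1.1) (x j).2.1) × ∀ j, X.obj (x j).1.1) (ρ.proj l)
      obtain rfl : ρ = .pi fun l => _ := congrArg Arr.pi (funext h')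
      refine (hG σ (fun l j => (x l j).1) fun l => .pair (Q.pre (a l).fst.fst (a l).fst.snd.proj)
        (a l).snd).trans (Eq.trans ?_ (hG σ (fun l j => (x l j).2) fun l => .pair (a l).fst.fst
          (.pi fun j => X.actA ((x l j).1.2.trans (x l j).2.2.symm) ((a l).fst.snd.proj j)
            ((a l).snd.proj j))).symm)
      exact (hF _ _).symm.trans ((h σ _ _ (fun l => (a l).fst.fst) (fun l => (a l).fst.snd.proj)
        fun l => (a l).snd.proj).trans (hF (fun l j => (x l j).2) (.pair σ (.pi fun l =>
          .pair (a l).fst.fst (.pi fun j => X.actA ((x l j).1.2.trans (x l j).2.2.symm)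
            ((a l).fst.snd.proj j) ((a l).snd.proj j))))))
  refine ⟨H, fun σ x p z => ?_⟩
  exact (hH σ (.pi fun l => Arr.map (Sigma.incl (x l)) (.pair (p l) (.pi (z l))))).trans
    ((hG σ x fun l => .pair (p l) (.pi (z l))).trans (hF x _).symm)

end

section

variable {J : Type} [Finite J] {d : J → D} {k : K} {S B : Type u} [Category.{u} S] [Category.{u} B]

/-- Maps out of a coend, with parameters, are determined by their values on classes. -/
theorem coend_ext (hQ : Q.ArrLaws) (hX : X.IsFunctor) {m n : Arr S → Arr (coend X d k) → Arr B}
    (hm : IsMap fun φ : Arr (S × coend X d k) => m φ.fst φ.snd)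
    (hn : IsMap fun φ : Arr (S × coend X d k) => n φ.fst φ.snd)
    (h : ∀ σ x p z, m σ (GN X d k x p z) = n σ (GN X d k x p z))
    (σ : Arr S) (w : Arr (coend X d k)) : m σ w = n σ w :=
  coendPi_ext hQ hX (L := Unit) (J := fun _ => J) (d := fun _ => d) (k := fun _ => k)
    (m := fun σ w => m σ (w ())) (n := fun σ w => n σ (w ()))
    (hm.comp (n := fun φ : Arr (S × ∀ _ : Unit, coend X d k) => .pair φ.fst (φ.snd.proj ()))
      (IsMap.self.fst.pair (IsMap.self.snd.proj ())))
    (hn.comp (n := fun φ : Arr (S × ∀ _ : Unit, coend X d k) => .pair φ.fst (φ.snd.proj ()))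
      (IsMap.self.fst.pair (IsMap.self.snd.proj ())))
    (fun σ x p z => h σ (x ()) (p ()) (z ())) σ fun _ => w

/-- Maps out of a coend, with parameters, from compatible values on classes. -/
theorem coend_lift (hQ : Q.ArrLaws) (hX : X.IsFunctor)
    (m : ∀ (x : ∀ j, {c // f c = d j}), Arr S → Arr (Q.Op (fun j => (x j).1) k) →
      (∀ j, Arr (X.obj (x j).1)) → Arr B)
    (hm : ∀ x, IsMap fun φ : Arr (S × (Q.Op (fun j => (x j).1) k × ∀ j, X.obj (x j).1)) =>
      m x φ.fst φ.snd.fst φ.snd.snd.proj)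
    (h : ∀ σ (x x' : ∀ j, {c // f c = d j}) (p : Arr (Q.Op (fun j => (x' j).1) k))
      (u : ∀ j, Arr (Q.Op (fun _ : Unit => (x j).1) (x' j).1)) (z : ∀ j, Arr (X.obj (x j).1)),
      m x σ (Q.pre p u) z =
        m x' σ p fun j => X.actA ((x j).2.trans (x' j).2.symm) (u j) (z j)) :
    ∃ F : S × coend X d k ⥤ B, ∀ σ x p z, Arr.map F (.pair σ (GN X d k x p z)) = m x σ p z := by
  obtain ⟨F, hF⟩ := coendPi_lift hQ hX (L := Unit) (J := fun _ => J) (d := fun _ => d)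
    (k := fun _ => k) (fun x σ p z => m (x ()) σ (p ()) (z ()))
    (fun x => (hm (x ())).comp (n := fun φ : Arr (S × ∀ l : Unit, (Q.Op (fun j => (x l j).1) k ×
      ∀ j, X.obj (x l j).1)) => .pair φ.fst (φ.snd.proj ()))
      (IsMap.self.fst.pair (IsMap.self.snd.proj ())))
    (fun σ x x' p u z => h σ (x ()) (x' ()) (p ()) (u ()) (z ()))
  exact ⟨(𝟭 S).prod (Functor.pi' fun _ : Unit => 𝟭 (coend X d k)) ⋙ F,
    fun σ x p z => hF σ (fun _ => x) (fun _ => p) fun _ => z⟩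

end

/-! ### Natural transformations on arrows -/

section HomCat

variable {Y : Weight Q f} {d : D}

/-- The components of a natural transformation, on arrows. -/
def cA (m : Arr (HomCat d X Y)) (k : {k // f k = d}) (ζ : Arr (X.obj k.1)) : Arr (Y.obj k.1) :=
  Arr.app (A := X.obj k.1) (B := Y.obj k.1) (Arr.map (component X Y k) m) ζ

theorem isMap_cA {S : Type*} [Category* S] (k : {k // f k = d}) {m : Arr S → Arr (HomCat d X Y)}
    {ζ : Arr S → Arr (X.obj k.1)} (hm : IsMap m) (hζ : IsMap ζ) :
    IsMap fun φ => cA (m φ) k (ζ φ) :=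
  (hm.map (component X Y k)).app hζ

theorem Equalized.map_incl {A B : Type u} [Category.{u} A] [Category.{u} B] (F G : A ⥤ B)
    (φ : Arr (Equalized F G)) : Arr.map F (Arr.map (Equalized.incl F G) φ) =
      Arr.map G (Arr.map (Equalized.incl F G) φ) :=
  Arr.mk_eq φ.dom.eq φ.cod.eq φ.hom.2

/-- Naturality of the components. -/
theorem cA_act (m : Arr (HomCat d X Y)) (k k' : {k // f k = d})
    (u : Arr (Q.Op (fun _ : Unit => k.1) k'.1)) (ζ : Arr (X.obj k.1)) :
    cA m k' (X.actA (k.2.trans k'.2.symm) u ζ) = Y.actA (k.2.trans k'.2.symm) u (cA m k ζ) := by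
  have h := congrArg (fun φ : Arr (∀ kk : {k // f k = d} × {k // f k = d},
      Q.Op (fun _ : Unit => kk.1.1) kk.2.1 ⥤ (X.obj kk.1.1 ⥤ Y.obj kk.2.1)) =>
    Arr.app (A := X.obj k.1) (B := Y.obj k'.1)
      (Arr.app (A := Q.Op (fun _ : Unit => k.1) k'.1) (φ.proj (k, k')) u) ζ)
    (Equalized.map_incl (actThen d X Y) (thenAct d X Y) m)
  have e₁ := Arr.app_app_whiskeringRight (Arr.map (component X Y k') m)
    (Arr.map (X.act (k.2.trans k'.2.symm)) u) ζ
  have e₂ := Arr.app_app_whiskeringLeft (Arr.map (component X Y k) m)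
    (Arr.map (Y.act (k.2.trans k'.2.symm)) u) ζ
  exact e₁.symm.trans (h.trans e₂)

/-- Functors into an equalizer are determined by their composites with the inclusion. -/
theorem Equalized.functor_ext {S A B : Type u} [Category.{u} S] [Category.{u} A] [Category.{u} B]
    {F G : A ⥤ B} {H H' : S ⥤ Equalized F G}
    (h : H ⋙ Equalized.incl F G = H' ⋙ Equalized.incl F G) : H = H' := by
  have hv : ∀ {a b : Equalized F G}, a.val = b.val → a = b := by
    rintro ⟨a, _⟩ ⟨b, _⟩ rfl
    rfl
  have ho : ∀ s, H.obj s = H'.obj s := fun s => hv (Functor.congr_obj h s)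
  refine CategoryTheory.Functor.hext ho fun s t g => ?_
  have hg := functor_heq h g
  have key : ∀ {a b a' b' : Equalized F G} (g : a ⟶ b) (g' : a' ⟶ b') (e : a = a') (e' : b = b'),
      g.1 ≍ g'.1 → g ≍ g' := by
    intro a b a' b' g g' e e' w
    subst e e'
    exact heq_of_eq (Subtype.ext (eq_of_heq w))
  exact key _ _ (ho s) (ho t) hg

/-- Functors into a category of natural transformations are determined by the components. -/
theorem homCat_ext {S : Type u} [Category.{u} S] {F G : S ⥤ HomCat d X Y}
    (h : ∀ σ k ζ, cA (Arr.map F σ) k ζ = cA (Arr.map G σ) k ζ) : F = G := by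
  refine Equalized.functor_ext ?_
  have e : ∀ k, F ⋙ component X Y k = G ⋙ component X Y k := fun k =>
    Arr.functor_ext₂ fun σ ζ => h σ k ζ
  exact Arr.functor_ext fun σ => congrArg Arr.pi (funext fun k => Arr.functor_congr (e k) σ :
    (Arr.map (F ⋙ Equalized.incl _ _) σ).proj = (Arr.map (G ⋙ Equalized.incl _ _) σ).proj)

/-- Functors into a category of natural transformations from natural families. -/
theorem homCat_lift {S : Type u} [Category.{u} S]
    (m : ∀ k : {k // f k = d}, Arr S → Arr (X.obj k.1) → Arr (Y.obj k.1))
    (hm : ∀ k, IsMap fun φ : Arr (S × X.obj k.1) => m k φ.fst φ.snd)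
    (h : ∀ σ (k k' : {k // f k = d}) (u : Arr (Q.Op (fun _ : Unit => k.1) k'.1))
      (ζ : Arr (X.obj k.1)),
      m k' σ (X.actA (k.2.trans k'.2.symm) u ζ) = Y.actA (k.2.trans k'.2.symm) u (m k σ ζ)) :
    ∃ F : S ⥤ HomCat d X Y, ∀ σ k ζ, cA (Arr.map F σ) k ζ = m k σ ζ := by
  choose F hF using hm
  let G : S ⥤ Families d X Y := Functor.pi' fun k => Functor.curry.obj (F k)
  have hG : ∀ σ k ζ, Arr.app (A := X.obj k.1) (B := Y.obj k.1) ((Arr.map G σ).proj k) ζ =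
      m k σ ζ := fun σ k ζ => (Arr.app_curry (F k) σ ζ).trans (hF k (.pair σ ζ)).symm
  have e : G ⋙ actThen d X Y = G ⋙ thenAct d X Y := by
    refine Arr.functor_ext fun σ => congrArg Arr.pi (funext fun kk => ?_ :
      (Arr.map (G ⋙ actThen d X Y) σ).proj = (Arr.map (G ⋙ thenAct d X Y) σ).proj)
    obtain ⟨k, k'⟩ := kk
    have e' : G ⋙ actThen d X Y ⋙ Pi.eval _ (k, k') = G ⋙ thenAct d X Y ⋙ Pi.eval _ (k, k') := by
      refine Arr.uncurry_injective (Arr.functor_ext₂ fun φ ζ => ?_)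
      have e₁ := Arr.app_app_whiskeringRight ((Arr.map G φ.fst).proj k')
        (Arr.map (X.act (k.2.trans k'.2.symm)) φ.snd) ζ
      have e₂ := Arr.app_app_whiskeringLeft ((Arr.map G φ.fst).proj k)
        (Arr.map (Y.act (k.2.trans k'.2.symm)) φ.snd) ζ
      refine e₁.trans (((hG φ.fst k' (X.actA (k.2.trans k'.2.symm) φ.snd ζ)).trans
        ((h φ.fst k k' φ.snd ζ).trans ?_)).trans e₂.symm)
      exact congrArg (Y.actA (k.2.trans k'.2.symm) φ.snd) (hG φ.fst k ζ).symm
    exact Arr.functor_congr e' σ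
  let H : S ⥤ HomCat d X Y :=
    { obj s := ⟨G.obj s, Functor.congr_obj e s⟩
      map g := ⟨G.map g, functor_heq e g⟩
      map_id s := Subtype.ext (G.map_id s)
      map_comp g g' := Subtype.ext (G.map_comp g g') }
  exact ⟨H, hG⟩

end HomCat

end Condensation

/-! ### The condensation -/

section Condensation

variable {K D : Type u} {Q : OperadData K} {f : K → D} {X : Weight Q f}

namespace OperadData

theorem isMap_rei {S : Type*} [Category* S] {I J : Type} [Finite I] [Finite J] (e : I ≃ J)
    {x : I → K} {y : J → K} (h : ∀ i, y (e i) = x i) {c : K} {p : Arr S → Arr (Q.Op x c)}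
    (hp : IsMap p) : IsMap fun φ => Q.rei e h (p φ) := hp.map (Q.reindex e h)

theorem isMap_cmp {S : Type*} [Category* S] {I : Type} [Finite I] {J : I → Type}
    [∀ i, Finite (J i)] (x : I → K) (y : ∀ i, J i → K) (c : K) {p : Arr S → Arr (Q.Op x c)}
    {q : ∀ i, Arr S → Arr (Q.Op (y i) (x i))} (hp : IsMap p) (hq : ∀ i, IsMap (q i)) :
    IsMap fun φ => Q.cmp x y c (p φ) fun i => q i φ := (hp.pair (.pi hq)).map (Q.comp x y c)

theorem isMap_post {S : Type*} [Category* S] {J : Type} [Finite J] {y : J → K} {k k' : K}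
    {v : Arr S → Arr (Q.Op (fun _ : Unit => k) k')} {p : Arr S → Arr (Q.Op y k)} (hv : IsMap v)
    (hp : IsMap p) : IsMap fun φ => Q.post (v φ) (p φ) := (hv.pair hp).map (Q.postcomp y k k')

theorem isMap_pre {S : Type*} [Category* S] {I : Type} [Finite I] {x x' : I → K} {k : K}
    {p : Arr S → Arr (Q.Op x' k)} {v : ∀ i, Arr S → Arr (Q.Op (fun _ : Unit => x i) (x' i))}
    (hp : IsMap p) (hv : ∀ i, IsMap (v i)) : IsMap fun φ => Q.pre (p φ) fun i => v i φ :=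
  (hp.pair (.pi hv)).map (Q.precomp x x' k)

namespace ArrLaws

variable (hQ : Q.ArrLaws)
include hQ

theorem post_pre {I : Type} [Finite I] {x x' : I → K} {k k' : K}
    (v : Arr (Q.Op (fun _ : Unit => k) k')) (p : Arr (Q.Op x' k))
    (u : ∀ i, Arr (Q.Op (fun _ : Unit => x i) (x' i))) :
    Q.post v (Q.pre p u) = Q.pre (Q.post v p) u := by
  refine (congrArg (Q.rei (y := x) (Equiv.uniqueSigma fun _ : Unit => I) fun _ => rfl)
    (hQ.cmp_pre (y := fun _ => x) (y' := fun _ => x') v (fun _ => p) fun _ => u)).trans ?_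
  exact hQ.rei_pre _ _ _ _ _ _ fun i => HEq.rfl

theorem pre_idA {k k' : K} (v : Arr (Q.Op (fun _ : Unit => k) k')) :
    Q.pre (Q.idA k') (fun _ => v) = v := by
  refine Eq.trans ?_ (hQ.one_cmp (fun _ : Unit => k) k' v)
  exact rei_congr _ (Equiv.ext fun s => rfl) _

theorem post_idA {k k' : K} (v : Arr (Q.Op (fun _ : Unit => k) k')) :
    Q.post v (Q.idA k) = v := by
  refine Eq.trans ?_ (hQ.cmp_one (fun _ : Unit => k) k' v)
  exact rei_congr _ (Equiv.ext fun s => rfl) _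

end ArrLaws

end OperadData

open OperadData

theorem isMap_actA {S : Type*} [Category* S] (X : Weight Q f) {k k' : K} (h : f k = f k')
    {v : Arr S → Arr (Q.Op (fun _ : Unit => k) k')} {z : Arr S → Arr (X.obj k)}
    (hv : IsMap v) (hz : IsMap z) : IsMap fun φ => X.actA h (v φ) (z φ) :=
  (hv.map (X.act h)).app hz

theorem isMap_GN {S : Type*} [Category* S] {I : Type} [Finite I] (d : I → D) (k : K)
    (x : ∀ i, {c // f c = d i}) {p : Arr S → Arr (Q.Op (fun i => (x i).1) k)}
    {z : ∀ i, Arr S → Arr (X.obj (x i).1)} (hp : IsMap p) (hz : ∀ i, IsMap (z i)) :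
    IsMap fun φ => GN X d k x (p φ) fun i => z i φ :=
  (hp.pair (.pi hz)).map (coendMk X d k x)

variable (hQ : Q.ArrLaws) (hX : X.IsFunctor)

theorem coend_ext₁ {hQ : Q.ArrLaws} {hX : X.IsFunctor} {J : Type} [Finite J] {d : J → D} {k : K}
    {B : Type u} [Category.{u} B]
    {m n : Arr (coend X d k) → Arr B} (hm : IsMap m) (hn : IsMap n)
    (h : ∀ x p z, m (GN X d k x p z) = n (GN X d k x p z)) (w : Arr (coend X d k)) : m w = n w :=
  coend_ext hQ hX (S := Discrete PUnit.{u + 1}) (m := fun _ => m) (n := fun _ => n)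
    (hm.comp IsMap.self.snd) (hn.comp IsMap.self.snd) (fun _ => h) (Arr.id ⟨⟨⟩⟩) w

include hQ hX

theorem exists_coendAct {I : Type} [Finite I] (d : I → D) (k k' : K) :
    ∃ F : Q.Op (fun _ : Unit => k) k' × coend X d k ⥤ coend X d k', ∀ v x p z,
      Arr.map F (.pair v (GN X d k x p z)) = GN X d k' x (Q.post v p) z :=
  coend_lift hQ hX (fun x v p z => GN X d k' x (Q.post v p) z)
    (fun x => isMap_GN _ _ _ (isMap_post IsMap.self.fst IsMap.self.snd.fst)
      fun i => IsMap.self.snd.snd.proj i)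
    fun v x x' p u z => (congrArg (fun p => GN X d k' x p z) (hQ.post_pre v p u)).trans
      (GN_pre x x' _ u z)

/-- Relabelling of coends, by values on classes. The class of `z` over `d` is sent to the class of
the family `j ↦ z (e.symm j)`; the formula holds for families indexed by `J`, pulled back along
`e`, which avoids transport. -/
theorem exists_relabel {I J : Type} [Finite I] [Finite J] (e : I ≃ J) {d : I → D} {d' : J → D}
    (h : ∀ i, d' (e i) = d i) (k : K) : ∃ F : coend X d k ⥤ coend X d' k,
      ∀ (x : ∀ j, {c // f c = d' j}) (p : Arr (Q.Op (fun i => (x (e i)).1) k))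
        (z : ∀ j, Arr (X.obj (x j).1)),
        Arr.map F (GN X d k (fun i => ⟨(x (e i)).1, (x (e i)).2.trans (h i)⟩) p fun i => z (e i)) =
          GN X d' k x (Q.rei e (y := fun j => (x j).1) (fun _ => rfl) p) z := by
  have hy : ∀ (x : ∀ i, {c // f c = d i}) (j : J), f (x (e.symm j)).1 = d' j := fun x j => by
    rw [(x (e.symm j)).2, ← h, e.apply_symm_apply]
  have hr : ∀ (x : ∀ i, {c // f c = d i}) (i : I), (x (e.symm (e i))).1 = (x i).1 := fun x i => by
    rw [e.symm_apply_apply]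
  obtain ⟨F, hF⟩ := coend_lift hQ hX (d := d) (k := k) (S := Discrete PUnit.{u + 1})
    (fun x _ p z => GN X d' k (fun j => ⟨(x (e.symm j)).1, hy x j⟩)
      (Q.rei e (y := fun j => (x (e.symm j)).1) (hr x) p) fun j => z (e.symm j))
    (fun x => isMap_GN _ _ _ (isMap_rei _ _ IsMap.self.snd.fst)
      fun i => IsMap.self.snd.snd.proj (e.symm i))
    fun _ x x' p u z => by
      refine (congrArg (fun p => GN X d' k (fun j => ⟨(x (e.symm j)).1, hy x j⟩) p
        fun j => z (e.symm j)) (hQ.rei_pre e (hr x) (hr x') p u (fun j => u (e.symm j))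
          fun i => ?_)).trans (GN_pre
          (fun j => ⟨(x (e.symm j)).1, hy x j⟩) (fun j => ⟨(x' (e.symm j)).1, hy x' j⟩)
          (Q.rei e (y := fun j => (x' (e.symm j)).1) (hr x') p) (fun j => u (e.symm j))
          fun j => z (e.symm j))
      rw [e.symm_apply_apply]
  refine ⟨Functor.prod' ((Functor.const _).obj ⟨⟨⟩⟩) (𝟭 _) ⋙ F, fun x p z => ?_⟩
  refine (hF (Arr.id ⟨⟨⟩⟩) (fun i => ⟨(x (e i)).1, (x (e i)).2.trans (h i)⟩) p
    fun i => z (e i)).trans ?_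
  have key : ∀ (g : J → J) (hg : g = fun j => j) (hy : ∀ j, f (x (g j)).1 = d' j)
      (hr : ∀ i, (x (g (e i))).1 = (x (e i)).1),
      GN X d' k (fun j => ⟨(x (g j)).1, hy j⟩) (Q.rei e (y := fun j => (x (g j)).1) hr p)
        (fun j => z (g j)) = GN X d' k x (Q.rei e (y := fun j => (x j).1) (fun _ => rfl) p) z := by
    rintro g rfl hy hr
    rfl
  exact key (fun j => e (e.symm j)) (funext e.apply_symm_apply) _ _

theorem exists_mul {I : Type} [Finite I] {J : I → Type} [∀ i, Finite (J i)] (x : I → K)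
    (d : ∀ i, J i → D) (k : K) :
    ∃ F : (Q.Op x k × ∀ i, coend X (d i) (x i)) ⥤ coend X (fun s : Σ i, J i => d s.1 s.2) k,
      ∀ p (y : ∀ i j, {c // f c = d i j}) (q : ∀ i, Arr (Q.Op (fun j => (y i j).1) (x i)))
        (z : ∀ i j, Arr (X.obj (y i j).1)),
        Arr.map F (.pair p (.pi fun i => GN X (d i) (x i) (y i) (q i) (z i))) =
          GN X (fun s : Σ i, J i => d s.1 s.2) k (fun s => y s.1 s.2)
            (Q.cmp x (fun i j => (y i j).1) k p q) fun s => z s.1 s.2 :=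
  coendPi_lift hQ hX (fun y p q z => GN X (fun s : Σ i, J i => d s.1 s.2) k (fun s => y s.1 s.2)
      (Q.cmp x (fun i j => (y i j).1) k p q) fun s => z s.1 s.2)
    (fun y => isMap_GN _ _ _ (isMap_cmp _ _ _ IsMap.self.fst fun i => (IsMap.self.snd.proj i).fst)
      fun s => (IsMap.self.snd.proj s.1).snd.proj s.2)
    fun p y y' q u z => (congrArg (fun p => GN X (fun s : Σ i, J i => d s.1 s.2) k
      (fun s => y s.1 s.2) p fun s => z s.1 s.2) (hQ.cmp_pre p q u)).trans (GN_pre _ _ _ _ _)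

/-- The action of the unary operations on the coends. -/
def coendAction : CoendAction X where
  act d k k' := Functor.curry.obj (exists_coendAct hQ hX d k k').choose
  act_mk d k k' x := Arr.functor_ext fun φ =>
    (Arr.app_curry _ φ.fst (GN X d k x φ.snd.fst φ.snd.snd.proj)).trans
      ((exists_coendAct hQ hX d k k').choose_spec _ _ _ _)

/-- Relabelling of the coends. -/
def relabelF {I J : Type} [Finite I] [Finite J] (e : I ≃ J) {d : I → D} {d' : J → D}
    (h : ∀ i, d' (e i) = d i) (k : K) : coend X d k ⥤ coend X d' k :=
  (exists_relabel hQ hX e h k).choose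

/-- Composition of operations with elements of coends. -/
def mulF {I : Type} [Finite I] {J : I → Type} [∀ i, Finite (J i)] (x : I → K)
    (d : ∀ i, J i → D) (k : K) :
    (Q.Op x k × ∀ i, coend X (d i) (x i)) ⥤ coend X (fun s : Σ i, J i => d s.1 s.2) k :=
  (exists_mul hQ hX x d k).choose

/-- The action of a unary operation on a coend, on arrows. -/
def actE {I : Type} [Finite I] {d : I → D} {k k' : K} (v : Arr (Q.Op (fun _ : Unit => k) k'))
    (w : Arr (coend X d k)) : Arr (coend X d k') :=
  Arr.app (A := coend X d k) (B := coend X d k') (Arr.map ((coendAction hQ hX).act d k k') v) w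

/-- Relabelling of the coends, on arrows. -/
def RL {I J : Type} [Finite I] [Finite J] (e : I ≃ J) {d : I → D} {d' : J → D}
    (h : ∀ i, d' (e i) = d i) {k : K} (w : Arr (coend X d k)) : Arr (coend X d' k) :=
  Arr.map (relabelF hQ hX e h k) w

/-- Composition of operations with elements of coends, on arrows. -/
def ML {I : Type} [Finite I] {J : I → Type} [∀ i, Finite (J i)] {x : I → K} (d : ∀ i, J i → D)
    {k : K} (p : Arr (Q.Op x k)) (w : ∀ i, Arr (coend X (d i) (x i))) :
    Arr (coend X (fun s : Σ i, J i => d s.1 s.2) k) :=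
  Arr.map (mulF hQ hX x d k) (.pair p (.pi w))

theorem actE_GN {I : Type} [Finite I] {d : I → D} {k k' : K}
    (v : Arr (Q.Op (fun _ : Unit => k) k')) (x p z) :
    actE hQ hX v (GN X d k x p z) = GN X d k' x (Q.post v p) z :=
  (Arr.app_curry _ v (GN X d k x p z)).trans ((exists_coendAct hQ hX d k k').choose_spec _ _ _ _)

theorem RL_GN {I J : Type} [Finite I] [Finite J] (e : I ≃ J) {d : I → D} {d' : J → D}
    (h : ∀ i, d' (e i) = d i) {k : K} (x : ∀ j, {c // f c = d' j})
    (p : Arr (Q.Op (fun i => (x (e i)).1) k)) (z : ∀ j, Arr (X.obj (x j).1)) :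
    RL hQ hX e h (GN X d k (fun i => ⟨(x (e i)).1, (x (e i)).2.trans (h i)⟩) p fun i => z (e i)) =
      GN X d' k x (Q.rei e (y := fun j => (x j).1) (fun _ => rfl) p) z :=
  (exists_relabel hQ hX e h k).choose_spec x p z

theorem ML_GN {I : Type} [Finite I] {J : I → Type} [∀ i, Finite (J i)] {x : I → K}
    (d : ∀ i, J i → D) {k : K} (p : Arr (Q.Op x k)) (y : ∀ i j, {c // f c = d i j})
    (q : ∀ i, Arr (Q.Op (fun j => (y i j).1) (x i))) (z : ∀ i j, Arr (X.obj (y i j).1)) :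
    ML hQ hX d p (fun i => GN X (d i) (x i) (y i) (q i) (z i)) =
      GN X (fun s : Σ i, J i => d s.1 s.2) k (fun s => y s.1 s.2)
        (Q.cmp x (fun i j => (y i j).1) k p q) fun s => z s.1 s.2 :=
  (exists_mul hQ hX x d k).choose_spec p y q z

theorem isMap_actE {S : Type*} [Category* S] {I : Type} [Finite I] {d : I → D} {k k' : K}
    {v : Arr S → Arr (Q.Op (fun _ : Unit => k) k')} {w : Arr S → Arr (coend X d k)}
    (hv : IsMap v) (hw : IsMap w) : IsMap fun φ => actE hQ hX (v φ) (w φ) :=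
  (hv.map _).app hw

theorem isMap_RL {S : Type*} [Category* S] {I J : Type} [Finite I] [Finite J] (e : I ≃ J)
    {d : I → D} {d' : J → D} (h : ∀ i, d' (e i) = d i) {k : K} {w : Arr S → Arr (coend X d k)}
    (hw : IsMap w) : IsMap fun φ => RL hQ hX e h (w φ) := hw.map _

theorem isMap_ML {S : Type*} [Category* S] {I : Type} [Finite I] {J : I → Type}
    [∀ i, Finite (J i)] {x : I → K} (d : ∀ i, J i → D) {k : K} {p : Arr S → Arr (Q.Op x k)}
    {w : ∀ i, Arr S → Arr (coend X (d i) (x i))} (hp : IsMap p) (hw : ∀ i, IsMap (w i)) :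
    IsMap fun φ => ML hQ hX d (p φ) fun i => w i φ := (hp.pair (.pi hw)).map _

section

variable {I : Type} [Finite I] {J : I → Type} [∀ i, Finite (J i)]

/-- Composition with operations is balanced: unary operations may act on the operation or on the
coends. -/
theorem ML_pre {x x' : I → K} (d : ∀ i, J i → D) {k : K} (p : Arr (Q.Op x' k))
    (u : ∀ i, Arr (Q.Op (fun _ : Unit => x i) (x' i))) (w : ∀ i, Arr (coend X (d i) (x i))) :
    ML hQ hX d (Q.pre p u) w = ML hQ hX d p fun i => actE hQ hX (u i) (w i) := by
  refine coendPi_ext hQ hX (S := Q.Op x' k × ∀ i, Q.Op (fun _ : Unit => x i) (x' i))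
    (m := fun σ w => ML hQ hX d (Q.pre σ.fst σ.snd.proj) w)
    (n := fun σ w => ML hQ hX d σ.fst fun i => actE hQ hX (σ.snd.proj i) (w i))
    (isMap_ML _ _ _ (isMap_pre IsMap.self.fst.fst fun i => IsMap.self.fst.snd.proj i)
      fun i => IsMap.self.snd.proj i)
    (isMap_ML _ _ _ IsMap.self.fst.fst
      fun i => isMap_actE _ _ (IsMap.self.fst.snd.proj i) (IsMap.self.snd.proj i))
    (fun σ y q z => ?_) (.pair p (.pi u)) w
  refine (ML_GN hQ hX d _ y q z).trans (Eq.trans ?_ (congrArg (ML hQ hX d σ.fst)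
    (funext fun i => actE_GN hQ hX (σ.snd.proj i) (y i) (q i) (z i))).symm)
  refine Eq.trans ?_ (ML_GN hQ hX d σ.fst y _ z).symm
  exact congrArg (fun p => GN X _ k _ p _) (hQ.cmp_pre_left σ.fst σ.snd.proj q)

theorem actE_ML {x : I → K} (d : ∀ i, J i → D) {k k' : K}
    (v : Arr (Q.Op (fun _ : Unit => k) k')) (p : Arr (Q.Op x k))
    (w : ∀ i, Arr (coend X (d i) (x i))) :
    actE hQ hX v (ML hQ hX d p w) = ML hQ hX d (Q.post v p) w := by
  refine coendPi_ext hQ hX (S := Q.Op (fun _ : Unit => k) k' × Q.Op x k)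
    (m := fun σ w => actE hQ hX σ.fst (ML hQ hX d σ.snd w))
    (n := fun σ w => ML hQ hX d (Q.post σ.fst σ.snd) w)
    (isMap_actE _ _ IsMap.self.fst.fst
      (isMap_ML _ _ _ IsMap.self.fst.snd fun i => IsMap.self.snd.proj i))
    (isMap_ML _ _ _ (isMap_post IsMap.self.fst.fst IsMap.self.fst.snd)
      fun i => IsMap.self.snd.proj i)
    (fun σ y q z => ?_) (.pair v p) w
  refine (congrArg (actE hQ hX σ.fst) (ML_GN hQ hX d σ.snd y q z)).trans ?_
  refine (actE_GN hQ hX _ _ _ _).trans (Eq.trans ?_ (ML_GN hQ hX d _ y q z).symm)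
  exact congrArg (fun p => GN X _ k' _ p _) (hQ.post_cmp σ.fst σ.snd q)

end

theorem RL_actE {I J : Type} [Finite I] [Finite J] (e : I ≃ J) {d : I → D} {d' : J → D}
    (h : ∀ i, d' (e i) = d i) {k k' : K} (v : Arr (Q.Op (fun _ : Unit => k) k'))
    (w : Arr (coend X d k)) :
    RL hQ hX e h (actE hQ hX v w) = actE hQ hX v (RL hQ hX e h w) := by
  obtain rfl : d = fun i => d' (e i) := funext fun i => (h i).symm
  refine coend_ext hQ hX (m := fun v w => RL hQ hX e h (actE hQ hX v w))
    (n := fun v w => actE hQ hX v (RL hQ hX e h w))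
    (isMap_RL _ _ _ _ (isMap_actE _ _ IsMap.self.fst IsMap.self.snd))
    (isMap_actE _ _ IsMap.self.fst (isMap_RL _ _ _ _ IsMap.self.snd)) (fun v x p z => ?_) v w
  obtain ⟨x, rfl⟩ := IsPresentation.exists_family e (T := fun j => {c // f c = d' j}) x
  obtain ⟨z, rfl⟩ := IsPresentation.exists_family e (T := fun j => Arr (X.obj (x j).1)) z
  refine (congrArg (RL hQ hX e h) (actE_GN hQ hX v _ p _)).trans ((RL_GN hQ hX e h x _ z).trans ?_)
  refine Eq.trans ?_ ((congrArg (actE hQ hX v) (RL_GN hQ hX e h x p z)).trans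
    (actE_GN hQ hX v _ _ _)).symm
  exact congrArg (fun p => GN X d' k' x p z) (hQ.rei_post e
    (y := fun i => (x (e i)).1) (z := fun j => (x j).1) (fun _ => rfl) v p)

end Condensation

section Condensation

variable {K D : Type u} {Q : OperadData K} {f : K → D} {X : Weight Q f}

open OperadData

variable (hQ : Q.ArrLaws) (hX : X.IsFunctor)

/-- The operations of the condensation with sources `d`, before taking natural transformations. -/
abbrev coendWeight {I : Type} [Finite I] (d : I → D) : Weight Q f := (coendAction hQ hX).weight d

include hQ hX

theorem exists_subst {I : Type} [Finite I] {J : I → Type} [∀ i, Finite (J i)] (d : I → D)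
    (d' : ∀ i, J i → D) (k : K) :
    ∃ F : (∀ i, HomCat (d i) X (coendWeight hQ hX (d' i))) × coend X d k ⥤
        coend X (fun s : Σ i, J i => d' s.1 s.2) k,
      ∀ n (x : ∀ i, {c // f c = d i}) (p : Arr (Q.Op (fun i => (x i).1) k))
        (z : ∀ i, Arr (X.obj (x i).1)),
        Arr.map F (.pair n (GN X d k x p z)) =
          ML hQ hX d' p fun i => cA (n.proj i) (x i) (z i) :=
  coend_lift hQ hX (S := ∀ i, HomCat (d i) X (coendWeight hQ hX (d' i)))
    (fun x n p z => ML hQ hX (x := fun i => (x i).1) d' p fun i => cA (n.proj i) (x i) (z i))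
    (fun x => isMap_ML _ _ _ IsMap.self.snd.fst fun i =>
      isMap_cA (x i) (IsMap.self.fst.proj i) (IsMap.self.snd.snd.proj i))
    fun n x x' p u z => (ML_pre hQ hX (x := fun i => (x i).1) (x' := fun i => (x' i).1) d' p u
      fun i => cA (n.proj i) (x i) (z i)).trans
      (congrArg (ML hQ hX (x := fun i => (x' i).1) d' p)
        (funext fun i => (cA_act (n.proj i) (x i) (x' i) (u i) (z i)).symm))

theorem exists_reindex {I J : Type} [Finite I] [Finite J] (e : I ≃ J) {d : I → D} {d' : J → D}
    (h : ∀ i, d' (e i) = d i) (d₀ : D) :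
    ∃ F : HomCat d₀ X (coendWeight hQ hX d) ⥤ HomCat d₀ X (coendWeight hQ hX d'),
      ∀ m k ζ, cA (Arr.map F m) k ζ = RL hQ hX e h (cA m k ζ) :=
  homCat_lift (Y := coendWeight hQ hX d')
    (fun k (m : Arr (HomCat d₀ X (coendWeight hQ hX d))) ζ => RL hQ hX e h (cA m k ζ))
    (fun k => isMap_RL _ _ _ _ (isMap_cA k IsMap.self.fst IsMap.self.snd))
    fun m k k' u ζ => (congrArg (RL hQ hX e h) (cA_act m k k' u ζ)).trans
      (RL_actE hQ hX e h u (cA m k ζ))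

/-- The identity operations of the condensation. -/
theorem exists_one (d : D) : ∃ m : HomCat d X (coendWeight hQ hX fun _ : Unit => d), ∀ k ζ,
    cA (Arr.id m) k ζ = GN X (fun _ : Unit => d) k.1 (fun _ => k) (Q.idA k.1) fun _ => ζ := by
  obtain ⟨F, hF⟩ := homCat_lift (Y := coendWeight hQ hX fun _ : Unit => d)
    (S := Discrete PUnit.{u + 1})
    (fun k _ ζ => GN X (fun _ : Unit => d) k.1 (fun _ => k) (Q.idA k.1) fun _ => ζ)
    (fun k => isMap_GN _ _ _ (.constId _) fun _ => IsMap.self.snd)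
    fun _ k k' u ζ => by
      refine (GN_pre (fun _ => k) (fun _ => k') (Q.idA k'.1) (fun _ => u) fun _ => ζ).symm.trans ?_
      refine Eq.trans ?_ (actE_GN hQ hX u (fun _ => k) (Q.idA k.1) fun _ => ζ).symm
      exact congrArg (fun p => GN X (fun _ : Unit => d) k'.1 (fun _ => k) p fun _ => ζ)
        ((hQ.pre_idA u).trans (hQ.post_idA u).symm)
  refine ⟨F.obj ⟨⟨⟩⟩, fun k ζ => ?_⟩
  exact (congrArg (fun m => cA m k ζ) (Arr.map_id F ⟨⟨⟩⟩).symm).trans (hF _ k ζ)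

/-- Substitution of natural transformations in a coend. -/
def substF {I : Type} [Finite I] {J : I → Type} [∀ i, Finite (J i)] (d : I → D)
    (d' : ∀ i, J i → D) (k : K) :
    (∀ i, HomCat (d i) X (coendWeight hQ hX (d' i))) × coend X d k ⥤
      coend X (fun s : Σ i, J i => d' s.1 s.2) k :=
  (exists_subst hQ hX d d' k).choose

/-- Substitution of natural transformations in a coend, on arrows. -/
def SB {I : Type} [Finite I] {J : I → Type} [∀ i, Finite (J i)] {d : I → D}
    {d' : ∀ i, J i → D} {k : K} (n : ∀ i, Arr (HomCat (d i) X (coendWeight hQ hX (d' i))))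
    (w : Arr (coend X d k)) : Arr (coend X (fun s : Σ i, J i => d' s.1 s.2) k) :=
  Arr.map (substF hQ hX d d' k) (.pair (.pi n) w)

theorem isMap_SB {S : Type*} [Category* S] {I : Type} [Finite I] {J : I → Type}
    [∀ i, Finite (J i)] {d : I → D} {d' : ∀ i, J i → D} {k : K}
    {n : ∀ i, Arr S → Arr (HomCat (d i) X (coendWeight hQ hX (d' i)))}
    {w : Arr S → Arr (coend X d k)} (hn : ∀ i, IsMap (n i)) (hw : IsMap w) :
    IsMap fun φ => SB hQ hX (fun i => n i φ) (w φ) := ((IsMap.pi hn).pair hw).map _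

section

variable {I : Type} [Finite I] {J : I → Type} [∀ i, Finite (J i)]

theorem SB_GN {d : I → D} {d' : ∀ i, J i → D} {k : K}
    (n : ∀ i, Arr (HomCat (d i) X (coendWeight hQ hX (d' i)))) (x : ∀ i, {c // f c = d i})
    (p : Arr (Q.Op (fun i => (x i).1) k)) (z : ∀ i, Arr (X.obj (x i).1)) :
    SB hQ hX n (GN X d k x p z) =
      ML hQ hX (x := fun i => (x i).1) d' p fun i => cA (n i) (x i) (z i) :=
  (exists_subst hQ hX d d' k).choose_spec (.pi n) x p z

theorem SB_actE {d : I → D} {d' : ∀ i, J i → D} {k k' : K}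
    (n : ∀ i, Arr (HomCat (d i) X (coendWeight hQ hX (d' i))))
    (v : Arr (Q.Op (fun _ : Unit => k) k')) (w : Arr (coend X d k)) :
    SB hQ hX n (actE hQ hX v w) = actE hQ hX v (SB hQ hX n w) := by
  refine coend_ext hQ hX (S := (∀ i, HomCat (d i) X (coendWeight hQ hX (d' i))) ×
      Q.Op (fun _ : Unit => k) k')
    (m := fun σ w => SB hQ hX σ.fst.proj (actE hQ hX σ.snd w))
    (n := fun σ w => actE hQ hX σ.snd (SB hQ hX σ.fst.proj w))
    (isMap_SB _ _ (fun i => IsMap.self.fst.fst.proj i)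
      (isMap_actE _ _ IsMap.self.fst.snd IsMap.self.snd))
    (isMap_actE _ _ IsMap.self.fst.snd
      (isMap_SB _ _ (fun i => IsMap.self.fst.fst.proj i) IsMap.self.snd))
    (fun σ x p z => ?_) (.pair (.pi n) v) w
  refine (congrArg (SB hQ hX σ.fst.proj) (actE_GN hQ hX σ.snd x p z)).trans ?_
  refine (SB_GN hQ hX _ x _ z).trans (Eq.trans ?_ (congrArg (actE hQ hX σ.snd)
    (SB_GN hQ hX σ.fst.proj x p z)).symm)
  exact (actE_ML hQ hX (x := fun i => (x i).1) d' σ.snd p _).symm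

theorem exists_comp (d : I → D) (d' : ∀ i, J i → D) (d₀ : D) :
    ∃ F : (HomCat d₀ X (coendWeight hQ hX d) × ∀ i, HomCat (d i) X (coendWeight hQ hX (d' i))) ⥤
        HomCat d₀ X (coendWeight hQ hX fun s : Σ i, J i => d' s.1 s.2),
      ∀ m k ζ, cA (Arr.map F m) k ζ = SB hQ hX m.snd.proj (cA m.fst k ζ) :=
  homCat_lift (Y := coendWeight hQ hX fun s : Σ i, J i => d' s.1 s.2)
    (fun k (m : Arr (HomCat d₀ X (coendWeight hQ hX d) ×
      ∀ i, HomCat (d i) X (coendWeight hQ hX (d' i)))) ζ => SB hQ hX m.snd.proj (cA m.fst k ζ))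
    (fun k => isMap_SB _ _ (fun i => IsMap.self.fst.snd.proj i)
      (isMap_cA k IsMap.self.fst.fst IsMap.self.snd))
    fun m k k' u ζ => (congrArg (SB hQ hX m.snd.proj) (cA_act m.fst k k' u ζ)).trans
      (SB_actE hQ hX m.snd.proj u (cA m.fst k ζ))

end

/-- The condensation of an operad along a function between colours. -/
def condensation : Condensation X where
  toCoendAction := coendAction hQ hX
  one d := (exists_one hQ hX d).choose
  one_component d k := Arr.functor_ext fun ζ => by
    refine Eq.trans ?_ ((exists_one hQ hX d).choose_spec k ζ)
    refine (Arr.app_id (A := X.obj k.1) (B := coend X (fun _ : Unit => d) k.1) _ ζ).symm.trans ?_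
    exact congrArg (fun w => Arr.app (A := X.obj k.1) (B := coend X (fun _ : Unit => d) k.1) w ζ)
      (Arr.map_id (component X (coendWeight hQ hX fun _ : Unit => d) k) _).symm
  relabel e _ _ h k := relabelF hQ hX e h k
  relabel_mk e d d' h k x := Arr.functor_ext fun φ => RL_GN hQ hX e h x φ.fst φ.snd.proj
  reindex e _ _ h d₀ := (exists_reindex hQ hX e h d₀).choose
  reindex_component e d d' h d₀ k := by
    refine Arr.functor_ext₂ fun m ζ => ((exists_reindex hQ hX e h d₀).choose_spec m k ζ).trans ?_
    exact (Arr.app_whiskeringRight (relabelF hQ hX e h k.1)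
      (Arr.map (component X (coendWeight hQ hX d) k) m) ζ).symm
  mul x d k := mulF hQ hX x d k
  mul_mk x d k y := Arr.functor_ext fun φ => ML_GN hQ hX d φ.fst y
    (fun i => (φ.snd.proj i).fst) fun i => (φ.snd.proj i).snd.proj
  subst d d' k := Functor.curry.obj (substF hQ hX d d' k)
  subst_mk d d' k x := Arr.functor_ext fun φ =>
    (Arr.app_curry (substF hQ hX d d' k) φ.fst (GN X d k x φ.snd.fst φ.snd.snd.proj)).trans
      (SB_GN hQ hX φ.fst.proj x φ.snd.fst φ.snd.snd.proj)
  comp d d' d₀ := (exists_comp hQ hX d d' d₀).choose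
  comp_component {I _ J _} d d' d₀ k := by
    refine Arr.functor_ext₂ fun m ζ => ((exists_comp hQ hX d d' d₀).choose_spec m k ζ).trans ?_
    refine (Arr.app_curry (substF hQ hX d d' k.1) m.snd (cA m.fst k ζ)).symm.trans ?_
    have e := Arr.app_app_whiskeringLeft (Arr.map (component X (coendWeight hQ hX d) k) m.fst)
      (Arr.map (Functor.curry.obj (substF hQ hX d d' k.1)) m.snd) ζ
    exact e.symm

theorem cA_one (d : D) (k : {k // f k = d}) (ζ : Arr (X.obj k.1)) :
    cA ((condensation hQ hX).operad.idA d) k ζ =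
      GN X (fun _ : Unit => d) k.1 (fun _ => k) (Q.idA k.1) fun _ => ζ :=
  (exists_one hQ hX d).choose_spec k ζ

theorem cA_rei {I J : Type} [Finite I] [Finite J] (e : I ≃ J) {d : I → D} {d' : J → D}
    (h : ∀ i, d' (e i) = d i) {d₀ : D} (m : Arr ((condensation hQ hX).operad.Op d d₀)) (k) (ζ) :
    cA (Y := coendWeight hQ hX d') ((condensation hQ hX).operad.rei e h m) k ζ =
      RL hQ hX e h (cA (Y := coendWeight hQ hX d) m k ζ) :=
  (exists_reindex hQ hX e h d₀).choose_spec m k ζ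

theorem cA_cmp {I : Type} [Finite I] {J : I → Type} [∀ i, Finite (J i)] (d : I → D)
    (d' : ∀ i, J i → D) (d₀ : D) (m : Arr ((condensation hQ hX).operad.Op d d₀))
    (n : ∀ i, Arr ((condensation hQ hX).operad.Op (d' i) (d i))) (k) (ζ) :
    cA (Y := coendWeight hQ hX fun s : Σ i, J i => d' s.1 s.2)
      ((condensation hQ hX).operad.cmp d d' d₀ m n) k ζ =
      SB hQ hX n (cA (Y := coendWeight hQ hX d) m k ζ) :=
  (exists_comp hQ hX d d' d₀).choose_spec (.pair m (.pi n)) k ζ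

end Condensation

/-! ### The axioms of an operad for the condensation -/

section Condensation

variable {K D : Type u} {Q : OperadData K} {f : K → D} {X : Weight Q f}

open OperadData

/-- Maps into a category of natural transformations are determined by the components. -/
theorem homCat_ext_isMap {Y : Weight Q f} {d : D} {S : Type u} [Category.{u} S]
    {m n : Arr S → Arr (HomCat d X Y)} (hm : IsMap m) (hn : IsMap n)
    (h : ∀ σ k ζ, cA (m σ) k ζ = cA (n σ) k ζ) (σ : Arr S) : m σ = n σ := by
  obtain ⟨F, hF⟩ := hm
  obtain ⟨G, hG⟩ := hn
  have e : F = G := homCat_ext fun σ k ζ => by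
    rw [← hF, ← hG]
    exact h σ k ζ
  rw [hF, hG, e]

variable (hQ : Q.ArrLaws) (hX : X.IsFunctor)
include hQ hX

theorem RL_refl {I : Type} [Finite I] {d : I → D} {k : K} (w : Arr (coend X d k)) :
    RL hQ hX (Equiv.refl I) (fun _ => rfl) w = w := by
  refine coend_ext₁ (hQ := hQ) (hX := hX) (m := fun w => RL hQ hX (Equiv.refl I) (fun _ => rfl) w)
    (n := fun w => w) (isMap_RL _ _ _ _ IsMap.self) IsMap.self (fun x p z => ?_) w
  refine (RL_GN hQ hX (Equiv.refl I) (fun _ => rfl) x p z).trans ?_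
  exact congrArg (fun p => GN X d k x p z) (hQ.rei_refl (fun i => (x i).1) k p)

theorem RL_RL {I J L : Type} [Finite I] [Finite J] [Finite L] (e : I ≃ J) (e' : J ≃ L) {d : I → D}
    {d' : J → D} {d'' : L → D} (h : ∀ i, d' (e i) = d i) (h' : ∀ j, d'' (e' j) = d' j) {k : K}
    (w : Arr (coend X d k)) : RL hQ hX e' h' (RL hQ hX e h w) =
      RL hQ hX (e.trans e') (fun i => (h' (e i)).trans (h i)) w := by
  obtain rfl : d' = fun j => d'' (e' j) := funext fun i => (h' i).symm
  obtain rfl : d = fun i => d'' (e' (e i)) := funext fun i => (h i).symm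
  refine coend_ext₁ (hQ := hQ) (hX := hX) (m := fun w => RL hQ hX e' h' (RL hQ hX e h w))
    (n := fun w => RL hQ hX (e.trans e') (fun i => (h' (e i)).trans (h i)) w)
    (isMap_RL _ _ _ _ (isMap_RL _ _ _ _ IsMap.self)) (isMap_RL _ _ _ _ IsMap.self)
    (fun x p z => ?_) w
  obtain ⟨x, rfl⟩ := IsPresentation.exists_family (e.trans e') (T := fun j => {c // f c = d'' j}) x
  obtain ⟨z, rfl⟩ := IsPresentation.exists_family (e.trans e')
    (T := fun j => Arr (X.obj (x j).1)) z
  refine (congrArg (RL hQ hX e' h') (RL_GN hQ hX e h (fun j => x (e' j)) p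
    fun j => z (e' j))).trans ?_
  refine (RL_GN hQ hX e' h' x _ z).trans (Eq.trans ?_ (RL_GN hQ hX (e.trans e') _ x p z).symm)
  exact congrArg (fun p => GN X d'' k x p z) (hQ.rei_rei e e' (x := fun i => (x (e' (e i))).1)
    (y := fun j => (x (e' j)).1) (z := fun l => (x l).1) (fun _ => rfl) (fun _ => rfl) k p)

section

variable {I : Type} [Finite I] {J : I → Type} [∀ i, Finite (J i)]

theorem ML_RL {J' : I → Type} [∀ i, Finite (J' i)] (e : ∀ i, J i ≃ J' i) {x : I → K}
    {d : ∀ i, J i → D} {d' : ∀ i, J' i → D} (h : ∀ i j, d' i (e i j) = d i j) {k : K}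
    (p : Arr (Q.Op x k)) (w : ∀ i, Arr (coend X (d i) (x i))) :
    ML hQ hX d' p (fun i => RL hQ hX (e i) (h i) (w i)) =
      RL hQ hX (d' := fun s : Σ i, J' i => d' s.1 s.2) (Equiv.sigmaCongrRight e)
        (fun s => h s.1 s.2) (ML hQ hX d p w) := by
  obtain rfl : d = fun i j => d' i (e i j) := funext₂ fun i j => (h i j).symm
  refine coendPi_ext hQ hX (S := Q.Op x k)
    (m := fun p w => ML hQ hX d' p (fun i => RL hQ hX (e i) (h i) (w i)))
    (n := fun p w => RL hQ hX (d' := fun s : Σ i, J' i => d' s.1 s.2) (Equiv.sigmaCongrRight e)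
        (fun s => h s.1 s.2) (ML hQ hX (fun i j => d' i (e i j)) p w))
    (isMap_ML _ _ _ IsMap.self.fst fun i => isMap_RL _ _ _ _ (IsMap.self.snd.proj i))
    (isMap_RL _ _ _ _ (isMap_ML _ _ _ IsMap.self.fst fun i => IsMap.self.snd.proj i))
    (fun p y q z => ?_) p w
  choose y' hy using fun i => IsPresentation.exists_family (e i)
    (T := fun j => {c // f c = d' i j}) (y i)
  obtain rfl : y = fun i j => y' i (e i j) := funext hy
  choose z' hz using fun i => IsPresentation.exists_family (e i)
    (T := fun j => Arr (X.obj (y' i j).1)) (z i)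
  obtain rfl : z = fun i j => z' i (e i j) := funext hz
  refine (congrArg (ML hQ hX d' p) (funext fun i => RL_GN hQ hX (e i) (h i) (y' i) (q i)
    (z' i))).trans ?_
  refine (ML_GN hQ hX d' p y' _ z').trans ?_
  refine Eq.trans ?_ (congrArg (RL hQ hX (d' := fun s : Σ i, J' i => d' s.1 s.2)
    (Equiv.sigmaCongrRight e) (fun s => h s.1 s.2)) (ML_GN hQ hX _ p _ q _)).symm
  refine Eq.trans ?_ (RL_GN hQ hX (d' := fun s : Σ i, J' i => d' s.1 s.2) (Equiv.sigmaCongrRight e)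
    (fun s => h s.1 s.2) (fun s => y' s.1 s.2) _ fun s => z' s.1 s.2).symm
  exact congrArg (fun p => GN X (fun s : Σ i, J' i => d' s.1 s.2) k (fun s => y' s.1 s.2) p
    fun s => z' s.1 s.2) (hQ.cmp_rei e x (y := fun i j => (y' i (e i j)).1)
      (y' := fun i j => (y' i j).1) (fun _ _ => rfl) k p q)

theorem ML_rei {I' : Type} [Finite I'] (e : I' ≃ I) {x : I → K} (d : ∀ i, J i → D) {k : K}
    (p : Arr (Q.Op (fun i => x (e i)) k)) (w : ∀ i, Arr (coend X (d i) (x i))) :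
    ML hQ hX d (Q.rei e (y := x) (fun _ => rfl) p) w =
      RL hQ hX (d' := fun s : Σ i, J i => d s.1 s.2) (Equiv.sigmaCongrLeft e) (fun _ => rfl)
        (ML hQ hX (fun i => d (e i)) p fun i => w (e i)) := by
  refine coendPi_ext hQ hX (S := Q.Op (fun i => x (e i)) k)
    (m := fun p w => ML hQ hX d (Q.rei e (y := x) (fun _ => rfl) p) w)
    (n := fun p w => RL hQ hX (d' := fun s : Σ i, J i => d s.1 s.2) (Equiv.sigmaCongrLeft e)
        (fun _ => rfl) (ML hQ hX (fun i => d (e i)) p fun i => w (e i)))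
    (isMap_ML _ _ _ (isMap_rei _ _ IsMap.self.fst) fun i => IsMap.self.snd.proj i)
    (isMap_RL _ _ _ _ (isMap_ML _ _ _ IsMap.self.fst fun i => IsMap.self.snd.proj (e i)))
    (fun p y q z => ?_) p w
  refine (ML_GN hQ hX d _ y q z).trans (Eq.trans ?_ (congrArg
    (RL hQ hX (d' := fun s : Σ i, J i => d s.1 s.2) (Equiv.sigmaCongrLeft e) fun _ => rfl)
      (ML_GN hQ hX (x := fun i => x (e i)) (fun i => d (e i)) p (fun i => y (e i))
        (fun i => q (e i)) fun i => z (e i))).symm)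
  refine Eq.trans ?_ (RL_GN hQ hX (d' := fun s : Σ i, J i => d s.1 s.2) (Equiv.sigmaCongrLeft e)
    (fun _ => rfl) (fun s => y s.1 s.2) _ fun s => z s.1 s.2).symm
  exact congrArg (fun p => GN X (fun s : Σ i, J i => d s.1 s.2) k (fun s => y s.1 s.2) p
    fun s => z s.1 s.2) (hQ.rei_cmp e x (fun i j => (y i j).1) k p q)

theorem ML_one {J : Type} [Finite J] {d : J → D} {k : K} (w : Arr (coend X d k)) :
    RL hQ hX (d' := d) (Equiv.uniqueSigma fun _ : Unit => J) (fun _ => rfl)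
      (ML hQ hX (fun _ : Unit => d) (Q.idA k) fun _ => w) = w := by
  refine coend_ext₁ (hQ := hQ) (hX := hX)
    (m := fun w => RL hQ hX (d' := d) (Equiv.uniqueSigma fun _ : Unit => J) (fun _ => rfl)
      (ML hQ hX (fun _ : Unit => d) (Q.idA k) fun _ => w)) (n := fun w => w)
    (isMap_RL _ _ _ _ (isMap_ML _ _ _ (.constId _) fun _ => IsMap.self)) IsMap.self
    (fun x p z => ?_) w
  refine (congrArg (RL hQ hX (d' := d) (Equiv.uniqueSigma fun _ : Unit => J) fun _ => rfl)
    (ML_GN hQ hX (fun _ : Unit => d) (Q.idA k) (fun _ => x) (fun _ => p) fun _ => z)).trans ?_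
  refine (RL_GN hQ hX (d' := d) (Equiv.uniqueSigma fun _ : Unit => J) (fun _ => rfl) x _ z).trans ?_
  exact congrArg (fun p => GN X d k x p z) (hQ.one_cmp (fun j => (x j).1) k p)

theorem ML_cmp {L : ∀ i, J i → Type} [∀ i j, Finite (L i j)] {x : I → K} {y : ∀ i, J i → K}
    (d : ∀ i j, L i j → D) {k : K} (p : Arr (Q.Op x k)) (q : ∀ i, Arr (Q.Op (y i) (x i)))
    (w : ∀ s : Σ i, J i, Arr (coend X (d s.1 s.2) (y s.1 s.2))) :
    RL hQ hX (d' := fun s : Σ i, Σ j, L i j => d s.1 s.2.1 s.2.2) (Equiv.sigmaAssoc L)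
      (fun _ => rfl) (ML hQ hX (x := fun s : Σ i, J i => y s.1 s.2) (fun s => d s.1 s.2)
        (Q.cmp x y k p q) w) =
      ML hQ hX (fun i (t : Σ j, L i j) => d i t.1 t.2) p
        fun i => ML hQ hX (d i) (q i) fun j => w ⟨i, j⟩ := by
  refine coendPi_ext hQ hX (S := Q.Op x k × ∀ i, Q.Op (y i) (x i))
    (d := fun s : Σ i, J i => d s.1 s.2) (k := fun s : Σ i, J i => y s.1 s.2)
    (m := fun σ w => RL hQ hX (d' := fun s : Σ i, Σ j, L i j => d s.1 s.2.1 s.2.2)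
      (Equiv.sigmaAssoc L) (fun _ => rfl) (ML hQ hX (x := fun s : Σ i, J i => y s.1 s.2)
        (fun s => d s.1 s.2) (Q.cmp x y k σ.fst σ.snd.proj) w))
    (n := fun σ w => ML hQ hX (fun i (t : Σ j, L i j) => d i t.1 t.2) σ.fst
        fun i => ML hQ hX (d i) (σ.snd.proj i) fun j => w ⟨i, j⟩)
    (isMap_RL _ _ _ _ (isMap_ML _ _ _
      (isMap_cmp _ _ _ IsMap.self.fst.fst fun i => IsMap.self.fst.snd.proj i)
      fun s => IsMap.self.snd.proj s))
    (isMap_ML _ _ _ IsMap.self.fst.fst fun i => isMap_ML _ _ _ (IsMap.self.fst.snd.proj i)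
      fun j => IsMap.self.snd.proj (⟨i, j⟩ : Σ i, J i))
    (fun σ a r z => ?_) (.pair p (.pi q)) w
  refine (congrArg (RL hQ hX (d' := fun s : Σ i, Σ j, L i j => d s.1 s.2.1 s.2.2)
    (Equiv.sigmaAssoc L) fun _ => rfl) (ML_GN hQ hX (x := fun s : Σ i, J i => y s.1 s.2)
      (fun s => d s.1 s.2) (Q.cmp x y k σ.fst σ.snd.proj) a r z)).trans ?_
  refine (RL_GN hQ hX (d' := fun s : Σ i, Σ j, L i j => d s.1 s.2.1 s.2.2) (Equiv.sigmaAssoc L)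
    (fun _ => rfl) (fun s => a ⟨s.1, s.2.1⟩ s.2.2) _ fun s => z ⟨s.1, s.2.1⟩ s.2.2).trans ?_
  refine Eq.trans ?_ (congrArg (ML hQ hX (fun i (t : Σ j, L i j) => d i t.1 t.2) σ.fst)
    (funext fun i => ML_GN hQ hX (d i) (σ.snd.proj i) (fun j => a ⟨i, j⟩) (fun j => r ⟨i, j⟩)
      fun j => z ⟨i, j⟩)).symm
  refine Eq.trans ?_ (ML_GN hQ hX (fun i (t : Σ j, L i j) => d i t.1 t.2) σ.fst
    (fun i t => a ⟨i, t.1⟩ t.2) _ fun i t => z ⟨i, t.1⟩ t.2).symm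
  exact congrArg (fun p => GN X (fun s : Σ i, Σ j, L i j => d s.1 s.2.1 s.2.2) k
    (fun s => a ⟨s.1, s.2.1⟩ s.2.2) p fun s => z ⟨s.1, s.2.1⟩ s.2.2)
    (hQ.assoc x y (fun i j l => (a ⟨i, j⟩ l).1) k σ.fst σ.snd.proj fun i j => r ⟨i, j⟩)

end

section

variable {I : Type} [Finite I] {J : I → Type} [∀ i, Finite (J i)]

theorem SB_RL {I' : Type} [Finite I'] (e : I' ≃ I) {d : I → D} {d' : ∀ i, J i → D} {k : K}
    (n : ∀ i, Arr (HomCat (d i) X (coendWeight hQ hX (d' i))))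
    (w : Arr (coend X (fun i => d (e i)) k)) :
    SB hQ hX n (RL hQ hX (d' := d) e (fun _ => rfl) w) =
      RL hQ hX (d' := fun s : Σ i, J i => d' s.1 s.2) (Equiv.sigmaCongrLeft e) (fun _ => rfl)
        (SB hQ hX (fun i => n (e i)) w) := by
  refine coend_ext hQ hX (S := ∀ i, HomCat (d i) X (coendWeight hQ hX (d' i)))
    (m := fun σ w => SB hQ hX σ.proj (RL hQ hX (d' := d) e (fun _ => rfl) w))
    (n := fun σ w => RL hQ hX (d' := fun s : Σ i, J i => d' s.1 s.2) (Equiv.sigmaCongrLeft e)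
      (fun _ => rfl) (SB hQ hX (fun i => σ.proj (e i)) w))
    (isMap_SB _ _ (fun i => IsMap.self.fst.proj i) (isMap_RL _ _ _ _ IsMap.self.snd))
    (isMap_RL _ _ _ _ (isMap_SB _ _ (fun i => IsMap.self.fst.proj (e i)) IsMap.self.snd))
    (fun σ x p z => ?_) (.pi n) w
  obtain ⟨x, rfl⟩ := IsPresentation.exists_family e (T := fun j => {c // f c = d j}) x
  obtain ⟨z, rfl⟩ := IsPresentation.exists_family e (T := fun j => Arr (X.obj (x j).1)) z
  refine (congrArg (SB hQ hX σ.proj) (RL_GN hQ hX e (fun _ => rfl) x p z)).trans ?_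
  refine (SB_GN hQ hX σ.proj x _ z).trans ?_
  refine (ML_rei hQ hX e (x := fun i => (x i).1) d' p fun i => cA (σ.proj i) (x i) (z i)).trans ?_
  exact congrArg (RL hQ hX (d' := fun s : Σ i, J i => d' s.1 s.2) (Equiv.sigmaCongrLeft e)
    fun _ => rfl) (SB_GN hQ hX (fun i => σ.proj (e i)) (fun i => x (e i)) p fun i => z (e i)).symm

theorem SB_rei {J' : I → Type} [∀ i, Finite (J' i)] (e : ∀ i, J i ≃ J' i) {d : I → D}
    {d' : ∀ i, J i → D} {d'' : ∀ i, J' i → D} (h : ∀ i j, d'' i (e i j) = d' i j) {k : K}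
    (n : ∀ i, Arr ((condensation hQ hX).operad.Op (d' i) (d i))) (w : Arr (coend X d k)) :
    SB hQ hX (d' := d'') (fun i => (condensation hQ hX).operad.rei (e i) (h i) (n i)) w =
      RL hQ hX (d' := fun s : Σ i, J' i => d'' s.1 s.2) (Equiv.sigmaCongrRight e)
        (fun s => h s.1 s.2) (SB hQ hX (d' := d') n w) := by
  refine coend_ext hQ hX (S := ∀ i, (condensation hQ hX).operad.Op (d' i) (d i))
    (m := fun σ w => SB hQ hX (d' := d'')
      (fun i => (condensation hQ hX).operad.rei (e i) (h i) (σ.proj i)) w)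
    (n := fun σ w => RL hQ hX (d' := fun s : Σ i, J' i => d'' s.1 s.2) (Equiv.sigmaCongrRight e)
      (fun s => h s.1 s.2) (SB hQ hX (d' := d') σ.proj w))
    (isMap_SB _ _ (fun i => isMap_rei _ _ (IsMap.self.fst.proj i)) IsMap.self.snd)
    (isMap_RL _ _ _ _ (isMap_SB _ _ (fun i => IsMap.self.fst.proj i) IsMap.self.snd))
    (fun σ x p z => ?_) (.pi n) w
  refine (SB_GN hQ hX (d' := d'') _ x p z).trans ?_
  refine (congrArg (ML hQ hX (x := fun i => (x i).1) d'' p) (funext fun i =>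
    cA_rei hQ hX (e i) (h i) (σ.proj i) (x i) (z i))).trans ?_
  refine (ML_RL hQ hX e (x := fun i => (x i).1) h p _).trans ?_
  exact congrArg (RL hQ hX (d' := fun s : Σ i, J' i => d'' s.1 s.2) (Equiv.sigmaCongrRight e)
    fun s => h s.1 s.2) (SB_GN hQ hX (d' := d') σ.proj x p z).symm

/-- The identity operations are neutral for substitution in coends. -/
theorem SB_one {d : I → D} {k : K} (w : Arr (coend X d k)) :
    RL hQ hX (d' := d) (Equiv.sigmaUnique I fun _ => Unit) (fun _ => rfl)
      (SB hQ hX (d' := fun i (_ : Unit) => d i)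
        (fun i => (condensation hQ hX).operad.idA (d i)) w) = w := by
  refine coend_ext₁ (hQ := hQ) (hX := hX)
    (m := fun w => RL hQ hX (d' := d) (Equiv.sigmaUnique I fun _ => Unit) (fun _ => rfl)
      (SB hQ hX (d' := fun i (_ : Unit) => d i)
        (fun i => (condensation hQ hX).operad.idA (d i)) w)) (n := fun w => w)
    (isMap_RL _ _ _ _ (isMap_SB _ _ (fun i => .constId _) IsMap.self)) IsMap.self
    (fun x p z => ?_) w
  refine (congrArg (RL hQ hX (d' := d) (Equiv.sigmaUnique I fun _ => Unit) fun _ => rfl)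
    ((SB_GN hQ hX (d' := fun i (_ : Unit) => d i) _ x p z).trans ((congrArg
      (ML hQ hX (x := fun i => (x i).1) (fun i (_ : Unit) => d i) p) (funext fun i =>
        cA_one hQ hX (d i) (x i) (z i))).trans (ML_GN hQ hX (x := fun i => (x i).1)
          (fun i (_ : Unit) => d i) p (fun i _ => x i) (fun i => Q.idA (x i).1)
            fun i _ => z i)))).trans ?_
  refine (RL_GN hQ hX (d' := d) (Equiv.sigmaUnique I fun _ => Unit) (fun _ => rfl) x _ z).trans ?_
  exact congrArg (fun p => GN X d k x p z) (hQ.cmp_one (fun i => (x i).1) k p)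

theorem SB_ML {L : ∀ i, J i → Type} [∀ i j, Finite (L i j)] {x : I → K} {d : ∀ i, J i → D}
    {d' : ∀ i j, L i j → D} {k : K}
    (r : ∀ i j, Arr (HomCat (d i j) X (coendWeight hQ hX (d' i j)))) (p : Arr (Q.Op x k))
    (w : ∀ i, Arr (coend X (d i) (x i))) :
    RL hQ hX (d' := fun s : Σ i, Σ j, L i j => d' s.1 s.2.1 s.2.2) (Equiv.sigmaAssoc L)
      (fun _ => rfl) (SB hQ hX (d := fun s : Σ i, J i => d s.1 s.2) (d' := fun s => d' s.1 s.2)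
        (fun s => r s.1 s.2) (ML hQ hX d p w)) =
      ML hQ hX (fun i (t : Σ j, L i j) => d' i t.1 t.2) p fun i => SB hQ hX (r i) (w i) := by
  refine coendPi_ext hQ hX
    (S := (∀ i j, HomCat (d i j) X (coendWeight hQ hX (d' i j))) × Q.Op x k)
    (m := fun σ w => RL hQ hX (d' := fun s : Σ i, Σ j, L i j => d' s.1 s.2.1 s.2.2)
      (Equiv.sigmaAssoc L) (fun _ => rfl) (SB hQ hX (d := fun s : Σ i, J i => d s.1 s.2)
        (d' := fun s => d' s.1 s.2) (fun s => (σ.fst.proj s.1).proj s.2) (ML hQ hX d σ.snd w)))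
    (n := fun σ w => ML hQ hX (fun i (t : Σ j, L i j) => d' i t.1 t.2) σ.snd
      fun i => SB hQ hX (σ.fst.proj i).proj (w i))
    (isMap_RL _ _ _ _ (isMap_SB _ _ (fun s => (IsMap.self.fst.fst.proj s.1).proj s.2)
      (isMap_ML _ _ _ IsMap.self.fst.snd fun i => IsMap.self.snd.proj i)))
    (isMap_ML _ _ _ IsMap.self.fst.snd fun i => isMap_SB _ _
      (fun j => (IsMap.self.fst.fst.proj i).proj j) (IsMap.self.snd.proj i))
    (fun σ y q z => ?_) (.pair (.pi fun i => .pi (r i)) p) w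
  refine (congrArg (RL hQ hX (d' := fun s : Σ i, Σ j, L i j => d' s.1 s.2.1 s.2.2)
    (Equiv.sigmaAssoc L) fun _ => rfl) ((congrArg (SB hQ hX (d := fun s : Σ i, J i => d s.1 s.2)
        (d' := fun s => d' s.1 s.2) fun s => (σ.fst.proj s.1).proj s.2)
          (ML_GN hQ hX d σ.snd y q z)).trans (SB_GN hQ hX (d := fun s : Σ i, J i => d s.1 s.2)
        (d' := fun s => d' s.1 s.2) (fun s => (σ.fst.proj s.1).proj s.2)
          (fun s => y s.1 s.2) _ fun s => z s.1 s.2))).trans ?_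
  refine (ML_cmp hQ hX d' σ.snd q (y := fun i j => (y i j).1) fun s =>
    cA ((σ.fst.proj s.1).proj s.2) (y s.1 s.2) (z s.1 s.2)).trans ?_
  exact congrArg (ML hQ hX (fun i (t : Σ j, L i j) => d' i t.1 t.2) σ.snd) (funext fun i =>
    (SB_GN hQ hX (σ.fst.proj i).proj (y i) (q i) (z i)).symm)

/-- Associativity of substitution, the component form of associativity in the condensation. -/
theorem SB_SB {L : ∀ i, J i → Type} [∀ i j, Finite (L i j)] {d : I → D} {d' : ∀ i, J i → D}
    {d'' : ∀ i j, L i j → D} {k : K}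
    (q : ∀ i, Arr ((condensation hQ hX).operad.Op (d' i) (d i)))
    (r : ∀ i j, Arr ((condensation hQ hX).operad.Op (d'' i j) (d' i j))) (w : Arr (coend X d k)) :
    RL hQ hX (d' := fun s : Σ i, Σ j, L i j => d'' s.1 s.2.1 s.2.2) (Equiv.sigmaAssoc L)
      (fun _ => rfl) (SB hQ hX (d := fun s : Σ i, J i => d' s.1 s.2) (d' := fun s => d'' s.1 s.2)
        (fun s => r s.1 s.2) (SB hQ hX (d' := d') q w)) =
      SB hQ hX (d' := fun i (t : Σ j, L i j) => d'' i t.1 t.2)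
        (fun i => (condensation hQ hX).operad.cmp (d' i) (d'' i) (d i) (q i) (r i)) w := by
  refine coend_ext hQ hX (S := (∀ i, (condensation hQ hX).operad.Op (d' i) (d i)) ×
      ∀ i j, (condensation hQ hX).operad.Op (d'' i j) (d' i j))
    (m := fun σ w => RL hQ hX (d' := fun s : Σ i, Σ j, L i j => d'' s.1 s.2.1 s.2.2)
      (Equiv.sigmaAssoc L) (fun _ => rfl) (SB hQ hX (d := fun s : Σ i, J i => d' s.1 s.2)
        (d' := fun s => d'' s.1 s.2) (fun s => (σ.snd.proj s.1).proj s.2)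
          (SB hQ hX (d' := d') σ.fst.proj w)))
    (n := fun σ w => SB hQ hX (d' := fun i (t : Σ j, L i j) => d'' i t.1 t.2)
      (fun i => (condensation hQ hX).operad.cmp (d' i) (d'' i) (d i) (σ.fst.proj i)
        (σ.snd.proj i).proj) w)
    (isMap_RL _ _ _ _ (isMap_SB _ _ (fun s => (IsMap.self.fst.snd.proj s.1).proj s.2)
      (isMap_SB _ _ (fun i => IsMap.self.fst.fst.proj i) IsMap.self.snd)))
    (isMap_SB _ _ (fun i => isMap_cmp _ _ _ (IsMap.self.fst.fst.proj i)
      fun j => (IsMap.self.fst.snd.proj i).proj j) IsMap.self.snd)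
    (fun σ x p z => ?_) (.pair (.pi q) (.pi fun i => .pi (r i))) w
  refine (congrArg (fun w => RL hQ hX (d' := fun s : Σ i, Σ j, L i j => d'' s.1 s.2.1 s.2.2)
    (Equiv.sigmaAssoc L) (fun _ => rfl) (SB hQ hX (d := fun s : Σ i, J i => d' s.1 s.2)
        (d' := fun s => d'' s.1 s.2) (fun s => (σ.snd.proj s.1).proj s.2) w))
          (SB_GN hQ hX (d' := d') σ.fst.proj x p z)).trans ?_
  refine (SB_ML hQ hX (fun i j => (σ.snd.proj i).proj j) (x := fun i => (x i).1) p
    fun i => cA (Y := coendWeight hQ hX (d' i)) (σ.fst.proj i) (x i) (z i)).trans ?_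
  refine Eq.trans ?_ (SB_GN hQ hX (d' := fun i (t : Σ j, L i j) => d'' i t.1 t.2) _ x p z).symm
  exact congrArg (ML hQ hX (x := fun i => (x i).1) (fun i (t : Σ j, L i j) => d'' i t.1 t.2) p)
    (funext fun i => (cA_cmp hQ hX (d' i) (d'' i) (d i) (σ.fst.proj i) (σ.snd.proj i).proj
      (x i) (z i)).symm)

end

/-- The condensation is an operad. Each axiom is compared on components, where it is a compatibility
between relabelling and substitution in coends. -/
theorem condensation_arrLaws : (condensation hQ hX).operad.ArrLaws where
  rei_refl d d₀ m := homCat_ext_isMap (S := (condensation hQ hX).operad.Op d d₀)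
    (Y := coendWeight hQ hX d) (m := fun m => (condensation hQ hX).operad.rei (Equiv.refl _)
      (fun _ => rfl) m) (n := fun m => m) (isMap_rei _ _ IsMap.self) IsMap.self
    (fun m k ζ => (cA_rei hQ hX (Equiv.refl _) (fun _ => rfl) m k ζ).trans (RL_refl hQ hX _)) m
  rei_rei e e' d d' d'' h h' d₀ m := homCat_ext_isMap (S := (condensation hQ hX).operad.Op d d₀)
    (Y := coendWeight hQ hX d'')
    (m := fun m => (condensation hQ hX).operad.rei e' h' ((condensation hQ hX).operad.rei e h m))
    (n := fun m => (condensation hQ hX).operad.rei (e.trans e') (fun i => (h' (e i)).trans (h i)) m)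
    (isMap_rei _ _ (isMap_rei _ _ IsMap.self)) (isMap_rei _ _ IsMap.self)
    (fun m k ζ => (cA_rei hQ hX e' h' _ k ζ).trans ((congrArg (RL hQ hX e' h')
      (cA_rei hQ hX e h m k ζ)).trans ((RL_RL hQ hX e e' h h' _).trans
        (cA_rei hQ hX (e.trans e') _ m k ζ).symm))) m
  cmp_rei {I _ J J' _ _} e d d' d'' h d₀ m n := homCat_ext_isMap
    (S := (condensation hQ hX).operad.Op d d₀ × ∀ i, (condensation hQ hX).operad.Op (d' i) (d i))
    (Y := coendWeight hQ hX fun s : Σ i, J' i => d'' s.1 s.2)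
    (m := fun σ => (condensation hQ hX).operad.cmp d d'' d₀ σ.fst
      fun i => (condensation hQ hX).operad.rei (e i) (h i) (σ.snd.proj i))
    (n := fun σ => (condensation hQ hX).operad.rei (y := fun s : Σ i, J' i => d'' s.1 s.2)
      (Equiv.sigmaCongrRight e) (fun s => h s.1 s.2)
      ((condensation hQ hX).operad.cmp d d' d₀ σ.fst σ.snd.proj))
    (isMap_cmp _ _ _ IsMap.self.fst fun i => isMap_rei _ _ (IsMap.self.snd.proj i))
    (isMap_rei _ _ (isMap_cmp _ _ _ IsMap.self.fst fun i => IsMap.self.snd.proj i))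
    (fun σ k ζ => (cA_cmp hQ hX d d'' d₀ σ.fst _ k ζ).trans ((SB_rei hQ hX e h σ.snd.proj _).trans
      ((cA_rei hQ hX (Equiv.sigmaCongrRight e) (d' := fun s : Σ i, J' i => d'' s.1 s.2)
        (fun s => h s.1 s.2) _ k ζ).trans (congrArg (RL hQ hX _ _)
          (cA_cmp hQ hX d d' d₀ σ.fst σ.snd.proj k ζ))).symm)) (.pair m (.pi n))
  rei_cmp {I I' _ _ J _} e d d' d₀ m n := homCat_ext_isMap
    (S := (condensation hQ hX).operad.Op (fun i => d (e i)) d₀ ×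
      ∀ i, (condensation hQ hX).operad.Op (d' i) (d i))
    (Y := coendWeight hQ hX fun s : Σ i, J i => d' s.1 s.2)
    (m := fun σ => (condensation hQ hX).operad.cmp d d' d₀
      ((condensation hQ hX).operad.rei e (y := d) (fun _ => rfl) σ.fst) σ.snd.proj)
    (n := fun σ => (condensation hQ hX).operad.rei (y := fun s : Σ i, J i => d' s.1 s.2)
      (Equiv.sigmaCongrLeft e) (fun _ => rfl) ((condensation hQ hX).operad.cmp (fun i => d (e i))
        (fun i => d' (e i)) d₀ σ.fst fun i => σ.snd.proj (e i)))
    (isMap_cmp _ _ _ (isMap_rei _ _ IsMap.self.fst) fun i => IsMap.self.snd.proj i)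
    (isMap_rei _ _ (isMap_cmp _ _ _ IsMap.self.fst fun i => IsMap.self.snd.proj (e i)))
    (fun σ k ζ => (cA_cmp hQ hX d d' d₀ _ σ.snd.proj k ζ).trans ((congrArg (SB hQ hX _)
      (cA_rei hQ hX e (d' := d) (fun _ => rfl) σ.fst k ζ)).trans
        ((SB_RL hQ hX e σ.snd.proj _).trans ((cA_rei hQ hX (Equiv.sigmaCongrLeft e)
          (d' := fun s : Σ i, J i => d' s.1 s.2) (fun _ => rfl) _ k ζ).trans
            (congrArg (RL hQ hX _ _) (cA_cmp hQ hX (fun i => d (e i)) (fun i => d' (e i)) d₀ σ.fst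
              (fun i => σ.snd.proj (e i)) k ζ))).symm))) (.pair m (.pi n))
  one_cmp {J _} d d₀ n := homCat_ext_isMap (S := (condensation hQ hX).operad.Op d d₀)
    (Y := coendWeight hQ hX d)
    (m := fun n => (condensation hQ hX).operad.rei (y := d) (Equiv.uniqueSigma fun _ : Unit => J)
      (fun _ => rfl) ((condensation hQ hX).operad.cmp (fun _ : Unit => d₀) (fun _ => d) d₀
        ((condensation hQ hX).operad.idA d₀) fun _ => n)) (n := fun n => n)
    (isMap_rei _ _ (isMap_cmp _ _ _ (.constId _) fun _ => IsMap.self)) IsMap.self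
    (fun n k ζ => by
      refine (cA_rei hQ hX (Equiv.uniqueSigma fun _ : Unit => J) (d' := d) (fun _ => rfl) _ k
        ζ).trans (Eq.trans ?_ (ML_one hQ hX (cA (Y := coendWeight hQ hX d) n k ζ)))
      refine congrArg (RL hQ hX _ _) ((cA_cmp hQ hX (fun _ : Unit => d₀) (fun _ => d) d₀
        ((condensation hQ hX).operad.idA d₀) (fun _ => n) k ζ).trans ?_)
      refine (congrArg (SB hQ hX _) (cA_one hQ hX d₀ k ζ)).trans ?_
      exact SB_GN hQ hX (d := fun _ : Unit => d₀) (d' := fun _ => d) (fun _ => n) (fun _ => k)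
        (Q.idA k.1) fun _ => ζ) n
  cmp_one {I _} d d₀ m := homCat_ext_isMap (S := (condensation hQ hX).operad.Op d d₀)
    (Y := coendWeight hQ hX d)
    (m := fun m => (condensation hQ hX).operad.rei (y := d) (Equiv.sigmaUnique I fun _ => Unit)
      (fun _ => rfl) ((condensation hQ hX).operad.cmp d (fun i (_ : Unit) => d i) d₀ m
        fun i => (condensation hQ hX).operad.idA (d i))) (n := fun m => m)
    (isMap_rei _ _ (isMap_cmp _ _ _ IsMap.self fun i => .constId _)) IsMap.self
    (fun m k ζ => (cA_rei hQ hX (Equiv.sigmaUnique I fun _ => Unit) (d' := d) (fun _ => rfl) _ k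
      ζ).trans ((congrArg (RL hQ hX _ _) (cA_cmp hQ hX d (fun i (_ : Unit) => d i) d₀ m
        (fun i => (condensation hQ hX).operad.idA (d i)) k ζ)).trans (SB_one hQ hX _))) m
  assoc {I _ J _ L _} d d' d'' d₀ m q r := homCat_ext_isMap
    (S := (condensation hQ hX).operad.Op d d₀ × (∀ i, (condensation hQ hX).operad.Op (d' i) (d i)) ×
      ∀ i j, (condensation hQ hX).operad.Op (d'' i j) (d' i j))
    (Y := coendWeight hQ hX fun s : Σ i, Σ j, L i j => d'' s.1 s.2.1 s.2.2)
    (m := fun σ => (condensation hQ hX).operad.rei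
      (y := fun s : Σ i, Σ j, L i j => d'' s.1 s.2.1 s.2.2) (Equiv.sigmaAssoc L) (fun _ => rfl)
      ((condensation hQ hX).operad.cmp (fun s : Σ i, J i => d' s.1 s.2) (fun s => d'' s.1 s.2) d₀
        ((condensation hQ hX).operad.cmp d d' d₀ σ.fst σ.snd.fst.proj)
        fun s => (σ.snd.snd.proj s.1).proj s.2))
    (n := fun σ => (condensation hQ hX).operad.cmp d (fun i (t : Σ j, L i j) => d'' i t.1 t.2) d₀
      σ.fst fun i => (condensation hQ hX).operad.cmp (d' i) (d'' i) (d i) (σ.snd.fst.proj i)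
        (σ.snd.snd.proj i).proj)
    (isMap_rei _ _ (isMap_cmp _ _ _ (isMap_cmp _ _ _ IsMap.self.fst
      fun i => IsMap.self.snd.fst.proj i) fun s => (IsMap.self.snd.snd.proj s.1).proj s.2))
    (isMap_cmp _ _ _ IsMap.self.fst fun i => isMap_cmp _ _ _ (IsMap.self.snd.fst.proj i)
      fun j => (IsMap.self.snd.snd.proj i).proj j)
    (fun σ k ζ => by
      refine (cA_rei hQ hX (Equiv.sigmaAssoc L)
        (d' := fun s : Σ i, Σ j, L i j => d'' s.1 s.2.1 s.2.2) (fun _ => rfl) _ k ζ).trans ?_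
      refine (congrArg (RL hQ hX _ _) ((cA_cmp hQ hX (fun s : Σ i, J i => d' s.1 s.2)
        (fun s => d'' s.1 s.2) d₀ _ _ k ζ).trans (congrArg (SB hQ hX _)
          (cA_cmp hQ hX d d' d₀ σ.fst σ.snd.fst.proj k ζ)))).trans ?_
      refine (SB_SB hQ hX σ.snd.fst.proj (fun i j => (σ.snd.snd.proj i).proj j) _).trans ?_
      exact (cA_cmp hQ hX d (fun i (t : Σ j, L i j) => d'' i t.1 t.2) d₀ σ.fst _ k ζ).symm)
    (.pair m (.pair (.pi q) (.pi fun i => .pi (r i))))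

end Condensation

/-! ### Algebras over the condensation -/

section Algebra

variable {K D : Type u} {Q : OperadData K} {B : K → Cat.{u, u}}

/-- The action of an operation of `Q` on an algebra, on arrows. -/
def OperadHom.actA (ρ : OperadAlgebra Q B) {I : Type} [Finite I] {x : I → K} {k : K}
    (p : Arr (Q.Op x k)) (b : ∀ i, Arr (B (x i))) : Arr (B k) :=
  Arr.app (A := ∀ i, B (x i)) (B := B k) (Arr.map (ρ.map x k) p) (.pi b)

namespace OperadHom

variable (ρ : OperadAlgebra Q B)

theorem actA_idA (k : K) (b : Unit → Arr (B k)) : actA ρ (Q.idA k) b = b () := by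
  refine (congrArg (fun w => Arr.app (A := ∀ _ : Unit, B k) (B := B k) w (.pi b))
    ((Arr.map_id (ρ.map (fun _ : Unit => k) k) (Q.one k)).trans
      (congrArg Arr.id (ρ.map_one k)))).trans ?_
  exact Arr.app_id (A := ∀ _ : Unit, B k) (B := B k) (Pi.eval (fun _ : Unit => B k) ()) (.pi b)

theorem actA_rei {I J : Type} [Finite I] [Finite J] (e : I ≃ J) {y : J → K} {k : K}
    (p : Arr (Q.Op (fun i => y (e i)) k)) (b : ∀ j, Arr (B (y j))) :
    actA ρ (Q.rei e (y := y) (fun _ => rfl) p) b = actA ρ p fun i => b (e i) :=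
  congrArg (fun w => Arr.app (A := ∀ j, B (y j)) (B := B k) w (.pi b))
    (Arr.functor_congr (ρ.map_reindex e (y := y) (fun _ => rfl) k) p)

theorem actA_cmp {I : Type} [Finite I] {J : I → Type} [∀ i, Finite (J i)] (x : I → K)
    (y : ∀ i, J i → K) (k : K) (p : Arr (Q.Op x k)) (q : ∀ i, Arr (Q.Op (y i) (x i)))
    (b : ∀ s : Σ i, J i, Arr (B (y s.1 s.2))) :
    actA ρ (Q.cmp x y k p q) b = actA ρ p fun i => actA ρ (q i) fun j => b ⟨i, j⟩ :=
  (congrArg (fun w => Arr.app (A := ∀ s : Σ i, J i, B (y s.1 s.2)) (B := B k) w (.pi b))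
    (Arr.functor_congr (ρ.map_comp x y k) (.pair p (.pi q)))).trans
    (Arr.app_endComp (fun i => B (x i)) (fun i j => B (y i j)) (B k) (Arr.map (ρ.map x k) p)
      (fun i => Arr.map (ρ.map (y i) (x i)) (q i)) (.pi b))

theorem actA_pre {I : Type} [Finite I] {x x' : I → K} {k : K} (p : Arr (Q.Op x' k))
    (u : ∀ i, Arr (Q.Op (fun _ : Unit => x i) (x' i))) (b : ∀ i, Arr (B (x i))) :
    actA ρ (Q.pre p u) b = actA ρ p fun i => actA ρ (u i) fun _ => b i :=
  (actA_rei ρ (Equiv.sigmaUnique I fun _ => Unit) (y := x) _ b).trans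
    (actA_cmp ρ x' (fun i (_ : Unit) => x i) k p u fun s => b s.1)

theorem actA_post {J : Type} [Finite J] {y : J → K} {k k' : K}
    (u : Arr (Q.Op (fun _ : Unit => k) k')) (p : Arr (Q.Op y k)) (b : ∀ j, Arr (B (y j))) :
    actA ρ (Q.post u p) b = actA ρ u fun _ => actA ρ p b :=
  (actA_rei ρ (Equiv.uniqueSigma fun _ : Unit => J) (y := y) _ b).trans
    (actA_cmp ρ (fun _ : Unit => k) (fun _ => y) k' u (fun _ => p) fun s => b s.2)

theorem isMap_actA {S : Type*} [Category* S] {I : Type} [Finite I] {x : I → K} {k : K}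
    {p : Arr S → Arr (Q.Op x k)} {b : ∀ i, Arr S → Arr (B (x i))} (hp : IsMap p)
    (hb : ∀ i, IsMap (b i)) : IsMap fun φ => actA ρ (p φ) fun i => b i φ :=
  (hp.map (ρ.map x k)).app (.pi hb)

end OperadHom

open OperadHom

variable {f : K → D} {X : Weight Q f} (hQ : Q.ArrLaws) (hX : X.IsFunctor) (ρ : OperadAlgebra Q B)

variable (f) in
/-- The underlying functor of an algebra. -/
abbrev algW : Weight Q f := algebraWeight f B fun x k => ρ.map x k

include hQ hX

theorem exists_ev {I : Type} [Finite I] (d : I → D) (k : K) :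
    ∃ F : (∀ i, HomCat (d i) X (algW f ρ)) × coend X d k ⥤ B k,
      ∀ n (x : ∀ i, {c // f c = d i}) (p : Arr (Q.Op (fun i => (x i).1) k))
        (z : ∀ i, Arr (X.obj (x i).1)),
        Arr.map F (.pair n (GN X d k x p z)) = actA ρ p fun i => cA (n.proj i) (x i) (z i) :=
  coend_lift hQ hX (S := ∀ i, HomCat (d i) X (algW f ρ))
    (fun x n p z => actA ρ (x := fun i => (x i).1) p fun i => cA (n.proj i) (x i) (z i))
    (fun x => OperadHom.isMap_actA ρ IsMap.self.snd.fst fun i =>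
      isMap_cA (x i) (IsMap.self.fst.proj i) (IsMap.self.snd.snd.proj i))
    fun n x x' p u z => (actA_pre ρ (x := fun i => (x i).1) (x' := fun i => (x' i).1) p u
      fun i => cA (n.proj i) (x i) (z i)).trans
      (congrArg (actA ρ (x := fun i => (x' i).1) p)
        (funext fun i => (cA_act (n.proj i) (x i) (x' i) (u i) (z i)).symm))

/-- Evaluation of elements of a coend on natural transformations. -/
def evF {I : Type} [Finite I] (d : I → D) (k : K) :
    (∀ i, HomCat (d i) X (algW f ρ)) × coend X d k ⥤ B k := (exists_ev hQ hX ρ d k).choose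

/-- Evaluation of elements of a coend on natural transformations, on arrows. -/
def EVC {I : Type} [Finite I] {d : I → D} {k : K} (n : ∀ i, Arr (HomCat (d i) X (algW f ρ)))
    (w : Arr (coend X d k)) : Arr (B k) := Arr.map (evF hQ hX ρ d k) (.pair (.pi n) w)

theorem isMap_EVC {S : Type*} [Category* S] {I : Type} [Finite I] {d : I → D} {k : K}
    {n : ∀ i, Arr S → Arr (HomCat (d i) X (algW f ρ))} {w : Arr S → Arr (coend X d k)}
    (hn : ∀ i, IsMap (n i)) (hw : IsMap w) :
    IsMap fun φ => EVC hQ hX ρ (fun i => n i φ) (w φ) := ((IsMap.pi hn).pair hw).map _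

theorem EVC_GN {I : Type} [Finite I] {d : I → D} {k : K}
    (n : ∀ i, Arr (HomCat (d i) X (algW f ρ))) (x : ∀ i, {c // f c = d i})
    (p : Arr (Q.Op (fun i => (x i).1) k)) (z : ∀ i, Arr (X.obj (x i).1)) :
    EVC hQ hX ρ n (GN X d k x p z) = actA ρ p fun i => cA (n i) (x i) (z i) :=
  (exists_ev hQ hX ρ d k).choose_spec (.pi n) x p z

theorem EVC_actE {I : Type} [Finite I] {d : I → D} {k k' : K}
    (n : ∀ i, Arr (HomCat (d i) X (algW f ρ))) (v : Arr (Q.Op (fun _ : Unit => k) k'))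
    (w : Arr (coend X d k)) :
    EVC hQ hX ρ n (actE hQ hX v w) = actA ρ v fun _ => EVC hQ hX ρ n w := by
  refine coend_ext hQ hX (S := (∀ i, HomCat (d i) X (algW f ρ)) × Q.Op (fun _ : Unit => k) k')
    (m := fun σ w => EVC hQ hX ρ σ.fst.proj (actE hQ hX σ.snd w))
    (n := fun σ w => actA ρ σ.snd fun _ => EVC hQ hX ρ σ.fst.proj w)
    (isMap_EVC _ _ _ (fun i => IsMap.self.fst.fst.proj i)
      (isMap_actE _ _ IsMap.self.fst.snd IsMap.self.snd))
    (OperadHom.isMap_actA _ IsMap.self.fst.snd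
      fun _ => isMap_EVC _ _ _ (fun i => IsMap.self.fst.fst.proj i) IsMap.self.snd)
    (fun σ x p z => ?_) (.pair (.pi n) v) w
  refine (congrArg (EVC hQ hX ρ σ.fst.proj) (actE_GN hQ hX σ.snd x p z)).trans ?_
  refine (EVC_GN hQ hX ρ _ x _ z).trans (Eq.trans ?_ (congrArg (fun b => actA ρ σ.snd fun _ => b)
    (EVC_GN hQ hX ρ σ.fst.proj x p z)).symm)
  exact actA_post ρ (y := fun i => (x i).1) σ.snd p _

theorem EVC_RL {I J : Type} [Finite I] [Finite J] (e : I ≃ J) {d : J → D} {k : K}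
    (n : ∀ j, Arr (HomCat (d j) X (algW f ρ))) (w : Arr (coend X (fun i => d (e i)) k)) :
    EVC hQ hX ρ n (RL hQ hX (d' := d) e (fun _ => rfl) w) = EVC hQ hX ρ (fun i => n (e i)) w := by
  refine coend_ext hQ hX (S := ∀ j, HomCat (d j) X (algW f ρ))
    (m := fun σ w => EVC hQ hX ρ σ.proj (RL hQ hX (d' := d) e (fun _ => rfl) w))
    (n := fun σ w => EVC hQ hX ρ (fun i => σ.proj (e i)) w)
    (isMap_EVC _ _ _ (fun i => IsMap.self.fst.proj i) (isMap_RL _ _ _ _ IsMap.self.snd))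
    (isMap_EVC _ _ _ (fun i => IsMap.self.fst.proj (e i)) IsMap.self.snd)
    (fun σ x p z => ?_) (.pi n) w
  obtain ⟨x, rfl⟩ := IsPresentation.exists_family e (T := fun j => {c // f c = d j}) x
  obtain ⟨z, rfl⟩ := IsPresentation.exists_family e (T := fun j => Arr (X.obj (x j).1)) z
  refine (congrArg (EVC hQ hX ρ σ.proj) (RL_GN hQ hX e (fun _ => rfl) x p z)).trans ?_
  refine (EVC_GN hQ hX ρ σ.proj x _ z).trans ?_
  refine (actA_rei ρ e (y := fun i => (x i).1) p fun i => cA (σ.proj i) (x i) (z i)).trans ?_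
  exact (EVC_GN hQ hX ρ (fun i => σ.proj (e i)) (fun i => x (e i)) p fun i => z (e i)).symm

section

variable {I : Type} [Finite I] {J : I → Type} [∀ i, Finite (J i)]

theorem EVC_ML {x : I → K} {d : ∀ i, J i → D} {k : K}
    (n : ∀ s : Σ i, J i, Arr (HomCat (d s.1 s.2) X (algW f ρ))) (p : Arr (Q.Op x k))
    (w : ∀ i, Arr (coend X (d i) (x i))) :
    EVC hQ hX ρ (d := fun s : Σ i, J i => d s.1 s.2) n (ML hQ hX d p w) =
      actA ρ p fun i => EVC hQ hX ρ (fun j => n ⟨i, j⟩) (w i) := by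
  refine coendPi_ext hQ hX
    (S := (∀ s : Σ i, J i, HomCat (d s.1 s.2) X (algW f ρ)) × Q.Op x k)
    (m := fun σ w => EVC hQ hX ρ (d := fun s : Σ i, J i => d s.1 s.2) σ.fst.proj
      (ML hQ hX d σ.snd w))
    (n := fun σ w => actA ρ σ.snd fun i => EVC hQ hX ρ
      (fun j => σ.fst.proj (I := Σ i, J i) ⟨i, j⟩) (w i))
    (isMap_EVC _ _ _ (fun s => IsMap.self.fst.fst.proj s)
      (isMap_ML _ _ _ IsMap.self.fst.snd fun i => IsMap.self.snd.proj i))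
    (OperadHom.isMap_actA _ IsMap.self.fst.snd fun i => isMap_EVC _ _ _
      (fun j => IsMap.self.fst.fst.proj (I := Σ i, J i) ⟨i, j⟩) (IsMap.self.snd.proj i))
    (fun σ y q z => ?_) (.pair (.pi n) p) w
  refine (congrArg (EVC hQ hX ρ (d := fun s : Σ i, J i => d s.1 s.2) σ.fst.proj)
    (ML_GN hQ hX d σ.snd y q z)).trans ?_
  refine (EVC_GN hQ hX ρ (d := fun s : Σ i, J i => d s.1 s.2) σ.fst.proj (fun s => y s.1 s.2) _
    fun s => z s.1 s.2).trans ?_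
  refine (actA_cmp ρ x (fun i j => (y i j).1) k σ.snd q fun s =>
    cA (σ.fst.proj s) (y s.1 s.2) (z s.1 s.2)).trans ?_
  exact congrArg (actA ρ σ.snd) (funext fun i => (EVC_GN hQ hX ρ
    (fun j => σ.fst.proj (I := Σ i, J i) ⟨i, j⟩) (y i) (q i) (z i)).symm)

theorem exists_alg (d : I → D) (d₀ : D) :
    ∃ F : (HomCat d₀ X (coendWeight hQ hX d) × ∀ i, HomCat (d i) X (algW f ρ)) ⥤
        HomCat d₀ X (algW f ρ),
      ∀ m k ζ, cA (Arr.map F m) k ζ = EVC hQ hX ρ m.snd.proj (cA m.fst k ζ) :=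
  homCat_lift (Y := algW f ρ)
    (fun k (m : Arr (HomCat d₀ X (coendWeight hQ hX d) × ∀ i, HomCat (d i) X (algW f ρ))) ζ =>
      EVC hQ hX ρ m.snd.proj (cA m.fst k ζ))
    (fun k => isMap_EVC _ _ _ (fun i => IsMap.self.fst.snd.proj i)
      (isMap_cA k IsMap.self.fst.fst IsMap.self.snd))
    fun m k k' u ζ => (congrArg (EVC hQ hX ρ m.snd.proj) (cA_act m.fst k k' u ζ)).trans
      (EVC_actE hQ hX ρ m.snd.proj u (cA m.fst k ζ))

/-- The action of the condensation on natural transformations to an algebra. -/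
def algF (d : I → D) (d₀ : D) :
    (HomCat d₀ X (coendWeight hQ hX d) × ∀ i, HomCat (d i) X (algW f ρ)) ⥤
      HomCat d₀ X (algW f ρ) := (exists_alg hQ hX ρ d d₀).choose

/-- The action of the condensation on natural transformations to an algebra, on arrows. -/
def AL {d : I → D} {d₀ : D} (m : Arr (HomCat d₀ X (coendWeight hQ hX d)))
    (n : ∀ i, Arr (HomCat (d i) X (algW f ρ))) : Arr (HomCat d₀ X (algW f ρ)) :=
  Arr.map (algF hQ hX ρ d d₀) (.pair m (.pi n))

theorem cA_AL {d : I → D} {d₀ : D} (m : Arr (HomCat d₀ X (coendWeight hQ hX d)))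
    (n : ∀ i, Arr (HomCat (d i) X (algW f ρ))) (k ζ) :
    cA (AL hQ hX ρ m n) k ζ = EVC hQ hX ρ n (cA m k ζ) :=
  (exists_alg hQ hX ρ d d₀).choose_spec (.pair m (.pi n)) k ζ

theorem app_curry_algF {d : I → D} {d₀ : D} (m : Arr (HomCat d₀ X (coendWeight hQ hX d)))
    (n : Arr (∀ i, HomCat (d i) X (algW f ρ))) :
    Arr.app (A := ∀ i, HomCat (d i) X (algW f ρ)) (B := HomCat d₀ X (algW f ρ))
      (Arr.map (Functor.curry.obj (algF hQ hX ρ d d₀)) m) n = AL hQ hX ρ m n.proj :=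
  Arr.app_curry (algF hQ hX ρ d d₀) m n

theorem isMap_AL {S : Type*} [Category* S] {d : I → D} {d₀ : D}
    {m : Arr S → Arr (HomCat d₀ X (coendWeight hQ hX d))}
    {n : ∀ i, Arr S → Arr (HomCat (d i) X (algW f ρ))} (hm : IsMap m) (hn : ∀ i, IsMap (n i)) :
    IsMap fun φ => AL hQ hX ρ (m φ) fun i => n i φ := (hm.pair (.pi hn)).map _

/-- Evaluation turns substitution into the action of the condensation on the arguments. -/
theorem EVC_SB {d : I → D} {d' : ∀ i, J i → D} {k : K}
    (n : ∀ s : Σ i, J i, Arr (HomCat (d' s.1 s.2) X (algW f ρ)))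
    (q : ∀ i, Arr (HomCat (d i) X (coendWeight hQ hX (d' i)))) (w : Arr (coend X d k)) :
    EVC hQ hX ρ (d := fun s : Σ i, J i => d' s.1 s.2) n (SB hQ hX q w) =
      EVC hQ hX ρ (fun i => AL hQ hX ρ (q i) fun j => n ⟨i, j⟩) w := by
  refine coend_ext hQ hX
    (S := (∀ s : Σ i, J i, HomCat (d' s.1 s.2) X (algW f ρ)) ×
      ∀ i, HomCat (d i) X (coendWeight hQ hX (d' i)))
    (m := fun σ w => EVC hQ hX ρ (d := fun s : Σ i, J i => d' s.1 s.2) σ.fst.proj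
      (SB hQ hX σ.snd.proj w))
    (n := fun σ w => EVC hQ hX ρ (fun i => AL hQ hX ρ (σ.snd.proj i)
      fun j => σ.fst.proj (I := Σ i, J i) ⟨i, j⟩) w)
    (isMap_EVC _ _ _ (fun s => IsMap.self.fst.fst.proj s)
      (isMap_SB _ _ (fun i => IsMap.self.fst.snd.proj i) IsMap.self.snd))
    (isMap_EVC _ _ _ (fun i => isMap_AL _ _ _ (IsMap.self.fst.snd.proj i)
      fun j => IsMap.self.fst.fst.proj (I := Σ i, J i) ⟨i, j⟩) IsMap.self.snd)
    (fun σ x p z => ?_) (.pair (.pi n) (.pi q)) w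
  refine (congrArg (EVC hQ hX ρ (d := fun s : Σ i, J i => d' s.1 s.2) σ.fst.proj)
    (SB_GN hQ hX σ.snd.proj x p z)).trans ?_
  refine (EVC_ML hQ hX ρ σ.fst.proj (x := fun i => (x i).1) p _).trans ?_
  refine Eq.trans ?_ (EVC_GN hQ hX ρ _ x p z).symm
  exact congrArg (actA ρ (x := fun i => (x i).1) p) (funext fun i => (cA_AL hQ hX ρ (σ.snd.proj i)
    (fun j => σ.fst.proj (I := Σ i, J i) ⟨i, j⟩) (x i) (z i)).symm)

end

/-- The categories of natural transformations to an algebra are an algebra over the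
condensation. -/
def condensedAlgebra : CondensedAlgebra (condensation hQ hX) B fun x k => ρ.map x k where
  ev d k := Functor.curry.obj (evF hQ hX ρ d k)
  ev_mk d k x := Arr.functor_ext fun φ =>
    (Arr.app_curry (evF hQ hX ρ d k) φ.fst (GN X d k x φ.snd.fst φ.snd.snd.proj)).trans
      (EVC_GN hQ hX ρ φ.fst.proj x φ.snd.fst φ.snd.snd.proj)
  alg :=
    { map d d₀ := Functor.curry.obj (algF hQ hX ρ d d₀)
      map_one d := by
        refine homCat_ext fun n k ζ => ?_
        refine Eq.trans (congrArg (fun w => cA (Y := algW f ρ) w k ζ)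
          (?_ : _ = AL hQ hX ρ ((condensation hQ hX).operad.idA d) n.proj)) ?_
        · refine Eq.trans ?_ (app_curry_algF hQ hX ρ (d := fun _ : Unit => d)
            ((condensation hQ hX).operad.idA d) n)
          refine (Arr.app_id (A := ∀ _ : Unit, HomCat d X (algW f ρ)) (B := HomCat d X (algW f ρ))
            _ n).symm.trans ?_
          exact congrArg (fun w => Arr.app (A := ∀ _ : Unit, HomCat d X (algW f ρ))
            (B := HomCat d X (algW f ρ)) w n) (Arr.map_id
              (Functor.curry.obj (algF hQ hX ρ (fun _ : Unit => d) d)) _).symm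
        · refine (cA_AL hQ hX ρ (d := fun _ : Unit => d) _ n.proj k ζ).trans ?_
          refine (congrArg (EVC hQ hX ρ (d := fun _ : Unit => d) n.proj)
            (cA_one hQ hX d k ζ)).trans ?_
          refine (EVC_GN hQ hX ρ (d := fun _ : Unit => d) n.proj (fun _ => k) (Q.idA k.1)
            fun _ => ζ).trans ?_
          exact actA_idA ρ k.1 fun _ => cA (n.proj ()) k ζ
      map_reindex {I J} _ _ e {d d'} h d₀ := by
        obtain rfl : d = fun i => d' (e i) := funext fun i => (h i).symm
        refine Arr.uncurry_injective (homCat_ext fun σ k ζ => ?_)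
        refine (congrArg (fun w => cA (Y := algW f ρ) w k ζ) (app_curry_algF hQ hX ρ
          ((condensation hQ hX).operad.rei e (y := d') (fun _ => rfl) σ.fst) σ.snd)).trans ?_
        refine Eq.trans ?_ (congrArg (fun w => cA (Y := algW f ρ) w k ζ)
          (app_curry_algF hQ hX ρ σ.fst (.pi fun i => σ.snd.proj (e i)))).symm
        refine (cA_AL hQ hX ρ _ σ.snd.proj k ζ).trans ?_
        refine (congrArg (EVC hQ hX ρ σ.snd.proj)
          (cA_rei hQ hX e (d' := d') (fun _ => rfl) σ.fst k ζ)).trans ?_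
        refine (EVC_RL hQ hX ρ e σ.snd.proj _).trans ?_
        exact (cA_AL hQ hX ρ σ.fst (fun i => σ.snd.proj (e i)) k ζ).symm
      map_comp {I} _ {J} _ d d' d₀ := by
        refine Arr.uncurry_injective (homCat_ext fun σ k ζ => ?_)
        refine (congrArg (fun w => cA (Y := algW f ρ) w k ζ) (app_curry_algF hQ hX ρ
          (d := fun s : Σ i, J i => d' s.1 s.2)
          ((condensation hQ hX).operad.cmp d d' d₀ σ.fst.fst σ.fst.snd.proj) σ.snd)).trans ?_
        have e : ∀ i, _ = AL hQ hX ρ (d := d' i) (d₀ := d i) (σ.fst.snd.proj i)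
            (fun j => σ.snd.proj (I := Σ i, J i) ⟨i, j⟩) := fun i =>
          app_curry_algF hQ hX ρ (d := d' i) (d₀ := d i) (σ.fst.snd.proj i)
            (.pi fun j => σ.snd.proj (I := Σ i, J i) ⟨i, j⟩)
        refine Eq.trans ?_ (congrArg (fun w => cA (Y := algW f ρ) w k ζ)
          ((Arr.app_endComp (fun i => HomCat (d i) X (algW f ρ))
            (fun i j => HomCat (d' i j) X (algW f ρ)) (HomCat d₀ X (algW f ρ))
            (Arr.map (Functor.curry.obj (algF hQ hX ρ d d₀)) σ.fst.fst)
            (fun i => Arr.map (Functor.curry.obj (algF hQ hX ρ (d' i) (d i))) (σ.fst.snd.proj i))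
            σ.snd).trans ((app_curry_algF hQ hX ρ σ.fst.fst _).trans
              (congrArg (AL hQ hX ρ σ.fst.fst) (funext e))))).symm
        refine (cA_AL hQ hX ρ (d := fun s : Σ i, J i => d' s.1 s.2) _ σ.snd.proj k ζ).trans ?_
        refine (congrArg (EVC hQ hX ρ (d := fun s : Σ i, J i => d' s.1 s.2) σ.snd.proj)
          (cA_cmp hQ hX d d' d₀ σ.fst.fst σ.fst.snd.proj k ζ)).trans ?_
        refine (EVC_SB hQ hX ρ σ.snd.proj σ.fst.snd.proj _).trans ?_
        exact (cA_AL hQ hX ρ σ.fst.fst _ k ζ).symm }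
  alg_component d d₀ k := by
    refine Arr.functor_ext₂ fun σ ζ => ?_
    refine (congrArg (fun w => cA (Y := algW f ρ) w k ζ)
      (app_curry_algF hQ hX ρ σ.fst σ.snd)).trans ?_
    refine (cA_AL hQ hX ρ σ.fst σ.snd.proj k ζ).trans ?_
    refine (Arr.app_curry (evF hQ hX ρ d k.1) σ.snd (cA σ.fst k ζ)).symm.trans ?_
    have e := Arr.app_app_whiskeringLeft (Arr.map (component X (coendWeight hQ hX d) k) σ.fst)
      (Arr.map (Functor.curry.obj (evF hQ hX ρ d k.1)) σ.snd) ζ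
    exact e.symm

end Algebra

/-! ### Functoriality of the weights -/

theorem OperadData.ArrLaws.post_post {K : Type u} {Q : OperadData K} (hQ : Q.ArrLaws) {J : Type}
    [Finite J] {y : J → K} {k k' k'' : K} (u' : Arr (Q.Op (fun _ : Unit => k') k''))
    (u : Arr (Q.Op (fun _ : Unit => k) k')) (p : Arr (Q.Op y k)) :
    Q.post (Q.post u' u) p = Q.post u' (Q.post u p) := by
  refine Eq.trans ?_ (hQ.rei_post (Equiv.uniqueSigma fun _ : Unit => J) (z := y) (fun _ => rfl)
    u' (Q.cmp (fun _ : Unit => k) (fun _ => y) k' u fun _ => p))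
  exact congrArg (Q.rei (y := y) (Equiv.uniqueSigma fun _ : Unit => J) fun _ => rfl)
    (hQ.post_cmp (y := fun _ : Unit => y) u' u fun _ => p).symm

section Condensation

open OperadData

variable {K D : Type u} {Q : OperadData K} {f : K → D} {X : Weight Q f}

theorem isFunctor_algW {B : K → Cat.{u, u}} (ρ : OperadAlgebra Q B) : (algW f ρ).IsFunctor :=
  Weight.isFunctor (fun k z => OperadHom.actA_idA ρ k fun _ => z)
    fun h h' u' u z => OperadHom.actA_post ρ u' u fun _ => z

theorem isFunctor_coendWeight (hQ : Q.ArrLaws) (hX : X.IsFunctor) {I : Type} [Finite I]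
    (d : I → D) : (coendWeight hQ hX d).IsFunctor := by
  refine Weight.isFunctor (fun k w => ?_) fun {k k' k''} h h' u' u w => ?_
  · refine coend_ext₁ (hQ := hQ) (hX := hX) (m := fun w => actE hQ hX (Q.idA k) w)
      (n := fun w => w) (isMap_actE _ _ (.constId _) IsMap.self) IsMap.self (fun x p z => ?_) w
    exact (actE_GN hQ hX (Q.idA k) x p z).trans
      (congrArg (fun p => GN X d k x p z) (hQ.post_one p))
  · refine coend_ext hQ hX
      (S := Q.Op (fun _ : Unit => k') k'' × Q.Op (fun _ : Unit => k) k')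
      (m := fun σ w => actE hQ hX (Q.post σ.fst σ.snd) w)
      (n := fun σ w => actE hQ hX σ.fst (actE hQ hX σ.snd w))
      (isMap_actE _ _ (isMap_post IsMap.self.fst.fst IsMap.self.fst.snd) IsMap.self.snd)
      (isMap_actE _ _ IsMap.self.fst.fst (isMap_actE _ _ IsMap.self.fst.snd IsMap.self.snd))
      (fun σ x p z => ?_) (.pair u' u) w
    refine (actE_GN hQ hX _ x p z).trans (Eq.trans ?_ ((congrArg (actE hQ hX σ.fst)
      (actE_GN hQ hX σ.snd x p z)).trans (actE_GN hQ hX σ.fst x _ z)).symm)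
    exact congrArg (fun p => GN X d k'' x p z) (hQ.post_post σ.fst σ.snd p)

/-- Functors into a category of natural transformations over a fibre with one element. -/
theorem homCat_lift_unique {Y : Weight Q f} {d : D} {S : Type u} [Category.{u} S]
    (k₀ : {k // f k = d}) (hk : ∀ k, k₀ = k) (m : Arr S → Arr (X.obj k₀.1) → Arr (Y.obj k₀.1))
    (hm : IsMap fun φ : Arr (S × X.obj k₀.1) => m φ.fst φ.snd)
    (h : ∀ σ (u : Arr (Q.Op (fun _ : Unit => k₀.1) k₀.1)) ζ,
      m σ (X.actA rfl u ζ) = Y.actA rfl u (m σ ζ)) :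
    ∃ F : S ⥤ HomCat d X Y, ∀ σ ζ, cA (Arr.map F σ) k₀ ζ = m σ ζ := by
  obtain ⟨F, hF⟩ := homCat_lift (X := X) (Y := Y)
    (fun k => Eq.rec (motive := fun k _ => Arr S → Arr (X.obj k.1) → Arr (Y.obj k.1)) m (hk k))
    (fun k => by
      obtain rfl := hk k
      exact hm)
    (fun σ k k' u ζ => by
      obtain rfl := hk k
      obtain rfl := hk k'
      exact h σ u ζ)
  exact ⟨F, fun σ ζ => hF σ k₀ ζ⟩

end Condensation

section Extend

variable {C : Type u} {P : OperadData C} {δ : Weight (PPlus P) Operation.tgt}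

theorem extend_actA_inr (c : C) (u ζ : Arr ((Psc P).Op (fun _ : Unit => Sum.inr c) (Sum.inr c))) :
    (extend δ).actA (k := Sum.inr c) (k' := Sum.inr c) rfl u ζ = (Psc P).post u ζ :=
  Arr.app_curry ((Psc P).postcomp (fun _ : Unit => Sum.inr c) (Sum.inr c) (Sum.inr c)) u ζ

/-- The extended weight is a functor: on operations this is the assumption, on colours it is
associativity of composition, and no unary operations connect the two. -/
theorem isFunctor_extend (hδ : δ.IsFunctor) : (extend δ).IsFunctor := by
  refine Weight.isFunctor (fun k z => ?_) fun {k k' k''} h h' u' u z => ?_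
  · cases k with
    | inl b => exact hδ.actA_one z
    | inr c => exact (extend_actA_inr c _ z).trans ((psc_arrLaws P).post_one z)
  · cases k with
    | inl b =>
      cases k' with
      | inr c => cases h
      | inl b' =>
        cases k'' with
        | inr c => cases h'
        | inl b'' => exact hδ.actA_post (Sum.inl.inj h) (Sum.inl.inj h') u' u z
    | inr c =>
      cases k' with
      | inl b => cases h
      | inr c' =>
        cases k'' with
        | inl b => cases h'
        | inr c'' =>
          obtain rfl : c = c' := Sum.inr.inj h
          obtain rfl : c = c'' := Sum.inr.inj h'
          refine (extend_actA_inr c _ z).trans (Eq.trans ?_ (((congrArg ((extend δ).actA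
            (k := Sum.inr c) (k' := Sum.inr c) rfl u') (extend_actA_inr c u z))).trans
              (extend_actA_inr c u' _)).symm)
          exact (psc_arrLaws P).post_post u' u z

/-! ### The Yoneda lemma -/

/-- The element of the fibre over the colour `c`. -/
abbrev inrPt (P : OperadData C) (c : C) : {k : Colour P // colourMap k = Sum.inr c} :=
  ⟨Sum.inr c, rfl⟩

/-- The fibre over a colour in the second copy of `C` has one element. -/
theorem inrPt_eq (c : C) (k : {k : Colour P // colourMap k = Sum.inr c}) : inrPt P c = k := by
  obtain ⟨k, hk⟩ := k
  cases k with
  | inl b => cases hk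
  | inr c' =>
    obtain rfl : c' = c := Sum.inr.inj hk
    rfl

variable {Y : Weight (Psc P) colourMap}

/-- The value at the identity, on arrows. -/
theorem map_evalAtOne (c : C) (m : Arr (HomCat (Sum.inr c) (extend δ) Y)) :
    Arr.map (evalAtOne δ c) m = cA m (inrPt P c) ((Psc P).idA (Sum.inr c)) :=
  (Arr.app_map_id (A := (extend δ).obj (Sum.inr c)) (B := Y.obj (Sum.inr c))
    (Arr.map (component (extend δ) Y (inrPt P c)) m) ((Psc P).one (Sum.inr c))).symm

/-- The Yoneda lemma: evaluation at the identity is an isomorphism, with inverse sending `σ` to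
`ζ ↦ ζ · σ`. -/
theorem exists_yoneda (hY : Y.IsFunctor) (c : C) :
    ∃ G : Y.obj (Sum.inr c) ⥤ HomCat (Sum.inr c) (extend δ) Y,
      evalAtOne δ c ⋙ G = 𝟭 _ ∧ G ⋙ evalAtOne δ c = 𝟭 _ := by
  obtain ⟨G, hG⟩ := homCat_lift_unique (X := extend δ) (Y := Y) (S := Y.obj (Sum.inr c)) (inrPt P c)
    (inrPt_eq c) (fun σ ζ => Y.actA (k := Sum.inr c) (k' := Sum.inr c) rfl ζ σ)
    (isMap_actA Y (k := Sum.inr c) (k' := Sum.inr c) rfl IsMap.self.snd IsMap.self.fst)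
    fun σ u ζ => (congrArg (fun ζ => Y.actA (k := Sum.inr c) (k' := Sum.inr c) rfl ζ σ)
      (extend_actA_inr c u ζ)).trans
        (hY.actA_post (k := Sum.inr c) (k' := Sum.inr c) (k'' := Sum.inr c) rfl rfl u ζ σ)
  refine ⟨G, homCat_ext fun m k ζ => ?_, Arr.functor_ext fun σ => ?_⟩
  · obtain rfl := inrPt_eq c k
    refine (hG (Arr.map (evalAtOne δ c) m) ζ).trans ?_
    refine (congrArg (fun σ => Y.actA (k := Sum.inr c) (k' := Sum.inr c) rfl ζ σ)
      (map_evalAtOne c m)).trans ?_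
    refine (cA_act m (inrPt P c) (inrPt P c) ζ ((Psc P).idA (Sum.inr c))).symm.trans ?_
    exact congrArg (cA m (inrPt P c)) ((extend_actA_inr c ζ _).trans ((psc_arrLaws P).post_idA ζ))
  · refine (map_evalAtOne c (Arr.map G σ)).trans ((hG σ _).trans ?_)
    exact hY.actA_one (k := Sum.inr c) σ

/-- Natural transformations out of the representable functor, from their value at the identity. -/
def yonedaInv (hY : Y.IsFunctor) (c : C) : Y.obj (Sum.inr c) ⥤ HomCat (Sum.inr c) (extend δ) Y :=
  (exists_yoneda hY c).choose

theorem evalAtOne_yonedaInv (hY : Y.IsFunctor) (c : C) :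
    evalAtOne δ c ⋙ yonedaInv hY c = 𝟭 _ := (exists_yoneda hY c).choose_spec.1

theorem yonedaInv_evalAtOne (hY : Y.IsFunctor) (c : C) :
    yonedaInv hY c ⋙ evalAtOne δ c = 𝟭 _ := (exists_yoneda hY c).choose_spec.2

/-! ### The comparison with the Hochschild object -/

variable {A : C → Cat.{u, u}} (α : OperadAlgebra P A)

/-- Restriction to the operations is an isomorphism, as the fibre over a colour in the first copy
of `C` contains operations only. -/
theorem exists_restrictHoch_inverse (c : C) :
    ∃ G : Hoch δ α c ⥤ HomCat (Sum.inl c) (extend δ) (pairWeight α),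
      restrictHoch δ α c ⋙ G = 𝟭 _ ∧ G ⋙ restrictHoch δ α c = 𝟭 _ := by
  let m : ∀ k : {k : Colour P // colourMap k = Sum.inl c}, Arr (Hoch δ α c) →
      Arr ((extend δ).obj k.1) → Arr ((pairWeight α).obj k.1) := fun k => match k with
    | ⟨Sum.inl b, hb⟩ => fun σ ζ => cA (X := δ) (Y := endWeight α) σ ⟨b, Sum.inl.inj hb⟩ ζ
    | ⟨Sum.inr _, h⟩ => absurd h fun h => by cases h
  obtain ⟨G, hG⟩ := homCat_lift (X := extend δ) (Y := pairWeight α) (S := Hoch δ α c) m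
    (fun k => by
      obtain ⟨b | c', hk⟩ := k
      · exact isMap_cA (X := δ) (Y := endWeight α) ⟨b, Sum.inl.inj hk⟩ IsMap.self.fst IsMap.self.snd
      · cases hk)
    (fun σ k k' u ζ => by
      obtain ⟨b | c', hk⟩ := k
      · obtain ⟨b' | c', hk'⟩ := k'
        · exact cA_act (X := δ) (Y := endWeight α) σ ⟨b, Sum.inl.inj hk⟩ ⟨b', Sum.inl.inj hk'⟩ u ζ
        · cases hk'
      · cases hk)
  refine ⟨G, homCat_ext fun σ k ζ => ?_, homCat_ext fun σ b ζ => ?_⟩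
  · obtain ⟨b | c', hk⟩ := k
    · exact hG (Arr.map (restrictHoch δ α c) σ) ⟨Sum.inl b, hk⟩ ζ
    · cases hk
  · exact hG σ ⟨Sum.inl b.1, congrArg Sum.inl b.2⟩ ζ

theorem exists_comparison_inverse (d : C ⊕ C) :
    ∃ G : hochPair δ α d ⥤ HomCat d (extend δ) (pairWeight α),
      comparison δ α d ⋙ G = 𝟭 _ ∧ G ⋙ comparison δ α d = 𝟭 _ := by
  cases d with
  | inl c => exact exists_restrictHoch_inverse α c
  | inr c => exact exists_yoneda (isFunctor_algW (f := colourMap) (pairAlgebra α)) c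

end Extend

/-! ### Transport of algebras along isomorphisms -/

section Transport

variable {K : Type u} {Q : OperadData K} {M N : K → Cat.{u, u}}

/-- An algebra from the axioms on arrows. -/
def OperadHom.ofArr
    (map : ∀ {I : Type} [Finite I] (x : I → K) (k : K), Q.Op x k ⥤ ((∀ i, M (x i)) ⥤ M k))
    (act : ∀ {I : Type} [Finite I] {x : I → K} {k : K}, Arr (Q.Op x k) → (∀ i, Arr (M (x i))) →
      Arr (M k))
    (hact : ∀ {I : Type} [Finite I] {x : I → K} {k : K} (p : Arr (Q.Op x k))
      (b : ∀ i, Arr (M (x i))),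
      Arr.app (A := ∀ i, M (x i)) (B := M k) (Arr.map (map x k) p) (.pi b) = act p b)
    (h1 : ∀ k (b : Unit → Arr (M k)), act (Q.idA k) b = b ())
    (h2 : ∀ {I J : Type} [Finite I] [Finite J] (e : I ≃ J) {y : J → K} {k : K}
      (p : Arr (Q.Op (fun i => y (e i)) k)) (b : ∀ j, Arr (M (y j))),
      act (Q.rei e (y := y) (fun _ => rfl) p) b = act p fun i => b (e i))
    (h3 : ∀ {I : Type} [Finite I] {J : I → Type} [∀ i, Finite (J i)] (x : I → K)
      (y : ∀ i, J i → K) (k : K) (p : Arr (Q.Op x k)) (q : ∀ i, Arr (Q.Op (y i) (x i)))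
      (b : ∀ s : Σ i, J i, Arr (M (y s.1 s.2))),
      act (Q.cmp x y k p q) b = act p fun i => act (q i) fun j => b ⟨i, j⟩) :
    OperadAlgebra Q M where
  map x k := map x k
  map_one k := Arr.functor_ext fun b => by
    refine Eq.trans ?_ ((hact (Q.idA k) b.proj).trans (h1 k b.proj))
    refine (Arr.app_id (A := ∀ _ : Unit, M k) (B := M k) _ b).symm.trans ?_
    exact congrArg (fun w => Arr.app (A := ∀ _ : Unit, M k) (B := M k) w b)
      (Arr.map_id (map (fun _ : Unit => k) k) (Q.one k)).symm
  map_reindex {I J} _ _ e {x y} h k := by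
    obtain rfl : x = fun i => y (e i) := funext fun i => (h i).symm
    exact Arr.functor_ext₂ fun p b => (hact (Q.rei e (y := y) (fun _ => rfl) p) b.proj).trans
      ((h2 e p b.proj).trans (hact p fun i => b.proj (e i)).symm)
  map_comp {I} _ {J} _ x y k := Arr.functor_ext₂ fun p b => by
    refine (hact (Q.cmp x y k p.fst p.snd.proj) b.proj).trans
      ((h3 x y k p.fst p.snd.proj b.proj).trans ?_)
    refine Eq.trans ?_ (Arr.app_endComp (fun i => M (x i)) (fun i j => M (y i j)) (M k)
      (Arr.map (map x k) p.fst) (fun i => Arr.map (map (y i) (x i)) (p.snd.proj i)) b).symm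
    refine (hact p.fst _).symm.trans ?_
    exact congrArg (fun c => Arr.app (A := ∀ i, M (x i)) (B := M k) (Arr.map (map x k) p.fst)
      (.pi c)) (funext fun i => (hact (p.snd.proj i) fun j => b.proj (I := Σ i, J i) ⟨i, j⟩).symm)

variable (ρ : OperadAlgebra Q M) (F : ∀ k, M k ⥤ N k) (G : ∀ k, N k ⥤ M k)
  (hFG : ∀ k, F k ⋙ G k = 𝟭 _) (hGF : ∀ k, G k ⋙ F k = 𝟭 _)

/-- The transported action, as functors. -/
def transportMap {I : Type} [Finite I] (x : I → K) (k : K) : Q.Op x k ⥤ ((∀ i, N (x i)) ⥤ N k) :=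
  ρ.map x k ⋙ (Functor.whiskeringRight _ _ _).obj (F k) ⋙
    (Functor.whiskeringLeft _ _ _).obj (Functor.pi fun i => G (x i))

theorem app_transportMap {I : Type} [Finite I] {x : I → K} {k : K} (p : Arr (Q.Op x k))
    (b : ∀ i, Arr (N (x i))) :
    Arr.app (A := ∀ i, N (x i)) (B := N k) (Arr.map (transportMap ρ F G x k) p) (.pi b) =
      Arr.map (F k) (ρ.actA p fun i => Arr.map (G (x i)) (b i)) :=
  Arr.app_whiskeringRight (A := ∀ i, M (x i)) (B := M k) (D := N k) (F k) (Arr.map (ρ.map x k) p)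
    (.pi fun i => Arr.map (G (x i)) (b i))

/-- The structure of an algebra transported along isomorphisms. -/
def transportAlgebra : OperadAlgebra Q N :=
  .ofArr (fun x k => transportMap ρ F G x k)
    (fun {I} _ {x k} p b => Arr.map (F k) (ρ.actA p fun i => Arr.map (G (x i)) (b i)))
    (fun p b => app_transportMap ρ F G p b)
    (fun k b => (congrArg (Arr.map (F k)) (OperadHom.actA_idA ρ k fun i => Arr.map (G k)
        (b i))).trans
      (Arr.functor_congr (hGF k) (b ())))
    (fun {I J} _ _ e {y k} p b => congrArg (Arr.map (F k))
      (OperadHom.actA_rei ρ e p fun i => Arr.map (G (y i)) (b i)))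
    (fun {I} _ {J} _ x y k p q b => congrArg (Arr.map (F k))
      ((OperadHom.actA_cmp ρ x y k p q fun s => Arr.map (G (y s.1 s.2)) (b s)).trans
        (congrArg (ρ.actA p) (funext fun i => (Arr.functor_congr (hFG (x i)) (ρ.actA (q i)
          fun j => Arr.map (G (y i j)) (b ⟨i, j⟩))).symm))))

/-- The given isomorphisms are compatible with the transported structure. -/
theorem transportAlgebra_comm {I : Type} [Finite I] (x : I → K) (k : K) :
    ρ.map x k ⋙ (Functor.whiskeringRight _ _ _).obj (F k) =
      (transportAlgebra ρ F G hFG hGF).map x k ⋙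
        (Functor.whiskeringLeft _ _ _).obj (Functor.pi fun i => F (x i)) := by
  refine Arr.functor_ext₂ fun p b => ?_
  refine (Arr.app_whiskeringRight (A := ∀ i, M (x i)) (B := M k) (D := N k) (F k)
    (Arr.map (ρ.map x k) p) b).trans ?_
  refine Eq.trans ?_ (app_transportMap ρ F G p fun i => Arr.map (F (x i)) (b.proj i)).symm
  exact congrArg (fun c => Arr.map (F k) (ρ.actA p c)) (funext fun i =>
    (Arr.functor_congr (hFG (x i)) (b.proj i)).symm)

end Transport

open OperadData

/-! ### Black vertices with unordered inputs -/

section Trees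

variable {C : Type u} {P : OperadData C} {X : Type} {x : X → Colour P}

namespace TreeCat

/-- A black vertex decorated with a unit may be removed. -/
theorem blackA_one {c : C} (t : Arr (TreeCat x c)) :
    blackA (P.rei (Equiv.ofUnique Unit (Fin 1)) (y := fun _ => c) (fun _ => rfl) (P.idA c))
      (fun _ => t) = t := by
  refine (congrArg (fun p => blackA (s := fun _ : Fin 1 => c) p fun _ => t) (Arr.map_id
    (P.reindex (Equiv.ofUnique Unit (Fin 1)) (y := fun _ => c) fun _ => rfl) (P.one c))).trans ?_
  exact Arr.mk_eq ((alg x).one_obj fun _ => t.dom) ((alg x).one_obj fun _ => t.cod)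
    ((alg x).one_map (a := fun _ => t.dom) (b := fun _ => t.cod) fun _ => t.hom)

/-- Adjacent black vertices may be multiplied, with any ordering of the inputs of the composite. -/
theorem blackA_merge {n l : ℕ} {m : Fin n → ℕ} (e : (Σ i, Fin (m i)) ≃ Fin l) {s : Fin n → C}
    {t : ∀ i, Fin (m i) → C} {y : Fin l → C} (h : ∀ s, y (e s) = t s.1 s.2) {c : C}
    (p : Arr (P.Op s c)) (q : ∀ i, Arr (P.Op (t i) (s i))) (ts : ∀ i j, Arr (TreeCat x (t i j)))
    (ws : ∀ j, Arr (TreeCat x (y j))) (hw : ∀ s, ws (e s) ≍ ts s.1 s.2) :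
    blackA p (fun i => blackA (q i) (ts i)) =
      blackA (P.rei e (x := fun s : Σ i, Fin (m i) => t s.1 s.2) h (P.cmp s t c p q)) ws := by
  obtain rfl : y = fun j => t (e.symm j).1 (e.symm j).2 := funext fun j => by
    rw [← h, e.apply_symm_apply]
  obtain rfl : ws = fun j => ts (e.symm j).1 (e.symm j).2 := funext fun j => eq_of_heq (by
    have := hw (e.symm j)
    rwa [e.apply_symm_apply] at this)
  exact Arr.mk_eq
    ((alg x).merge_obj e p.dom (fun i => (q i).dom) fun i j => (ts i j).dom)
    ((alg x).merge_obj e p.cod (fun i => (q i).cod) fun i j => (ts i j).cod)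
    ((alg x).merge_map e p.hom (fun i => (q i).hom) fun i j => (ts i j).hom)

/-- A black vertex with inputs indexed by an arbitrary finite set. -/
def BK {I : Type} [Finite I] {z : I → C} {c : C} (p : Arr (P.Op z c))
    (w : ∀ i, Arr (TreeCat x (z i))) : Arr (TreeCat x c) :=
  blackA (s := fun j => z ((Finite.equivFin I).symm j))
    (P.rei (Finite.equivFin I) (y := fun j => z ((Finite.equivFin I).symm j))
      (fun i => congrArg z ((Finite.equivFin I).symm_apply_apply i)) p)
    fun j => w ((Finite.equivFin I).symm j)

section

variable (hP : P.ArrLaws)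
include hP

/-- The ordering of the inputs of a black vertex is irrelevant. -/
theorem BK_eq {I : Type} [Finite I] {n : ℕ} (e : I ≃ Fin n) {z : I → C} {y : Fin n → C}
    (h : ∀ i, y (e i) = z i) {c : C} (p : Arr (P.Op z c)) (w : ∀ i, Arr (TreeCat x (z i)))
    (ws : ∀ j, Arr (TreeCat x (y j))) (hw : ∀ i, ws (e i) ≍ w i) :
    BK p w = blackA (P.rei e h p) ws := by
  let e₀ := Finite.equivFin I
  have h₀ : ∀ i, z (e₀.symm (e₀ i)) = z i := fun i => congrArg z (e₀.symm_apply_apply i)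
  -- Insert unit black vertices at all inputs and multiply them in again: the quotient relation then
  -- allows any ordering `ε` of the inputs of the composite.
  let ε : (Σ _ : Fin (Nat.card I), Fin 1) ≃ Fin n :=
    (Equiv.sigmaUnique (Fin (Nat.card I)) fun _ => Fin 1).trans (e₀.symm.trans e)
  refine (congrArg (blackA (s := fun j => z (e₀.symm j)) (P.rei e₀ h₀ p))
    (funext fun j => (blackA_one (w (e₀.symm j))).symm)).trans ?_
  refine (blackA_merge ε (y := y) (fun s => h _) _ _ (fun j _ => w (e₀.symm j)) ws
    fun s => hw _).trans ?_
  refine congrArg (fun p => blackA p ws) ?_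
  refine (congrArg (P.rei ε _) (hP.cmp_rei (fun _ : Fin (Nat.card I) =>
    Equiv.ofUnique Unit (Fin 1)) (fun j => z (e₀.symm j)) (y := fun j _ => z (e₀.symm j))
      (y' := fun j _ => z (e₀.symm j)) (fun _ _ => rfl) c (P.rei e₀ h₀ p)
        fun j => P.idA (z (e₀.symm j)))).trans ?_
  refine (hP.rei_rei_congr (Equiv.sigmaCongrRight fun _ : Fin (Nat.card I) =>
    Equiv.ofUnique Unit (Fin 1)) ε (Equiv.sigmaUnique (Fin (Nat.card I)) fun _ => Unit)
    (e₀.symm.trans e) (y := fun s => z (e₀.symm s.1)) (y' := fun j => z (e₀.symm j))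
    (fun _ => rfl) (fun s => h _) (fun _ => rfl) (fun j => h _) _ fun s => rfl).trans ?_
  refine (congrArg (P.rei (e₀.symm.trans e) (y := y) fun j => h _)
    (hP.cmp_one (fun j => z (e₀.symm j)) c (P.rei e₀ h₀ p))).trans ?_
  refine (hP.rei_rei e₀ (e₀.symm.trans e) h₀ (fun j => h _) c p).trans ?_
  exact rei_congr _ (Equiv.ext fun i =>
    (congrArg e (e₀.symm_apply_apply i) : e (e₀.symm (e₀ i)) = e i)) p

theorem BK_fin {n : ℕ} {s : Fin n → C} {c : C} (p : Arr (P.Op s c))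
    (ts : ∀ i, Arr (TreeCat x (s i))) : BK p ts = blackA p ts :=
  (BK_eq hP (Equiv.refl (Fin n)) (fun _ => rfl) p ts ts fun _ => HEq.rfl).trans
    (congrArg (fun p => blackA p ts) (hP.rei_refl s c p))

theorem BK_one {c : C} (w : Unit → Arr (TreeCat x c)) : BK (P.idA c) w = w () :=
  (BK_eq hP (Equiv.ofUnique Unit (Fin 1)) (y := fun _ => c) (fun _ => rfl) (P.idA c) w
    (fun _ => w ()) fun _ => HEq.rfl).trans (blackA_one (w ()))

theorem BK_rei {I J : Type} [Finite I] [Finite J] (e : I ≃ J) {z : J → C} {c : C}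
    (p : Arr (P.Op (fun i => z (e i)) c)) (w : ∀ j, Arr (TreeCat x (z j))) :
    BK (P.rei e (y := z) (fun _ => rfl) p) w = BK p fun i => w (e i) := by
  have h : ∀ j, z ((Finite.equivFin J).symm (Finite.equivFin J j)) = z j := fun j =>
    congrArg z ((Finite.equivFin J).symm_apply_apply j)
  refine (congrArg (fun p => blackA (s := fun j => z ((Finite.equivFin J).symm j)) p
    fun j => w ((Finite.equivFin J).symm j)) (hP.rei_rei e (Finite.equivFin J) (fun _ => rfl) h c
      p)).trans (BK_eq hP (e.trans (Finite.equivFin J)) _ p _ _ fun i => ?_).symm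
  exact congr_arg_heq w ((Finite.equivFin J).symm_apply_apply (e i))

theorem BK_cmp_fin {n : ℕ} {J : Fin n → Type} [∀ i, Finite (J i)] {s : Fin n → C}
    {y : ∀ i, J i → C} {c : C} (p : Arr (P.Op s c)) (q : ∀ i, Arr (P.Op (y i) (s i)))
    (w : ∀ i j, Arr (TreeCat x (y i j))) :
    BK (P.cmp s y c p q) (fun t : Σ i, J i => w t.1 t.2) = BK p fun i => BK (q i) (w i) := by
  refine Eq.trans ?_ (BK_fin hP p _).symm
  let e : ∀ i, J i ≃ Fin (Nat.card (J i)) := fun i => Finite.equivFin (J i)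
  have he : ∀ i j, y i ((e i).symm (e i j)) = y i j := fun i j =>
    congrArg (y i) ((e i).symm_apply_apply j)
  let E := Finite.equivFin (Σ i, J i)
  let ε : (Σ i, Fin (Nat.card (J i))) ≃ Fin (Nat.card (Σ i, J i)) :=
    (Equiv.sigmaCongrRight fun i => (e i).symm).trans E
  have hE : ∀ t : Σ i, J i, y (E.symm (E t)).1 (E.symm (E t)).2 = y t.1 t.2 := fun t =>
    congrArg (fun t : Σ i, J i => y t.1 t.2) (E.symm_apply_apply t)
  refine Eq.trans ?_ (blackA_merge ε (t := fun i j => y i ((e i).symm j))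
    (y := fun j => y (E.symm j).1 (E.symm j).2)
    (fun t => hE ⟨t.1, (e t.1).symm t.2⟩) p (fun i => P.rei (e i) (he i) (q i))
      (fun i j => w i ((e i).symm j)) (fun j => w (E.symm j).1 (E.symm j).2) fun t =>
        congr_arg_heq (fun t : Σ i, J i => w t.1 t.2)
          (E.symm_apply_apply ⟨t.1, (e t.1).symm t.2⟩)).symm
  refine congrArg (fun p => blackA (s := fun j => y (E.symm j).1 (E.symm j).2) p
    fun j => w (E.symm j).1 (E.symm j).2) ?_
  refine Eq.trans ?_ (congrArg (P.rei ε (y := fun j => y (E.symm j).1 (E.symm j).2) _)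
    (hP.cmp_rei e s (y' := fun i j => y i ((e i).symm j)) he c p q)).symm
  refine Eq.trans ?_ (hP.rei_rei _ _ _ _ _ _).symm
  refine rei_congr _ (Equiv.ext fun t => ?_) _
  exact congrArg E (Sigma.ext rfl (heq_of_eq ((e t.1).symm_apply_apply t.2).symm))

/-- Grafting black vertices on a black vertex is composition of operations. -/
theorem BK_cmp {I : Type} [Finite I] {J : I → Type} [∀ i, Finite (J i)] {z : I → C}
    {y : ∀ i, J i → C} {c : C} (p : Arr (P.Op z c)) (q : ∀ i, Arr (P.Op (y i) (z i)))
    (w : ∀ i j, Arr (TreeCat x (y i j))) :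
    BK (P.cmp z y c p q) (fun s : Σ i, J i => w s.1 s.2) = BK p fun i => BK (q i) (w i) := by
  let e := Finite.equivFin I
  obtain ⟨J, rfl⟩ := IsPresentation.exists_family e (T := fun _ => Type) J
  have : ∀ a, Finite (J a) := fun a => by
    obtain ⟨i, rfl⟩ := e.surjective a
    infer_instance
  obtain ⟨z, rfl⟩ := IsPresentation.exists_family e (T := fun _ => C) z
  obtain ⟨y, rfl⟩ := IsPresentation.exists_family e (T := fun a => J a → C) y
  obtain ⟨q, rfl⟩ := IsPresentation.exists_family e (T := fun a => Arr (P.Op (y a) (z a))) q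
  obtain ⟨w, rfl⟩ := IsPresentation.exists_family e (T := fun a => ∀ j, Arr (TreeCat x (y a j))) w
  refine (BK_rei hP (Equiv.sigmaCongrLeft e) (z := fun s : Σ a, J a => y s.1 s.2) _
    fun s => w s.1 s.2).symm.trans ?_
  refine (congrArg (fun p => BK (z := fun s : Σ a, J a => y s.1 s.2) p fun s => w s.1 s.2)
    (hP.rei_cmp e z y c p q)).symm.trans ?_
  refine (BK_cmp_fin hP (P.rei e (y := z) (fun _ => rfl) p) q w).trans ?_
  exact BK_rei hP e p fun a => BK (q a) (w a)

end

end TreeCat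

end Trees

open OperadData TreeCat PscObj

/-! ### Black corollas -/

section Corolla

variable {C : Type u} {P : OperadData C}

/-- The white vertex without inputs of colour `x i`, on arrows. -/
def lfA {I : Type} (x : I → C) (c : C) (i : I) :
    Arr (TreeCat (wl (P := P) (fun i => Sum.inr (x i)) (Sum.inr c)) (x i)) :=
  Arr.id ((whiteAt (x := wl (P := P) (fun i => Sum.inr (x i)) (Sum.inr c)) (k := Sum.inr (x i))
    (Sum.inl i) rfl).obj fun l => l.elim0)

theorem lfA_eq {I : Type} (x : I → C) (c : C) (i : I) (ts) :
    lfA (P := P) x c i =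
      whiteA (x := wl (P := P) (fun i => Sum.inr (x i)) (Sum.inr c)) (Sum.inl i) ts := by
  refine (Arr.map_id (whiteAt (x := wl (P := P) (fun i => Sum.inr (x i)) (Sum.inr c))
    (k := Sum.inr (x i)) (Sum.inl i) rfl) fun l => l.elim0).symm.trans ?_
  exact congrArg (Arr.map (white (x := wl (P := P) (fun i => Sum.inr (x i)) (Sum.inr c))
    (Sum.inl i))) (pi_fin_zero ts).symm

/-- The black corolla, on arrows. -/
def BC {I : Type} [Finite I] {x : I → C} {c : C} (p : Arr (P.Op x c)) :
    Arr ((Psc P).Op (fun i => Sum.inr (x i)) (Sum.inr c)) := Arr.map (blackCorolla x c) p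

theorem PL_BK {Y W : Type} {y : Y → Colour P} {w : W → Colour P} (k : Colour P) (r : Y → W)
    (h : ∀ j, w (r j) = y j) {I : Type} [Finite I] {z : I → C} {c : C} (p : Arr (P.Op z c))
    (ts : ∀ i, Arr (TreeCat (wl y k) (z i))) (us : ∀ i, Arr (TreeCat w (src k i))) :
    PL k r h (BK p ts) us = BK p fun i => PL k r h (ts i) us := PL_black k r h _ _ us

theorem TC_BK {I₀ Y : Type} {J₀ : I₀ → Type} {v : I₀ → Colour P} {y : ∀ i, J₀ i → Colour P}
    {w : Y → Colour P} (r : (Σ i, J₀ i) → Y) (h : ∀ s, w (r s) = y s.1 s.2) (k : Colour P)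
    {I : Type} [Finite I] {z : I → C} {c : C} (p : Arr (P.Op z c))
    (ts : ∀ i, Arr (TreeCat (wl v k) (z i)))
    (q : ∀ i, Arr (Ctx (y i) (v i))) :
    TC r h k (BK p ts) q = BK p fun i => TC r h k (ts i) q := TC_black r h k _ _ q

/-- Over a colour of `P` the arrows carry no morphism `ε`. -/
theorem psc_arr_ext_inr {X : Type} {x : X → Colour P} {c : C} {φ ψ : Arr (PscObj x (Sum.inr c))}
    (h : treeA φ = treeA ψ) : φ = ψ :=
  PscObj.arr_ext h (fun hk => absurd hk (by simp)) fun hk => absurd hk (by simp)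

variable (hP : P.ArrLaws)
include hP

/-- The black corolla of a unit is a leaf, which is the unit of the colour. -/
theorem BC_idA (c : C) : BC (P.idA c) = (Psc P).idA (Sum.inr c) := by
  refine psc_arr_ext_inr ((BK_one hP (lfA (fun _ : Unit => c) c)).trans ?_)
  refine (lfA_eq (P := P) (fun _ : Unit => c) c () (leafA _ (Sum.inr c))).trans ?_
  exact ((treeA_idA (Sum.inr c)).trans (unitA_eq (P := P) (Sum.inr c))).symm

theorem BC_rei {I J : Type} [Finite I] [Finite J] (e : I ≃ J) {y : J → C} {c : C}
    (p : Arr (P.Op (fun i => y (e i)) c)) :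
    BC (P.rei e (y := y) (fun _ => rfl) p) =
      (Psc P).rei e (y := fun j => Sum.inr (y j)) (fun _ => rfl) (BC p) := by
  refine psc_arr_ext_inr ((BK_rei hP e p (lfA y c)).trans ?_)
  refine Eq.trans ?_ (treeA_rei e (y := fun j => Sum.inr (y j)) (fun _ => rfl) (BC p)).symm
  refine Eq.trans ?_ (PL_BK (P := P) (Sum.inr c) (y := fun i => Sum.inr (y (e i)))
    (w := wl (P := P) (fun j => Sum.inr (y j)) (Sum.inr c)) (fun i => Sum.inl (e i))
      (fun _ => rfl) p (lfA (fun i => y (e i)) c) _).symm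
  refine congrArg (BK p) (funext fun i => ?_)
  refine (lfA_eq (P := P) y c (e i) fun l : Fin 0 => l.elim0).trans (Eq.symm ?_)
  refine (congrArg (fun t => PL (P := P) (Sum.inr c) (y := fun i => Sum.inr (y (e i)))
    (w := wl (P := P) (fun j => Sum.inr (y j)) (Sum.inr c)) (fun i => Sum.inl (e i))
      (fun _ => rfl) t (leafA _ (Sum.inr c))) (lfA_eq (P := P) (fun i => y (e i)) c i
        fun l : Fin 0 => l.elim0)).trans ?_
  refine (PL_white_inl (P := P) (Sum.inr c) (y := fun i => Sum.inr (y (e i)))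
    (w := wl (P := P) (fun j => Sum.inr (y j)) (Sum.inr c)) (fun i => Sum.inl (e i))
      (fun _ => rfl) i _ _).trans ?_
  exact congrArg (whiteA (x := wl (P := P) (fun j => Sum.inr (y j)) (Sum.inr c)) (Sum.inl (e i)))
    (funext fun l : Fin 0 => l.elim0)

/-- Black corollas compose as operations of `P` do: grafting black corollas on a black corolla
creates adjacent black vertices, which are multiplied. -/
theorem BC_cmp {I : Type} [Finite I] {J : I → Type} [∀ i, Finite (J i)] (x : I → C)
    (y : ∀ i, J i → C) (c : C) (p : Arr (P.Op x c)) (q : ∀ i, Arr (P.Op (y i) (x i))) :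
    BC (P.cmp x y c p q) = (Psc P).cmp (fun i => Sum.inr (x i)) (fun i j => Sum.inr (y i j))
      (Sum.inr c) (BC p) fun i => BC (q i) := by
  refine psc_arr_ext_inr ((BK_cmp hP p q fun i j => lfA (fun s : Σ i, J i => y s.1 s.2) c
    ⟨i, j⟩).trans ?_)
  refine Eq.trans ?_ (treeA_cmp (fun i => Sum.inr (x i)) (fun i j => Sum.inr (y i j)) (Sum.inr c)
    (BC p) fun i => BC (q i)).symm
  refine Eq.trans ?_ (TC_BK (P := P) (y := fun i j => Sum.inr (y i j))
    (w := fun s : Σ i, J i => Sum.inr (y s.1 s.2)) (fun s => s) (fun _ => rfl) (Sum.inr c) p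
      (lfA x c) fun i => treeA (BC (q i))).symm
  refine congrArg (BK p) (funext fun i => Eq.symm ?_)
  refine (congrArg (fun t => TC (P := P) (y := fun i j => Sum.inr (y i j))
    (z := fun s : Σ i, J i => Sum.inr (y s.1 s.2)) (fun s => s) (fun _ => rfl) (Sum.inr c) t
      fun i => treeA (BC (q i))) (lfA_eq (P := P) x c i fun l : Fin 0 => l.elim0)).trans ?_
  refine (TC_white_inl (P := P) (x := fun i => Sum.inr (x i)) (y := fun i j => Sum.inr (y i j))
    (z := fun s : Σ i, J i => Sum.inr (y s.1 s.2)) (fun s => s) (fun _ => rfl) (Sum.inr c) i _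
      fun i => treeA (BC (q i))).trans ?_
  refine (PL_BK (P := P) (Sum.inr (x i)) (y := fun j => Sum.inr (y i j))
    (w := wl (P := P) (fun s : Σ i, J i => Sum.inr (y s.1 s.2)) (Sum.inr c))
      (fun j => Sum.inl ⟨i, j⟩) (fun _ => rfl) (q i) (lfA (y i) (x i)) _).trans ?_
  refine congrArg (BK (q i)) (funext fun j => ?_)
  refine (congrArg (fun t => PL (P := P) (Sum.inr (x i)) (y := fun j => Sum.inr (y i j))
    (w := wl (P := P) (fun s : Σ i, J i => Sum.inr (y s.1 s.2)) (Sum.inr c))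
      (fun j => Sum.inl ⟨i, j⟩) (fun _ => rfl) t _) (lfA_eq (P := P) (y i) (x i) j
        fun l : Fin 0 => l.elim0)).trans ?_
  refine (PL_white_inl (P := P) (Sum.inr (x i)) (y := fun j => Sum.inr (y i j))
    (w := wl (P := P) (fun s : Σ i, J i => Sum.inr (y s.1 s.2)) (Sum.inr c))
      (fun j => Sum.inl ⟨i, j⟩) (fun _ => rfl) j _ _).trans ?_
  refine Eq.symm ((lfA_eq (P := P) (fun s : Σ i, J i => y s.1 s.2) c ⟨i, j⟩
    fun l : Fin 0 => l.elim0).trans ?_)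
  exact congrArg (whiteA (x := wl (P := P) (fun s : Σ i, J i => Sum.inr (y s.1 s.2)) (Sum.inr c))
    (Sum.inl ⟨i, j⟩)) (funext fun l : Fin 0 => l.elim0)

end Corolla

/-! ### The inclusion of the operad and the restricted action -/

section Inclusion

variable {C : Type u} {P : OperadData C} {A : C → Cat.{u, u}} (α : OperadAlgebra P A)

theorem EP_inr (c : C) (φ : Arr (A c)) (v) : EP (P := P) A (Sum.inr c) φ v = φ :=
  Arr.mk_eq rfl rfl (heq_of_eq (Category.comp_id _))

/-- A black corolla acts on the pair as the operation decorating it acts on `A`. -/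
theorem actA_BC {I : Type} [Finite I] {x : I → C} {c : C} (p : Arr (P.Op x c))
    (b : ∀ i, Arr (A (x i))) :
    (pairAlgebra α).actA (x := fun i => Sum.inr (x i)) (k := Sum.inr c) (BC p) b = α.actA p b := by
  refine (EP_inr (P := P) c _ fun l : Fin 0 => l.elim0).symm.trans ?_
  refine (EP_PM α (x := fun i => Sum.inr (x i)) (Sum.inr c) (treeA (BC p)) b
    fun l : Fin 0 => l.elim0).trans ?_
  refine (EV_black α (x := fun i => Sum.inr (x i)) (Sum.inr c) b (fun l : Fin 0 => l.elim0)
    (P.rei (Finite.equivFin I) (y := fun j => x ((Finite.equivFin I).symm j))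
      (fun i => congrArg x ((Finite.equivFin I).symm_apply_apply i)) p) fun j => lfA (P := P) x c
          ((Finite.equivFin I).symm j)).trans ?_
  have hl : ∀ i, EV α (x := fun i => Sum.inr (x i)) (Sum.inr c) (lfA (P := P) x c i) b
      (fun l : Fin 0 => l.elim0) = b i := fun i => by
    refine (congrArg (fun t => EV α (x := fun i => Sum.inr (x i)) (Sum.inr c) t b
      fun l : Fin 0 => l.elim0) (lfA_eq (P := P) x c i fun l : Fin 0 => l.elim0)).trans ?_
    refine (EV_white_inl α (x := fun i => Sum.inr (x i)) (Sum.inr c) b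
      (fun l : Fin 0 => l.elim0) i _).trans ?_
    exact EP_inr (P := P) (x i) (b i) _
  refine (congrArg (α.actA (P.rei (Finite.equivFin I)
    (y := fun j => x ((Finite.equivFin I).symm j)) _ p))
      (funext fun j => hl ((Finite.equivFin I).symm j))).trans ?_
  have key : ∀ {n : ℕ} (e : I ≃ Fin n) (y : Fin n → C) (h : ∀ i, y (e i) = x i)
      (w : ∀ j, Arr (A (y j))), (∀ i, w (e i) ≍ b i) → α.actA (P.rei e h p) w = α.actA p b := by
    intro n e y h w hw
    obtain rfl : x = fun i => y (e i) := funext fun i => (h i).symm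
    obtain rfl : b = fun i => w (e i) := funext fun i => (eq_of_heq (hw i)).symm
    exact OperadHom.actA_rei α e p w
  exact key _ _ _ _ fun i => congr_arg_heq b ((Finite.equivFin I).symm_apply_apply i)

variable {δ : Weight (PPlus P) Operation.tgt} (hP : P.ArrLaws) (hδ : δ.IsFunctor)

/-- The condensation of the Swiss cheese plus construction. -/
abbrev scCondensation : Condensation (extend δ) :=
  condensation (psc_arrLaws P) (isFunctor_extend hδ)

/-- The natural transformation with value the class of the black corolla at the identity. -/
def inclMap {I : Type} [Finite I] (x : I → C) (c : C) :
    P.Op x c ⥤ (scCondensation hδ).operad.Op (fun i => Sum.inr (x i)) (Sum.inr c) :=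
  corollaClass δ x c ⋙ yonedaInv (isFunctor_coendWeight (psc_arrLaws P) (isFunctor_extend hδ)
    fun i => Sum.inr (x i)) c

theorem inclMap_evalAtOne {I : Type} [Finite I] (x : I → C) (c : C) :
    inclMap hδ x c ⋙ evalAtOne δ c = corollaClass δ x c :=
  congrArg (corollaClass δ x c ⋙ ·) (yonedaInv_evalAtOne (isFunctor_coendWeight (psc_arrLaws P)
    (isFunctor_extend hδ) fun i => Sum.inr (x i)) c)

theorem cA_inclMap {I : Type} [Finite I] (x : I → C) (c : C) (p : Arr (P.Op x c)) :
    cA (Y := coendWeight (psc_arrLaws P) (isFunctor_extend hδ) fun i => Sum.inr (x i))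
      (Arr.map (inclMap hδ x c) p) (inrPt P c) ((Psc P).idA (Sum.inr c)) =
      GN (extend δ) (fun i => Sum.inr (x i)) (Sum.inr c)
        (fun i => inrPt P (x i)) (BC p) fun i => (Psc P).idA (Sum.inr (x i)) :=
  (map_evalAtOne c _).symm.trans (Arr.functor_congr (inclMap_evalAtOne hδ x c) p)

/-- Functors into natural transformations out of a representable functor are determined by their
values at the identity. -/
theorem yoneda_ext {Y : Weight (Psc P) colourMap} (hY : Y.IsFunctor) {c : C} {S : Type u}
    [Category.{u} S] {F G : S ⥤ HomCat (Sum.inr c) (extend δ) Y}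
    (h : ∀ σ, cA (Arr.map F σ) (inrPt P c) ((Psc P).idA (Sum.inr c)) =
      cA (Arr.map G σ) (inrPt P c) ((Psc P).idA (Sum.inr c))) : F = G := by
  have e : F ⋙ evalAtOne δ c = G ⋙ evalAtOne δ c := Arr.functor_ext fun σ =>
    (map_evalAtOne c _).trans ((h σ).trans (map_evalAtOne c _).symm)
  have := congrArg (fun H => H ⋙ yonedaInv (δ := δ) hY c) e
  simpa only [Functor.assoc, evalAtOne_yonedaInv, Functor.comp_id] using this

/-- The morphism from `P` to the condensation. -/
def inclHom : OperadHom Sum.inr P (scCondensation hδ).operad where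
  map x c := inclMap hδ x c
  map_one c := by
    have e : (Functor.const (Discrete PUnit.{u + 1})).obj
        ((inclMap hδ (fun _ : Unit => c) c).obj (P.one c)) =
        (Functor.const (Discrete PUnit.{u + 1})).obj
          ((scCondensation hδ).operad.one (Sum.inr c)) := by
      refine yoneda_ext (isFunctor_coendWeight (psc_arrLaws P) (isFunctor_extend hδ)
        fun _ : Unit => Sum.inr c) fun σ => ?_
      refine (congrArg (fun m : Arr (HomCat (Sum.inr c) (extend δ) (coendWeight (psc_arrLaws P)
        (isFunctor_extend hδ) fun _ : Unit => Sum.inr c)) => cA m (inrPt P c)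
          ((Psc P).idA (Sum.inr c))) (Arr.map_id (inclMap hδ (fun _ : Unit => c) c)
            (P.one c))).symm.trans ?_
      refine (cA_inclMap hδ (fun _ : Unit => c) c (P.idA c)).trans ?_
      refine Eq.trans ?_ (cA_one (psc_arrLaws P) (isFunctor_extend hδ) (Sum.inr c) (inrPt P c)
        ((Psc P).idA (Sum.inr c))).symm
      exact congrArg (fun p => GN (extend δ) (fun _ : Unit => Sum.inr c) (Sum.inr c)
        (fun _ => inrPt P c) p fun _ => (Psc P).idA (Sum.inr c)) (BC_idA hP c)
    exact Functor.congr_obj e ⟨⟨⟩⟩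
  map_reindex {I J} _ _ e {x y} h c := by
    obtain rfl : x = fun i => y (e i) := funext fun i => (h i).symm
    refine yoneda_ext (isFunctor_coendWeight (psc_arrLaws P) (isFunctor_extend hδ)
      fun j => Sum.inr (y j)) fun p => ?_
    refine (cA_inclMap hδ y c (P.rei e (y := y) (fun _ => rfl) p)).trans ?_
    refine Eq.trans ?_ (cA_rei (psc_arrLaws P) (isFunctor_extend hδ) e
      (d' := fun j => Sum.inr (y j)) (fun _ => rfl) (Arr.map (inclMap hδ (fun i => y (e i)) c) p)
        (inrPt P c) ((Psc P).idA (Sum.inr c))).symm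
    refine Eq.trans ?_ (congrArg (RL (psc_arrLaws P) (isFunctor_extend hδ) e
      (d' := fun j => Sum.inr (y j)) fun _ => rfl) (cA_inclMap hδ (fun i => y (e i)) c p)).symm
    refine Eq.trans ?_ (RL_GN (psc_arrLaws P) (isFunctor_extend hδ) e
      (d' := fun j => Sum.inr (y j)) (fun _ => rfl) (fun j => inrPt P (y j)) (BC p)
        fun j => (Psc P).idA (Sum.inr (y j))).symm
    exact congrArg (fun p => GN (extend δ) (fun j => Sum.inr (y j)) (Sum.inr c)
        (fun j => inrPt P (y j)) p fun j => (Psc P).idA (Sum.inr (y j))) (BC_rei hP e p)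
  map_comp {I} _ {J} _ x y c := by
    refine yoneda_ext (isFunctor_coendWeight (psc_arrLaws P) (isFunctor_extend hδ)
      fun s : Σ i, J i => Sum.inr (y s.1 s.2)) fun p => ?_
    refine (cA_inclMap hδ (fun s : Σ i, J i => y s.1 s.2) c
      (P.cmp x y c p.fst p.snd.proj)).trans (Eq.symm ?_)
    refine (cA_cmp (psc_arrLaws P) (isFunctor_extend hδ) (fun i => Sum.inr (x i))
      (fun i j => Sum.inr (y i j)) (Sum.inr c) (Arr.map (inclMap hδ x c) p.fst)
        (fun i => Arr.map (inclMap hδ (y i) (x i)) (p.snd.proj i)) (inrPt P c)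
          ((Psc P).idA (Sum.inr c))).trans ?_
    refine (congrArg (SB (psc_arrLaws P) (isFunctor_extend hδ) (d := fun i => Sum.inr (x i))
      (d' := fun i j => Sum.inr (y i j))
        fun i => Arr.map (inclMap hδ (y i) (x i)) (p.snd.proj i))
          (cA_inclMap hδ x c p.fst)).trans ?_
    refine (SB_GN (psc_arrLaws P) (isFunctor_extend hδ) (d := fun i => Sum.inr (x i))
      (d' := fun i j => Sum.inr (y i j)) _ (fun i => inrPt P (x i)) (BC p.fst)
        fun i => (Psc P).idA (Sum.inr (x i))).trans ?_
    refine (congrArg (ML (psc_arrLaws P) (isFunctor_extend hδ) (x := fun i => Sum.inr (x i))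
      (fun i j => Sum.inr (y i j)) (BC p.fst)) (funext fun i =>
        cA_inclMap hδ (y i) (x i) (p.snd.proj i))).trans ?_
    refine (ML_GN (psc_arrLaws P) (isFunctor_extend hδ) (x := fun i => Sum.inr (x i))
      (fun i j => Sum.inr (y i j)) (BC p.fst) (fun i j => inrPt P (y i j))
        (fun i => BC (p.snd.proj i)) fun i j => (Psc P).idA (Sum.inr (y i j))).trans ?_
    exact congrArg (fun p => GN (extend δ) (fun s : Σ i, J i => Sum.inr (y s.1 s.2)) (Sum.inr c)
      (fun s => inrPt P (y s.1 s.2)) p fun s => (Psc P).idA (Sum.inr (y s.1 s.2)))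
        (BC_cmp hP x y c p.fst p.snd.proj).symm

/-- The action of the condensation on natural transformations to the pair. -/
abbrev scAlgebra : CondensedAlgebra (scCondensation hδ) (pair A) (pairMap α) :=
  condensedAlgebra (psc_arrLaws P) (isFunctor_extend hδ) (pairAlgebra α)

/-- The value at the identity of the action of the class of a black corolla. -/
theorem evalAtOne_actA_inclMap {I : Type} [Finite I] (x : I → C) (c : C) (p : Arr (P.Op x c))
    (n : ∀ i, Arr (HomCat (Sum.inr (x i)) (extend δ) (pairWeight α))) :
    Arr.map (evalAtOne δ (Y := pairWeight α) c) ((scAlgebra α hδ).alg.actA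
      (x := fun i => Sum.inr (x i)) (k := Sum.inr c) (Arr.map (inclMap hδ x c) p) n) =
      α.actA p fun i => Arr.map (evalAtOne δ (Y := pairWeight α) (x i)) (n i) := by
  refine (map_evalAtOne c _).trans ?_
  refine (congrArg (fun m => cA (Y := pairWeight α) m (inrPt P c) ((Psc P).idA (Sum.inr c)))
    (app_curry_algF (psc_arrLaws P) (isFunctor_extend hδ) (pairAlgebra α)
      (d := fun i => Sum.inr (x i)) (Arr.map (inclMap hδ x c) p) (.pi n))).trans ?_
  refine (cA_AL (psc_arrLaws P) (isFunctor_extend hδ) (pairAlgebra α)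
    (d := fun i => Sum.inr (x i)) (Arr.map (inclMap hδ x c) p) n (inrPt P c)
      ((Psc P).idA (Sum.inr c))).trans ?_
  refine (congrArg (EVC (psc_arrLaws P) (isFunctor_extend hδ) (pairAlgebra α)
    (d := fun i => Sum.inr (x i)) n) (cA_inclMap hδ x c p)).trans ?_
  refine (EVC_GN (psc_arrLaws P) (isFunctor_extend hδ) (pairAlgebra α)
    (d := fun i => Sum.inr (x i)) n (fun i => inrPt P (x i)) (BC p)
      fun i => (Psc P).idA (Sum.inr (x i))).trans ?_
  refine (actA_BC α p _).trans ?_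
  exact congrArg (α.actA p) (funext fun i => (map_evalAtOne (x i) (n i)).symm)

end Inclusion

end
end SwissCheese

theorem mainTheorem2 {C : Type u} (P : OperadData C) (hP : P.IsOperad) (A : C → Cat.{u, u})
    (α : OperadAlgebra P A) (δ : Weight (PPlus P) Operation.tgt) (hδ : δ.IsFunctor) :
    (Psc P).IsOperad ∧ (extend δ).IsFunctor ∧
    (∃ ρ : OperadAlgebra (Psc P) (pair A),
      ∀ {I : Type} [Finite I] (x : I → Colour P) (k : Colour P), ρ.map x k = pairMap α x k) ∧
    ∃ S : Condensation (extend δ), S.operad.IsOperad ∧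
      ∃ κ : CondensedAlgebra S (pair A) (pairMap α),
        (∀ d, ∃ F : hochPair δ α d ⥤ HomCat d (extend δ) (pairWeight α),
          comparison δ α d ⋙ F = 𝟭 _ ∧ F ⋙ comparison δ α d = 𝟭 _) ∧
        ∃ Φ : OperadAlgebra S.operad (hochPair δ α),
          (∀ {I : Type} [Finite I] (d : I → C ⊕ C) (d₀ : C ⊕ C),
            κ.alg.map d d₀ ⋙ (Functor.whiskeringRight _ _ _).obj (comparison δ α d₀) =
              Φ.map d d₀ ⋙
                (Functor.whiskeringLeft _ _ _).obj (Functor.pi fun i => comparison δ α (d i))) ∧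
          ∃ ι : OperadHom Sum.inr P S.operad,
            (∀ {I : Type} [Finite I] (x : I → C) (c : C),
              ι.map x c ⋙ evalAtOne δ c = corollaClass δ x c) ∧
            ∀ {I : Type} [Finite I] (x : I → C) (c : C),
              ι.map x c ⋙ Φ.map (fun i => Sum.inr (x i)) (Sum.inr c) = α.map x c := by
  choose G hFG hGF using fun d => exists_comparison_inverse (δ := δ) α d
  refine ⟨(psc_arrLaws P).isOperad, isFunctor_extend hδ, ⟨pairAlgebra α, fun x k => rfl⟩,
    scCondensation hδ, (condensation_arrLaws _ _).isOperad, scAlgebra α hδ,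
    exists_comparison_inverse α,
    transportAlgebra (scAlgebra α hδ).alg (fun d => comparison δ α d) G hFG hGF,
    fun d d₀ => transportAlgebra_comm _ _ _ _ _ d d₀,
    inclHom hP.arrLaws hδ, fun x c => inclMap_evalAtOne hδ x c, fun x c => ?_⟩
  refine Arr.functor_ext₂ fun p b => ?_
  refine (app_transportMap (scAlgebra α hδ).alg (fun d => comparison δ α d) G
    (x := fun i => Sum.inr (x i)) (k := Sum.inr c) (Arr.map (inclMap hδ x c) p) b.proj).trans ?_
  refine (evalAtOne_actA_inclMap α hδ x c p fun i =>
    Arr.map (G (Sum.inr (x i))) (b.proj i)).trans ?_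
  exact congrArg (α.actA p) (funext fun i =>
    Arr.functor_congr (hGF (Sum.inr (x i))) (b.proj i))
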